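/- Let $(M,g)$ be an oriented smooth pseudo-Riemannian four-manifold which is Einstein, i.e. $\mathrm{Ric}=\frac{s}{4}\,g$, and let $g$ be Riemannian $(++++)$, neutral $(--++)$ or Lorentzian $(-+++)$. The Weyl tensor $W$ and the Hodge star $*$ act on bivectors; they commute, and $**=\mathrm{Id}$ if $g$ is Riemannian or neutral, while $**=-\mathrm{Id}$ if $g$ is Lorentzian. Let $\mathcal E$ be the following complex vector bundle of rank $3$ over $M$: if $g$ is Riemannian or neutral, $\mathcal E$ is the complexification of the $(+1)$-eigenspace bundle $\Lambda^+M$ of $*$ in the bundle $[TM]^{\wedge 2}$ of real bivectors; if $g$ is Lorentzian, $\mathcal E$ is the $(+i)$-eigenspace bundle of $*$ in the complexified bundle $([TM]^{\wedge 2})^{\mathbb C}$. Let $W^{(+)}:\mathcal E\to\mathcal E$ be the restriction to $\mathcal E$ of the complex-linear extension of $W$ (so in the Riemannian and neutral cases $W^{(+)}$ is the complex-linear extension of the self-dual Weyl tensor $W^+:\Lambda^+M\to\Lambda^+M$). Suppose that $W^{(+)}$ is diagonalizable at every point of $M$ and has constant eigenvalues, i.e. the set of its eigenvalues is the same at all points.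 (i) If $g$ is Riemannian, then the self-dual Weyl tensor $W^+$ is parallel. (ii) If $g$ is Lorentzian or neutral, and $W^{(+)}$ is not parallel, then every point of $M$ has a neighbourhood $U$ with $C^\infty$ complex vector fields $w,v_1,v_2,v_3$ (sections of the complexified tangent bundle over $U$) that are linearly independent over $\mathbb C$ at every point of $U$, commute with every real Killing field defined on any open subset of $U$, and satisfy, for some constant $\gamma\in\mathbb C\smallsetminus\{0\}$ and all $j,k\in\{1,2,3\}$, $$g(w,w)=g(v_j,v_j)=\gamma,\qquad g(w,v_j)=0,\qquad g(v_j,v_k)=0\ \text{ if } j\ne k,$$ $$[w,v_j]=\rho_j v_j,\qquad [v_j,v_k]=0,$$ where $\rho_1,\rho_2,\rho_3\in\mathbb C$ are the three cube roots of $\gamma^2$, and both $g$ and the Lie bracket are extended complex-bilinearly to complex vector fields. -/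

import Mathlib

open scoped Manifold ContDiff Topology

noncomputable section

namespace EinsteinFour

/-- The model space of four-dimensional manifolds. -/
abbrev E4 : Type := EuclideanSpace ℝ (Fin 4)

/-! ### Tensor calculus in a coordinate domain

Here `G` is the matrix `(g_ij)` of a pseudo-Riemannian metric, as a function of the
coordinates. All objects are given by their components in the coordinate frame. -/

/-- The partial derivative `∂ᵢ f` at `y`. -/
def pderiv {F : Type*} [NormedAddCommGroup F] [NormedSpace ℝ F] (i : Fin 4) (f : E4 → F)
    (y : E4) : F :=
  fderiv ℝ f y (EuclideanSpace.single i 1)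

section Local

variable (G : E4 → Matrix (Fin 4) (Fin 4) ℝ)

/-- The Christoffel symbol `Γᵏᵢⱼ` of the Levi-Civita connection: `∇_{∂ᵢ} ∂ⱼ = ∑ₖ Γᵏᵢⱼ ∂ₖ`. -/
def christoffel (k i j : Fin 4) (y : E4) : ℝ :=
  (1 / 2 : ℝ) * ∑ l, (G y)⁻¹ k l *
    (pderiv i (fun z => G z j l) y + pderiv j (fun z => G z i l) y - pderiv l (fun z => G z i j) y)

/-- The component `Rᵢⱼₖˡ` of the curvature tensor, `R(∂ᵢ,∂ⱼ)∂ₖ = ∑ₗ Rᵢⱼₖˡ ∂ₗ`, with the convention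
`R(u,v)w = ∇_v ∇_u w - ∇_u ∇_v w + ∇_[u,v] w`. -/
def curvature (i j k l : Fin 4) (y : E4) : ℝ :=
  pderiv j (christoffel G l i k) y - pderiv i (christoffel G l j k) y
    + ∑ m, (christoffel G m i k y * christoffel G l j m y
      - christoffel G m j k y * christoffel G l i m y)

/-- The four-times covariant curvature tensor `Rᵢⱼₖₗ = g(R(∂ᵢ,∂ⱼ)∂ₖ,∂ₗ)`. -/
def curvatureLow (i j k l : Fin 4) (y : E4) : ℝ :=
  ∑ m, curvature G i j k m y * G y m l

/-- The Ricci tensor `Ric(u,w) = Trace [v ↦ R(u,v)w]`. -/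
def ricci (i k : Fin 4) (y : E4) : ℝ :=
  ∑ j, curvature G i j k j y

/-- The scalar curvature `s = Trace_g Ric`. -/
def scalarCurvature (y : E4) : ℝ :=
  ∑ i, ∑ k, (G y)⁻¹ i k * ricci G i k y

/-- The Schouten tensor `σ = Ric - s g / (2n - 2)` in dimension `n = 4`. -/
def schouten (i k : Fin 4) (y : E4) : ℝ :=
  ricci G i k y - scalarCurvature G y / 6 * G y i k

/-- The Weyl tensor `W = R - (n - 2)⁻¹ g ∧ σ` in dimension `n = 4`, where
`(g ∧ σ)(u,v) = g(u,·) ∧ σ(v,·) - g(v,·) ∧ σ(u,·)`. -/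
def weyl (i j k l : Fin 4) (y : E4) : ℝ :=
  curvatureLow G i j k l y - (1 / 2 : ℝ) *
    (G y i k * schouten G j l y - G y i l * schouten G j k y
      - G y j k * schouten G i l y + G y j l * schouten G i k y)

/-- The sign of `(i,j,k,l)` as a permutation of `(0,1,2,3)`, and `0` if it is not a permutation. -/
def leviCivitaSymbol (i j k l : Fin 4) : ℝ :=
  Matrix.det (Matrix.of fun a b : Fin 4 => if ![i, j, k, l] a = b then (1 : ℝ) else 0)

/-- The volume form, where `ε y` is `1` or `-1` according to whether the coordinate frame is
positively oriented at `y` or not. -/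
def volumeForm (ε : E4 → ℝ) (i j k l : Fin 4) (y : E4) : ℝ :=
  ε y * Real.sqrt |(G y).det| * leviCivitaSymbol i j k l

/-- The complexified bivectors at a point: `α = ½ ∑ αⁱʲ ∂ᵢ ∧ ∂ⱼ` is represented by the
skew-symmetric complex matrix `(αⁱʲ)`, so that `v ∧ u` has the components `vⁱuʲ - vʲuⁱ`. -/
def bivectors : Submodule ℂ (Matrix (Fin 4) (Fin 4) ℂ) where
  carrier := {α | ∀ i j, α i j = -α j i}
  zero_mem' := by intro i j; simp
  add_mem' := by
    intro a b ha hb i j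
    simp only [Matrix.add_apply]
    rw [ha i j, hb i j]; ring
  smul_mem' := by
    intro c a ha i j
    simp only [Matrix.smul_apply, smul_eq_mul]
    rw [ha i j]; ring

/-- The complex-linear operator `α ↦ T α` on bivectors defined by a four-times covariant tensor `T`,
`⟨T(u ∧ v), w ∧ w'⟩ = T(u,v,w,w')`, i.e. `(Tα)ᵏˡ = ½ ∑ gᵏᵖ gˡᵠ Tᵢⱼₚᵩ αⁱʲ`. -/
def bivectorOperator (T : Fin 4 → Fin 4 → Fin 4 → Fin 4 → E4 → ℝ) (y : E4) :
    Module.End ℂ (Matrix (Fin 4) (Fin 4) ℂ) where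
  toFun α := Matrix.of fun k l => (1 / 2 : ℂ) * ∑ i, ∑ j, ∑ p, ∑ q,
    (((G y)⁻¹ k p * (G y)⁻¹ l q * T i j p q y : ℝ) : ℂ) * α i j
  map_add' a b := by
    ext k l
    simp only [Matrix.of_apply, Matrix.add_apply, mul_add, Finset.sum_add_distrib]
  map_smul' c a := by
    ext k l
    simp only [Matrix.of_apply, Matrix.smul_apply, smul_eq_mul, Finset.mul_sum, RingHom.id_apply]
    refine Finset.sum_congr rfl fun i _ => Finset.sum_congr rfl fun j _ =>
      Finset.sum_congr rfl fun p _ => Finset.sum_congr rfl fun q _ => ?_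
    ring

/-- The Weyl tensor acting on (complexified) bivectors. -/
def weylOperator (y : E4) : Module.End ℂ (Matrix (Fin 4) (Fin 4) ℂ) :=
  bivectorOperator G (weyl G) y

/-- The Hodge star acting on (complexified) bivectors, `α ∧ β = ⟨*α, β⟩ vol`. -/
def hodgeStar (ε : E4 → ℝ) (y : E4) : Module.End ℂ (Matrix (Fin 4) (Fin 4) ℂ) :=
  bivectorOperator G (volumeForm G ε) y

/-- The eigenvalue of the Hodge star which defines self-duality: `1` for metrics of Riemannian or
neutral signature (positive determinant), where `** = 1`, and `i` for Lorentzian metrics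
(negative determinant), where `** = -1`. -/
def starEigenvalue (y : E4) : ℂ := if 0 < (G y).det then 1 else Complex.I

/-- The fibre at `y` of the bundle of self-dual bivectors. For Riemannian or neutral metrics it is
the complexification of the `1`-eigenspace of the Hodge star in the real bivectors; for Lorentzian
metrics it is the `i`-eigenspace of the Hodge star in the complexified bivectors. -/
def selfDual (ε : E4 → ℝ) (y : E4) : Submodule ℂ (Matrix (Fin 4) (Fin 4) ℂ) :=
  bivectors ⊓ Module.End.eigenspace (hodgeStar G ε y) (starEigenvalue G y)

/-- The covariant derivative `∇_{∂ᵢ} α` of a complex bivector field `α`, at `y`. -/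
def covDeriv (i : Fin 4) (α : E4 → Matrix (Fin 4) (Fin 4) ℂ) (y : E4) :
    Matrix (Fin 4) (Fin 4) ℂ :=
  Matrix.of fun k l => pderiv i (fun z => α z k l) y
    + ∑ m, ((christoffel G k i m y : ℂ) * α y m l + (christoffel G l i m y : ℂ) * α y k m)

end Local

/-! ### Metrics and orientations on four-manifolds -/

section Global

variable {M : Type*} [TopologicalSpace M] [ChartedSpace E4 M]

/-- The coordinate frame `∂₀, …, ∂₃` of the preferred chart at `x₀`, at the point with
coordinates `y`. -/
def frame (x₀ : M) (y : E4) (i : Fin 4) :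
    TangentSpace (𝓡 4) ((extChartAt (𝓡 4) x₀).symm y) :=
  mfderiv 𝓘(ℝ, E4) (𝓡 4) (extChartAt (𝓡 4) x₀).symm y (EuclideanSpace.single i (1 : ℝ) : E4)

/-- The coordinates of `x₀` in its preferred chart. -/
def coord (x₀ : M) : E4 := extChartAt (𝓡 4) x₀ x₀

variable (M) in
/-- A smooth pseudo-Riemannian metric. -/
structure PseudoRiemannianMetric [IsManifold (𝓡 4) ∞ M] where
  /-- The scalar product in each tangent space. -/
  inner (x : M) : TangentSpace (𝓡 4) x →L[ℝ] TangentSpace (𝓡 4) x →L[ℝ] ℝ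
  symm (x : M) (v w : TangentSpace (𝓡 4) x) : inner x v w = inner x w v
  nondegenerate (x : M) (v : TangentSpace (𝓡 4) x) (hv : ∀ w, inner x v w = 0) : v = 0
  contMDiff : ContMDiff (𝓡 4) ((𝓡 4).prod 𝓘(ℝ, E4 →L[ℝ] E4 →L[ℝ] ℝ)) ∞
    (fun x ↦ Bundle.TotalSpace.mk' (E4 →L[ℝ] E4 →L[ℝ] ℝ) x (inner x))

/-- A family of four vectors is a positively oriented basis. -/
def IsPositiveFrame {V : Type*} [AddCommGroup V] [Module ℝ V] (o : Orientation ℝ V (Fin 4))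
    (b : Fin 4 → V) : Prop :=
  ∃ B : Module.Basis (Fin 4) ℝ V, ⇑B = b ∧ B.orientation = o

variable (M) in
/-- An orientation of a four-manifold: a choice of an orientation of each tangent space such that
the coordinate frames do not change their orientation near any point. -/
structure ManifoldOrientation where
  /-- The orientation of each tangent space. -/
  orient (x : M) : Orientation ℝ (TangentSpace (𝓡 4) x) (Fin 4)
  locallyConstant (x₀ : M) : ∀ᶠ y in 𝓝 (coord x₀),
    (IsPositiveFrame (orient ((extChartAt (𝓡 4) x₀).symm y)) (frame x₀ y) ↔
      IsPositiveFrame (orient ((extChartAt (𝓡 4) x₀).symm (coord x₀))) (frame x₀ (coord x₀)))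

open Classical in
/-- `1` where the coordinate frame of the preferred chart at `x₀` is positively oriented, and `-1`
elsewhere. -/
def ManifoldOrientation.sign (o : ManifoldOrientation M) (x₀ : M) (y : E4) : ℝ :=
  if IsPositiveFrame (o.orient ((extChartAt (𝓡 4) x₀).symm y)) (frame x₀ y) then 1 else -1

variable [IsManifold (𝓡 4) ∞ M]

namespace PseudoRiemannianMetric

variable (g : PseudoRiemannianMetric M)

/-- The matrix `(g_ij)` of the metric in the preferred chart at `x₀`, as a function of the
coordinates. -/
def inChart (x₀ : M) (y : E4) : Matrix (Fin 4) (Fin 4) ℝ :=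
  Matrix.of fun i j => g.inner ((extChartAt (𝓡 4) x₀).symm y) (frame x₀ y i) (frame x₀ y j)

/-- The metric has the sign pattern `s`: every tangent space has an orthonormal basis whose
vectors have the squares `s 0, …, s 3`. -/
def HasSignature (s : Fin 4 → ℝ) : Prop :=
  ∀ x : M, ∃ b : Module.Basis (Fin 4) ℝ (TangentSpace (𝓡 4) x),
    ∀ i j, g.inner x (b i) (b j) = if i = j then s i else 0

/-- Sign pattern `++++`. -/
def IsRiemannian : Prop := g.HasSignature ![1, 1, 1, 1]

/-- Sign pattern `--++`. -/
def IsNeutral : Prop := g.HasSignature ![-1, -1, 1, 1]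

/-- Sign pattern `-+++`. -/
def IsLorentzian : Prop := g.HasSignature ![-1, 1, 1, 1]

/-- The Einstein condition `Ric = s g / 4`. -/
def IsEinstein : Prop :=
  ∀ (x : M) (i k : Fin 4), ricci (g.inChart x) i k (coord x) =
    scalarCurvature (g.inChart x) (coord x) / 4 * g.inChart x (coord x) i k

variable (o : ManifoldOrientation M)

/-- The fibre `ℰₓ` of the bundle of self-dual bivectors (see `selfDual`); components are taken with
respect to the preferred chart at `x`. -/
def selfDualAt (x : M) : Submodule ℂ (Matrix (Fin 4) (Fin 4) ℂ) :=
  selfDual (g.inChart x) (o.sign x) (coord x)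

/-- The nonzero `α` is an eigenvector, for the eigenvalue `μ`, of the self-dual Weyl operator
`W⁽⁺⁾(x) : ℰₓ → ℰₓ`, the restriction to `ℰₓ` of the Weyl operator. -/
def IsWeylPlusEigenvector (x : M) (μ : ℂ) (α : Matrix (Fin 4) (Fin 4) ℂ) : Prop :=
  α ∈ g.selfDualAt o x ∧ α ≠ 0 ∧ weylOperator (g.inChart x) (coord x) α = μ • α

/-- `W⁽⁺⁾(x)` is diagonalizable: its eigenvectors span `ℰₓ`. -/
def IsWeylPlusDiagonalizableAt (x : M) : Prop :=
  Submodule.span ℂ {α | ∃ μ, g.IsWeylPlusEigenvector o x μ α} = g.selfDualAt o x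

/-- The set of the eigenvalues of `W⁽⁺⁾(x)`. -/
def weylPlusEigenvalues (x : M) : Set ℂ :=
  {μ | ∃ α, g.IsWeylPlusEigenvector o x μ α}

/-- `W⁽⁺⁾` is parallel: `∇_v (W⁽⁺⁾ α) = W⁽⁺⁾ (∇_v α)` at every point `x`, for all tangent vectors
`v` at `x` and all smooth sections `α` of `ℰ` on a neighbourhood of `x`. -/
def IsWeylPlusParallel : Prop :=
  ∀ (x : M) (V : Set E4), IsOpen V → coord x ∈ V → V ⊆ (extChartAt (𝓡 4) x).target →
    ∀ α : E4 → Matrix (Fin 4) (Fin 4) ℂ,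
      (∀ k l, ContDiffOn ℝ ∞ (fun y => α y k l) V) →
      (∀ y ∈ V, α y ∈ selfDual (g.inChart x) (o.sign x) y) →
      ∀ i, covDeriv (g.inChart x) i (fun y => weylOperator (g.inChart x) y (α y)) (coord x) =
        weylOperator (g.inChart x) (coord x) (covDeriv (g.inChart x) i α (coord x))

end PseudoRiemannianMetric

/-! ### Vector fields -/

/-- The (real) vector field `X` is of class `C^∞` on `U`. -/
def IsSmoothOn (X : Π x : M, TangentSpace (𝓡 4) x) (U : Set M) : Prop :=
  ContMDiffOn (𝓡 4) (𝓡 4).tangent ∞ (fun x => (⟨x, X x⟩ : TangentBundle (𝓡 4) M)) U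

/-- `X` is a (real) Killing field on the open set `V`: `X` is smooth there and `ℒ_X g = 0`, i.e.
`X (g(Y,Z)) = g([X,Y],Z) + g(Y,[X,Z])` for all smooth vector fields `Y`, `Z` on `V`. -/
def PseudoRiemannianMetric.IsKillingOn (g : PseudoRiemannianMetric M)
    (X : Π x : M, TangentSpace (𝓡 4) x) (V : Set M) : Prop :=
  IsSmoothOn X V ∧ ∀ Y Z : Π x : M, TangentSpace (𝓡 4) x, IsSmoothOn Y V → IsSmoothOn Z V →
    ∀ x ∈ V, (mfderiv (𝓡 4) 𝓘(ℝ, ℝ) (fun p => g.inner p (Y p) (Z p)) x (X x) : ℝ) =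
      g.inner x (VectorField.mlieBracket (𝓡 4) X Y x) (Z x)
        + g.inner x (Y x) (VectorField.mlieBracket (𝓡 4) X Z x)

variable (M) in
/-- A complex vector field `re + i im` (a section of the complexified tangent bundle). -/
@[ext] structure ComplexVectorField where
  /-- The real part. -/
  re : Π x : M, TangentSpace (𝓡 4) x
  /-- The imaginary part. -/
  im : Π x : M, TangentSpace (𝓡 4) x

namespace ComplexVectorField

/-- The complex vector field is of class `C^∞` on `U`. -/
def IsSmoothOn (w : ComplexVectorField M) (U : Set M) : Prop :=
  EinsteinFour.IsSmoothOn w.re U ∧ EinsteinFour.IsSmoothOn w.im U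

/-- A real vector field, as a complex one. -/
def ofReal (X : Π x : M, TangentSpace (𝓡 4) x) : ComplexVectorField M := ⟨X, fun _ => 0⟩

/-- The zero field. -/
def zero : ComplexVectorField M := ⟨fun _ => 0, fun _ => 0⟩

/-- Multiplication by a complex constant. -/
def smul (c : ℂ) (w : ComplexVectorField M) : ComplexVectorField M :=
  ⟨fun x => c.re • w.re x - c.im • w.im x, fun x => c.re • w.im x + c.im • w.re x⟩

/-- Finite sums of complex vector fields. -/
def sum (b : Fin 4 → ComplexVectorField M) : ComplexVectorField M :=
  ⟨fun x => ∑ a, (b a).re x, fun x => ∑ a, (b a).im x⟩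

/-- Two complex vector fields agree at `x`. -/
def EqAt (x : M) (w w' : ComplexVectorField M) : Prop := w.re x = w'.re x ∧ w.im x = w'.im x

/-- Linear independence over `ℂ` of the values at `x`. -/
def LinearIndependentAt (x : M) (b : Fin 4 → ComplexVectorField M) : Prop :=
  ∀ c : Fin 4 → ℂ, EqAt x (sum fun a => smul (c a) (b a)) zero → ∀ a, c a = 0

/-- The complex-bilinear extension of the Lie bracket. -/
def bracket (w w' : ComplexVectorField M) : ComplexVectorField M where
  re x := VectorField.mlieBracket (𝓡 4) w.re w'.re x - VectorField.mlieBracket (𝓡 4) w.im w'.im x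
  im x := VectorField.mlieBracket (𝓡 4) w.re w'.im x + VectorField.mlieBracket (𝓡 4) w.im w'.re x

end ComplexVectorField

/-- The complex-bilinear (not sesquilinear) extension of the metric, at `x`. -/
def PseudoRiemannianMetric.complexInner (g : PseudoRiemannianMetric M) (x : M)
    (w w' : ComplexVectorField M) : ℂ :=
  ⟨g.inner x (w.re x) (w'.re x) - g.inner x (w.im x) (w'.im x),
    g.inner x (w.re x) (w'.im x) + g.inner x (w.im x) (w'.re x)⟩

end Global

end EinsteinFour

end

/-! All local work takes place in a complex frame `E` of the complexified tangent bundle that is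
orthonormal for the bilinear metric, `Eᵀ G E = 1`; over ℂ the three signatures look alike. Such a
frame gives a basis `E I_j Eᵀ` of the self-dual bivectors, and near each point it can be chosen
smoothly so that these bivectors are eigenvectors of the Weyl tensor with constant eigenvalues λ_j
(`IsLocalMetric.exists_adaptedFrame`). Let θ be the dual coframe, α_j the self-dual two-forms, ξ_j
the self-dual connection forms, and d_j = λ_{j+1} − λ_{j+2} with j modulo 3. For an Einstein metric
Cartan's equations become dξ_j = ξ_{j+1}∧ξ_{j+2} + (λ_j + s/12) α_j and dα_j = ξ_{j+1}∧α_{j+2} −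
ξ_{j+2}∧α_{j+1}. This is `SelfDualEquations`, stated over a commutative ℂ-algebra with four
commuting derivations, so that the argument is pure algebra; the algebra used is `SmoothFun V`.

The condition d(dξ_j) = 0 is linear in the ξ's. It says that d_j ξ_j = X_j, where X_1, X_2, X_3 are
the images of a single one-form under the quaternionic triple I_j
(`SelfDualEquations.exists_quatForm`). If two eigenvalues coincide, one X_j vanishes, hence all do,
and this means that W⁽⁺⁾ is parallel. So if W⁽⁺⁾ is not parallel, the eigenvalues are distinct
somewhere, and therefore everywhere, the spectrum being constant.

Suppose that they are distinct. The three-form X_j∧α_j does not depend on j. Its exterior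
derivative, computed for each j, gives three equations, from which the square of the one-form is
found to be a nonzero constant m² (`SelfDualEquations.trace_curvature`,
`SelfDualEquations.exists_canonical`). A rotation by a unit quaternion leaves every α_j unchanged
and achieves ξ_j = (m/d_j) θ_j. The structure equations then yield dθ_0 = 0, Σ d_j² = 0 and dθ_j =
−(m d_j²/P) θ_0∧θ_j with P = d_0 d_1 d_2 (`SelfDualEquations.structure_equations`). Dually, [e_0,
e_j] = r_j e_j and [e_j, e_k] = 0 with r_j = m d_j²/P. Since Σ d_j = Σ d_j² = 0, the d_j are the
cube roots of P, and rescaling the frame by κ = m³/P gives the asserted form with γ = κ².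

For a Riemannian metric the eigenvalues are real, so Σ d_j² = 0 is incompatible with distinct
eigenvalues. A Killing field acts on the frame through a skew-symmetric matrix; the Jacobi identity,
with the r_j nonzero and distinct, forces that matrix to vanish (`lie_eq_zero_of_skew`).

The hypotheses on the manifold are imposed only at the centre of each preferred chart. The tensor
transformation laws carry them to all points of a fixed chart, and the frame found there is
transported back to the manifold. -/

noncomputable section

namespace EinsteinFour

/-! ### Connections over a ring with commuting derivations -/

section DifferentialRing

variable {A : Type*} [CommRing A] [Algebra ℂ A]

theorem map_mul_derivation (d : Derivation ℂ A A) (M N : Matrix (Fin 4) (Fin 4) A) :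
    (M * N).map d = M.map d * N + M * N.map d := by
  ext i j
  simp only [Matrix.map_apply, Matrix.mul_apply, Matrix.add_apply, map_sum, Derivation.leibniz,
    smul_eq_mul, ← Finset.sum_add_distrib]
  exact Finset.sum_congr rfl fun k _ => by ring

theorem map_add_derivation (d : Derivation ℂ A A) (M N : Matrix (Fin 4) (Fin 4) A) :
    (M + N).map d = M.map d + N.map d := by
  ext i j; simp

theorem map_sub_derivation (d : Derivation ℂ A A) (M N : Matrix (Fin 4) (Fin 4) A) :
    (M - N).map d = M.map d - N.map d := by
  ext i j; simp

theorem map_one_derivation (d : Derivation ℂ A A) :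
    (1 : Matrix (Fin 4) (Fin 4) A).map d = 0 := by
  ext i j
  by_cases h : i = j <;> simp [h]

/-- The connection matrices `(Γᵢ)ₖⱼ = Γᵏᵢⱼ` are those of the Levi-Civita connection of `G`. -/
structure IsLeviCivita (D : Fin 4 → Derivation ℂ A A) (G : Matrix (Fin 4) (Fin 4) A)
    (Γ : Fin 4 → Matrix (Fin 4) (Fin 4) A) : Prop where
  torsionFree : ∀ i j k, Γ i k j = Γ j k i
  metric : ∀ i, G.map (D i) = (Γ i).transpose * G + G * Γ i

/-- The curvature matrices of a connection. -/
def connCurv (D : Fin 4 → Derivation ℂ A A) (Γ : Fin 4 → Matrix (Fin 4) (Fin 4) A) (i j : Fin 4) :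
    Matrix (Fin 4) (Fin 4) A :=
  (Γ j).map (D i) - (Γ i).map (D j) + Γ i * Γ j - Γ j * Γ i

/-- Torsion-freeness makes the lowered symbols symmetric, and the metric condition writes each
derivative of `G` as a sum of two of them; the alternating sum isolates one. -/
theorem IsLeviCivita.koszul {D : Fin 4 → Derivation ℂ A A} {G : Matrix (Fin 4) (Fin 4) A}
    {Γ : Fin 4 → Matrix (Fin 4) (Fin 4) A} (h : IsLeviCivita D G Γ) (hG : G.transpose = G)
    (i j l : Fin 4) :
    2 * (G * Γ i) l j = D i (G j l) + D j (G i l) - D l (G i j) := by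
  have sG : ∀ a b, G a b = G b a := fun a b => congrFun (congrFun hG b) a
  have hs : ∀ i j l, (G * Γ i) l j = (G * Γ j) l i := by
    intro i j l
    simp only [Matrix.mul_apply]
    exact Finset.sum_congr rfl fun m _ => by rw [h.torsionFree]
  have hm : ∀ i a b, D i (G a b) = (G * Γ i) b a + (G * Γ i) a b := by
    intro i a b
    have := congrFun (congrFun (h.metric i) a) b
    rw [Matrix.map_apply] at this
    rw [this, Matrix.add_apply]
    congr 1
    simp only [Matrix.mul_apply, Matrix.transpose_apply]
    exact Finset.sum_congr rfl fun m _ => by rw [sG b m]; ring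
  rw [hm, hm, hm, hs i j l, hs i l j, hs j l i]
  ring

theorem two_mul_cancel {a b : A} (h : 2 * a = 2 * b) : a = b := by
  have : (algebraMap ℂ A (1 / 2)) * 2 = 1 := by
    rw [← map_ofNat (algebraMap ℂ A) 2, ← map_mul]; norm_num
  linear_combination (algebraMap ℂ A (1 / 2)) * h + (b - a) * this

theorem three_mul_cancel {a : A} (h : 3 * a = 0) : a = 0 := by
  have : (algebraMap ℂ A (1 / 3)) * 3 = 1 := by
    rw [← map_ofNat (algebraMap ℂ A) 3, ← map_mul]; norm_num
  linear_combination (algebraMap ℂ A (1 / 3)) * h - a * this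

/-- This gives the transformation law of the connection for free: the transformed connection is
again Levi-Civita, hence it is the one of the transformed metric. -/
theorem IsLeviCivita.unique {D : Fin 4 → Derivation ℂ A A} {G H : Matrix (Fin 4) (Fin 4) A}
    {Γ Γ' : Fin 4 → Matrix (Fin 4) (Fin 4) A} (h : IsLeviCivita D G Γ) (h' : IsLeviCivita D G Γ')
    (hG : G.transpose = G) (hH : H * G = 1) : Γ = Γ' := by
  funext i
  have : G * Γ i = G * Γ' i := by
    ext l j
    exact two_mul_cancel (by rw [h.koszul hG, h'.koszul hG])
  calc Γ i = H * G * Γ i := by rw [hH, one_mul]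
    _ = H * G * Γ' i := by rw [Matrix.mul_assoc, this, Matrix.mul_assoc]
    _ = Γ' i := by rw [hH, one_mul]

theorem isLeviCivita_of_koszul {D : Fin 4 → Derivation ℂ A A} {G H : Matrix (Fin 4) (Fin 4) A}
    {Γ : Fin 4 → Matrix (Fin 4) (Fin 4) A} (hG : G.transpose = G) (hH : H * G = 1)
    (hΓ : ∀ i j l, 2 * (G * Γ i) l j = D i (G j l) + D j (G i l) - D l (G i j)) :
    IsLeviCivita D G Γ := by
  have sG : ∀ a b, G a b = G b a := fun a b => congrFun (congrFun hG b) a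
  have hs : ∀ i j l, (G * Γ i) l j = (G * Γ j) l i := by
    intro i j l
    apply two_mul_cancel
    rw [hΓ, hΓ, sG i j]; ring
  refine ⟨fun i j k => ?_, fun i => ?_⟩
  · have e : ∀ i, Γ i = H * (G * Γ i) := fun i => by rw [← Matrix.mul_assoc, hH, one_mul]
    rw [e i, e j, Matrix.mul_apply, Matrix.mul_apply]
    exact Finset.sum_congr rfl fun m _ => by rw [hs]
  · ext a b
    have : ((Γ i).transpose * G) a b = (G * Γ i) b a := by
      simp only [Matrix.mul_apply, Matrix.transpose_apply]
      exact Finset.sum_congr rfl fun m _ => by rw [sG b m]; ring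
    rw [Matrix.add_apply, this, Matrix.map_apply]
    apply two_mul_cancel
    rw [mul_add, hΓ, hΓ, sG a b, sG i a, sG i b]
    ring

/-- The second derivatives of `G`, expressed twice through the metric condition, must be symmetric;
their antisymmetric part is the claimed expression. -/
theorem IsLeviCivita.curv_skew {D : Fin 4 → Derivation ℂ A A} {G : Matrix (Fin 4) (Fin 4) A}
    {Γ : Fin 4 → Matrix (Fin 4) (Fin 4) A} (hD : ∀ i j f, D i (D j f) = D j (D i f))
    (h : IsLeviCivita D G Γ) (i j : Fin 4) :
    (connCurv D Γ i j).transpose * G + G * connCurv D Γ i j = 0 := by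
  have key : ∀ i j, (G.map (D j)).map (D i) =
      ((Γ j).map (D i)).transpose * G + (Γ j).transpose * ((Γ i).transpose * G + G * Γ i) +
        (((Γ i).transpose * G + G * Γ i) * Γ j + G * (Γ j).map (D i)) := by
    intro i j
    rw [h.metric j, map_add_derivation, map_mul_derivation, map_mul_derivation, h.metric i,
      Matrix.transpose_map]
  have hc : (G.map (D j)).map (D i) = (G.map (D i)).map (D j) := by
    ext a b; simp only [Matrix.map_apply]; exact hD _ _ _
  rw [key i j, key j i] at hc
  rw [← sub_eq_zero] at hc
  rw [← hc, connCurv]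
  simp only [Matrix.transpose_sub, Matrix.transpose_add, Matrix.transpose_mul]
  noncomm_ring

theorem IsLeviCivita.bianchi {D : Fin 4 → Derivation ℂ A A} {G : Matrix (Fin 4) (Fin 4) A}
    {Γ : Fin 4 → Matrix (Fin 4) (Fin 4) A} (h : IsLeviCivita D G Γ) (i j k l : Fin 4) :
    connCurv D Γ i j l k + connCurv D Γ j k l i + connCurv D Γ k i l j = 0 := by
  have q : ∀ i j k, (Γ i * Γ j) l k = (Γ i * Γ k) l j := by
    intro i j k
    simp only [Matrix.mul_apply]
    exact Finset.sum_congr rfl fun m _ => by rw [h.torsionFree j k m]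
  simp only [connCurv, Matrix.sub_apply, Matrix.add_apply, Matrix.map_apply]
  rw [h.torsionFree i k, h.torsionFree j i, h.torsionFree k j, q i j k, q j k i, q k i j]
  ring

theorem connCurv_swap (D : Fin 4 → Derivation ℂ A A) (Γ : Fin 4 → Matrix (Fin 4) (Fin 4) A)
    (i j : Fin 4) : connCurv D Γ j i = -connCurv D Γ i j := by
  simp only [connCurv]; abel

/-- The pair symmetry of the curvature tensor. -/
theorem IsLeviCivita.pair_symm {D : Fin 4 → Derivation ℂ A A} {G : Matrix (Fin 4) (Fin 4) A}
    {Γ : Fin 4 → Matrix (Fin 4) (Fin 4) A} (hD : ∀ i j f, D i (D j f) = D j (D i f))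
    (h : IsLeviCivita D G Γ) (hG : G.transpose = G) (i j k l : Fin 4) :
    (G * connCurv D Γ i j) l k = (G * connCurv D Γ k l) j i := by
  set R : Fin 4 → Fin 4 → Fin 4 → Fin 4 → A := fun i j k l => (G * connCurv D Γ i j) l k with hR
  have s1 : ∀ i j k l, R j i k l = -R i j k l := by
    intro i j k l; simp only [hR]; rw [connCurv_swap]; simp
  have s2 : ∀ i j k l, R i j l k = -R i j k l := by
    intro i j k l
    have := congrFun (congrFun (h.curv_skew hD i j) k) l
    have e : ((connCurv D Γ i j).transpose * G) = (G * connCurv D Γ i j).transpose := by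
      rw [Matrix.transpose_mul, hG]
    rw [e] at this
    simp only [Matrix.add_apply, Matrix.transpose_apply, Matrix.zero_apply] at this
    simp only [hR]
    linear_combination this
  have b : ∀ i j k l, R i j k l + R j k i l + R k i j l = 0 := by
    intro i j k l
    simp only [hR, Matrix.mul_apply, ← Finset.sum_add_distrib, ← mul_add]
    exact Finset.sum_eq_zero fun m _ => by rw [h.bianchi, mul_zero]
  change R i j k l = R k l i j
  apply two_mul_cancel
  -- The octahedron argument: four rotations of the first Bianchi identity, combined so that by
  -- skew-symmetry all terms cancel except two copies of each side.
  have b1 := b i j k l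
  have b2 := b j k l i
  have b3 := b k l i j
  have b4 := b l i j k
  have t : ∀ i j k l, R i j k l = R j i l k := fun i j k l => by rw [s1, s2]; ring
  linear_combination b1 + b2 - b3 - b4 - s2 j k i l - s2 k l i j + s2 l i j k + t i k l j
    + s2 i j k l - t l j k i

/-- The curvature matrices change by conjugation under a gauge transformation. -/
theorem connCurv_gauge {D : Fin 4 → Derivation ℂ A A} (hD : ∀ i j f, D i (D j f) = D j (D i f))
    {J : Matrix (Fin 4) (Fin 4) A} {P Q : Fin 4 → Matrix (Fin 4) (Fin 4) A}
    (h : ∀ i, J * Q i = J.map (D i) + P i * J) (i j : Fin 4) :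
    J * connCurv D Q i j = connCurv D P i j * J := by
  -- The hypothesis is a first-order system for `J`; its integrability condition, obtained from two
  -- orders of differentiation, is the conjugation rule.
  have key : ∀ i j, (J.map (D j)).map (D i) =
      (J * Q i - P i * J) * Q j + J * (Q j).map (D i) - (P j).map (D i) * J
        - P j * (J * Q i - P i * J) := by
    intro i j
    have e : ∀ i, J.map (D i) = J * Q i - P i * J := fun i => by rw [h i]; abel
    rw [e j, map_sub_derivation, map_mul_derivation, map_mul_derivation, e i]
    abel
  have hc : (J.map (D j)).map (D i) = (J.map (D i)).map (D j) := by
    ext a b; simp only [Matrix.map_apply]; exact hD _ _ _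
  rw [key i j, key j i, ← sub_eq_zero] at hc
  rw [← sub_eq_zero, ← hc]
  simp only [connCurv]
  noncomm_ring

end DifferentialRing

end EinsteinFour

end

noncomputable section

namespace EinsteinFour

/-! ### Pullback of connections and their curvature -/

section Pullback

variable {A B : Type*} [CommRing A] [Algebra ℂ A] [CommRing B] [Algebra ℂ B]

/-- The pullback of connection matrices under a map with Jacobian matrix `J`. -/
def pullbackConn (φ : A →+* B) (J : Matrix (Fin 4) (Fin 4) B)
    (Γ : Fin 4 → Matrix (Fin 4) (Fin 4) A) (i : Fin 4) : Matrix (Fin 4) (Fin 4) B :=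
  ∑ b, J b i • (Γ b).map φ

theorem map_sum_derivation (d : Derivation ℂ B B) (M : Fin 4 → Matrix (Fin 4) (Fin 4) B) :
    (∑ b, M b).map d = ∑ b, (M b).map d := by
  ext i j; simp [Matrix.sum_apply]

theorem map_smul_derivation (d : Derivation ℂ B B) (f : B) (M : Matrix (Fin 4) (Fin 4) B) :
    (f • M).map d = d f • M + f • M.map d := by
  ext i j; simp [mul_comm]; ring

/-- The curvature is a matrix-valued two-form built from exterior derivative and product, so it
commutes with pullback. The derivatives of the Jacobian drop out because `hJ` makes them symmetric.
-/
theorem connCurv_pullback {D : Fin 4 → Derivation ℂ A A} {D' : Fin 4 → Derivation ℂ B B}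
    {φ : A →+* B} {J : Matrix (Fin 4) (Fin 4) B}
    (hφ : ∀ i f, D' i (φ f) = ∑ b, J b i * φ (D b f))
    (hJ : ∀ i j b, D' i (J b j) = D' j (J b i))
    (Γ : Fin 4 → Matrix (Fin 4) (Fin 4) A) (i j : Fin 4) :
    connCurv D' (pullbackConn φ J Γ) i j =
      ∑ b, ∑ c, (J b i * J c j) • (connCurv D Γ b c).map φ := by
  have hmap : ∀ i b, ((Γ b).map φ).map (D' i) = ∑ c, J c i • ((Γ b).map (D c)).map φ := by
    intro i b
    ext k l
    simp [Matrix.sum_apply, hφ]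
  have h1 : ∀ i j, (pullbackConn φ J Γ j).map (D' i) =
      ∑ b, D' i (J b j) • (Γ b).map φ + ∑ b, ∑ c, (J b i * J c j) • ((Γ c).map (D b)).map φ := by
    intro i j
    rw [pullbackConn, map_sum_derivation]
    simp only [map_smul_derivation, hmap, Finset.sum_add_distrib, Finset.smul_sum, smul_smul]
    rw [Finset.sum_comm (f := fun b c => (J b i * J c j) • ((Γ c).map (D b)).map φ)]
    simp only [mul_comm]
  have h2 : ∀ i j, pullbackConn φ J Γ i * pullbackConn φ J Γ j =
      ∑ b, ∑ c, (J b i * J c j) • ((Γ b * Γ c).map φ) := by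
    intro i j
    simp only [pullbackConn, Finset.sum_mul_sum, Matrix.smul_mul, Matrix.mul_smul, smul_smul,
      Matrix.map_mul]
    exact Finset.sum_congr rfl fun b _ => Finset.sum_congr rfl fun c _ => by rw [mul_comm]
  have h3 : ∀ b c, (connCurv D Γ b c).map φ = ((Γ c).map (D b)).map φ - ((Γ b).map (D c)).map φ
      + (Γ b * Γ c).map φ - (Γ c * Γ b).map φ := by
    intro b c; ext k l; simp [connCurv, -Matrix.map_mul]
  rw [connCurv, h1, h1, h2, h2]
  simp only [h3, smul_sub, smul_add, Finset.sum_sub_distrib, Finset.sum_add_distrib, hJ i j]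
  rw [Finset.sum_comm (f := fun b c => (J b j * J c i) • ((Γ c).map (D b)).map φ),
    Finset.sum_comm (f := fun b c => (J b j * J c i) • (Γ b * Γ c).map φ)]
  simp only [mul_comm (J _ j)]
  abel

/-- The Levi-Civita connection of the pullback of a metric. -/
theorem IsLeviCivita.pullback {D : Fin 4 → Derivation ℂ A A} {D' : Fin 4 → Derivation ℂ B B}
    {φ : A →+* B} {J K : Matrix (Fin 4) (Fin 4) B}
    (hφ : ∀ i f, D' i (φ f) = ∑ b, J b i * φ (D b f))
    (hJ : ∀ i j b, D' i (J b j) = D' j (J b i)) (hJK : J * K = 1)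
    {G : Matrix (Fin 4) (Fin 4) A} {Γ : Fin 4 → Matrix (Fin 4) (Fin 4) A}
    (h : IsLeviCivita D G Γ) :
    IsLeviCivita D' (J.transpose * G.map φ * J)
      (fun i => K * (J.map (D' i) + pullbackConn φ J Γ i * J)) := by
  have hKJ : K * J = 1 := mul_eq_one_comm.mp hJK
  -- The pulled-back connection preserves the pulled-back metric in the old frame; passing to the
  -- new coordinate frame is then a gauge transformation by `J`.
  have hP : ∀ i, (G.map φ).map (D' i) =
      (pullbackConn φ J Γ i).transpose * G.map φ + G.map φ * pullbackConn φ J Γ i := by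
    intro i
    have e : (G.map φ).map (D' i) = ∑ b, J b i • (G.map (D b)).map φ := by
      ext k l
      simp [Matrix.sum_apply, hφ]
    rw [e]
    simp only [h.metric, pullbackConn, Matrix.transpose_sum, Matrix.transpose_smul, Finset.sum_mul,
      Finset.mul_sum, ← Finset.sum_add_distrib]
    refine Finset.sum_congr rfl fun b _ => ?_
    rw [Matrix.map_add _ (map_add φ), Matrix.map_mul, Matrix.map_mul, smul_add, Matrix.smul_mul,
      Matrix.mul_smul, Matrix.transpose_map]
  refine ⟨fun i j k => ?_, fun i => ?_⟩
  · rw [Matrix.mul_apply, Matrix.mul_apply]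
    refine Finset.sum_congr rfl fun a _ => ?_
    congr 1
    simp only [Matrix.add_apply, Matrix.map_apply]
    rw [hJ i j a]
    congr 1
    simp only [pullbackConn, Matrix.mul_apply, Matrix.sum_apply, Matrix.smul_apply, Matrix.map_apply,
      smul_eq_mul, Finset.sum_mul]
    rw [Finset.sum_comm]
    refine Finset.sum_congr rfl fun b _ => Finset.sum_congr rfl fun c _ => ?_
    rw [h.torsionFree b c a]; ring
  · have e : J * (K * (J.map (D' i) + pullbackConn φ J Γ i * J)) =
        J.map (D' i) + pullbackConn φ J Γ i * J := by
      rw [← Matrix.mul_assoc, hJK, Matrix.one_mul]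
    have e' := congrArg Matrix.transpose e
    rw [Matrix.transpose_mul] at e'
    rw [map_mul_derivation, map_mul_derivation, hP, Matrix.mul_assoc (J.transpose * G.map φ), e,
      ← Matrix.mul_assoc (Matrix.transpose _) (J.transpose * G.map φ),
      ← Matrix.mul_assoc (Matrix.transpose _) J.transpose, e', Matrix.transpose_map]
    simp only [Matrix.transpose_add, Matrix.transpose_mul, ]
    noncomm_ring

end Pullback

/-! ### Cartan's structure equations and their self-dual part -/

section Frame

variable {A : Type*} [CommRing A] [Algebra ℂ A]

/-- The coframe dual to an orthonormal frame. -/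
def coframe (G E : Matrix (Fin 4) (Fin 4) A) : Matrix (Fin 4) (Fin 4) A := E.transpose * G

/-- The connection forms in an orthonormal frame. -/
def frameConn (D : Fin 4 → Derivation ℂ A A) (G : Matrix (Fin 4) (Fin 4) A)
    (Γ : Fin 4 → Matrix (Fin 4) (Fin 4) A) (E : Matrix (Fin 4) (Fin 4) A) (i : Fin 4) :
    Matrix (Fin 4) (Fin 4) A :=
  coframe G E * (E.map (D i) + Γ i * E)

variable {D : Fin 4 → Derivation ℂ A A} {G E : Matrix (Fin 4) (Fin 4) A}
  {Γ : Fin 4 → Matrix (Fin 4) (Fin 4) A}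

omit [Algebra ℂ A] in
theorem coframe_mul (hE : E.transpose * G * E = 1) : coframe G E * E = 1 := hE

omit [Algebra ℂ A] in
theorem mul_coframe (hE : E.transpose * G * E = 1) : E * coframe G E = 1 :=
  mul_eq_one_comm.mp hE

theorem mul_frameConn (hE : E.transpose * G * E = 1) (i : Fin 4) :
    E * frameConn D G Γ E i = E.map (D i) + Γ i * E := by
  rw [frameConn, ← Matrix.mul_assoc, mul_coframe hE, Matrix.one_mul]

theorem frameConn_skew (hΓ : IsLeviCivita D G Γ) (hG : G.transpose = G)
    (hE : E.transpose * G * E = 1) (i : Fin 4) :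
    (frameConn D G Γ E i).transpose = -frameConn D G Γ E i := by
  have h := congrArg (fun M => M.map (D i)) hE
  simp only [map_mul_derivation, map_one_derivation, hΓ.metric i] at h
  rw [eq_neg_iff_add_eq_zero, ← h, frameConn, coframe]
  simp only [Matrix.transpose_mul, Matrix.transpose_add, Matrix.transpose_transpose, hG,
    Matrix.transpose_map]
  noncomm_ring

/-- Cartan's first structure equation. Differentiating `θ E = 1` gives dθ = θΓ − ωθ, and the first
term is symmetric in the form indices. -/
theorem frameConn_torsionFree (hΓ : IsLeviCivita D G Γ) (hE : E.transpose * G * E = 1)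
    (i j a : Fin 4) :
    D i (coframe G E a j) - D j (coframe G E a i) =
      ∑ b, (frameConn D G Γ E j a b * coframe G E b i - frameConn D G Γ E i a b * coframe G E b j) := by
  set θ := coframe G E with hθ
  have key : ∀ i, θ.map (D i) = θ * Γ i - frameConn D G Γ E i * θ := by
    intro i
    have h := congrArg (fun M => M.map (D i)) (coframe_mul hE)
    simp only [map_mul_derivation, map_one_derivation] at h
    have h2 : θ.map (D i) = -(θ * E.map (D i)) * θ := by
      calc θ.map (D i) = θ.map (D i) * (E * θ) := by rw [mul_coframe hE, Matrix.mul_one]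
        _ = (θ.map (D i) * E) * θ := by rw [Matrix.mul_assoc]
        _ = _ := by rw [eq_neg_of_add_eq_zero_left h]
    rw [h2, frameConn, ← hθ]
    have e : θ * Γ i = θ * Γ i * (E * θ) := by rw [mul_coframe hE, Matrix.mul_one]
    rw [e]
    noncomm_ring
  have h1 := congrFun (congrFun (key i) a) j
  have h2 := congrFun (congrFun (key j) a) i
  have h3 : (θ * Γ i) a j = (θ * Γ j) a i := by
    simp only [Matrix.mul_apply]
    exact Finset.sum_congr rfl fun m _ => by rw [hΓ.torsionFree]
  simp only [Matrix.map_apply, Matrix.sub_apply] at h1 h2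
  rw [h1, h2, h3, Finset.sum_sub_distrib]
  simp only [Matrix.mul_apply]
  ring

/-- The basis `I₁, I₂, I₃` of the self-dual bivectors in an oriented orthonormal frame. -/
def sdBasis (R : Type*) [CommRing R] (j : Fin 3) : Matrix (Fin 4) (Fin 4) R :=
  match j with
  | 0 => !![0, 1, 0, 0; -1, 0, 0, 0; 0, 0, 0, 1; 0, 0, -1, 0]
  | 1 => !![0, 0, 1, 0; 0, 0, 0, -1; -1, 0, 0, 0; 0, 1, 0, 0]
  | 2 => !![0, 0, 0, 1; 0, 0, 1, 0; 0, -1, 0, 0; -1, 0, 0, 0]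

/-- The self-dual components of a skew-symmetric matrix. -/
def sdPart (j : Fin 3) (M : Matrix (Fin 4) (Fin 4) A) : A :=
  M 0 j.succ + M (j + 1).succ (j + 2).succ

/-- The self-dual connection forms. -/
def sdConn (D : Fin 4 → Derivation ℂ A A) (G : Matrix (Fin 4) (Fin 4) A)
    (Γ : Fin 4 → Matrix (Fin 4) (Fin 4) A) (E : Matrix (Fin 4) (Fin 4) A) (j : Fin 3) (i : Fin 4) :
    A :=
  sdPart j (frameConn D G Γ E i)

/-- The self-dual two-forms of a coframe. -/
def sdForm (θ : Matrix (Fin 4) (Fin 4) A) (j : Fin 3) (p q : Fin 4) : A :=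
  θ 0 p * θ j.succ q - θ 0 q * θ j.succ p
    + (θ (j + 1).succ p * θ (j + 2).succ q - θ (j + 1).succ q * θ (j + 2).succ p)

/-- The exterior product of a one-form and a two-form. -/
def wedge (ξ : Fin 4 → A) (α : Fin 4 → Fin 4 → A) (i p q : Fin 4) : A :=
  ξ i * α p q + ξ p * α q i + ξ q * α i p

/-- The algebra so(4) is a sum of two commuting copies of so(3). Hence the self-dual part of ω∧ω
involves only the self-dual part of ω, and it is the cross product in so(3). -/
theorem extDeriv_sdConn (hΓ : IsLeviCivita D G Γ) (hG : G.transpose = G)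
    (hE : E.transpose * G * E = 1) (j : Fin 3) (p q : Fin 4) :
    D p (sdConn D G Γ E j q) - D q (sdConn D G Γ E j p) =
      sdConn D G Γ E (j + 1) p * sdConn D G Γ E (j + 2) q
        - sdConn D G Γ E (j + 1) q * sdConn D G Γ E (j + 2) p
        + sdPart j (connCurv D (frameConn D G Γ E) p q) := by
  have hs : ∀ i a b, frameConn D G Γ E i b a = -frameConn D G Γ E i a b := fun i a b =>
    congrFun (congrFun (frameConn_skew hΓ hG hE i) a) b
  have hd : ∀ i a, frameConn D G Γ E i a a = 0 := fun i a =>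
    two_mul_cancel (by linear_combination hs i a a)
  generalize hW : frameConn D G Γ E = W at *
  fin_cases j <;>
  simp [sdConn, sdPart, connCurv, Matrix.mul_apply, Fin.sum_univ_four, hW, hd,
    hs _ 0 1, hs _ 0 2, hs _ 0 3, hs _ 1 2, hs _ 1 3, hs _ 2 3] <;>
  ring

theorem extDeriv_wedge (d : Fin 4 → Derivation ℂ A A) (u v : Fin 4 → A) (i p q : Fin 4) :
    d i (u p * v q - u q * v p) + d p (u q * v i - u i * v q) + d q (u i * v p - u p * v i) =
      (d i (u p) - d p (u i)) * v q + (d p (u q) - d q (u p)) * v i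
        + (d q (u i) - d i (u q)) * v p
        - (u i * (d p (v q) - d q (v p)) + u p * (d q (v i) - d i (v q))
          + u q * (d i (v p) - d p (v i))) := by
  simp only [map_sub, Derivation.leibniz, smul_eq_mul]
  ring

/-- By the first structure equation the forms α_j are rotated by ω; the anti-self-dual part of ω
acts trivially on them, so only the ξ's remain. -/
theorem extDeriv_sdForm (hΓ : IsLeviCivita D G Γ) (hG : G.transpose = G)
    (hE : E.transpose * G * E = 1) (j : Fin 3) (i p q : Fin 4) :
    D i (sdForm (coframe G E) j p q) + D p (sdForm (coframe G E) j q i)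
        + D q (sdForm (coframe G E) j i p) =
      wedge (sdConn D G Γ E (j + 1)) (sdForm (coframe G E) (j + 2)) i p q
        - wedge (sdConn D G Γ E (j + 2)) (sdForm (coframe G E) (j + 1)) i p q := by
  have hs : ∀ i a b, frameConn D G Γ E i b a = -frameConn D G Γ E i a b := fun i a b =>
    congrFun (congrFun (frameConn_skew hΓ hG hE i) a) b
  have hd : ∀ i a, frameConn D G Γ E i a a = 0 := fun i a =>
    two_mul_cancel (by linear_combination hs i a a)
  have hT := frameConn_torsionFree hΓ hE
  have e1 := extDeriv_wedge D (coframe G E 0) (coframe G E j.succ) i p q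
  have e2 := extDeriv_wedge D (coframe G E (j + 1).succ) (coframe G E (j + 2).succ) i p q
  simp only [hT] at e1 e2
  generalize coframe G E = θ at *
  generalize hW : frameConn D G Γ E = W at *
  simp only [sdForm, map_add]
  fin_cases j <;>
  simp [wedge, sdForm, sdConn, sdPart, Fin.sum_univ_four, hW, hd, -map_sub,
    hs _ 0 1, hs _ 0 2, hs _ 0 3, hs _ 1 2, hs _ 1 3, hs _ 2 3] at e1 e2 ⊢ <;>
  linear_combination e1 + e2

end Frame

end EinsteinFour

end

noncomputable section

namespace EinsteinFour

/-! ### The linear system imposed by the Bianchi identity -/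

section SelfDual

variable {A : Type*} [CommRing A] [Algebra ℂ A]

/-- The structure equations of the self-dual part of an Einstein metric in a coframe `θ`, with dual
frame `E`, that diagonalizes the self-dual Weyl tensor with the constant eigenvalues `lam`. -/
structure SelfDualEquations (D : Fin 4 → Derivation ℂ A A) (θ E : Matrix (Fin 4) (Fin 4) A)
    (ξ : Fin 3 → Fin 4 → A) (lam : Fin 3 → ℂ) (σ : A) : Prop where
  comm : ∀ i j f, D i (D j f) = D j (D i f)
  dual : θ * E = 1
  curvature : ∀ j p q, D p (ξ j q) - D q (ξ j p) =
    ξ (j + 1) p * ξ (j + 2) q - ξ (j + 1) q * ξ (j + 2) p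
      + (algebraMap ℂ A (lam j) + σ) * sdForm θ j p q
  torsion : ∀ j i p q, D i (sdForm θ j p q) + D p (sdForm θ j q i) + D q (sdForm θ j i p) =
    wedge (ξ (j + 1)) (sdForm θ (j + 2)) i p q - wedge (ξ (j + 2)) (sdForm θ (j + 1)) i p q

/-- This is d(dξ₁) = 0 after substitution of the structure equations. The terms cubic in the ξ's
contain a repeated factor and vanish. The coefficients are arbitrary functions here, so that the
differential of the scalar curvature is kept. -/
theorem second_bianchi {D : Fin 4 → Derivation ℂ A A} (hD : ∀ i j f, D i (D j f) = D j (D i f))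
    {ξ₁ ξ₂ ξ₃ : Fin 4 → A} {α₁ α₂ α₃ : Fin 4 → Fin 4 → A} {c₁ c₂ c₃ : A}
    (h₁ : ∀ p q, D p (ξ₁ q) - D q (ξ₁ p) = ξ₂ p * ξ₃ q - ξ₂ q * ξ₃ p + c₁ * α₁ p q)
    (h₂ : ∀ p q, D p (ξ₂ q) - D q (ξ₂ p) = ξ₃ p * ξ₁ q - ξ₃ q * ξ₁ p + c₂ * α₂ p q)
    (h₃ : ∀ p q, D p (ξ₃ q) - D q (ξ₃ p) = ξ₁ p * ξ₂ q - ξ₁ q * ξ₂ p + c₃ * α₃ p q)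
    (hα : ∀ i p q, D i (α₁ p q) + D p (α₁ q i) + D q (α₁ i p) =
      wedge ξ₂ α₃ i p q - wedge ξ₃ α₂ i p q) (i p q : Fin 4) :
    (c₂ - c₁) * wedge ξ₃ α₂ i p q + (c₁ - c₃) * wedge ξ₂ α₃ i p q
      + wedge (fun i => D i c₁) α₁ i p q = 0 := by
  have key : D i (D p (ξ₁ q) - D q (ξ₁ p)) + D p (D q (ξ₁ i) - D i (ξ₁ q))
      + D q (D i (ξ₁ p) - D p (ξ₁ i)) = 0 := by
    simp only [map_sub, hD p i, hD q i, hD q p]; ring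
  simp only [h₁] at key
  simp only [map_add, Derivation.leibniz, smul_eq_mul] at key
  have e := extDeriv_wedge D ξ₂ ξ₃ i p q
  simp only [h₂, h₃] at e
  have e2 := hα i p q
  simp only [wedge] at *
  linear_combination key - e - c₁ * e2

omit [Algebra ℂ A] in
theorem sdForm_contract {θ E : Matrix (Fin 4) (Fin 4) A} (h : θ * E = 1) (j : Fin 3) (a b : Fin 4) :
    ∑ p, ∑ q, E p a * E q b * sdForm θ j p q = sdForm (1 : Matrix (Fin 4) (Fin 4) A) j a b := by
  rw [← h]
  simp only [sdForm, Matrix.mul_apply, Fin.sum_univ_four]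
  ring

omit [Algebra ℂ A] in
-- Evaluation on the dual frame turns identities between forms into identities with constant
-- coefficients, since there the coframe becomes the identity matrix.
theorem wedge_contract (E : Matrix (Fin 4) (Fin 4) A) (ξ : Fin 4 → A) (α : Fin 4 → Fin 4 → A)
    (a b c : Fin 4) :
    ∑ i, ∑ p, ∑ q, E i a * E p b * E q c * wedge ξ α i p q =
      wedge (fun a => ∑ i, E i a * ξ i) (fun a b => ∑ p, ∑ q, E p a * E q b * α p q) a b c := by
  simp only [wedge, Fin.sum_univ_four]
  ring

/-- The components `X₁, X₂, X₃` of `(λ₂ - λ₃) ξ₁, (λ₃ - λ₁) ξ₂, (λ₁ - λ₂) ξ₃` in the coframe, for a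
vector `(q, p₁, p₂, p₃)`. -/
def quatForm (θ : Matrix (Fin 4) (Fin 4) A) (q p₁ p₂ p₃ : A) (j : Fin 3) (i : Fin 4) : A :=
  match j with
  | 0 => p₁ * θ 0 i + q * θ 1 i + p₃ * θ 2 i - p₂ * θ 3 i
  | 1 => p₂ * θ 0 i - p₃ * θ 1 i + q * θ 2 i + p₁ * θ 3 i
  | 2 => p₃ * θ 0 i + p₂ * θ 1 i - p₁ * θ 2 i + q * θ 3 i

variable {D : Fin 4 → Derivation ℂ A A} {θ E : Matrix (Fin 4) (Fin 4) A}
  {ξ : Fin 3 → Fin 4 → A} {lam : Fin 3 → ℂ} {σ : A}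

/-- In frame components the three instances of `second_bianchi` are twelve linear equations for the
ξ's and dσ. They force dσ = 0 and make the nonconstant choices collapse: the components of the three
forms d_j ξ_j coincide up to sign and position, so that four functions describe them all. -/
theorem SelfDualEquations.exists_quatForm (h : SelfDualEquations D θ E ξ lam σ) :
    ∃ q p₁ p₂ p₃ : A, ∀ j i,
      algebraMap ℂ A (lam (j + 1) - lam (j + 2)) * ξ j i = quatForm θ q p₁ p₂ p₃ j i := by
  have hDl : ∀ i j, D i (algebraMap ℂ A (lam j) + σ) = D i σ := by intro i j; simp
  have b1 := second_bianchi h.comm (h.curvature 0) (h.curvature 1) (h.curvature 2) (h.torsion 0)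
  have b2 := second_bianchi h.comm (h.curvature 1) (h.curvature 2) (h.curvature 0) (h.torsion 1)
  have b3 := second_bianchi h.comm (h.curvature 2) (h.curvature 0) (h.curvature 1) (h.torsion 2)
  set x : Fin 3 → Fin 4 → A := fun j a => ∑ i, E i a * ξ j i with hx
  set d : Fin 4 → A := fun a => ∑ i, E i a * D i σ with hd
  have contr : ∀ (c₁ c₂ : A) (ξ₁ ξ₂ : Fin 4 → A) (j₁ j₂ j₃ : Fin 3),
      (∀ i p q, c₁ * wedge ξ₁ (sdForm θ j₁) i p q + c₂ * wedge ξ₂ (sdForm θ j₂) i p q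
        + wedge (fun i => D i σ) (sdForm θ j₃) i p q = 0) → ∀ a b c,
      c₁ * wedge (fun a => ∑ i, E i a * ξ₁ i) (sdForm (1 : Matrix (Fin 4) (Fin 4) A) j₁) a b c
        + c₂ * wedge (fun a => ∑ i, E i a * ξ₂ i) (sdForm (1 : Matrix (Fin 4) (Fin 4) A) j₂) a b c
        + wedge d (sdForm (1 : Matrix (Fin 4) (Fin 4) A) j₃) a b c = 0 := by
    intro c₁ c₂ ξ₁ ξ₂ j₁ j₂ j₃ H a b c
    have e : ∀ j, sdForm (1 : Matrix (Fin 4) (Fin 4) A) j =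
        fun a b => ∑ p, ∑ q, E p a * E q b * sdForm θ j p q := by
      intro j; funext a b; rw [sdForm_contract h.dual]
    rw [e, e, e, hd, ← wedge_contract, ← wedge_contract, ← wedge_contract]
    simp only [Finset.mul_sum, ← Finset.sum_add_distrib]
    refine Finset.sum_eq_zero fun i _ => Finset.sum_eq_zero fun p _ => Finset.sum_eq_zero fun q _ => ?_
    linear_combination E i a * E p b * E q c * H i p q
  simp only [hDl] at b1 b2 b3
  replace b1 := contr _ _ _ _ _ _ _ b1
  replace b2 := contr _ _ _ _ _ _ _ b2
  replace b3 := contr _ _ _ _ _ _ _ b3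
  have hback : ∀ j i, ξ j i = ∑ a, x j a * θ a i := by
    intro j i
    have hEθ : E * θ = 1 := mul_eq_one_comm.mp h.dual
    have : ∀ k, ∑ a, E k a * θ a i = if k = i then 1 else 0 := by
      intro k
      rw [← Matrix.mul_apply, hEθ, Matrix.one_apply]
    simp only [hx, Finset.sum_mul]
    rw [Finset.sum_comm]
    simp only [mul_right_comm _ (ξ j _), ← Finset.sum_mul, this]
    simp
  have o : ∀ a b : Fin 4, (1 : Matrix (Fin 4) (Fin 4) A) a b = if a = b then 1 else 0 :=
    fun a b => Matrix.one_apply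
  have m1 := b1 0 1 2
  have m2 := b1 0 1 3
  have m3 := b1 0 2 3
  have m4 := b1 1 2 3
  have m5 := b2 0 1 2
  have m6 := b2 0 1 3
  have m7 := b2 0 2 3
  have m8 := b2 1 2 3
  have m9 := b3 0 1 2
  have m10 := b3 0 1 3
  have m11 := b3 0 2 3
  have m12 := b3 1 2 3
  clear b1 b2 b3 contr
  change _ * wedge (x _) _ _ _ _ + _ * wedge (x _) _ _ _ _ + _ = 0 at m1 m2 m3 m4 m5 m6
  change _ * wedge (x _) _ _ _ _ + _ * wedge (x _) _ _ _ _ + _ = 0 at m7 m8 m9 m10 m11 m12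
  simp [wedge, sdForm, o] at m1 m2 m3 m4 m5 m6 m7 m8 m9 m10 m11 m12
  -- In these combinations the components of the ξ's cancel, which leaves three times a component of
  -- dσ.
  have d0 : d 0 = 0 := three_mul_cancel (by linear_combination m3 - m6 + m9)
  have d1 : d 1 = 0 := three_mul_cancel (by linear_combination m4 - m5 - m10)
  have d2 : d 2 = 0 := three_mul_cancel (by linear_combination m1 + m8 - m11)
  have d3 : d 3 = 0 := three_mul_cancel (by linear_combination m2 + m7 + m12)
  -- The entries p₁, p₂, p₃ are the θ₀-components of the three forms, and q is the common value of
  -- the θ_j-component of the jth one.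
  refine ⟨algebraMap ℂ A (lam 1 - lam 2) * x 0 1, algebraMap ℂ A (lam 1 - lam 2) * x 0 0,
    algebraMap ℂ A (lam 2 - lam 0) * x 1 0, algebraMap ℂ A (lam 0 - lam 1) * x 2 0,
    fun j i => ?_⟩
  rw [hback, Fin.sum_univ_four]
  fin_cases j <;> simp [quatForm]
  · linear_combination θ 2 i * (m7 - d3) - θ 3 i * (m11 + d2)
  · linear_combination θ 1 i * (m2 - d3) - θ 2 i * (m9 - d0) - θ 3 i * (m10 + d1)
  · linear_combination θ 1 i * (m1 - d2) - θ 2 i * (m5 + d1) - θ 3 i * (m6 + d0)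

/-- Each X_j has q, p₁, p₂, p₃ up to sign as its four components, so the vanishing of one X_j makes
all of them vanish. -/
theorem SelfDualEquations.mul_eq_zero (h : SelfDualEquations D θ E ξ lam σ) {j₀ : Fin 3}
    (hj₀ : lam (j₀ + 1) = lam (j₀ + 2)) (j : Fin 3) (i : Fin 4) :
    algebraMap ℂ A (lam (j + 1) - lam (j + 2)) * ξ j i = 0 := by
  obtain ⟨q, p₁, p₂, p₃, hX⟩ := h.exists_quatForm
  have h0 : ∀ i, quatForm θ q p₁ p₂ p₃ j₀ i = 0 := by
    intro i; rw [← hX, hj₀, sub_self, map_zero, zero_mul]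
  -- Contraction with the dual frame reads off the four coefficients.
  have h1 : ∀ a, ∑ i, E i a * quatForm θ q p₁ p₂ p₃ j₀ i =
      quatForm (1 : Matrix (Fin 4) (Fin 4) A) q p₁ p₂ p₃ j₀ a := by
    intro a
    rw [← h.dual]
    fin_cases j₀ <;> simp only [quatForm, Matrix.mul_apply, Fin.sum_univ_four] <;> ring
  simp only [h0, mul_zero, Finset.sum_const_zero] at h1
  rw [hX]
  have r0 := h1 0
  have r1 := h1 1
  have r2 := h1 2
  have r3 := h1 3
  have : q = 0 ∧ p₁ = 0 ∧ p₂ = 0 ∧ p₃ = 0 := by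
    fin_cases j₀ <;> simp [quatForm] at r0 r1 r2 r3 <;> simp_all
  obtain ⟨rfl, rfl, rfl, rfl⟩ := this
  fin_cases j <;> simp [quatForm]

end SelfDual

end EinsteinFour

end

noncomputable section

namespace EinsteinFour

/-! ### Constancy of the norm and the canonical rotation of the frame -/

section Canonical

variable {A : Type*} [CommRing A] [Algebra ℂ A]

/-- The component `0123` of the exterior product of two two-forms. -/
def wedgeTwoTwo (α β : Fin 4 → Fin 4 → A) : A :=
  α 0 1 * β 2 3 - α 0 2 * β 1 3 + α 0 3 * β 1 2 + α 1 2 * β 0 3 - α 1 3 * β 0 2 + α 2 3 * β 0 1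

/-- The component `0123` of the exterior product of a one-form and a three-form. -/
def wedgeOneThree (ξ : Fin 4 → A) (τ : Fin 4 → Fin 4 → Fin 4 → A) : A :=
  ξ 0 * τ 1 2 3 - ξ 1 * τ 0 2 3 + ξ 2 * τ 0 1 3 - ξ 3 * τ 0 1 2

/-- The component `0123` of the exterior derivative of a three-form. -/
def extDerivThree (D : Fin 4 → Derivation ℂ A A) (τ : Fin 4 → Fin 4 → Fin 4 → A) : A :=
  D 0 (τ 1 2 3) - D 1 (τ 0 2 3) + D 2 (τ 0 1 3) - D 3 (τ 0 1 2)

theorem extDerivThree_wedge (D : Fin 4 → Derivation ℂ A A) (ξ : Fin 4 → A)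
    (α : Fin 4 → Fin 4 → A) (hα : ∀ p q, α q p = -α p q) :
    extDerivThree D (wedge ξ α) =
      wedgeTwoTwo (fun p q => D p (ξ q) - D q (ξ p)) α
        - wedgeOneThree ξ (fun i p q => D i (α p q) + D p (α q i) + D q (α i p)) := by
  simp only [extDerivThree, wedge, wedgeTwoTwo, wedgeOneThree, map_add, Derivation.leibniz,
    smul_eq_mul, hα 1 3, hα 0 3, hα 0 2, map_neg]
  ring

omit [Algebra ℂ A] in
theorem det_eq_sum (θ : Matrix (Fin 4) (Fin 4) A) :
    θ.det = wedgeTwoTwo (fun p q => θ 0 p * θ 1 q - θ 0 q * θ 1 p)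
      (fun p q => θ 2 p * θ 3 q - θ 2 q * θ 3 p) := by
  rw [Matrix.det_succ_row_zero]
  simp [Fin.sum_univ_succ, Matrix.det_fin_three, wedgeTwoTwo, Fin.succAbove]
  ring

omit [Algebra ℂ A] in
theorem sdForm_swap (θ : Matrix (Fin 4) (Fin 4) A) (j : Fin 3) (p q : Fin 4) :
    sdForm θ j q p = -sdForm θ j p q := by
  simp only [sdForm]; ring

omit [Algebra ℂ A] in
theorem sdForm_wedge_self (θ : Matrix (Fin 4) (Fin 4) A) (j : Fin 3) :
    wedgeTwoTwo (sdForm θ j) (sdForm θ j) = 2 * θ.det := by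
  rw [det_eq_sum]
  fin_cases j <;> simp [sdForm, wedgeTwoTwo] <;> ring

omit [Algebra ℂ A] in
-- In the coframe θ each X_j is, up to sign, I_j applied to w = (q, −p₁, −p₂, −p₃); wedging with α_j
-- undoes I_j and gives the Hodge dual of w, whatever j is.
theorem quatForm_wedge_sdForm (θ : Matrix (Fin 4) (Fin 4) A) (q p₁ p₂ p₃ : A) (j : Fin 3)
    (a b c : Fin 4) :
    wedge (quatForm θ q p₁ p₂ p₃ j) (sdForm θ j) a b c =
      wedge (quatForm θ q p₁ p₂ p₃ 0) (sdForm θ 0) a b c := by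
  fin_cases j <;> simp [sdForm, wedge, quatForm] <;> ring

omit [Algebra ℂ A] in
-- By the quaternion relations X_{j+1} and X_{j+2} are related by I_j up to sign, and their common
-- square is the norm of the quaternion.
theorem quatForm_wedge_quatForm (θ : Matrix (Fin 4) (Fin 4) A) (q p₁ p₂ p₃ : A) (j : Fin 3) :
    wedgeOneThree (quatForm θ q p₁ p₂ p₃ (j + 1)) (wedge (quatForm θ q p₁ p₂ p₃ (j + 2)) (sdForm θ j))
      = (q ^ 2 + p₁ ^ 2 + p₂ ^ 2 + p₃ ^ 2) * θ.det := by
  rw [det_eq_sum]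
  fin_cases j <;> simp [sdForm, wedge, wedgeTwoTwo, wedgeOneThree, quatForm] <;> ring

omit [Algebra ℂ A] in
theorem wedgeOneThree_swap (ξ η : Fin 4 → A) (α : Fin 4 → Fin 4 → A) (hα : ∀ p q, α q p = -α p q) :
    wedgeOneThree η (wedge ξ α) = -wedgeOneThree ξ (wedge η α) := by
  simp only [wedgeOneThree, wedge, hα 1 3, hα 0 3, hα 0 2]; ring

omit [Algebra ℂ A] in
theorem wedgeTwoTwo_wedge (ξ η : Fin 4 → A) (α : Fin 4 → Fin 4 → A) (hα : ∀ p q, α q p = -α p q) :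
    wedgeTwoTwo (fun p q => ξ p * η q - ξ q * η p) α = wedgeOneThree ξ (wedge η α) := by
  simp only [wedgeOneThree, wedgeTwoTwo, wedge, hα 1 3, hα 0 3, hα 0 2]; ring

variable {D : Fin 4 → Derivation ℂ A A} {θ E : Matrix (Fin 4) (Fin 4) A}
  {ξ : Fin 3 → Fin 4 → A} {lam : Fin 3 → ℂ} {σ : A}

/-- The left side is the divergence of the vector field (q, −p₁, −p₂, −p₃) and does not see j,
whereas the right side comes from d(X_j∧α_j) and the structure equations for the index j. Comparing
the three values of j eliminates both the divergence and σ. -/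
theorem SelfDualEquations.trace_curvature (h : SelfDualEquations D θ E ξ lam σ) {q p₁ p₂ p₃ : A}
    {κ : Fin 3 → A} (hκ : ∀ j, algebraMap ℂ A (lam (j + 1) - lam (j + 2)) * κ j = 1)
    (hX : ∀ j i, ξ j i = κ j * quatForm θ q p₁ p₂ p₃ j i) (j : Fin 3) :
    extDerivThree D (wedge (quatForm θ q p₁ p₂ p₃ 0) (sdForm θ 0)) * E.det =
      algebraMap ℂ A (lam (j + 1) - lam (j + 2)) * (2 * (algebraMap ℂ A (lam j) + σ)
        + (q ^ 2 + p₁ ^ 2 + p₂ ^ 2 + p₃ ^ 2) *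
          (κ (j + 1) * κ (j + 2) - κ j * κ (j + 1) - κ j * κ (j + 2))) := by
  have hdet : θ.det * E.det = 1 := by rw [← Matrix.det_mul, h.dual, Matrix.det_one]
  set d := algebraMap ℂ A (lam (j + 1) - lam (j + 2)) with hd
  set X := quatForm θ q p₁ p₂ p₃ with hXdef
  set n := q ^ 2 + p₁ ^ 2 + p₂ ^ 2 + p₃ ^ 2 with hn
  have hXj : ∀ i, X j i = d * ξ j i := by
    intro i; rw [hX, ← mul_assoc, hκ, one_mul]
  have e1 : wedge (X 0) (sdForm θ 0) = wedge (X j) (sdForm θ j) := by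
    funext a b c; exact (quatForm_wedge_sdForm θ q p₁ p₂ p₃ j a b c).symm
  have e2 : ∀ p r, D p (X j r) - D r (X j p) =
      d * (κ (j + 1) * κ (j + 2) * (X (j + 1) p * X (j + 2) r - X (j + 1) r * X (j + 2) p)
        + (algebraMap ℂ A (lam j) + σ) * sdForm θ j p r) := by
    intro p r
    have : ∀ i f, D i (d * f) = d * D i f := by intro i f; simp [hd]
    rw [hXj, hXj, this, this, ← mul_sub, h.curvature, hX, hX, hX, hX]
    ring
  rw [e1, extDerivThree_wedge D _ _ (sdForm_swap θ j)]
  simp only [e2, h.torsion]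
  have w1 := quatForm_wedge_quatForm θ q p₁ p₂ p₃ j
  rw [← wedgeTwoTwo_wedge _ _ _ (sdForm_swap θ j), ← hXdef, ← hn] at w1
  have w2 := sdForm_wedge_self θ j
  have w3 := quatForm_wedge_quatForm θ q p₁ p₂ p₃ (j + 2)
  have w4 := quatForm_wedge_quatForm θ q p₁ p₂ p₃ (j + 1)
  rw [wedgeOneThree_swap _ _ _ (sdForm_swap θ _)] at w4
  have i1 : j + 2 + 1 = j := by omega
  have i2 : j + 2 + 2 = j + 1 := by omega
  have i3 : j + 1 + 1 = j + 2 := by omega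
  have i4 : j + 1 + 2 = j := by omega
  rw [i1, i2, ← hXdef, ← hn] at w3
  rw [i3, i4, ← hXdef, ← hn] at w4
  have k1 : d * κ j = 1 := hκ j
  simp only [wedgeTwoTwo, wedgeOneThree, wedge, hX] at *
  -- The contributions are: the quadratic part of dξ_j (`w1`), its curvature part through α_j∧α_j
  -- (`w2`), and the two terms of dα_j (`w3`, `w4`).
  linear_combination (d * κ (j + 1) * κ (j + 2) * E.det) * w1
    + d * (algebraMap ℂ A (lam j) + σ) * E.det * w2 
    - κ (j + 1) * E.det * w3 - κ (j + 2) * E.det * w4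
    + (d * (2 * (algebraMap ℂ A (lam j) + σ) + n * (κ (j + 1) * κ (j + 2))) - n * (κ (j + 1) + κ (j + 2)))* hdet
    + n * (κ (j + 1) + κ (j + 2)) * k1


/-- The orthogonal matrix which turns a frame into one starting with a multiple of the vector
`(q, -p₁, -p₂, -p₃)`. -/
def quatMatrix (μ q p₁ p₂ p₃ : A) : Matrix (Fin 4) (Fin 4) A :=
  !![μ * q, μ * p₁, μ * p₂, μ * p₃; -(μ * p₁), μ * q, -(μ * p₃), μ * p₂;
    -(μ * p₂), μ * p₃, μ * q, -(μ * p₁); -(μ * p₃), -(μ * p₂), μ * p₁, μ * q]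

omit [Algebra ℂ A] in
theorem quatMatrix_orthogonal {μ q p₁ p₂ p₃ : A}
    (h : μ ^ 2 * (q ^ 2 + p₁ ^ 2 + p₂ ^ 2 + p₃ ^ 2) = 1) :
    (quatMatrix μ q p₁ p₂ p₃).transpose * quatMatrix μ q p₁ p₂ p₃ = 1 := by
  ext i j
  fin_cases i <;> fin_cases j <;>
  simp [quatMatrix, Matrix.mul_apply, Fin.sum_univ_four] <;>
  first
  | ring1
  | linear_combination h

omit [Algebra ℂ A] in
theorem quatMatrix_mul_succ (μ q p₁ p₂ p₃ : A) (θ : Matrix (Fin 4) (Fin 4) A) (j : Fin 3)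
    (i : Fin 4) :
    ((quatMatrix μ q p₁ p₂ p₃).transpose * θ) j.succ i = μ * quatForm θ q p₁ p₂ p₃ j i := by
  fin_cases j <;>
  simp [quatMatrix, Matrix.mul_apply, Fin.sum_univ_four, quatForm] <;>
  ring

omit [Algebra ℂ A] in
-- SO(4,ℂ) is generated by left and right multiplications by unit quaternions, and one of the two
-- factors fixes all self-dual forms. The rotation lies in that factor, so it changes the coframe
-- but neither the α_j nor the ξ_j.
theorem sdForm_quatMatrix {μ q p₁ p₂ p₃ : A} (h : μ ^ 2 * (q ^ 2 + p₁ ^ 2 + p₂ ^ 2 + p₃ ^ 2) = 1)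
    (θ : Matrix (Fin 4) (Fin 4) A) :
    sdForm ((quatMatrix μ q p₁ p₂ p₃).transpose * θ) = sdForm θ := by
  funext j a b
  fin_cases j <;>
  simp [quatMatrix, Matrix.mul_apply, Fin.sum_univ_four, sdForm]
  · linear_combination (θ 0 a * θ 1 b - θ 0 b * θ 1 a + (θ 2 a * θ 3 b - θ 2 b * θ 3 a)) * h
  · linear_combination (θ 0 a * θ 2 b - θ 0 b * θ 2 a + (θ 3 a * θ 1 b - θ 3 b * θ 1 a)) * h
  · linear_combination (θ 0 a * θ 3 b - θ 0 b * θ 3 a + (θ 1 a * θ 2 b - θ 1 b * θ 2 a)) * h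

omit [Algebra ℂ A] in
-- Clearing the inverses κ_j turns the bracket into n d₀ (d₀ − d₁ − d₂), which is 2 n d₀² because
-- the differences sum to zero.
theorem trace_relation {d₀ d₁ d₂ κ₀ κ₁ κ₂ n c Y : A} (hd : d₀ + d₁ + d₂ = 0) (k₀ : d₀ * κ₀ = 1)
    (k₁ : d₁ * κ₁ = 1) (k₂ : d₂ * κ₂ = 1)
    (t : Y = d₀ * (2 * c + n * (κ₁ * κ₂ - κ₀ * κ₁ - κ₀ * κ₂))) :
    d₀ * d₁ * d₂ * Y = 2 * (d₀ * d₁ * d₂) * (d₀ * c) + 2 * n * d₀ ^ 2 := by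
  linear_combination d₀ * d₁ * d₂ * t + n * d₀ ^ 2 * (k₁ * d₂ * κ₂ + k₂)
    - n * d₀ * d₂ * (k₀ * d₁ * κ₁ + k₁) - n * d₀ * d₁ * (k₀ * d₂ * κ₂ + k₂) - n * d₀ * hd

/-- The relations from `trace_relation` show that the norm n of the quaternion satisfies nV = 3P²
with constants V and P ≠ 0. Hence n is a nonzero constant m², and the unit quaternion obtained by
dividing by m aligns the coframe with the connection forms. -/
theorem SelfDualEquations.exists_canonical [Nontrivial A] (h : SelfDualEquations D θ E ξ lam σ)
    (hlam : ∀ j, lam (j + 1) ≠ lam (j + 2)) :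
    ∃ (S : Matrix (Fin 4) (Fin 4) A) (m : ℂ), m ≠ 0 ∧ S.transpose * S = 1 ∧
      SelfDualEquations D (S.transpose * θ) (E * S) ξ lam σ ∧
      ∀ j i, ξ j i = algebraMap ℂ A (m / (lam (j + 1) - lam (j + 2))) *
        (S.transpose * θ) j.succ i := by
  obtain ⟨q, p₁, p₂, p₃, hX⟩ := h.exists_quatForm
  have hne : ∀ j, lam (j + 1) - lam (j + 2) ≠ 0 := fun j => sub_ne_zero.mpr (hlam j)
  have hκ : ∀ j, algebraMap ℂ A (lam (j + 1) - lam (j + 2)) *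
      algebraMap ℂ A (lam (j + 1) - lam (j + 2))⁻¹ = 1 := by
    intro j; rw [← map_mul, mul_inv_cancel₀ (hne j), map_one]
  have hξ : ∀ j i, ξ j i = algebraMap ℂ A (lam (j + 1) - lam (j + 2))⁻¹ *
      quatForm θ q p₁ p₂ p₃ j i := by
    intro j i; rw [← hX, ← mul_assoc, mul_comm (algebraMap ℂ A _), hκ, one_mul]
  have ht := h.trace_curvature hκ hξ
  set n := q ^ 2 + p₁ ^ 2 + p₂ ^ 2 + p₃ ^ 2 with hn
  generalize extDerivThree D (wedge (quatForm θ q p₁ p₂ p₃ 0) (sdForm θ 0)) * E.det = Y at ht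
  -- The weights d₂ − d₁, d₀ − d₂, d₁ − d₀ are orthogonal to (1, 1, 1) and to (d₀, d₁, d₂), so in
  -- the weighted sum of the three relations both `Y` and σ disappear.
  set V : ℂ := (lam 1 - lam 2) ^ 2 * ((lam 0 - lam 1) - (lam 2 - lam 0))
    + (lam 2 - lam 0) ^ 2 * ((lam 1 - lam 2) - (lam 0 - lam 1))
    + (lam 0 - lam 1) ^ 2 * ((lam 2 - lam 0) - (lam 1 - lam 2)) with hV
  set P : ℂ := (lam 1 - lam 2) * (lam 2 - lam 0) * (lam 0 - lam 1) with hP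
  have hP0 : P ≠ 0 := mul_ne_zero (mul_ne_zero (hne 0) (hne 1)) (hne 2)
  have hnV : n * algebraMap ℂ A V = algebraMap ℂ A (3 * P ^ 2) := by
    have t0 := ht 0
    have t1 := ht 1
    have t2 := ht 2
    have k0 := hκ 0
    have k1 := hκ 1
    have k2 := hκ 2
    simp only [Fin.isValue, show (0 : Fin 3) + 1 = 1 from rfl, show (0 : Fin 3) + 2 = 2 from rfl,
      show (1 : Fin 3) + 1 = 2 from rfl, show (1 : Fin 3) + 2 = 0 from rfl,
      show (2 : Fin 3) + 1 = 0 from rfl, show (2 : Fin 3) + 2 = 1 from rfl] at t0 t1 t2 k0 k1 k2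
    generalize algebraMap ℂ A (lam 1 - lam 2)⁻¹ = κ0 at *
    generalize algebraMap ℂ A (lam 2 - lam 0)⁻¹ = κ1 at *
    generalize algebraMap ℂ A (lam 0 - lam 1)⁻¹ = κ2 at *
    rw [hV, hP]
    simp only [map_sub, map_mul, map_add, map_pow, map_ofNat] at *
    generalize algebraMap ℂ A (lam 0) = l0 at *
    generalize algebraMap ℂ A (lam 1) = l1 at *
    generalize algebraMap ℂ A (lam 2) = l2 at *
    apply two_mul_cancel
    have u0 : (l1 - l2) * (l2 - l0) * (l0 - l1) * Y =
        2 * ((l1 - l2) * (l2 - l0) * (l0 - l1)) * ((l1 - l2) * (l0 + σ)) + 2 * n * (l1 - l2) ^ 2 := by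
      exact trace_relation (by ring) k0 k1 k2 t0
    have u1 : (l1 - l2) * (l2 - l0) * (l0 - l1) * Y =
        2 * ((l1 - l2) * (l2 - l0) * (l0 - l1)) * ((l2 - l0) * (l1 + σ)) + 2 * n * (l2 - l0) ^ 2 := by
      linear_combination trace_relation (by ring) k1 k2 k0 t1
    have u2 : (l1 - l2) * (l2 - l0) * (l0 - l1) * Y =
        2 * ((l1 - l2) * (l2 - l0) * (l0 - l1)) * ((l0 - l1) * (l2 + σ)) + 2 * n * (l0 - l1) ^ 2 := by
      linear_combination trace_relation (by ring) k2 k0 k1 t2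
    linear_combination -(u0 * ((l0 - l1) - (l2 - l0)) + u1 * ((l1 - l2) - (l0 - l1)) + u2 * ((l2 - l0) - (l1 - l2)))
  have hinj := FaithfulSMul.algebraMap_injective ℂ A
  have hV0 : V ≠ 0 := by
    intro h0
    rw [h0, map_zero, mul_zero] at hnV
    have := hinj (hnV.symm.trans (map_zero _).symm)
    exact hP0 (by simpa using this)
  -- The constant m² may be negative or non-real; a square root exists because the scalars are
  -- complex.
  obtain ⟨m, hm⟩ := IsAlgClosed.exists_pow_nat_eq (3 * P ^ 2 / V) (n := 2) (by norm_num)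
  have hm0 : m ≠ 0 := by
    rintro rfl
    have : 3 * P ^ 2 / V ≠ 0 := div_ne_zero (mul_ne_zero (by norm_num) (pow_ne_zero 2 hP0)) hV0
    exact this (by rw [← hm]; norm_num)
  have hnm : n = algebraMap ℂ A (m ^ 2) := by
    rw [hm, div_eq_mul_inv, map_mul, ← hnV, mul_assoc, ← map_mul, mul_inv_cancel₀ hV0]; simp
  have hμ : (algebraMap ℂ A m⁻¹) ^ 2 * (q ^ 2 + p₁ ^ 2 + p₂ ^ 2 + p₃ ^ 2) = 1 := by
    rw [← hn, hnm, ← map_pow, ← map_mul]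
    field_simp
    simp
  set S := quatMatrix (algebraMap ℂ A m⁻¹) q p₁ p₂ p₃ with hS
  have hSS : S.transpose * S = 1 := quatMatrix_orthogonal hμ
  refine ⟨S, m, hm0, hSS, ⟨h.comm, ?_, ?_, ?_⟩, ?_⟩
  · rw [Matrix.mul_assoc, ← Matrix.mul_assoc θ, h.dual, Matrix.one_mul, hSS]
  · rw [hS, sdForm_quatMatrix hμ]; exact h.curvature
  · rw [hS, sdForm_quatMatrix hμ]; exact h.torsion
  · intro j i
    rw [hS, quatMatrix_mul_succ, ← mul_assoc, ← map_mul, hξ]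
    congr 2
    field_simp

end Canonical

end EinsteinFour

end

noncomputable section

namespace EinsteinFour

/-! ### Structure equations of the canonical coframe -/

section Structure

variable {A : Type*} [CommRing A] [Algebra ℂ A]

/-- The exterior derivative of a one-form. -/
def extDerivOne (D : Fin 4 → Derivation ℂ A A) (η : Fin 4 → A) (p q : Fin 4) : A :=
  D p (η q) - D q (η p)

variable {D : Fin 4 → Derivation ℂ A A} {θ E : Matrix (Fin 4) (Fin 4) A}

omit [Algebra ℂ A] in
theorem two_form_eq_zero (h : θ * E = 1) {β : Fin 4 → Fin 4 → A}
    (hβ : ∀ a b, ∑ p, ∑ q, E p a * E q b * β p q = 0) (p q : Fin 4) : β p q = 0 := by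
  have hEθ : E * θ = 1 := mul_eq_one_comm.mp h
  have e : (Matrix.of β) = θ.transpose * (E.transpose * Matrix.of β * E) * θ := by
    have : θ.transpose * E.transpose = 1 := by rw [← Matrix.transpose_mul, hEθ, Matrix.transpose_one]
    calc (Matrix.of β) = (θ.transpose * E.transpose) * Matrix.of β * (E * θ) := by
          rw [this, hEθ, Matrix.one_mul, Matrix.mul_one]
      _ = _ := by simp only [Matrix.mul_assoc]
  have z : E.transpose * Matrix.of β * E = 0 := by
    ext a b
    rw [Matrix.zero_apply, ← hβ a b]
    simp only [Matrix.mul_apply, Matrix.transpose_apply, Matrix.of_apply, Finset.sum_mul]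
    rw [Finset.sum_comm]
    exact Finset.sum_congr rfl fun _ _ => Finset.sum_congr rfl fun _ _ => by ring
  rw [z] at e
  have := congrFun (congrFun e p) q
  simpa using this

/-- The exterior derivatives of the coframe whose last three forms are proportional to the self-dual
connection forms, up to the constants. -/
theorem SelfDualEquations.structure_aux {ξ : Fin 3 → Fin 4 → A} {lam : Fin 3 → ℂ} {σ : A}
    (h : SelfDualEquations D θ E ξ lam σ) {m R T : Fin 3 → A}
    (hm : ∀ j i, ξ j i = m j * θ j.succ i)
    (hdθ : ∀ j p q, extDerivOne D (θ j.succ) p q =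
      R j * (θ 0 p * θ j.succ q - θ 0 q * θ j.succ p) +
      T j * (θ (j + 1).succ p * θ (j + 2).succ q - θ (j + 1).succ q * θ (j + 2).succ p)) :
    (∀ p q, extDerivOne D (θ 0) p q = 0) ∧
      ∀ j, T j - R (j + 1) - R (j + 2) = m (j + 1) + m (j + 2) := by
  -- Expand dα_j for α_j = θ_0∧θ_j + θ_{j+1}∧θ_{j+2}. By `hdθ` and `hm`, everything except dθ_0∧θ_j
  -- is a multiple of θ_0∧θ_{j+1}∧θ_{j+2}.
  have key : ∀ j i p q, extDerivOne D (θ 0) i p * θ j.succ q + extDerivOne D (θ 0) p q * θ j.succ i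
      + extDerivOne D (θ 0) q i * θ j.succ p =
      (T j - R (j + 1) - R (j + 2) - m (j + 1) - m (j + 2)) *
        wedge (θ 0) (fun p q => θ (j + 1).succ p * θ (j + 2).succ q
          - θ (j + 1).succ q * θ (j + 2).succ p) i p q := by
    intro j i p q
    have e := h.torsion j i p q
    have e1 := extDeriv_wedge D (θ 0) (θ j.succ) i p q
    have e2 := extDeriv_wedge D (θ (j + 1).succ) (θ (j + 2).succ) i p q
    have i1 : j + 2 + 1 = j := by omega
    have i2 : j + 2 + 2 = j + 1 := by omega
    have i3 : j + 1 + 1 = j + 2 := by omega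
    have i4 : j + 1 + 2 = j := by omega
    have f := hdθ j
    have f1 := hdθ (j + 1)
    have f2 := hdθ (j + 2)
    simp only [extDerivOne] at f f1 f2
    simp only [f, f1, f2, i1, i2, i3, i4] at e1 e2
    simp only [sdForm, wedge, hm, map_add, i1, i2, i3, i4] at e
    simp only [extDerivOne, wedge]
    linear_combination e - e1 - e2
  set b : Fin 4 → Fin 4 → A := fun a c => ∑ p, ∑ q, E p a * E q c * extDerivOne D (θ 0) p q with hb
  have hdual : ∀ a c, ∑ i, E i c * θ a i = if a = c then 1 else 0 := by
    intro a c
    rw [← Matrix.one_apply, ← h.dual, Matrix.mul_apply]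
    exact Finset.sum_congr rfl fun _ _ => mul_comm _ _
  have con : ∀ j a c d, (b a c * (if j.succ = d then 1 else 0) + b c d * (if j.succ = a then 1 else 0)
      + b d a * (if j.succ = c then 1 else 0)) =
      (T j - R (j + 1) - R (j + 2) - m (j + 1) - m (j + 2)) *
        wedge (fun a => ∑ i, E i a * θ 0 i) (fun a c => ∑ p, ∑ q, E p a * E q c *
          (θ (j + 1).succ p * θ (j + 2).succ q
          - θ (j + 1).succ q * θ (j + 2).succ p)) a c d := by
    intro j a c d
    rw [← wedge_contract]
    have := key j
    generalize T j - R (j + 1) - R (j + 2) - m (j + 1) - m (j + 2) = K at this ⊢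
    trans ∑ i, ∑ p, ∑ q, E i a * E p c * E q d * (K * wedge (θ 0)
      (fun p q => θ (j + 1).succ p * θ (j + 2).succ q
          - θ (j + 1).succ q * θ (j + 2).succ p) i p q)
    · simp only [← this, ← hdual, hb, Fin.sum_univ_four]
      ring
    · simp only [Finset.mul_sum, mul_left_comm K]
  have eps : ∀ (k l : Fin 4) a c, ∑ p, ∑ q, E p a * E q c * (θ k p * θ l q - θ k q * θ l p) =
      (if k = a then 1 else 0) * (if l = c then 1 else 0)
        - (if k = c then 1 else 0) * (if l = a then 1 else 0) := by
    intro k l a c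
    simp only [← hdual, Fin.sum_univ_four]
    ring
  simp only [eps, hdual, wedge] at con
  have bs : ∀ a c, b c a = -b a c := by
    intro a c
    simp only [hb, extDerivOne, Fin.sum_univ_four]
    ring
  have bd : ∀ a, b a a = 0 := fun a => two_mul_cancel (by linear_combination bs a a)
  -- Evaluate on e_0, e_{j+1}, e_{j+2}: the form θ_j vanishes on all three, so the coefficient on
  -- the right is zero.
  have hT : ∀ j, T j - R (j + 1) - R (j + 2) - m (j + 1) - m (j + 2) = 0 := by
    intro j
    have := con j 0 (j + 1).succ (j + 2).succ
    fin_cases j <;> simp at this ⊢ <;> simpa using this.symm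
  -- Now dθ_0∧θ_j = 0 for three independent forms θ_j. Each component of dθ_0 is isolated by a θ_j
  -- that does not involve its two indices.
  have hb0 : ∀ a c, b a c = 0 := by
    simp only [hT, zero_mul] at con
    have b01 : b 0 1 = 0 := by have := con 1 0 1 2; simpa using this
    have b02 : b 0 2 = 0 := by have := con 0 0 2 1; simpa using this
    have b03 : b 0 3 = 0 := by have := con 0 0 3 1; simpa using this
    have b12 : b 1 2 = 0 := by have := con 2 1 2 3; simpa using this
    have b13 : b 1 3 = 0 := by have := con 1 1 3 2; simpa using this
    have b23 : b 2 3 = 0 := by have := con 0 2 3 1; simpa using this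
    clear_value b
    clear hb
    intro a c
    fin_cases a <;> fin_cases c <;>
    first
    | exact bd _
    | exact b01 | exact b02 | exact b03 | exact b12 | exact b13 | exact b23
    | exact (bs 0 1).trans (by rw [b01, neg_zero])
    | exact (bs 0 2).trans (by rw [b02, neg_zero])
    | exact (bs 0 3).trans (by rw [b03, neg_zero])
    | exact (bs 1 2).trans (by rw [b12, neg_zero])
    | exact (bs 1 3).trans (by rw [b13, neg_zero])
    | exact (bs 2 3).trans (by rw [b23, neg_zero])
  refine ⟨two_form_eq_zero h.dual fun a c => by rw [← hb0 a c], fun j => ?_⟩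
  linear_combination hT j

/-- The relation among the differences of the eigenvalues. -/
theorem sum_sq_eq_zero {d₀ d₁ d₂ c₀ c₁ c₂ m : ℂ} (hd : d₀ + d₁ + d₂ = 0) (h₀ : d₀ ≠ 0) (h₁ : d₁ ≠ 0)
    (h₂ : d₂ ≠ 0)
    (e₀ : c₀ * d₀ * (d₀ * d₁ * d₂) = m ^ 2 * (d₁ ^ 2 + d₂ ^ 2))
    (e₁ : c₁ * d₁ * (d₀ * d₁ * d₂) = m ^ 2 * (d₂ ^ 2 + d₀ ^ 2))
    (e₂ : c₂ * d₂ * (d₀ * d₁ * d₂) = m ^ 2 * (d₀ ^ 2 + d₁ ^ 2))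
    (f₀ : c₁ - c₂ = d₀) (f₁ : c₂ - c₀ = d₁) (f₂ : c₀ - c₁ = d₂) :
    d₀ ^ 2 + d₁ ^ 2 + d₂ ^ 2 = 0 := by
  obtain rfl : d₂ = -d₀ - d₁ := by linear_combination hd
  -- Eliminating the c's from pairs of equations gives P² = m² (d₁ − d₀) x₂ and its cyclic versions,
  -- where x_j = d_j² + (d₀² + d₀d₁ + d₁²).
  have g₂ : (d₀ * d₁ * (-d₀ - d₁)) ^ 2 =
      m ^ 2 * (d₁ - d₀) * ((-d₀ - d₁) ^ 2 + (d₀ ^ 2 + d₀ * d₁ + d₁ ^ 2)) := by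
    linear_combination d₁ * e₀ - d₀ * e₁ - d₀ * d₁ * (d₀ * d₁ * (-d₀ - d₁)) * f₂
  have g₀ : (d₀ * d₁ * (-d₀ - d₁)) ^ 2 =
      m ^ 2 * ((-d₀ - d₁) - d₁) * (d₀ ^ 2 + (d₀ ^ 2 + d₀ * d₁ + d₁ ^ 2)) := by
    linear_combination (-d₀ - d₁) * e₁ - d₁ * e₂ - d₁ * (-d₀ - d₁) * (d₀ * d₁ * (-d₀ - d₁)) * f₀
  have g₁ : (d₀ * d₁ * (-d₀ - d₁)) ^ 2 =
      m ^ 2 * (d₀ - (-d₀ - d₁)) * (d₁ ^ 2 + (d₀ ^ 2 + d₀ * d₁ + d₁ ^ 2)) := by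
    linear_combination d₀ * e₂ - (-d₀ - d₁) * e₀ - (-d₀ - d₁) * d₀ * (d₀ * d₁ * (-d₀ - d₁)) * f₁
  have hP : (d₀ * d₁ * (-d₀ - d₁)) ^ 2 ≠ 0 :=
    pow_ne_zero 2 (mul_ne_zero (mul_ne_zero h₀ h₁) h₂)
  -- Multiply each equation by the other two x's and add: the right sides sum to m² x₀x₁x₂ times a
  -- telescoping sum, which is zero.
  have hz : (d₀ * d₁ * (-d₀ - d₁)) ^ 2 * (8 * (d₀ ^ 2 + d₀ * d₁ + d₁ ^ 2) ^ 2) = 0 := by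
    set x₀ := d₀ ^ 2 + (d₀ ^ 2 + d₀ * d₁ + d₁ ^ 2) with hx₀
    set x₁ := d₁ ^ 2 + (d₀ ^ 2 + d₀ * d₁ + d₁ ^ 2) with hx₁
    set x₂ := (-d₀ - d₁) ^ 2 + (d₀ ^ 2 + d₀ * d₁ + d₁ ^ 2) with hx₂
    have : 8 * (d₀ ^ 2 + d₀ * d₁ + d₁ ^ 2) ^ 2 = x₀ * x₁ + x₁ * x₂ + x₂ * x₀ := by
      rw [hx₀, hx₁, hx₂]; ring
    rw [this]
    linear_combination x₀ * x₁ * g₂ + x₁ * x₂ * g₀ + x₂ * x₀ * g₁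
  have : d₀ ^ 2 + d₀ * d₁ + d₁ ^ 2 = 0 := by
    have := (mul_eq_zero.mp hz).resolve_left hP
    simpa using this
  linear_combination 2 * this

/-- The structure equations of the canonical coframe. -/
theorem SelfDualEquations.structure_equations [Nontrivial A] {ξ : Fin 3 → Fin 4 → A} {lam : Fin 3 → ℂ}
    {σ : A} (h : SelfDualEquations D θ E ξ lam σ) (hlam : ∀ j, lam (j + 1) ≠ lam (j + 2)) {m : ℂ}
    (hm0 : m ≠ 0)
    (hm : ∀ j i, ξ j i = algebraMap ℂ A (m / (lam (j + 1) - lam (j + 2))) * θ j.succ i) :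
    ∑ j, (lam (j + 1) - lam (j + 2)) ^ 2 = 0 ∧ (∀ p q, extDerivOne D (θ 0) p q = 0) ∧
      ∀ j p q, extDerivOne D (θ j.succ) p q = algebraMap ℂ A (-m * (lam (j + 1) - lam (j + 2)) ^ 2 /
          ((lam 1 - lam 2) * (lam 2 - lam 0) * (lam 0 - lam 1))) *
        (θ 0 p * θ j.succ q - θ 0 q * θ j.succ p) := by
  set d : Fin 3 → ℂ := fun j => lam (j + 1) - lam (j + 2) with hd
  have hd0 : ∀ j, d j ≠ 0 := fun j => sub_ne_zero.mpr (hlam j)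
  set P : ℂ := (lam 1 - lam 2) * (lam 2 - lam 0) * (lam 0 - lam 1) with hP
  have hPd : d 0 * d 1 * d 2 = P := rfl
  have hP0 : P ≠ 0 := mul_ne_zero (mul_ne_zero (hd0 0) (hd0 1)) (hd0 2)
  have hsum : d 0 + d 1 + d 2 = 0 := by simp [hd]
  have hcyc : ∀ j, d j * d (j + 1) * d (j + 2) = P := by
    intro j; rw [← hPd]; fin_cases j <;> simp <;> ring
  have hcs : ∀ j, d j + d (j + 1) + d (j + 2) = 0 := by
    intro j; rw [← hsum]; fin_cases j <;> simp <;> ring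
  -- Since θ_j = (d_j/m) ξ_j, the curvature equation becomes a formula for dθ_j. The coefficient R
  -- comes from the curvature term, and T has in addition the product ξ_{j+1}∧ξ_{j+2}.
  set R : Fin 3 → A := fun j => algebraMap ℂ A (d j / m) * (algebraMap ℂ A (lam j) + σ) with hR
  set T : Fin 3 → A := fun j => R j + algebraMap ℂ A (m * d j ^ 2 / P) with hT
  have hdθ : ∀ j p q, extDerivOne D (θ j.succ) p q =
      R j * (θ 0 p * θ j.succ q - θ 0 q * θ j.succ p) +
      T j * (θ (j + 1).succ p * θ (j + 2).succ q - θ (j + 1).succ q * θ (j + 2).succ p) := by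
    intro j p q
    have e := h.curvature j p q
    simp only [hm, Derivation.leibniz, Derivation.map_algebraMap, smul_eq_mul,
      mul_zero, add_zero] at e
    have k1 : algebraMap ℂ A (d j / m) * algebraMap ℂ A (m / d j) = 1 := by
      rw [← map_mul, div_mul_div_cancel₀ hm0, div_self (hd0 j), map_one]
    have k2 : algebraMap ℂ A (d j / m) * (algebraMap ℂ A (m / d (j + 1)) *
        algebraMap ℂ A (m / d (j + 2))) = algebraMap ℂ A (m * d j ^ 2 / P) := by
      rw [← map_mul, ← map_mul, ← hcyc j]
      congr 1
      have := hd0 j; have := hd0 (j + 1); have := hd0 (j + 2)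
      field_simp
    simp only [extDerivOne, hT, hR, sdForm] at e ⊢
    rw [← k2]
    linear_combination algebraMap ℂ A (d j / m) * e - (D p (θ j.succ q) - D q (θ j.succ p)) * k1
  obtain ⟨h0, h1⟩ := h.structure_aux hm hdθ
  have hinj := FaithfulSMul.algebraMap_injective ℂ A
  have h2 : ∀ j, R j - R (j + 1) - R (j + 2) = algebraMap ℂ A (-2 * m * d j ^ 2 / P) := by
    intro j
    have e : m / d (j + 1) + m / d (j + 2) - m * d j ^ 2 / P = -2 * m * d j ^ 2 / P := by
      rw [← hcyc j]
      have := hd0 j; have := hd0 (j + 1); have := hd0 (j + 2)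
      field_simp
      linear_combination (hcs j)
    rw [← e, map_sub, map_add, ← h1 j, hT]
    ring
  -- In the sum of the equations `h2` for j + 1 and j + 2 only −2 R_j survives. So each R_j is a
  -- constant.
  have h3 : ∀ j, R j = algebraMap ℂ A (m * (d (j + 1) ^ 2 + d (j + 2) ^ 2) / P) := by
    intro j
    have e1 := h2 (j + 1)
    have e2 := h2 (j + 2)
    have i1 : j + 2 + 1 = j := by omega
    have i2 : j + 2 + 2 = j + 1 := by omega
    have i3 : j + 1 + 1 = j + 2 := by omega
    have i4 : j + 1 + 2 = j := by omega
    rw [i1, i2] at e2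
    rw [i3, i4] at e1
    apply two_mul_cancel
    have : m * (d (j + 1) ^ 2 + d (j + 2) ^ 2) / P =
      -(1 / 2) * (-2 * m * d (j + 1) ^ 2 / P + -2 * m * d (j + 2) ^ 2 / P) := by ring
    rw [this, map_mul, map_add, ← e1, ← e2, map_neg]
    have : (algebraMap ℂ A (1 / 2)) * 2 = 1 := by
      rw [← map_ofNat (algebraMap ℂ A) 2, ← map_mul]; norm_num
    linear_combination -2 * R j * this
  -- Constancy of R_0 makes σ constant; after this the relations `h3` are relations between complex
  -- numbers, to which `sum_sq_eq_zero` applies.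
  obtain ⟨s, hs⟩ : ∃ s : ℂ, σ = algebraMap ℂ A s := by
    refine ⟨m / d 0 * (m * (d (0 + 1) ^ 2 + d (0 + 2) ^ 2) / P) - lam 0, ?_⟩
    rw [map_sub, map_mul, ← h3 0, hR]
    simp only
    rw [← mul_assoc, ← map_mul, div_mul_div_cancel₀ (hd0 0), div_self hm0]
    simp
  have h4 : ∀ j, (lam j + s) * d j * P = m ^ 2 * (d (j + 1) ^ 2 + d (j + 2) ^ 2) := by
    intro j
    have := h3 j
    rw [hR, hs] at this
    simp only [← map_add, ← map_mul] at this
    have := hinj this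
    field_simp at this
    linear_combination this
  have hsq : d 0 ^ 2 + d 1 ^ 2 + d 2 ^ 2 = 0 :=
    sum_sq_eq_zero hsum (hd0 0) (hd0 1) (hd0 2) (h4 0) (h4 1) (h4 2)
      (by simp [hd]) (by simp [hd]) (by simp [hd])
  have hsq' : ∀ j, d j ^ 2 + d (j + 1) ^ 2 + d (j + 2) ^ 2 = 0 := by
    intro j; rw [← hsq]; fin_cases j <;> simp <;> ring
  -- By Σ d_j² = 0 the two other squares add up to −d_j². This value of R_j cancels the extra term
  -- of T_j, so the θ_{j+1}∧θ_{j+2} part of dθ_j is absent.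
  have h5 : ∀ j, R j = algebraMap ℂ A (-m * d j ^ 2 / P) := by
    intro j
    rw [h3 j]
    congr 2
    linear_combination m * hsq' j
  refine ⟨by rw [Fin.sum_univ_three]; exact hsq, h0, fun j p q => ?_⟩
  rw [hdθ j, hT]
  simp only [h5, ← map_add]
  rw [show -m * d j ^ 2 / P + m * d j ^ 2 / P = 0 by ring, map_zero, zero_mul, add_zero]

end Structure

end EinsteinFour

end

noncomputable section

namespace EinsteinFour

/-! ### Brackets of the canonical frame and infinitesimal isometries -/

section Brackets

variable {A : Type*} [CommRing A] [Algebra ℂ A]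

/-- The derivation defined by the components of a vector field. -/
def vecDer (D : Fin 4 → Derivation ℂ A A) (X : Fin 4 → A) : Derivation ℂ A A := ∑ i, X i • D i

theorem vecDer_apply (D : Fin 4 → Derivation ℂ A A) (X : Fin 4 → A) (f : A) :
    vecDer D X f = ∑ i, X i * D i f := by
  simp [vecDer, Fin.sum_univ_four]

/-- The components of the Lie bracket of two vector fields. -/
def vecBracket (D : Fin 4 → Derivation ℂ A A) (X Y : Fin 4 → A) (k : Fin 4) : A :=
  vecDer D X (Y k) - vecDer D Y (X k)

theorem lie_vecDer {D : Fin 4 → Derivation ℂ A A} (hD : ∀ i j f, D i (D j f) = D j (D i f))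
    (X Y : Fin 4 → A) : ⁅vecDer D X, vecDer D Y⁆ = vecDer D (vecBracket D X Y) := by
  ext f
  simp only [Derivation.commutator_apply, vecDer_apply, vecBracket, map_sum, Derivation.leibniz,
    smul_eq_mul, sub_mul, Finset.sum_mul, Finset.sum_sub_distrib, Finset.sum_add_distrib,
    Finset.mul_sum]
  have e1 : ∑ i, ∑ j, Y i * (X j * D j (D i f)) = ∑ i, ∑ j, X i * (Y j * D j (D i f)) := by
    rw [Finset.sum_comm]
    exact Finset.sum_congr rfl fun i _ => Finset.sum_congr rfl fun j _ => by rw [hD]; ring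
  rw [e1]
  have e2 : ∀ X Y : Fin 4 → A, ∑ j, ∑ i, D j f * (X i * D i (Y j)) =
      ∑ j, ∑ i, X i * D i (Y j) * D j f := by
    intro X Y
    exact Finset.sum_congr rfl fun i _ => Finset.sum_congr rfl fun j _ => by ring
  rw [e2, e2]
  ring

theorem smul_lie_derivation (f : A) (d e : Derivation ℂ A A) : ⁅f • d, e⁆ = f • ⁅d, e⁆ - e f • d := by
  ext x
  simp [Derivation.commutator_apply]
  ring

theorem lie_smul_derivation (f : A) (d e : Derivation ℂ A A) : ⁅d, f • e⁆ = f • ⁅d, e⁆ + d f • e := by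
  ext x
  simp [Derivation.commutator_apply]

/-- The components of the brackets of the vector fields of a frame. -/
theorem vecBracket_frame {D : Fin 4 → Derivation ℂ A A} {θ E : Matrix (Fin 4) (Fin 4) A}
    (h : θ * E = 1) (a b k : Fin 4) :
    vecBracket D (fun i => E i a) (fun i => E i b) k =
      -∑ c, (∑ p, ∑ q, E p a * E q b * extDerivOne D (θ c) p q) * E k c := by
  have hEθ : E * θ = 1 := mul_eq_one_comm.mp h
  have hd : ∀ i c b, ∑ k, θ c k * D i (E k b) = -∑ k, D i (θ c k) * E k b := by
    intro i c b
    have := congrFun (congrFun (map_mul_derivation (D i) θ E) c) b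
    rw [h, map_one_derivation] at this
    simp only [Matrix.add_apply, Matrix.mul_apply, Matrix.map_apply, Matrix.zero_apply] at this
    linear_combination -this
  have key : ∀ c, ∑ k, θ c k * vecBracket D (fun i => E i a) (fun i => E i b) k =
      -(∑ p, ∑ q, E p a * E q b * extDerivOne D (θ c) p q) := by
    intro c
    have e1 : ∀ a b, ∑ k, θ c k * vecDer D (fun i => E i a) (E k b) =
        -∑ i, ∑ k, E i a * (D i (θ c k) * E k b) := by
      intro a b
      simp only [vecDer_apply, Finset.mul_sum]
      rw [Finset.sum_comm, ← Finset.sum_neg_distrib]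
      refine Finset.sum_congr rfl fun i _ => ?_
      rw [← Finset.mul_sum, ← mul_neg, ← hd, Finset.mul_sum]
      exact Finset.sum_congr rfl fun _ _ => by ring
    simp only [vecBracket, mul_sub, Finset.sum_sub_distrib, e1, extDerivOne]
    rw [Finset.sum_comm (f := fun i k => E i b * (D i (θ c k) * E k a))]
    have e2 : ∑ i, ∑ k, E i a * (D i (θ c k) * E k b) = ∑ p, ∑ q, E p a * E q b * D p (θ c q) :=
      Finset.sum_congr rfl fun _ _ => Finset.sum_congr rfl fun _ _ => by ring
    have e3 : ∑ k, ∑ i, E i b * (D i (θ c k) * E k a) = ∑ p, ∑ q, E p a * E q b * D q (θ c p) :=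
      Finset.sum_congr rfl fun _ _ => Finset.sum_congr rfl fun _ _ => by ring
    rw [e2, e3]
    ring
  have : ∀ V : Fin 4 → A, V k = ∑ c, (∑ i, θ c i * V i) * E k c := by
    intro V
    have h1 : V = (E * θ).mulVec V := by rw [hEθ, Matrix.one_mulVec]
    rw [← Matrix.mulVec_mulVec] at h1
    have := congrFun h1 k
    rw [this]
    simp only [Matrix.mulVec, dotProduct]
    exact Finset.sum_congr rfl fun _ _ => mul_comm _ _
  rw [this (vecBracket _ _ _)]
  simp only [key, neg_mul, Finset.sum_neg_distrib]

/-- A structure-constant version of the infinitesimal symmetry equation. -/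
theorem jacobi_components {e : Fin 4 → Derivation ℂ A A} (he : ∀ f : Fin 4 → A, ∑ c, f c • e c = 0 → f = 0)
    {C : Fin 4 → Fin 4 → Fin 4 → A} (hC : ∀ a b, ⁅e a, e b⁆ = ∑ c, C a b c • e c)
    {X : Derivation ℂ A A} (hX : ∀ a b c, X (C a b c) = 0) {z : Fin 4 → Fin 4 → A}
    (hz : ∀ a, ⁅X, e a⁆ = ∑ b, z a b • e b)
    (a b d : Fin 4) :
    ∑ c, C a b c * z c d = ∑ c, z a c * C c b d + ∑ c, z b c * C a c d - e b (z a d) + e a (z b d) := by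
  -- The bracket with `X` is a derivation of the Lie bracket; comparing coefficients in the frame
  -- gives the formula, and `hX` removes the derivatives of the structure functions.
  have j := leibniz_lie X (e a) (e b)
  rw [hC, hz, hz] at j
  simp only [sum_lie, lie_sum, smul_lie_derivation, lie_smul_derivation, hX, zero_smul, add_zero, hz, hC,
    Finset.smul_sum, Finset.sum_sub_distrib, Finset.sum_add_distrib, smul_smul] at j
  rw [Finset.sum_comm, Finset.sum_comm (f := fun c d => (z a c * C c b d) • e d),
    Finset.sum_comm (f := fun c d => (z b c * C a c d) • e d)] at j
  simp only [← Finset.sum_smul] at j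
  have := he (fun d => ∑ c, C a b c * z c d - (∑ c, z a c * C c b d - e b (z a d)
    + (∑ c, z b c * C a c d + e a (z b d)))) (by
      simp only [sub_smul, add_smul, Finset.sum_sub_distrib, Finset.sum_add_distrib]
      rw [j]; abel)
  have := congrFun this d
  simp only [Pi.zero_apply] at this
  linear_combination this

theorem mul_algebraMap_eq_zero {c : ℂ} (hc : c ≠ 0) {f : A} (h : algebraMap ℂ A c * f = 0) :
    f = 0 := by
  have e : algebraMap ℂ A c⁻¹ * algebraMap ℂ A c = 1 := by
    rw [← map_mul, inv_mul_cancel₀ hc, map_one]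
  linear_combination algebraMap ℂ A c⁻¹ * h - f * e

/-- Infinitesimal isometries commute with a canonical frame. -/
theorem lie_eq_zero_of_skew {e : Fin 4 → Derivation ℂ A A}
    (he : ∀ f : Fin 4 → A, ∑ c, f c • e c = 0 → f = 0) {r : Fin 3 → ℂ} (hr : ∀ j, r j ≠ 0)
    (hr' : ∀ j k, j ≠ k → r j ≠ r k)
    (h0 : ∀ j : Fin 3, ⁅e 0, e j.succ⁆ = algebraMap ℂ A (r j) • e j.succ)
    (hs : ∀ j k : Fin 3, ⁅e j.succ, e k.succ⁆ = 0)
    {X : Derivation ℂ A A} {z : Fin 4 → Fin 4 → A}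
    (hz : ∀ a, ⁅X, e a⁆ = ∑ b, z a b • e b) (hskew : ∀ a b, z b a = -z a b) (a : Fin 4) :
    ⁅X, e a⁆ = 0 := by
  have zd : ∀ a, z a a = 0 := fun a => two_mul_cancel (by linear_combination hskew a a)
  -- With s_0 = 0 all brackets are covered by one formula, [e_a, e_b] = δ_{a0} s_b e_b − δ_{b0} s_a
  -- e_a.
  set s : Fin 4 → ℂ := Fin.cons 0 r with hs'
  set C : Fin 4 → Fin 4 → Fin 4 → A := fun a b c => algebraMap ℂ A
    ((if a = 0 then (if c = b then s b else 0) else 0) - (if b = 0 then (if c = a then s a else 0) else 0))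
    with hCdef
  have hC : ∀ a b, ⁅e a, e b⁆ = ∑ c, C a b c • e c := by
    intro a b
    refine Fin.cases ?_ (fun j => ?_) a <;> refine Fin.cases ?_ (fun k => ?_) b
    · simp [hCdef]
    · rw [h0]; simp [hCdef, hs', apply_ite (algebraMap ℂ A), ite_smul]
    · rw [← lie_skew, h0]; simp [hCdef, hs', apply_ite (algebraMap ℂ A), ite_smul]
    · rw [hs]; simp [hCdef]
  have J := jacobi_components he hC (X := X) (fun a b c => by simp [hCdef]) hz
  set ra : Fin 3 → A := fun j => algebraMap ℂ A (r j) with hra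
  have hne : ∀ j : Fin 3, (0 : Fin 4) ≠ j.succ := fun j => (Fin.succ_ne_zero j).symm
  have J1 : ∀ j : Fin 3, e 0 (z 0 j.succ) = ra j * z 0 j.succ := by
    intro j
    have := J 0 j.succ 0
    simp [hCdef, hs', zd, apply_ite (algebraMap ℂ A)] at this
    rw [hskew 0 j.succ] at this
    simp only [map_neg] at this
    linear_combination this
  have J2 : ∀ j k : Fin 3, e 0 (z j.succ k.succ) - e j.succ (z 0 k.succ) =
      (ra j - ra k) * z j.succ k.succ := by
    intro j k
    have := J 0 j.succ k.succ
    simp [hCdef, hs', zd, apply_ite (algebraMap ℂ A)] at this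
    linear_combination -this
  have J3 : ∀ j k : Fin 3, e j.succ (z 0 k.succ) = e k.succ (z 0 j.succ) := by
    intro j k
    have := J j.succ k.succ 0
    simp [hCdef, hs', hne, apply_ite (algebraMap ℂ A)] at this
    rw [hskew 0 j.succ, hskew 0 k.succ] at this
    simp only [map_neg] at this
    linear_combination this
  have J4 : ∀ j k : Fin 3, j ≠ k → e j.succ (z k.succ j.succ) = -ra j * z 0 k.succ := by
    intro j k hjk
    have := J j.succ k.succ j.succ
    simp [hCdef, hs', zd, apply_ite (algebraMap ℂ A), hjk] at this
    rw [hskew 0 k.succ] at this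
    linear_combination -this
  -- Exchange j and k in `J2`. By `J3` and skew-symmetry all terms agree except the derivative along
  -- e_0, which changes sign.
  have J5 : ∀ j k : Fin 3, e 0 (z j.succ k.succ) = 0 := by
    intro j k
    have a1 := J2 j k
    have a2 := J2 k j
    rw [hskew j.succ k.succ, map_neg, J3 k j] at a2
    exact two_mul_cancel (by linear_combination a1 - a2)
  -- Apply [e_0, e_j] = r_j e_j to the function z_{kj}. By `J4`, `J5` and `J1` both sides are
  -- multiples of z_{0k}, and the difference is r_j (r_j − r_k) z_{0k}; both factors r_j and r_j −
  -- r_k are nonzero.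
  have h0k : ∀ k : Fin 3, z 0 k.succ = 0 := by
    intro k
    obtain ⟨j, hjk⟩ : ∃ j : Fin 3, j ≠ k := ⟨k + 1, by omega⟩
    have e1 := congrArg (fun d : Derivation ℂ A A => d (z k.succ j.succ)) (h0 j)
    simp only [Derivation.commutator_apply, Derivation.smul_apply, smul_eq_mul] at e1
    rw [J4 j k hjk, J5, map_zero] at e1
    have e2 : e 0 (-ra j * z 0 k.succ) = -ra j * (ra k * z 0 k.succ) := by
      rw [← J1 k]; simp [hra]
    rw [e2] at e1
    apply mul_algebraMap_eq_zero (mul_ne_zero (hr j) (sub_ne_zero.mpr (hr' j k hjk)))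
    rw [map_mul, map_sub]
    linear_combination e1
  have hjk0 : ∀ j k : Fin 3, z j.succ k.succ = 0 := by
    intro j k
    by_cases hjk : j = k
    · rw [hjk, zd]
    · have := J2 j k
      rw [J5, h0k, map_zero] at this
      apply mul_algebraMap_eq_zero (sub_ne_zero.mpr (hr' j k hjk))
      rw [map_sub]
      linear_combination -this
  have hz0 : ∀ a b, z a b = 0 := by
    intro a b
    refine Fin.cases ?_ (fun j => ?_) a <;> refine Fin.cases ?_ (fun k => ?_) b
    · exact zd 0
    · exact h0k k
    · rw [hskew 0 j.succ, h0k, neg_zero]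
    · exact hjk0 j k
  rw [hz]
  simp [hz0]

/-- The components of the bracket of a Killing field with the vector fields of an orthonormal frame
are skew-symmetric. -/
theorem killing_skew {D : Fin 4 → Derivation ℂ A A} {G E : Matrix (Fin 4) (Fin 4) A}
    (hG : G.transpose = G) (hE : E.transpose * G * E = 1) {X : Fin 4 → A}
    (hX : ∀ i j, vecDer D X (G i j) + ∑ k, (D i (X k) * G k j + G i k * D j (X k)) = 0) (a b : Fin 4) :
    ∑ k, coframe G E a k * vecBracket D X (fun i => E i b) k =
      -∑ k, coframe G E b k * vecBracket D X (fun i => E i a) k := by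
  set dX : Matrix (Fin 4) (Fin 4) A := Matrix.of fun k i => D i (X k) with hdX
  set V : Matrix (Fin 4) (Fin 4) A := E.map (vecDer D X) - dX * E with hV
  have hVb : ∀ a b, ∑ k, coframe G E a k * vecBracket D X (fun i => E i b) k
      = (E.transpose * G * V) a b := by
    intro a b
    rw [Matrix.mul_apply]
    refine Finset.sum_congr rfl fun k _ => ?_
    rw [vecBracket, hV, Matrix.sub_apply, Matrix.map_apply, coframe]
    congr 2
    rw [vecDer_apply, Matrix.mul_apply]
    exact Finset.sum_congr rfl fun _ _ => by rw [hdX, Matrix.of_apply, mul_comm]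
  have hK : G.map (vecDer D X) + dX.transpose * G + G * dX = 0 := by
    ext i j
    simp only [Matrix.add_apply, Matrix.map_apply, Matrix.mul_apply, Matrix.transpose_apply,
      Matrix.zero_apply, add_assoc, ← Finset.sum_add_distrib, hdX, Matrix.of_apply]
    exact hX i j
  -- The columns of `V` are the brackets [X, E_b]. Differentiating `Eᵀ G E = 1` along `X` and
  -- replacing the derivative of `G` by the Killing equation gives skew-symmetry.
  have h1 : (E.transpose * G * V) + (E.transpose * G * V).transpose = 0 := by
    have := congrArg (fun M => M.map (vecDer D X)) hE
    simp only [map_mul_derivation, map_one_derivation] at this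
    rw [eq_neg_of_add_eq_zero_left (show G.map (vecDer D X) + (dX.transpose * G + G * dX) = 0 by
      rw [← hK]; abel)] at this
    rw [← this, hV]
    simp only [Matrix.transpose_mul, Matrix.transpose_sub, Matrix.transpose_transpose, hG,
      Matrix.transpose_map]
    noncomm_ring
  rw [hVb, hVb]
  have := congrFun (congrFun h1 a) b
  simp only [Matrix.add_apply, Matrix.transpose_apply, Matrix.zero_apply] at this
  linear_combination this

end Brackets

end EinsteinFour

end

noncomputable section

namespace EinsteinFour

/-! ### The ring of smooth functions on an open set -/

section SmoothFunctions

open TopologicalSpace (Opens)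

theorem pderiv_congr {F : Type*} [NormedAddCommGroup F] [NormedSpace ℝ F] {f g : E4 → F}
    {V : Set E4} (hV : IsOpen V) (h : Set.EqOn f g V) {y : E4} (hy : y ∈ V) (i : Fin 4) :
    pderiv i f y = pderiv i g y := by
  rw [pderiv, pderiv, Filter.EventuallyEq.fderiv_eq]
  filter_upwards [hV.mem_nhds hy] with z hz using h hz

theorem contDiffOn_pderiv {F : Type*} [NormedAddCommGroup F] [NormedSpace ℝ F] {f : E4 → F}
    {V : Set E4} (hV : IsOpen V) (hf : ContDiffOn ℝ ∞ f V) (i : Fin 4) :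
    ContDiffOn ℝ ∞ (pderiv i f) V :=
  (hf.fderiv_of_isOpen hV (by simp)).clm_apply contDiffOn_const

theorem differentiableAt_of_contDiffOn {F : Type*} [NormedAddCommGroup F] [NormedSpace ℝ F]
    {f : E4 → F} {V : Set E4} (hV : IsOpen V) (hf : ContDiffOn ℝ ∞ f V) {y : E4} (hy : y ∈ V) :
    DifferentiableAt ℝ f y :=
  (hf.contDiffAt (hV.mem_nhds hy)).differentiableAt (by simp)

theorem pderiv_comm {f : E4 → ℂ} {V : Set E4} (hV : IsOpen V) (hf : ContDiffOn ℝ ∞ f V) {y : E4}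
    (hy : y ∈ V) (i j : Fin 4) : pderiv i (pderiv j f) y = pderiv j (pderiv i f) y := by
  have hd : DifferentiableAt ℝ (fderiv ℝ f) y :=
    differentiableAt_of_contDiffOn hV (hf.fderiv_of_isOpen hV (by simp)) hy
  have key : ∀ i j, pderiv i (pderiv j f) y =
      fderiv ℝ (fderiv ℝ f) y (EuclideanSpace.single i 1) (EuclideanSpace.single j 1) := by
    intro i j
    have : pderiv j f = fun z => fderiv ℝ f z (EuclideanSpace.single j 1) := rfl
    rw [this, pderiv, fderiv_clm_apply hd (differentiableAt_const _)]
    simp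
  rw [key, key]
  exact ((hf.contDiffAt (hV.mem_nhds hy)).isSymmSndFDerivAt (by simpa using WithTop.coe_le_coe.mpr (le_top : (2 : ℕ∞) ≤ ⊤))).eq _ _

/-- The smooth complex-valued functions on an open subset of `E4`. -/
def smoothSubalgebra (V : Opens E4) : Subalgebra ℂ (V → ℂ) where
  carrier := {f | ∃ F : E4 → ℂ, ContDiffOn ℝ ∞ F V ∧ ∀ x : V, F x = f x}
  mul_mem' := by
    rintro f g ⟨F, hF, hf⟩ ⟨H, hH, hg⟩
    exact ⟨fun x => F x * H x, hF.mul hH, fun x => by simp [hf, hg]⟩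
  add_mem' := by
    rintro f g ⟨F, hF, hf⟩ ⟨H, hH, hg⟩
    exact ⟨fun x => F x + H x, hF.add hH, fun x => by simp [hf, hg]⟩
  algebraMap_mem' c := ⟨fun _ => c, contDiffOn_const, fun _ => rfl⟩

/-- The ring of smooth complex-valued functions on an open subset of `E4`. -/
abbrev SmoothFun (V : Opens E4) : Type := smoothSubalgebra V

variable {V : Opens E4}

/-- The element of `SmoothFun V` defined by a function on `E4`. -/
def SmoothFun.mk (F : E4 → ℂ) (hF : ContDiffOn ℝ ∞ F V) : SmoothFun V :=
  ⟨fun x => F x, F, hF, fun _ => rfl⟩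

/-- A function on `E4` which represents the element of `SmoothFun V`. -/
def SmoothFun.rep (f : SmoothFun V) : E4 → ℂ := f.2.choose

theorem SmoothFun.contDiffOn_rep (f : SmoothFun V) : ContDiffOn ℝ ∞ f.rep V := f.2.choose_spec.1

theorem SmoothFun.rep_apply (f : SmoothFun V) (x : V) : f.rep x = f.1 x := f.2.choose_spec.2 x

theorem SmoothFun.ext {f g : SmoothFun V} (h : ∀ x : V, f.1 x = g.1 x) : f = g :=
  Subtype.ext (funext h)

@[simp] theorem SmoothFun.mk_apply (F : E4 → ℂ) (hF : ContDiffOn ℝ ∞ F V) (x : V) :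
    (SmoothFun.mk F hF).1 x = F x := rfl

/-- Partial derivatives at a point of the open set V depend only on values on V, so the choice of a
representative is harmless. -/
theorem SmoothFun.pderiv_rep {f : SmoothFun V} {F : E4 → ℂ} (hF : ∀ x : V, F x = f.1 x) (i : Fin 4)
    (x : V) : pderiv i f.rep x = pderiv i F x :=
  pderiv_congr V.2 (fun y hy => (f.rep_apply ⟨y, hy⟩).trans (hF ⟨y, hy⟩).symm) x.2 i

/-- The partial derivatives of smooth functions. -/
def SmoothFun.D (i : Fin 4) : Derivation ℂ (SmoothFun V) (SmoothFun V) :=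
  Derivation.mk'
    { toFun := fun f => SmoothFun.mk (pderiv i f.rep) (contDiffOn_pderiv V.2 f.contDiffOn_rep i)
      map_add' := fun f g => SmoothFun.ext fun x => by
        rw [SmoothFun.mk_apply, SmoothFun.pderiv_rep (F := fun y => f.rep y + g.rep y)
          (fun x => by simp [SmoothFun.rep_apply])]
        simp only [pderiv]
        rw [fderiv_fun_add (differentiableAt_of_contDiffOn V.2 f.contDiffOn_rep x.2)
          (differentiableAt_of_contDiffOn V.2 g.contDiffOn_rep x.2)]
        rfl
      map_smul' := fun c f => SmoothFun.ext fun x => by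
        rw [SmoothFun.mk_apply, SmoothFun.pderiv_rep (F := fun y => c * f.rep y)
          (fun x => by simp [SmoothFun.rep_apply])]
        simp only [pderiv]
        rw [fderiv_const_mul (differentiableAt_of_contDiffOn V.2 f.contDiffOn_rep x.2)]
        rfl }
    (fun f g => SmoothFun.ext fun x => by
      have hf := differentiableAt_of_contDiffOn V.2 f.contDiffOn_rep x.2
      have hg := differentiableAt_of_contDiffOn V.2 g.contDiffOn_rep x.2
      simp only [LinearMap.coe_mk, AddHom.coe_mk]
      rw [SmoothFun.mk_apply, SmoothFun.pderiv_rep (F := fun y => f.rep y * g.rep y)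
        (fun x => by simp [SmoothFun.rep_apply])]
      simp only [pderiv]
      rw [fderiv_fun_mul hf hg]
      simp [SmoothFun.rep_apply, pderiv])

theorem SmoothFun.D_apply {f : SmoothFun V} {F : E4 → ℂ} (hF : ∀ x : V, F x = f.1 x) (i : Fin 4)
    (x : V) : (SmoothFun.D i f).1 x = pderiv i F x :=
  SmoothFun.pderiv_rep hF i x

theorem SmoothFun.D_mk (F : E4 → ℂ) (hF : ContDiffOn ℝ ∞ F V) (i : Fin 4) (x : V) :
    (SmoothFun.D i (SmoothFun.mk F hF)).1 x = pderiv i F x :=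
  SmoothFun.D_apply (fun _ => rfl) i x

theorem SmoothFun.D_comm (i j : Fin 4) (f : SmoothFun V) :
    SmoothFun.D i (SmoothFun.D j f) = SmoothFun.D j (SmoothFun.D i f) := by
  refine SmoothFun.ext fun x => ?_
  rw [SmoothFun.D_apply (F := pderiv j f.rep) (fun _ => rfl),
    SmoothFun.D_apply (F := pderiv i f.rep) (fun _ => rfl)]
  exact pderiv_comm V.2 f.contDiffOn_rep x.2 i j

theorem pderiv_ofReal {f : E4 → ℝ} {y : E4} (hf : DifferentiableAt ℝ f y) (i : Fin 4) :
    pderiv i (fun z => (f z : ℂ)) y = ((pderiv i f y : ℝ) : ℂ) := by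
  have h : (fun z => (f z : ℂ)) = Complex.ofRealCLM ∘ f := rfl
  rw [pderiv, h, fderiv_comp _ Complex.ofRealCLM.differentiableAt hf]
  simp [pderiv]

theorem contDiffOn_ofReal {f : E4 → ℝ} {U : Set E4} (hf : ContDiffOn ℝ ∞ f U) :
    ContDiffOn ℝ ∞ (fun z => (f z : ℂ)) U :=
  Complex.ofRealCLM.contDiff.comp_contDiffOn hf

/-- The element of `SmoothFun V` defined by a real function on `E4`. -/
def SmoothFun.ofReal (F : E4 → ℝ) (hF : ContDiffOn ℝ ∞ F V) : SmoothFun V :=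
  SmoothFun.mk (fun z => (F z : ℂ)) (contDiffOn_ofReal hF)

@[simp] theorem SmoothFun.ofReal_apply (F : E4 → ℝ) (hF : ContDiffOn ℝ ∞ F V) (x : V) :
    (SmoothFun.ofReal F hF).1 x = F x := rfl

theorem SmoothFun.D_ofReal (F : E4 → ℝ) (hF : ContDiffOn ℝ ∞ F V) (i : Fin 4) (x : V) :
    (SmoothFun.D i (SmoothFun.ofReal F hF)).1 x = ((pderiv i F x : ℝ) : ℂ) := by
  rw [SmoothFun.ofReal, SmoothFun.D_mk, pderiv_ofReal (differentiableAt_of_contDiffOn V.2 hF x.2)]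

/-- The evaluation at a point. -/
def SmoothFun.eval (x : V) : SmoothFun V →ₐ[ℂ] ℂ :=
  (Pi.evalAlgHom ℂ (fun _ : V => ℂ) x).comp (smoothSubalgebra V).val

@[simp] theorem SmoothFun.eval_apply (x : V) (f : SmoothFun V) : SmoothFun.eval x f = f.1 x := rfl

/-- The coordinate functions. -/
def SmoothFun.coordFun (V : Opens E4) (i : Fin 4) : SmoothFun V :=
  SmoothFun.ofReal (fun z => z i) (by fun_prop)

theorem SmoothFun.D_coordFun (i j : Fin 4) :
    SmoothFun.D i (SmoothFun.coordFun V j) = if i = j then 1 else 0 := by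
  refine SmoothFun.ext fun x => ?_
  rw [SmoothFun.coordFun, SmoothFun.D_ofReal, pderiv]
  have : (fun z : E4 => z j) = (EuclideanSpace.proj j : E4 →L[ℝ] ℝ) := rfl
  rw [this, ContinuousLinearMap.fderiv]
  by_cases h : i = j
  · subst h; simp
  · rw [if_neg h]; simp [Ne.symm h]

theorem SmoothFun.vecDer_injective {X : Fin 4 → SmoothFun V} (h : vecDer SmoothFun.D X = 0) : X = 0 := by
  funext j
  have := congrArg (fun d : Derivation ℂ (SmoothFun V) (SmoothFun V) => d (SmoothFun.coordFun V j)) h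
  simp only [vecDer_apply, SmoothFun.D_coordFun] at this
  simpa using this

instance [Nonempty V] : Nontrivial (SmoothFun V) := by
  obtain ⟨x⟩ := ‹Nonempty V›
  exact (SmoothFun.eval x).toRingHom.domain_nontrivial

end SmoothFunctions

end EinsteinFour

end

noncomputable section

namespace EinsteinFour

/-! ### A metric on a coordinate domain as a matrix over the ring of smooth functions -/

section LocalMetric

open TopologicalSpace (Opens)

variable {V : Opens E4} {G : E4 → Matrix (Fin 4) (Fin 4) ℝ}

/-- `G` is a smooth pseudo-Riemannian metric on the open set `V`. -/
structure IsLocalMetric (V : Opens E4) (G : E4 → Matrix (Fin 4) (Fin 4) ℝ) : Prop where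
  smooth : ∀ i j, ContDiffOn ℝ ∞ (fun z => G z i j) V
  symm : ∀ z ∈ V, (G z).transpose = G z
  det_ne_zero : ∀ z ∈ V, (G z).det ≠ 0

theorem contDiffOn_det {F : Type*} [NormedField F] [NormedAlgebra ℝ F] {n : Type*} [Fintype n]
    [DecidableEq n] {M : E4 → Matrix n n F} {U : Set E4}
    (hM : ∀ i j, ContDiffOn ℝ ∞ (fun z => M z i j) U) : ContDiffOn ℝ ∞ (fun z => (M z).det) U := by
  simp only [Matrix.det_apply]
  refine ContDiffOn.sum fun σ _ => ContDiffOn.const_smul _ ?_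
  exact contDiffOn_prod fun i _ => hM _ _

theorem IsLocalMetric.contDiffOn_inv (h : IsLocalMetric V G) (i j : Fin 4) :
    ContDiffOn ℝ ∞ (fun z => (G z)⁻¹ i j) V := by
  have e : Set.EqOn (fun z => (G z)⁻¹ i j)
      (fun z => ((G z).det)⁻¹ * ((G z).updateRow j (Pi.single i 1)).det) V := by
    intro z _
    simp only [Matrix.inv_def, Matrix.smul_apply, Matrix.adjugate_apply, smul_eq_mul,
      Ring.inverse_eq_inv']
  refine ContDiffOn.congr ?_ e
  refine ((contDiffOn_det h.smooth).inv h.det_ne_zero).mul (contDiffOn_det fun k l => ?_)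
  by_cases hk : k = j
  · subst hk; simp [contDiffOn_const]
  · simpa [hk] using h.smooth k l

theorem IsLocalMetric.contDiffOn_christoffel (h : IsLocalMetric V G) (k i j : Fin 4) :
    ContDiffOn ℝ ∞ (christoffel G k i j) V := by
  unfold christoffel
  refine contDiffOn_const.mul (ContDiffOn.sum fun l _ => (h.contDiffOn_inv k l).mul ?_)
  exact ((contDiffOn_pderiv V.2 (h.smooth j l) i).add (contDiffOn_pderiv V.2 (h.smooth i l) j)).sub
    (contDiffOn_pderiv V.2 (h.smooth i j) l)

theorem IsLocalMetric.contDiffOn_curvature (h : IsLocalMetric V G) (i j k l : Fin 4) :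
    ContDiffOn ℝ ∞ (curvature G i j k l) V := by
  have := h.contDiffOn_christoffel
  unfold curvature
  refine ((contDiffOn_pderiv V.2 (this l i k) j).sub (contDiffOn_pderiv V.2 (this l j k) i)).add ?_
  exact ContDiffOn.sum fun m _ => ((this _ _ _).mul (this _ _ _)).sub ((this _ _ _).mul (this _ _ _))

theorem IsLocalMetric.contDiffOn_curvatureLow (h : IsLocalMetric V G) (i j k l : Fin 4) :
    ContDiffOn ℝ ∞ (curvatureLow G i j k l) V := by
  unfold curvatureLow
  exact ContDiffOn.sum fun m _ => (h.contDiffOn_curvature _ _ _ _).mul (h.smooth _ _)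

theorem IsLocalMetric.contDiffOn_ricci (h : IsLocalMetric V G) (i k : Fin 4) :
    ContDiffOn ℝ ∞ (ricci G i k) V := by
  unfold ricci
  exact ContDiffOn.sum fun j _ => h.contDiffOn_curvature _ _ _ _

theorem IsLocalMetric.contDiffOn_scalarCurvature (h : IsLocalMetric V G) :
    ContDiffOn ℝ ∞ (scalarCurvature G) V := by
  unfold scalarCurvature
  exact ContDiffOn.sum fun i _ => ContDiffOn.sum fun k _ =>
    (h.contDiffOn_inv _ _).mul (h.contDiffOn_ricci _ _)

/-- The metric as a matrix of smooth functions. -/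
def IsLocalMetric.mat (h : IsLocalMetric V G) : Matrix (Fin 4) (Fin 4) (SmoothFun V) :=
  Matrix.of fun i j => SmoothFun.ofReal (fun z => G z i j) (h.smooth i j)

/-- The inverse metric as a matrix of smooth functions. -/
def IsLocalMetric.invMat (h : IsLocalMetric V G) : Matrix (Fin 4) (Fin 4) (SmoothFun V) :=
  Matrix.of fun i j => SmoothFun.ofReal (fun z => (G z)⁻¹ i j) (h.contDiffOn_inv i j)

/-- The Levi-Civita connection matrices as matrices of smooth functions. -/
def IsLocalMetric.conn (h : IsLocalMetric V G) (i : Fin 4) : Matrix (Fin 4) (Fin 4) (SmoothFun V) :=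
  Matrix.of fun k j => SmoothFun.ofReal (christoffel G k i j) (h.contDiffOn_christoffel k i j)

theorem IsLocalMetric.mat_transpose (h : IsLocalMetric V G) : h.mat.transpose = h.mat := by
  ext i j x
  have := congrFun (congrFun (h.symm x x.2) i) j
  simp only [Matrix.transpose_apply] at this
  simp [mat, this]

theorem IsLocalMetric.eval_mat (h : IsLocalMetric V G) (x : V) :
    h.mat.map (SmoothFun.eval x) = (G x).map Complex.ofReal := rfl

theorem IsLocalMetric.eval_invMat (h : IsLocalMetric V G) (x : V) :
    h.invMat.map (SmoothFun.eval x) = ((G x)⁻¹).map Complex.ofReal := rfl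

theorem matrix_ext_eval {m n : Type*} {M N : Matrix m n (SmoothFun V)}
    (h : ∀ x : V, M.map (SmoothFun.eval x) = N.map (SmoothFun.eval x)) : M = N := by
  ext i j x
  exact congrFun (congrFun (h x) i) j

theorem map_ofReal_mul {l m n : Type*} [Fintype m] (M : Matrix l m ℝ) (N : Matrix m n ℝ) :
    (M * N).map Complex.ofReal = M.map Complex.ofReal * N.map Complex.ofReal :=
  Matrix.map_mul (f := Complex.ofRealHom)

theorem map_ofReal_one {n : Type*} [DecidableEq n] :
    (1 : Matrix n n ℝ).map Complex.ofReal = 1 :=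
  Matrix.map_one _ Complex.ofReal_zero Complex.ofReal_one

theorem IsLocalMetric.invMat_mul (h : IsLocalMetric V G) : h.invMat * h.mat = 1 := by
  refine matrix_ext_eval fun x => ?_
  rw [Matrix.map_mul, h.eval_mat, h.eval_invMat, ← map_ofReal_mul,
    Matrix.nonsing_inv_mul _ (isUnit_iff_ne_zero.mpr (h.det_ne_zero x x.2)), map_ofReal_one,
    Matrix.map_one _ (map_zero _) (map_one _)]

/-- The Christoffel symbols are the inverse metric applied to the Koszul expression; lowering the
index cancels the inverse, and `isLeviCivita_of_koszul` applies. -/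
theorem IsLocalMetric.isLeviCivita (h : IsLocalMetric V G) :
    IsLeviCivita SmoothFun.D h.mat h.conn := by
  refine isLeviCivita_of_koszul h.mat_transpose h.invMat_mul fun i j l => SmoothFun.ext fun x => ?_
  have hx : G x * (G x)⁻¹ = 1 :=
    Matrix.mul_nonsing_inv _ (isUnit_iff_ne_zero.mpr (h.det_ne_zero x x.2))
  have key : 2 * ∑ k, G x l k * christoffel G k i j x =
      pderiv i (fun z => G z j l) x + pderiv j (fun z => G z i l) x - pderiv l (fun z => G z i j) x := by
    set T : Fin 4 → ℝ := fun l => pderiv i (fun z => G z j l) x + pderiv j (fun z => G z i l) x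
      - pderiv l (fun z => G z i j) x with hT
    have e1 : ∀ k, christoffel G k i j x = (1 / 2 : ℝ) * ((G x)⁻¹).mulVec T k := fun k => rfl
    have e2 : (G x).mulVec (((G x)⁻¹).mulVec T) l = T l := by
      rw [Matrix.mulVec_mulVec, hx, Matrix.one_mulVec]
    change _ = T l
    rw [← e2]
    simp only [e1]
    rw [Matrix.mulVec, dotProduct, Finset.mul_sum]
    exact Finset.sum_congr rfl fun k _ => by ring
  have e : ∀ i j l, (SmoothFun.D i (h.mat j l)).1 x = ((pderiv i (fun z => G z j l) x : ℝ) : ℂ) :=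
    fun i j l => SmoothFun.D_ofReal (fun z => G z j l) (h.smooth j l) i x
  have lhs : (2 * (h.mat * h.conn i) l j).1 x = ((2 * ∑ k, G x l k * christoffel G k i j x : ℝ) : ℂ) := by
    rw [Matrix.mul_apply, ← SmoothFun.eval_apply, map_mul, map_sum]
    simp only [map_mul, SmoothFun.eval_apply, mat, conn, Matrix.of_apply, SmoothFun.ofReal_apply]
    push_cast
    congr 1
  rw [lhs, key, ← SmoothFun.eval_apply, map_sub, map_add]
  simp only [SmoothFun.eval_apply, e]
  push_cast
  ring

/-- The sign reflects the convention R(u,v) = ∇_v∇_u − ∇_u∇_v + ∇_[u,v] for the curvature tensor,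
opposite to that of dΓ + Γ∧Γ. -/
theorem IsLocalMetric.connCurv_apply (h : IsLocalMetric V G) (i j k l : Fin 4) (x : V) :
    (connCurv SmoothFun.D h.conn i j l k).1 x = -((curvature G i j k l x : ℝ) : ℂ) := by
  have e : ∀ i k j m, (SmoothFun.D m (h.conn i k j)).1 x = ((pderiv m (christoffel G k i j) x : ℝ) : ℂ) :=
    fun i k j m => SmoothFun.D_ofReal (christoffel G k i j) (h.contDiffOn_christoffel k i j) m x
  rw [connCurv, ← SmoothFun.eval_apply]
  simp only [Matrix.sub_apply, Matrix.add_apply, Matrix.map_apply, Matrix.mul_apply, map_sub, map_add,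
    map_sum, map_mul]
  simp only [SmoothFun.eval_apply, e]
  simp only [conn, Matrix.of_apply, SmoothFun.ofReal_apply, curvature]
  push_cast
  simp only [Finset.sum_sub_distrib, mul_comm ((christoffel G l _ _ x : ℝ) : ℂ)]
  ring

end LocalMetric

end EinsteinFour

end

noncomputable section

namespace EinsteinFour

/-! ### The self-dual curvature of an Einstein metric -/

section CurvatureOperator

open TopologicalSpace (Opens)

variable {G : E4 → Matrix (Fin 4) (Fin 4) ℝ} {y : E4}

/-- The value of a metric as a complex matrix. -/
def cMat (G : E4 → Matrix (Fin 4) (Fin 4) ℝ) (y : E4) : Matrix (Fin 4) (Fin 4) ℂ :=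
  (G y).map Complex.ofReal

theorem cMat_transpose (hs : (G y).transpose = G y) : (cMat G y).transpose = cMat G y := by
  rw [cMat, ← Matrix.transpose_map, hs]

theorem cMat_mul_inv (hd : (G y).det ≠ 0) : cMat G y * ((G y)⁻¹).map Complex.ofReal = 1 := by
  rw [cMat, ← map_ofReal_mul, Matrix.mul_nonsing_inv _ (isUnit_iff_ne_zero.mpr hd), map_ofReal_one]

theorem inv_mul_cMat (hd : (G y).det ≠ 0) : ((G y)⁻¹).map Complex.ofReal * cMat G y = 1 :=
  mul_eq_one_comm.mp (cMat_mul_inv hd)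

theorem bivectorOperator_eq (T : Fin 4 → Fin 4 → Fin 4 → Fin 4 → E4 → ℝ)
    (hs : (G y).transpose = G y) (α : Matrix (Fin 4) (Fin 4) ℂ) :
    bivectorOperator G T y α = ((G y)⁻¹).map Complex.ofReal *
      (Matrix.of fun p q => (1 / 2 : ℂ) * ∑ i, ∑ j, (T i j p q y : ℂ) * α i j) *
        ((G y)⁻¹).map Complex.ofReal := by
  have hsi : ∀ q l, (G y)⁻¹ q l = (G y)⁻¹ l q := by
    intro q l
    have : ((G y)⁻¹).transpose = (G y)⁻¹ := by rw [Matrix.transpose_nonsing_inv, hs]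
    exact congrFun (congrFun this l) q
  ext k l
  simp only [bivectorOperator, LinearMap.coe_mk, AddHom.coe_mk, Matrix.of_apply, Matrix.mul_apply,
    Matrix.map_apply, Finset.sum_mul, Finset.mul_sum, hsi _ l]
  rw [Finset.sum_comm' (t' := Finset.univ) (s' := fun _ => Finset.univ) (by simp)]
  have : ∀ f : Fin 4 → Fin 4 → Fin 4 → Fin 4 → ℂ, ∑ j, ∑ i, ∑ p, ∑ q, f j i p q =
      ∑ q, ∑ p, ∑ i, ∑ j, f j i p q := by
    intro f
    simp only [Fin.sum_univ_four]
    ring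
  rw [this]
  refine Finset.sum_congr rfl fun i _ => Finset.sum_congr rfl fun j _ =>
      Finset.sum_congr rfl fun p _ => Finset.sum_congr rfl fun q _ => ?_
  push_cast
  ring

theorem lower_bivectorOperator (T : Fin 4 → Fin 4 → Fin 4 → Fin 4 → E4 → ℝ)
    (hs : (G y).transpose = G y) (hd : (G y).det ≠ 0) (α : Matrix (Fin 4) (Fin 4) ℂ) :
    cMat G y * bivectorOperator G T y α * cMat G y =
      Matrix.of fun p q => (1 / 2 : ℂ) * ∑ i, ∑ j, (T i j p q y : ℂ) * α i j := by
  rw [bivectorOperator_eq T hs, Matrix.mul_assoc, Matrix.mul_assoc, inv_mul_cMat hd, Matrix.mul_one,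
    ← Matrix.mul_assoc, cMat_mul_inv hd, Matrix.one_mul]

theorem weyl_of_einstein
    (hEin : ∀ i k, ricci G i k y = scalarCurvature G y / 4 * G y i k) (i j k l : Fin 4) :
    weyl G i j k l y = curvatureLow G i j k l y
      - scalarCurvature G y / 12 * (G y i k * G y j l - G y i l * G y j k) := by
  rw [weyl]
  simp only [schouten, hEin]
  ring

/-- For an Einstein metric the Schouten tensor is (s/12) g, so on bivectors the curvature operator
is W + s/12; here both sides have their indices lowered. -/
theorem lower_weylOperator (hs : (G y).transpose = G y) (hd : (G y).det ≠ 0)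
    (hEin : ∀ i k, ricci G i k y = scalarCurvature G y / 4 * G y i k)
    {α : Matrix (Fin 4) (Fin 4) ℂ} (hα : α.transpose = -α) :
    cMat G y * (weylOperator G y α + ((scalarCurvature G y / 12 : ℝ) : ℂ) • α) * cMat G y =
      Matrix.of fun p q => (1 / 2 : ℂ) * ∑ i, ∑ j, (curvatureLow G i j p q y : ℂ) * α i j := by
  rw [Matrix.mul_add, Matrix.add_mul, weylOperator, lower_bivectorOperator _ hs hd]
  ext p q
  have e : ∀ i j, α j i = -α i j := fun i j => congrFun (congrFun hα i) j
  have hg : ∀ p i, G y p i = G y i p := fun p i => congrFun (congrFun hs i) p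
  have key : (cMat G y * α * cMat G y) p q =
      (1 / 2 : ℂ) * ∑ i, ∑ j, ((G y i p * G y j q - G y i q * G y j p : ℝ) : ℂ) * α i j := by
    have h1 : (cMat G y * α * cMat G y) p q =
        ∑ i, ∑ j, ((G y i p * G y j q : ℝ) : ℂ) * α i j := by
      simp only [Matrix.mul_apply, cMat, Matrix.map_apply, Finset.sum_mul]
      rw [Finset.sum_comm]
      refine Finset.sum_congr rfl fun i _ => Finset.sum_congr rfl fun j _ => ?_
      rw [hg p i]; push_cast; ring
    have h2 : (cMat G y * α * cMat G y) p q =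
        -∑ i, ∑ j, ((G y i q * G y j p : ℝ) : ℂ) * α i j := by
      rw [h1, Finset.sum_comm, ← Finset.sum_neg_distrib]
      refine Finset.sum_congr rfl fun i _ => ?_
      rw [← Finset.sum_neg_distrib]
      refine Finset.sum_congr rfl fun j _ => ?_
      rw [e i j]; push_cast; ring
    have h3 : ∑ i, ∑ j, ((G y i p * G y j q - G y i q * G y j p : ℝ) : ℂ) * α i j =
        ∑ i, ∑ j, ((G y i p * G y j q : ℝ) : ℂ) * α i j
          - ∑ i, ∑ j, ((G y i q * G y j p : ℝ) : ℂ) * α i j := by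
      simp only [← Finset.sum_sub_distrib]
      refine Finset.sum_congr rfl fun i _ => Finset.sum_congr rfl fun j _ => ?_
      push_cast; ring
    rw [h3]
    linear_combination (1 / 2 : ℂ) * h1 + (1 / 2 : ℂ) * h2
  rw [Matrix.add_apply, Matrix.mul_smul, Matrix.smul_mul, Matrix.smul_apply, key]
  simp only [Matrix.of_apply, weyl_of_einstein hEin, smul_eq_mul]
  rw [mul_left_comm, ← mul_add, Finset.mul_sum, ← Finset.sum_add_distrib]
  congr 1
  refine Finset.sum_congr rfl fun i _ => ?_
  rw [Finset.mul_sum, ← Finset.sum_add_distrib]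
  refine Finset.sum_congr rfl fun j _ => ?_
  push_cast; ring

theorem trace_mul_sdBasis {R : Type*} [CommRing R] {M : Matrix (Fin 4) (Fin 4) R}
    (hM : M.transpose = -M) (j : Fin 3) : (M * sdBasis R j).trace = -(2 * sdPart j M) := by
  have e : ∀ a b, M b a = -M a b := fun i j => congrFun (congrFun hM i) j
  fin_cases j <;>
  simp [Matrix.trace, Matrix.mul_apply, Fin.sum_univ_four, sdBasis, sdPart, e 0 1, e 0 2, e 0 3,
    e 1 2, e 1 3, e 2 3] <;> ring

theorem sdForm_eq {R : Type*} [CommRing R] (θ : Matrix (Fin 4) (Fin 4) R) (j : Fin 3) (p q : Fin 4) :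
    sdForm θ j p q = (θ.transpose * sdBasis R j * θ) p q := by
  fin_cases j <;>
  simp [Matrix.mul_apply, Fin.sum_univ_four, sdBasis, sdForm] <;> ring

theorem sdBasis_transpose {R : Type*} [CommRing R] (j : Fin 3) :
    (sdBasis R j).transpose = -sdBasis R j := by
  ext a b
  fin_cases j <;> fin_cases a <;> fin_cases b <;> simp [sdBasis]

theorem skew_conj {R : Type*} [CommRing R] (E : Matrix (Fin 4) (Fin 4) R) {B : Matrix (Fin 4) (Fin 4) R}
    (hB : B.transpose = -B) : (E * B * E.transpose).transpose = -(E * B * E.transpose) := by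
  rw [Matrix.transpose_mul, Matrix.transpose_mul, hB, Matrix.transpose_transpose]
  noncomm_ring

variable {V : Opens E4}

/-- Passing to the frame conjugates the curvature matrix, by `connCurv_gauge`, and pairing with I_j
under the trace extracts the self-dual component. Cyclicity of the trace moves the frame onto I_j.
-/
theorem two_mul_sdPart_connCurv {A : Type*} [CommRing A] [Algebra ℂ A] {D : Fin 4 → Derivation ℂ A A}
    {g E : Matrix (Fin 4) (Fin 4) A} {Γ : Fin 4 → Matrix (Fin 4) (Fin 4) A}
    (hD : ∀ i j f, D i (D j f) = D j (D i f)) (hΓ : IsLeviCivita D g Γ) (hg : g.transpose = g)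
    (hE : E.transpose * g * E = 1) (j : Fin 3) (p q : Fin 4) :
    2 * sdPart j (connCurv D (frameConn D g Γ E) p q) =
      -(g * connCurv D Γ p q * (E * sdBasis A j * E.transpose)).trace := by
  have hc : E * connCurv D (frameConn D g Γ E) p q = connCurv D Γ p q * E :=
    connCurv_gauge hD (fun i => mul_frameConn hE i) p q
  have hskew := hΓ.curv_skew hD p q
  generalize connCurv D (frameConn D g Γ E) p q = W at *
  generalize connCurv D Γ p q = F at *
  have hW' : W = coframe g E * F * E := by
    rw [Matrix.mul_assoc, ← hc, ← Matrix.mul_assoc, coframe_mul hE, Matrix.one_mul]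
  have hWs : W.transpose = -W := by
    rw [eq_neg_iff_add_eq_zero, hW', coframe]
    simp only [Matrix.transpose_mul, Matrix.transpose_transpose, hg]
    have : E.transpose * (F.transpose * (g * E)) + E.transpose * g * F * E =
        E.transpose * (F.transpose * g + g * F) * E := by noncomm_ring
    rw [this, hskew]; simp
  have htr := trace_mul_sdBasis hWs j
  have htr2 : (W * sdBasis A j).trace = (g * F * (E * sdBasis A j * E.transpose)).trace := by
    rw [hW', coframe]
    simp only [Matrix.mul_assoc]
    rw [Matrix.trace_mul_comm]
    simp only [Matrix.mul_assoc]
  linear_combination htr - htr2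

theorem IsLocalMetric.mat_mul_connCurv_apply (h : IsLocalMetric V G) (p q a b : Fin 4) (x : V) :
    ((h.mat * connCurv SmoothFun.D h.conn p q) a b).1 x = -((curvatureLow G p q b a x : ℝ) : ℂ) := by
  rw [Matrix.mul_apply, ← SmoothFun.eval_apply, map_sum, curvatureLow]
  push_cast
  rw [← Finset.sum_neg_distrib]
  refine Finset.sum_congr rfl fun m _ => ?_
  have hs : G x m a = G x a m := congrFun (congrFun (h.symm x x.2) a) m
  rw [map_mul, SmoothFun.eval_apply, SmoothFun.eval_apply, h.connCurv_apply, hs]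
  simp only [IsLocalMetric.mat, Matrix.of_apply, SmoothFun.ofReal_apply]
  ring

theorem IsLocalMetric.curvatureLow_pair_symm (h : IsLocalMetric V G) (i j k l : Fin 4) (x : V) :
    curvatureLow G i j k l x = curvatureLow G k l i j x := by
  have h2 := congrArg (SmoothFun.eval x)
    (h.isLeviCivita.pair_symm (SmoothFun.D_comm (V := V)) h.mat_transpose i j k l)
  rw [SmoothFun.eval_apply, SmoothFun.eval_apply, h.mat_mul_connCurv_apply,
    h.mat_mul_connCurv_apply] at h2
  exact_mod_cast (neg_injective h2)

theorem sdBasis_map {R S : Type*} [CommRing R] [CommRing S] (f : R →+* S) (j : Fin 3) :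
    (sdBasis R j).map f = sdBasis S j := by
  ext a b
  fin_cases j <;> fin_cases a <;> fin_cases b <;> simp [sdBasis]

theorem sdForm_map {R S : Type*} [CommRing R] [CommRing S] (f : R →+* S)
    (θ : Matrix (Fin 4) (Fin 4) R) (j : Fin 3) (p q : Fin 4) :
    f (sdForm θ j p q) = sdForm (θ.map f) j p q := by
  simp [sdForm]

/-- The self-dual part of the curvature form is R contracted with an eigenbivector in its second
pair of indices. Pair symmetry moves the contraction to the first pair, where it is the curvature
operator W + s/12. -/
theorem IsLocalMetric.sdPart_connCurv (h : IsLocalMetric V G) {E : Matrix (Fin 4) (Fin 4) (SmoothFun V)}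
    (hE : E.transpose * h.mat * E = 1) (x : V)
    (hEin : ∀ i k, ricci G i k x = scalarCurvature G x / 4 * G x i k) {j : Fin 3} {c : ℂ}
    (hc : weylOperator G x (E.map (SmoothFun.eval x) * sdBasis ℂ j * (E.map (SmoothFun.eval x)).transpose) =
      c • (E.map (SmoothFun.eval x) * sdBasis ℂ j * (E.map (SmoothFun.eval x)).transpose)) (p q : Fin 4) :
    (sdPart j (connCurv SmoothFun.D (frameConn SmoothFun.D h.mat h.conn E) p q)).1 x =
      (c + ((scalarCurvature G x / 12 : ℝ) : ℂ)) * (sdForm (coframe h.mat E) j p q).1 x := by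
  have h1 := congrArg (SmoothFun.eval x)
    (two_mul_sdPart_connCurv (SmoothFun.D_comm (V := V)) h.isLeviCivita h.mat_transpose hE j p q)
  rw [map_mul, map_ofNat, map_neg, Matrix.trace, map_sum] at h1
  rw [← SmoothFun.eval_apply, ← SmoothFun.eval_apply]
  generalize SmoothFun.eval x (sdPart j (connCurv SmoothFun.D (frameConn SmoothFun.D h.mat h.conn E) p q))
    = S at *
  have hform : SmoothFun.eval x (sdForm (coframe h.mat E) j p q) =
      (cMat G x * (E.map (SmoothFun.eval x) * sdBasis ℂ j * (E.map (SmoothFun.eval x)).transpose)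
        * cMat G x) p q := by
    have e : (coframe h.mat E).map (SmoothFun.eval x) =
        (E.map (SmoothFun.eval x)).transpose * cMat G x := by
      rw [coframe, Matrix.map_mul, h.eval_mat, Matrix.transpose_map]; rfl
    have e1 := sdForm_map (SmoothFun.eval x : SmoothFun V →+* ℂ) (coframe h.mat E) j p q
    refine e1.trans ?_
    refine (congrArg (fun θ => sdForm θ j p q) e).trans ?_
    rw [sdForm_eq, Matrix.transpose_mul, Matrix.transpose_transpose,
      cMat_transpose (h.symm x x.2)]
    simp only [Matrix.mul_assoc]
  have hαx : (E * sdBasis (SmoothFun V) j * E.transpose).map (SmoothFun.eval x) =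
      E.map (SmoothFun.eval x) * sdBasis ℂ j * (E.map (SmoothFun.eval x)).transpose := by
    rw [Matrix.map_mul, Matrix.map_mul, Matrix.transpose_map]
    congr 2
    exact sdBasis_map (SmoothFun.eval x : SmoothFun V →+* ℂ) j
  generalize E * sdBasis (SmoothFun V) j * E.transpose = β at *
  have hα := skew_conj (E.map (SmoothFun.eval x)) (sdBasis_transpose (R := ℂ) j)
  generalize E.map (SmoothFun.eval x) * sdBasis ℂ j * (E.map (SmoothFun.eval x)).transpose = α at *
  have key := lower_weylOperator (h.symm x x.2) (h.det_ne_zero x x.2) hEin hα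
  rw [hc, ← add_smul, Matrix.mul_smul, Matrix.smul_mul] at key
  have keypq := congrFun (congrFun key p) q
  rw [hform]
  rw [Matrix.smul_apply, smul_eq_mul] at keypq
  rw [keypq, Matrix.of_apply]
  have hαx' : ∀ a b, (β a b).1 x = α a b := fun a b => congrFun (congrFun hαx a) b
  have h5 : 2 * S = ∑ i, ∑ k, (curvatureLow G i k p q x : ℂ) * α i k := by
    rw [h1, Finset.sum_comm, ← Finset.sum_neg_distrib]
    refine Finset.sum_congr rfl fun k _ => ?_
    rw [Matrix.diag_apply, Matrix.mul_apply, map_sum, ← Finset.sum_neg_distrib]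
    refine Finset.sum_congr rfl fun i _ => ?_
    rw [map_mul, SmoothFun.eval_apply, SmoothFun.eval_apply, h.mat_mul_connCurv_apply, hαx',
      h.curvatureLow_pair_symm]
    ring
  linear_combination (1 / 2 : ℂ) * h5

/-- The structure equations in an orthonormal frame which diagonalizes the self-dual Weyl tensor. -/
theorem IsLocalMetric.selfDualEquations (h : IsLocalMetric V G)
    {E : Matrix (Fin 4) (Fin 4) (SmoothFun V)} (hE : E.transpose * h.mat * E = 1)
    (hEin : ∀ x ∈ V, ∀ i k, ricci G i k x = scalarCurvature G x / 4 * G x i k) {lam : Fin 3 → ℂ}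
    (hlam : ∀ (x : V) (j : Fin 3), weylOperator G x
        (E.map (SmoothFun.eval x) * sdBasis ℂ j * (E.map (SmoothFun.eval x)).transpose) =
      lam j • (E.map (SmoothFun.eval x) * sdBasis ℂ j * (E.map (SmoothFun.eval x)).transpose)) :
    SelfDualEquations SmoothFun.D (coframe h.mat E) E (sdConn SmoothFun.D h.mat h.conn E) lam
      (SmoothFun.ofReal (fun z => scalarCurvature G z / 12)
        (h.contDiffOn_scalarCurvature.div_const 12)) where
  comm := SmoothFun.D_comm
  dual := coframe_mul hE
  curvature j p q := by
    rw [extDeriv_sdConn h.isLeviCivita h.mat_transpose hE]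
    congr 1
    refine SmoothFun.ext fun x => ?_
    rw [h.sdPart_connCurv hE x (hEin x x.2) (hlam x j)]
    rfl
  torsion := extDeriv_sdForm h.isLeviCivita h.mat_transpose hE

end CurvatureOperator

end EinsteinFour

end

noncomputable section

namespace EinsteinFour

/-! ### Square roots of matrices -/

section SquareRoot

open Polynomial

/-- A square root of X modulo f: interpolation at the roots of f gives one up to a nilpotent error,
and Newton's method removes the error. -/
theorem exists_dvd_sq_sub_X {f : ℂ[X]} (hf : f ≠ 0) (h0 : f.eval 0 ≠ 0) : ∃ p : ℂ[X], f ∣ p ^ 2 - X := by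
  classical
  set p₀ : ℂ[X] := Lagrange.interpolate f.roots.toFinset id fun z => z ^ (1 / 2 : ℂ) with hp₀
  have hroot : ∀ z ∈ f.roots, (X - C z) ∣ p₀ ^ 2 - X := by
    intro z hz
    rw [dvd_iff_isRoot, IsRoot.def, eval_sub, eval_pow, eval_X]
    have : p₀.eval z = z ^ (1 / 2 : ℂ) :=
      Lagrange.eval_interpolate_at_node (v := id) _ Function.injective_id.injOn
        (Multiset.mem_toFinset.mpr hz)
    rw [this, one_div, Complex.cpow_ofNat_inv_pow, sub_self]
  -- The polynomial p₀² − X vanishes at each root, but perhaps only to first order; a power of it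
  -- absorbs all multiplicities.
  have hdvd : f ∣ (p₀ ^ 2 - X) ^ (Multiset.card f.roots) := by
    have h1 := (IsAlgClosed.splits f).eq_prod_roots
    have h2 : (f.roots.map (X - C ·)).prod ∣ (f.roots.map fun _ => p₀ ^ 2 - X).prod :=
      Multiset.prod_dvd_prod_of_dvd _ _ hroot
    rw [Multiset.map_const', Multiset.prod_replicate] at h2
    refine dvd_trans ?_ h2
    conv_lhs => rw [h1]
    exact (isUnit_C.mpr (leadingCoeff_ne_zero.mpr hf).isUnit).mul_left_dvd.mpr dvd_rfl
  set x : AdjoinRoot f := AdjoinRoot.mk f X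
  have hnil : IsNilpotent ((AdjoinRoot.mk f p₀) ^ 2 - x) :=
    ⟨Multiset.card f.roots, by rw [← map_pow, ← map_sub, ← map_pow, AdjoinRoot.mk_eq_zero]; exact hdvd⟩
  have hx : IsUnit x := by
    have hc : IsCoprime X f := by
      rw [irreducible_X.coprime_iff_not_dvd, X_dvd_iff, coeff_zero_eq_eval_zero]; exact h0
    obtain ⟨a, b, hab⟩ := hc
    refine IsUnit.of_mul_eq_one (AdjoinRoot.mk f a) ?_
    have := congrArg (AdjoinRoot.mk f) hab
    rw [map_add, map_mul, map_mul, AdjoinRoot.mk_self, mul_zero, add_zero, map_one] at this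
    rw [mul_comm]; exact this
  have hp : IsUnit (AdjoinRoot.mk f p₀) := by
    have : IsUnit (x + ((AdjoinRoot.mk f p₀) ^ 2 - x)) :=
      hnil.isUnit_add_left_of_commute hx (Commute.all _ _)
    rw [add_sub_cancel] at this
    exact (isUnit_pow_iff two_ne_zero).mp this
  have h2 : IsUnit (2 : AdjoinRoot f) := by
    have := (isUnit_iff_ne_zero.mpr (two_ne_zero' ℂ)).map (algebraMap ℂ (AdjoinRoot f))
    rwa [map_ofNat] at this
  -- Newton's method for T² = X needs the derivative 2p₀ to be a unit. It is one, since p₀² differs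
  -- by a nilpotent from X, which is a unit because f(0) ≠ 0.
  obtain ⟨r, ⟨-, hr⟩, -⟩ := existsUnique_nilpotent_sub_and_aeval_eq_zero
    (P := (X ^ 2 - C x : (AdjoinRoot f)[X])) (x := AdjoinRoot.mk f p₀)
    (by simpa using hnil)
    (by simpa [one_add_one_eq_two] using And.intro h2 hp)
  obtain ⟨p, rfl⟩ := AdjoinRoot.mk_surjective r
  refine ⟨p, ?_⟩
  rw [← AdjoinRoot.mk_eq_zero, map_sub, map_pow]
  simpa [x] using hr

/-- An invertible complex matrix has a square root which is a polynomial in the matrix. -/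
theorem exists_aeval_sq_eq {n : Type*} [Fintype n] [DecidableEq n] {S : Matrix n n ℂ}
    (hS : S.det ≠ 0) : ∃ p : ℂ[X], aeval S p * aeval S p = S := by
  have h0 : S.charpoly.eval 0 ≠ 0 := by
    rw [Matrix.eval_charpoly, map_zero, zero_sub, Matrix.det_neg]
    exact mul_ne_zero (pow_ne_zero _ (by simp)) hS
  obtain ⟨p, q, hq⟩ := exists_dvd_sq_sub_X S.charpoly_monic.ne_zero h0
  refine ⟨p, ?_⟩
  have := congrArg (aeval S) hq
  rw [map_mul, Matrix.aeval_self_charpoly, zero_mul, map_sub, map_pow, aeval_X, sub_eq_zero] at this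
  rw [← sq, this]

theorem transpose_aeval {n : Type*} [Fintype n] [DecidableEq n] (S : Matrix n n ℂ) (p : ℂ[X]) :
    (aeval S p).transpose = aeval S.transpose p := by
  induction p using Polynomial.induction_on' with
  | add p q hp hq => rw [map_add, map_add, Matrix.transpose_add, hp, hq]
  | monomial k a =>
    rw [aeval_monomial, aeval_monomial, Matrix.transpose_mul, Matrix.transpose_pow,
      Matrix.algebraMap_eq_diagonal, Matrix.diagonal_transpose]
    rw [← Matrix.algebraMap_eq_diagonal, Algebra.commutes]

theorem commute_aeval {A : Type*} [Ring A] [Algebra ℂ A] {S T : A} (h : Commute T S) (p : ℂ[X]) :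
    Commute T (aeval S p) := by
  induction p using Polynomial.induction_on' with
  | add p q hp hq => rw [map_add]; exact hp.add_right hq
  | monomial k a =>
    rw [aeval_monomial]
    exact Commute.mul_right (Algebra.commutes a T).symm (h.pow_right k)

/-- A symmetric invertible complex matrix can be normalized by a congruence, which commutes
with every matrix that commutes with the given one. -/
theorem exists_congruence_one {n : Type*} [Fintype n] [DecidableEq n] {S : Matrix n n ℂ}
    (hS : S.det ≠ 0) (hs : S.transpose = S) :
    ∃ T : Matrix n n ℂ, T.transpose * S * T = 1 ∧ ∀ D, Commute D S → Commute D T := by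
  obtain ⟨p, hp⟩ := exists_aeval_sq_eq hS
  set r := aeval S p with hr
  have hdet : IsUnit r.det := by
    have h := congrArg Matrix.det hp
    rw [Matrix.det_mul] at h
    exact isUnit_iff_ne_zero.mpr fun h0 => hS (by rw [← h, h0, zero_mul])
  have hrt : r.transpose = r := by rw [hr, transpose_aeval, hs]
  refine ⟨r⁻¹, ?_, fun D hD => ?_⟩
  · rw [Matrix.transpose_nonsing_inv, hrt, ← hp, ← Matrix.mul_assoc, Matrix.nonsing_inv_mul _ hdet,
      Matrix.one_mul, Matrix.mul_nonsing_inv _ hdet]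
  · have hc : Commute D r := commute_aeval hD p
    calc D * r⁻¹ = r⁻¹ * (r * D) * r⁻¹ := by
          rw [← Matrix.mul_assoc, Matrix.nonsing_inv_mul _ hdet, Matrix.one_mul]
      _ = r⁻¹ * D * (r * r⁻¹) := by rw [← hc.eq]; simp only [Matrix.mul_assoc]
      _ = r⁻¹ * D := by rw [Matrix.mul_nonsing_inv _ hdet, Matrix.mul_one]

end SquareRoot

section SmoothSquareRoot

/-- The inverse function theorem for squaring, whose derivative at 1 is twice the identity. The
class `ω` is used because it passes from a point to a neighbourhood. The last clause is local
uniqueness, from which symmetry and commutation properties of the root are deduced. -/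
theorem exists_analytic_sqrt (A : Type*) [NormedRing A] [NormedAlgebra ℝ A] [CompleteSpace A] :
    ∃ r : A → A, (∀ᶠ a in 𝓝 (1 : A), ContDiffAt ℝ ω r a) ∧ r 1 = 1 ∧
      (∀ᶠ a in 𝓝 (1 : A), r a * r a = a) ∧ ∀ᶠ b in 𝓝 (1 : A), r (b * b) = b := by
  have hc : ContDiffAt ℝ ω (fun a : A => a * a) 1 := (contDiff_id.mul contDiff_id).contDiffAt
  have hd : HasFDerivAt (fun a : A => a * a)
      ((ContinuousLinearEquiv.smulLeft (R₁ := ℝ) (M₁ := A) (Units.mk0 (2 : ℝ) two_ne_zero) :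
        A ≃L[ℝ] A) : A →L[ℝ] A) 1 := by
    have h := (hasFDerivAt_id (𝕜 := ℝ) (1 : A)).mul' (hasFDerivAt_id (𝕜 := ℝ) (1 : A))
    refine (h.congr_fderiv ?_)
    ext a
    simp [two_smul, Units.smul_def]
  have hn : (ω : WithTop ℕ∞) ≠ 0 := by simp
  set φ := ContDiffAt.toOpenPartialHomeomorph _ hc hd hn with hφ
  have hsrc : (1 : A) ∈ φ.source := hc.mem_toOpenPartialHomeomorph_source hd hn
  have hφ1 : φ 1 = 1 := mul_one (1 : A)
  refine ⟨φ.symm, ?_, ?_, ?_, ?_⟩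
  · have h := hc.to_localInverse hd hn
    rw [mul_one] at h
    exact h.eventually (by simp)
  · conv_lhs => rw [← hφ1]
    exact φ.left_inv hsrc
  · have h := φ.eventually_right_inverse (x := φ 1) (φ.map_source hsrc)
    rw [hφ1] at h
    exact h
  · exact φ.eventually_left_inverse hsrc

attribute [local instance] Matrix.linftyOpNormedRing Matrix.linftyOpNormedAlgebra

/-- A smooth matrix-valued function which is the identity at a point has a smooth square root near
that point. -/
theorem exists_smooth_sqrt {n : Type*} [Fintype n] [DecidableEq n] {U : Set E4} (hU : IsOpen U)
    {y₀ : E4} (hy₀ : y₀ ∈ U) {S : E4 → Matrix n n ℂ}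
    (hS : ∀ i j, ContDiffOn ℝ ∞ (fun y => S y i j) U) (h1 : S y₀ = 1) {D : Matrix n n ℂ}
    (hD : IsUnit D.det) :
    ∃ U' ⊆ U, IsOpen U' ∧ y₀ ∈ U' ∧ ∃ r : E4 → Matrix n n ℂ,
      (∀ i j, ContDiffOn ℝ ∞ (fun y => r y i j) U') ∧ r y₀ = 1 ∧ ∀ y ∈ U', r y * r y = S y ∧
        ((S y).transpose = S y → (r y).transpose = r y) ∧
        (D * S y = S y * D → D * r y = r y * D) := by
  obtain ⟨r, hr, hr1, hrs, hri⟩ := exists_analytic_sqrt (Matrix n n ℂ)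
  have hcont : ContinuousAt r 1 := hr.self_of_nhds.continuousAt
  let tr : Matrix n n ℂ →L[ℝ] Matrix n n ℂ :=
    LinearMap.toContinuousLinearMap (Matrix.transposeLinearEquiv n n ℝ ℂ).toLinearMap
  let toMat : (n → n → ℂ) →L[ℝ] Matrix n n ℂ :=
    LinearMap.toContinuousLinearMap (Matrix.ofLinearEquiv ℝ).toLinearMap
  let ofMat : Matrix n n ℂ →L[ℝ] (n → n → ℂ) :=
    LinearMap.toContinuousLinearMap (Matrix.ofLinearEquiv ℝ).symm.toLinearMap
  have hSm : ContDiffOn ℝ ∞ S U :=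
    toMat.contDiff.comp_contDiffOn (contDiffOn_pi.mpr fun i => contDiffOn_pi.mpr fun j => hS i j)
  have ht : Filter.Tendsto S (𝓝 y₀) (𝓝 1) := by
    have := (hSm.contDiffAt (hU.mem_nhds hy₀)).continuousAt.tendsto
    rwa [h1] at this
  -- The transpose of r(a) is close to 1, so it is the distinguished root of its own square; for
  -- symmetric a that square is a.
  have e1 : ∀ᶠ a in 𝓝 (1 : Matrix n n ℂ), r ((r a).transpose * (r a).transpose) = (r a).transpose := by
    have : Filter.Tendsto (fun a => (r a).transpose) (𝓝 1) (𝓝 1) := by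
      have h := (tr.continuous.continuousAt.comp hcont).tendsto
      have h2 : (tr ∘ r) 1 = 1 := by
        change (r 1).transpose = 1
        rw [hr1, Matrix.transpose_one]
      rw [h2] at h
      exact h
    exact this.eventually hri
  -- The same uniqueness for the conjugate of r(a) by `D`, which yields commutation with `D`.
  have e2 : ∀ᶠ a in 𝓝 (1 : Matrix n n ℂ), r ((D * r a * D⁻¹) * (D * r a * D⁻¹)) = D * r a * D⁻¹ := by
    have : Filter.Tendsto (fun a => D * r a * D⁻¹) (𝓝 1) (𝓝 1) := by
      have h := ((hcont.const_mul D).mul_const D⁻¹).tendsto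
      rwa [hr1, mul_one, Matrix.mul_nonsing_inv _ hD] at h
    exact this.eventually hri
  have hev := (ht.eventually (hr.and (hrs.and (e1.and e2)))).and (hU.mem_nhds hy₀)
  obtain ⟨U', hU', hopen, hmem⟩ := eventually_nhds_iff.mp hev
  refine ⟨U', fun y hy => (hU' y hy).2, hopen, hmem, fun y => r (S y), fun i j => ?_, ?_,
    fun y hy => ?_⟩
  · have : ContDiffOn ℝ ∞ (fun y => r (S y)) U' := fun y hy =>
      (((hU' y hy).1.1.of_le (by simp)).comp y
        (hSm.contDiffAt (hU.mem_nhds (hU' y hy).2))).contDiffWithinAt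
    have h2 := ofMat.contDiff.comp_contDiffOn this
    exact contDiffOn_pi.mp (contDiffOn_pi.mp h2 i) j
  · simp only [h1, hr1]
  · obtain ⟨⟨-, h2, h3, h4⟩, -⟩ := hU' y hy
    refine ⟨h2, fun hs => ?_, fun hc => ?_⟩
    · rw [← Matrix.transpose_mul, h2, hs] at h3
      exact h3.symm
    · have e : D * r (S y) * D⁻¹ * (D * r (S y) * D⁻¹) = S y := by
        calc _ = D * r (S y) * (D⁻¹ * D) * r (S y) * D⁻¹ := by simp only [Matrix.mul_assoc]
          _ = D * (r (S y) * r (S y)) * D⁻¹ := by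
            rw [Matrix.nonsing_inv_mul _ hD, Matrix.mul_one]; simp only [Matrix.mul_assoc]
          _ = S y := by
            rw [h2, hc, Matrix.mul_assoc, Matrix.mul_nonsing_inv _ hD, Matrix.mul_one]
      rw [e] at h4
      calc D * r (S y) = D * r (S y) * (D⁻¹ * D) := by
            rw [Matrix.nonsing_inv_mul _ hD, Matrix.mul_one]
        _ = D * r (S y) * D⁻¹ * D := by simp only [Matrix.mul_assoc]
        _ = r (S y) * D := by rw [← h4]

end SmoothSquareRoot

end EinsteinFour

end

noncomputable section

namespace EinsteinFour

/-! ### Smooth orthonormal diagonalization of symmetric complex matrices -/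

section SmoothMatrices

variable {l m n : Type*}

/-- A matrix of smooth functions on `U`. -/
def SmoothMatOn (U : Set E4) (M : E4 → Matrix m n ℂ) : Prop :=
  ∀ i j, ContDiffOn ℝ ∞ (fun y => M y i j) U

variable {U : Set E4}

theorem SmoothMatOn.mono {M : E4 → Matrix m n ℂ} (h : SmoothMatOn U M) {U' : Set E4} (hU : U' ⊆ U) :
    SmoothMatOn U' M := fun i j => (h i j).mono hU

theorem SmoothMatOn.const (M : Matrix m n ℂ) : SmoothMatOn U fun _ => M :=
  fun _ _ => contDiffOn_const

theorem SmoothMatOn.transpose {M : E4 → Matrix m n ℂ} (h : SmoothMatOn U M) :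
    SmoothMatOn U fun y => (M y).transpose := fun i j => h j i

theorem SmoothMatOn.add {M N : E4 → Matrix m n ℂ} (hM : SmoothMatOn U M) (hN : SmoothMatOn U N) :
    SmoothMatOn U fun y => M y + N y := fun i j => (hM i j).add (hN i j)

theorem SmoothMatOn.smul {M : E4 → Matrix m n ℂ} (hM : SmoothMatOn U M) {f : E4 → ℂ}
    (hf : ContDiffOn ℝ ∞ f U) : SmoothMatOn U fun y => f y • M y := fun i j => hf.mul (hM i j)

theorem SmoothMatOn.mul [Fintype m] {M : E4 → Matrix l m ℂ} {N : E4 → Matrix m n ℂ}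
    (hM : SmoothMatOn U M) (hN : SmoothMatOn U N) : SmoothMatOn U fun y => M y * N y := fun i j => by
  simp only [Matrix.mul_apply]
  exact ContDiffOn.sum fun k _ => (hM i k).mul (hN k j)

theorem SmoothMatOn.pow [Fintype n] [DecidableEq n] {M : E4 → Matrix n n ℂ}
    (hM : SmoothMatOn U M) (k : ℕ) : SmoothMatOn U fun y => M y ^ k := by
  induction k with
  | zero => simpa using SmoothMatOn.const 1
  | succ k ih => simpa only [pow_succ] using ih.mul hM

theorem SmoothMatOn.aeval [Fintype n] [DecidableEq n] {M : E4 → Matrix n n ℂ}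
    (hM : SmoothMatOn U M) (p : Polynomial ℂ) : SmoothMatOn U fun y => Polynomial.aeval (M y) p := by
  induction p using Polynomial.induction_on' with
  | add p q hp hq => simpa only [map_add] using hp.add hq
  | monomial k a => simpa only [Polynomial.aeval_monomial] using (SmoothMatOn.const _).mul (hM.pow k)

theorem SmoothMatOn.inv [Fintype n] [DecidableEq n] {M : E4 → Matrix n n ℂ}
    (hM : SmoothMatOn U M) (hd : ∀ y ∈ U, (M y).det ≠ 0) : SmoothMatOn U fun y => (M y)⁻¹ := by
  intro i j
  have e : (fun z => (M z)⁻¹ i j) =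
      (fun z => ((M z).det)⁻¹ * ((M z).updateRow j (Pi.single i 1)).det) := by
    funext z
    simp only [Matrix.inv_def, Matrix.smul_apply, Matrix.adjugate_apply, smul_eq_mul,
      Ring.inverse_eq_inv']
  rw [e]
  refine ((contDiffOn_det hM).inv hd).mul (contDiffOn_det fun k l => ?_)
  by_cases hk : k = j
  · subst hk; simp [contDiffOn_const]
  · simpa [hk] using hM k l

/-- A smooth congruence which normalizes a symmetric matrix close to the identity. -/
theorem SmoothMatOn.exists_congruence_one [Fintype n] [DecidableEq n] (hU : IsOpen U)
    {y₀ : E4} (hy₀ : y₀ ∈ U) {S : E4 → Matrix n n ℂ} (hS : SmoothMatOn U S)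
    (hs : ∀ y ∈ U, (S y).transpose = S y) (h1 : S y₀ = 1) {D : Matrix n n ℂ} (hD : IsUnit D.det) :
    ∃ U' ⊆ U, IsOpen U' ∧ y₀ ∈ U' ∧ ∃ T : E4 → Matrix n n ℂ, SmoothMatOn U' T ∧ T y₀ = 1 ∧
      ∀ y ∈ U', (T y).transpose * S y * T y = 1 ∧ (Commute D (S y) → Commute D (T y)) := by
  obtain ⟨U₁, hU₁, ho, hm, r, hr, hr1, h⟩ := exists_smooth_sqrt hU hy₀ hS h1 hD
  have hr' : SmoothMatOn U₁ r := hr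
  refine ⟨U₁ ∩ (fun y => (r y).det) ⁻¹' {0}ᶜ, fun y hy => hU₁ hy.1,
    (contDiffOn_det hr).continuousOn.isOpen_inter_preimage ho isOpen_compl_singleton, ⟨hm, ?_⟩,
    fun y => (r y)⁻¹, ?_, ?_, fun y hy => ?_⟩
  · simp [hr1]
  · exact (hr'.mono Set.inter_subset_left).inv fun y hy => hy.2
  · simp [hr1]
  · obtain ⟨h2, h3, h4⟩ := h y hy.1
    have hdet : IsUnit (r y).det := isUnit_iff_ne_zero.mpr hy.2
    refine ⟨?_, fun hc => ?_⟩
    · rw [Matrix.transpose_nonsing_inv, h3 (hs y (hU₁ hy.1)), ← h2, ← Matrix.mul_assoc,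
        Matrix.nonsing_inv_mul _ hdet, Matrix.one_mul, Matrix.mul_nonsing_inv _ hdet]
    · have hc' : D * r y = r y * D := h4 hc
      calc D * (r y)⁻¹ = (r y)⁻¹ * (r y * D) * (r y)⁻¹ := by
            rw [← Matrix.mul_assoc, Matrix.nonsing_inv_mul _ hdet, Matrix.one_mul]
        _ = (r y)⁻¹ * D * (r y * (r y)⁻¹) := by rw [← hc']; simp only [Matrix.mul_assoc]
        _ = (r y)⁻¹ * D := by rw [Matrix.mul_nonsing_inv _ hdet, Matrix.mul_one]

/-- Both products equal `Qᵀ M Q`. Hence a Gram matrix of eigenvectors can be normalized without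
leaving the eigenspaces. -/
theorem commute_transpose_mul_self [Fintype n] [DecidableEq n] {M Q : Matrix n n ℂ} {lam : n → ℂ}
    (hM : M.transpose = M) (hQ : M * Q = Q * Matrix.diagonal lam) :
    Commute (Matrix.diagonal lam) (Q.transpose * Q) := by
  have h : Q.transpose * M = Matrix.diagonal lam * Q.transpose := by
    have := congrArg Matrix.transpose hQ
    rwa [Matrix.transpose_mul, Matrix.transpose_mul, hM, Matrix.diagonal_transpose] at this
  change _ * _ = _ * _
  rw [← Matrix.mul_assoc, ← h, Matrix.mul_assoc, hQ, Matrix.mul_assoc]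

/-- An orthonormal eigenbasis of a diagonalizable symmetric complex matrix. -/
theorem exists_orthogonal_diagonalization [Fintype n] [DecidableEq n] {M : Matrix n n ℂ}
    (hM : M.transpose = M)
    (hspan : Submodule.span ℂ {v : n → ℂ | ∃ μ : ℂ, v ≠ 0 ∧ M.mulVec v = μ • v} = ⊤) :
    ∃ (O : Matrix n n ℂ) (lam : n → ℂ), O.transpose * O = 1 ∧ M * O = O * Matrix.diagonal lam := by
  set b₀ := Module.Basis.ofSpan hspan.ge
  set b := b₀.reindex (b₀.indexEquiv (Pi.basisFun ℂ n))
  have hb : ∀ j, ∃ μ : ℂ, M.mulVec (b j) = μ • b j := by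
    intro j
    have h := Module.Basis.ofSpan_subset hspan.ge
      (Set.mem_range_self ((b₀.indexEquiv (Pi.basisFun ℂ n)).symm j))
    obtain ⟨μ, -, hμ⟩ := h
    exact ⟨μ, by simpa [b, b₀] using hμ⟩
  choose lam hlam using hb
  set Q : Matrix n n ℂ := Matrix.of fun i j => b j i with hQ
  have hQd : IsUnit Q.det := by
    rw [← Matrix.isUnit_iff_isUnit_det, ← Matrix.linearIndependent_cols_iff_isUnit]
    exact b.linearIndependent
  have hMQ : M * Q = Q * Matrix.diagonal lam := by
    ext i j
    rw [Matrix.mul_diagonal]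
    have := congrFun (hlam j) i
    simp only [Matrix.mulVec, dotProduct, Pi.smul_apply, smul_eq_mul] at this
    rw [Matrix.mul_apply]
    simp only [hQ, Matrix.of_apply]
    rw [this, mul_comm]
  have hc := commute_transpose_mul_self hM hMQ
  -- Gram-Schmidt could meet isotropic vectors. The inverse square root of the Gram matrix of the
  -- whole eigenbasis always exists, and it commutes with the diagonal matrix.
  obtain ⟨T, hT, hTc⟩ := EinsteinFour.exists_congruence_one (S := Q.transpose * Q)
    (by rw [Matrix.det_mul, Matrix.det_transpose]; exact mul_ne_zero hQd.ne_zero hQd.ne_zero)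
    (by rw [Matrix.transpose_mul, Matrix.transpose_transpose])
  refine ⟨Q * T, lam, ?_, ?_⟩
  · rw [← hT, Matrix.transpose_mul]; simp only [Matrix.mul_assoc]
  · rw [← Matrix.mul_assoc, hMQ, Matrix.mul_assoc, (hTc _ hc).eq, Matrix.mul_assoc]

theorem aeval_mulVec_of_eigenvector [Fintype n] [DecidableEq n] {M : Matrix n n ℂ} {v : n → ℂ}
    {μ : ℂ} (h : M.mulVec v = μ • v) (p : Polynomial ℂ) :
    (Polynomial.aeval M p).mulVec v = p.eval μ • v := by
  induction p using Polynomial.induction_on' with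
  | add p q hp hq => rw [map_add, Matrix.add_mulVec, hp, hq, Polynomial.eval_add, add_smul]
  | monomial k a =>
    have hk : ∀ k : ℕ, (M ^ k).mulVec v = μ ^ k • v := by
      intro k
      induction k with
      | zero => simp
      | succ k ih =>
        rw [pow_succ, ← Matrix.mulVec_mulVec, h, Matrix.mulVec_smul, ih, smul_smul, pow_succ, mul_comm]
    rw [Polynomial.aeval_monomial, ← Matrix.mulVec_mulVec, hk, Polynomial.eval_monomial,
      Algebra.algebraMap_eq_smul_one, Matrix.smul_mulVec, Matrix.one_mulVec, smul_smul]

/-- For a diagonalizable matrix with spectrum in L, the Lagrange polynomial at ν kills the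
eigenvectors for all other eigenvalues, so its range consists of ν-eigenvectors. -/
theorem mulVec_aeval_basis [Fintype n] [DecidableEq n] {M : Matrix n n ℂ} {L : Finset ℂ}
    (hspan : Submodule.span ℂ {v : n → ℂ | ∃ μ : ℂ, v ≠ 0 ∧ M.mulVec v = μ • v} = ⊤)
    (hL : ∀ (μ : ℂ) (v : n → ℂ), v ≠ 0 → M.mulVec v = μ • v → μ ∈ L) (ν : ℂ) (v : n → ℂ) :
    M.mulVec ((Polynomial.aeval M (Lagrange.basis L id ν)).mulVec v) =
      ν • (Polynomial.aeval M (Lagrange.basis L id ν)).mulVec v := by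
  have hv : v ∈ Submodule.span ℂ {v : n → ℂ | ∃ μ : ℂ, v ≠ 0 ∧ M.mulVec v = μ • v} := by
    rw [hspan]; trivial
  induction hv using Submodule.span_induction with
  | mem v hv =>
    obtain ⟨μ, h0, hμ⟩ := hv
    rw [aeval_mulVec_of_eigenvector hμ, Matrix.mulVec_smul, hμ, smul_comm]
    by_cases h : μ = ν
    · rw [h]
    · have : (Lagrange.basis L id ν).eval μ = 0 :=
        Lagrange.eval_basis_of_ne (v := id) (Ne.symm h) (hL μ v h0 hμ)
      rw [this]; simp
  | zero => simp
  | add v w _ _ hv hw => rw [Matrix.mulVec_add, Matrix.mulVec_add, hv, hw, smul_add]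
  | smul c v _ hv => rw [Matrix.mulVec_smul, Matrix.mulVec_smul, hv, smul_comm]

/-- Smooth orthonormal eigenbases of diagonalizable symmetric matrices with constant eigenvalues. -/
theorem SmoothMatOn.exists_diagonalization [Fintype n] [DecidableEq n] (hU : IsOpen U)
    {y₀ : E4} (hy₀ : y₀ ∈ U) {M : E4 → Matrix n n ℂ} (hM : SmoothMatOn U M)
    (hs : ∀ y ∈ U, (M y).transpose = M y) {Λ : Set ℂ}
    (hspan : ∀ y ∈ U,
      Submodule.span ℂ {v : n → ℂ | ∃ μ : ℂ, v ≠ 0 ∧ (M y).mulVec v = μ • v} = ⊤)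
    (hΛ : ∀ y ∈ U, {μ : ℂ | ∃ v : n → ℂ, v ≠ 0 ∧ (M y).mulVec v = μ • v} = Λ) :
    ∃ U' ⊆ U, IsOpen U' ∧ y₀ ∈ U' ∧ ∃ (O : E4 → Matrix n n ℂ) (lam : n → ℂ),
      SmoothMatOn U' O ∧ Set.range lam = Λ ∧
      ∀ y ∈ U', (O y).transpose * O y = 1 ∧ M y * O y = O y * Matrix.diagonal lam := by
  obtain ⟨O₀, lam, hO, hMO⟩ := exists_orthogonal_diagonalization (hs y₀ hy₀) (hspan y₀ hy₀)
  have hO' : O₀ * O₀.transpose = 1 := mul_eq_one_comm.mp hO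
  have hcol : ∀ j, (M y₀).mulVec (O₀.col j) = lam j • O₀.col j := by
    intro j
    ext i
    have := congrFun (congrFun hMO i) j
    rw [Matrix.mul_diagonal, Matrix.mul_apply] at this
    simpa [Matrix.mulVec, dotProduct, mul_comm] using this
  have hcol0 : ∀ j, O₀.col j ≠ 0 := by
    intro j h0
    have h1 := congrFun (congrFun hO j) j
    rw [Matrix.mul_apply] at h1
    have h2 : ∀ i, O₀ i j = 0 := fun i => congrFun h0 i
    simp [h2] at h1
  have hrange : Set.range lam = Λ := by
    rw [← hΛ y₀ hy₀]
    apply Set.Subset.antisymm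
    · rintro _ ⟨j, rfl⟩
      exact ⟨_, hcol0 j, hcol j⟩
    · rintro μ ⟨v, hv0, hv⟩
      have h1 : O₀.transpose * M y₀ = Matrix.diagonal lam * O₀.transpose := by
        have := congrArg Matrix.transpose hMO
        rwa [Matrix.transpose_mul, Matrix.transpose_mul, hs y₀ hy₀, Matrix.diagonal_transpose] at this
      have h2 : (Matrix.diagonal lam).mulVec (O₀.transpose.mulVec v) = μ • O₀.transpose.mulVec v := by
        rw [Matrix.mulVec_mulVec, ← h1, ← Matrix.mulVec_mulVec, hv, Matrix.mulVec_smul]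
      have h3 : O₀.transpose.mulVec v ≠ 0 := by
        intro h0
        apply hv0
        rw [← Matrix.one_mulVec v, ← hO', ← Matrix.mulVec_mulVec, h0, Matrix.mulVec_zero]
      obtain ⟨j, hj⟩ := Function.ne_iff.mp h3
      have h4 := congrFun h2 j
      rw [Matrix.mulVec_diagonal, Pi.smul_apply, smul_eq_mul] at h4
      exact ⟨j, mul_right_cancel₀ hj h4⟩
  set L : Finset ℂ := Finset.univ.image lam with hL
  have hLmem : ∀ y ∈ U, ∀ (μ : ℂ) (v : n → ℂ), v ≠ 0 → (M y).mulVec v = μ • v → μ ∈ L := by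
    intro y hy μ v hv0 hv
    have : μ ∈ Set.range lam := by rw [hrange, ← hΛ y hy]; exact ⟨v, hv0, hv⟩
    simpa [hL] using this
  -- Apply the spectral projections of M(y) to the fixed orthonormal eigenvectors at y₀. As the
  -- eigenvalues are constant, so are the polynomials; thus P is smooth, consists of eigenvectors,
  -- and equals O₀ at y₀.
  set P : E4 → Matrix n n ℂ := fun y => Matrix.of fun i j =>
    ((Polynomial.aeval (M y) (Lagrange.basis L id (lam j))).mulVec (O₀.col j)) i with hP
  have hPs : SmoothMatOn U P := by
    intro i j
    simp only [hP, Matrix.of_apply, Matrix.mulVec, dotProduct]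
    exact ContDiffOn.sum fun k _ => (hM.aeval _ i k).mul contDiffOn_const
  have hMP : ∀ y ∈ U, M y * P y = P y * Matrix.diagonal lam := by
    intro y hy
    ext i j
    have := congrFun (mulVec_aeval_basis (hspan y hy) (hLmem y hy) (lam j) (O₀.col j)) i
    rw [Matrix.mul_diagonal, Matrix.mul_apply, mul_comm]
    exact this
  have hP0 : P y₀ = O₀ := by
    ext i j
    have hj : lam j ∈ L := by simp [hL]
    simp only [hP, Matrix.of_apply]
    rw [aeval_mulVec_of_eigenvector (hcol j)]
    have : (Lagrange.basis L id (lam j)).eval (lam j) = 1 :=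
      Lagrange.eval_basis_self (v := id) Function.injective_id.injOn hj
    rw [this, one_smul]; rfl
  -- The square root lemma requires an invertible matrix to commute with. Adding a scalar to the
  -- diagonal matrix achieves this and does not change what commutes with it.
  obtain ⟨c, hc⟩ := Infinite.exists_notMem_finset (L.image fun z => -z)
  have hD : IsUnit (Matrix.diagonal fun j => lam j + c).det := by
    rw [Matrix.det_diagonal, isUnit_iff_ne_zero, Finset.prod_ne_zero_iff]
    intro j _ h0
    apply hc
    rw [Finset.mem_image]
    exact ⟨lam j, by simp [hL], by linear_combination -h0⟩
  have hDe : (Matrix.diagonal fun j => lam j + c) = Matrix.diagonal lam + c • (1 : Matrix n n ℂ) := by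
    ext i j
    by_cases h : i = j
    · subst h; simp
    · simp [h]
  have hcomm : ∀ T : Matrix n n ℂ, Commute (Matrix.diagonal fun j => lam j + c) T ↔
      Commute (Matrix.diagonal lam) T := by
    intro T
    rw [hDe]
    have h1 : Commute (c • (1 : Matrix n n ℂ)) T := (Commute.one_left T).smul_left c
    exact ⟨fun h => by simpa using h.sub_left h1, fun h => h.add_left h1⟩
  obtain ⟨U', hU', ho, hm, T, hT, -, hTT⟩ := SmoothMatOn.exists_congruence_one hU hy₀
    (hPs.transpose.mul hPs) (fun y _ => by rw [Matrix.transpose_mul, Matrix.transpose_transpose])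
    (by rw [hP0, hO]) hD
  refine ⟨U', hU', ho, hm, fun y => P y * T y, lam, (hPs.mono hU').mul hT, hrange, fun y hy => ⟨?_, ?_⟩⟩
  · rw [← (hTT y hy).1, Matrix.transpose_mul]; simp only [Matrix.mul_assoc]
  · have h1 := (hTT y hy).2 ((hcomm _).mpr (commute_transpose_mul_self (hs y (hU' hy)) (hMP y (hU' hy))))
    have h2 := ((hcomm _).mp h1).eq
    rw [← Matrix.mul_assoc, hMP y (hU' hy), Matrix.mul_assoc, h2, Matrix.mul_assoc]

end SmoothMatrices

end EinsteinFour

end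

noncomputable section

namespace EinsteinFour

/-! ### The Hodge star in a complex orthonormal frame -/

section Star

/-- Multiply the selection matrix by the Vandermonde matrix of 0, 1, 2, 3, whose determinant is 12.
The result is a polynomial formula that makes finite checks computable. -/
theorem leviCivitaSymbol_mul (i j k l : Fin 4) :
    leviCivitaSymbol i j k l * 12 = ((j : ℝ) - i) * ((k : ℝ) - i) * ((l : ℝ) - i) *
      ((k : ℝ) - j) * ((l : ℝ) - j) * ((l : ℝ) - k) := by
  set v : Fin 4 → ℝ := fun a => ((a : ℕ) : ℝ) with hv
  have h1 : (Matrix.of fun a b : Fin 4 => if ![i, j, k, l] a = b then (1 : ℝ) else 0) *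
      Matrix.vandermonde v = Matrix.vandermonde (v ∘ ![i, j, k, l]) := by
    ext a b
    simp [Matrix.mul_apply, Matrix.vandermonde_apply]
  have h2 := congrArg Matrix.det h1
  rw [Matrix.det_mul, Matrix.det_vandermonde, Matrix.det_vandermonde] at h2
  have e : ∀ f : Fin 4 → Fin 4 → ℝ, ∏ a, ∏ b ∈ Finset.Ioi a, f a b =
      f 0 1 * f 0 2 * f 0 3 * (f 1 2 * f 1 3) * f 2 3 := by
    intro f
    have h0 : Finset.Ioi (0 : Fin 4) = {1, 2, 3} := by decide
    have h1 : Finset.Ioi (1 : Fin 4) = {2, 3} := by decide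
    have h2 : Finset.Ioi (2 : Fin 4) = {3} := by decide
    have h3 : Finset.Ioi (3 : Fin 4) = ∅ := by decide
    rw [Fin.prod_univ_four, h0, h1, h2, h3]
    simp [mul_assoc]
  rw [e, e] at h2
  simp only [hv, Function.comp_apply] at h2
  rw [leviCivitaSymbol]
  simp at h2
  linear_combination h2

/-- Multiplicativity of the determinant for `E` times a selection matrix, with the entries expanded
over permutations. -/
theorem sum_leviCivitaSymbol (E : Matrix (Fin 4) (Fin 4) ℂ) (c d a b : Fin 4) :
    ∑ i, ∑ j, ∑ p, ∑ q, (leviCivitaSymbol i j p q : ℂ) * (E i c * E j d * E p a * E q b) =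
      E.det * leviCivitaSymbol c d a b := by
  have hP : ∀ i j p q, (leviCivitaSymbol i j p q : ℂ) =
      (Matrix.of fun s r : Fin 4 => if ![i, j, p, q] r = s then (1 : ℂ) else 0).det := by
    intro i j p q
    rw [leviCivitaSymbol, ← Complex.ofRealHom_eq_coe, RingHom.map_det, ← Matrix.det_transpose]
    congr 1
    ext r s
    simp [apply_ite]
  have h1 : E * (Matrix.of fun s r : Fin 4 => if ![c, d, a, b] r = s then (1 : ℂ) else 0) =
      Matrix.of fun s r => E s (![c, d, a, b] r) := by
    ext r s
    simp [Matrix.mul_apply]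
  have h2 : E.det * leviCivitaSymbol c d a b = (Matrix.of fun s r => E s (![c, d, a, b] r)).det := by
    rw [← h1, Matrix.det_mul, hP]
  rw [h2]
  simp only [hP, Matrix.det_apply', Finset.sum_mul]
  have e : ∀ f : Fin 4 → Fin 4 → Fin 4 → Fin 4 → Equiv.Perm (Fin 4) → ℂ,
      ∑ i, ∑ j, ∑ p, ∑ q, ∑ s, f i j p q s = ∑ s, ∑ i, ∑ j, ∑ p, ∑ q, f i j p q s := by
    intro f
    simp only [Finset.sum_comm (s := Finset.univ (α := Fin 4)) (t := Finset.univ (α := Equiv.Perm (Fin 4)))]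
  rw [e]
  refine Finset.sum_congr rfl fun σ _ => ?_
  have e2 : ∀ i j p q : Fin 4, (((Equiv.Perm.sign σ : ℤ) : ℂ) *
      ∏ r, (Matrix.of fun s r : Fin 4 => if ![i, j, p, q] r = s then (1 : ℂ) else 0) (σ r) r) *
        (E i c * E j d * E p a * E q b) =
      ((Equiv.Perm.sign σ : ℤ) : ℂ) * ((if i = σ 0 then E i c else 0) * (if j = σ 1 then E j d else 0) *
        (if p = σ 2 then E p a else 0) * (if q = σ 3 then E q b else 0)) := by
    intro i j p q
    rw [mul_assoc]
    congr 1
    simp only [Fin.prod_univ_four, Matrix.of_apply, Matrix.cons_val]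
    by_cases h1 : i = σ 0 <;> by_cases h2 : j = σ 1 <;> by_cases h3 : p = σ 2 <;>
      by_cases h4 : q = σ 3 <;> simp [h1, h2, h3, h4]
  simp only [e2]
  simp only [← Finset.mul_sum, ← Finset.sum_mul, Finset.sum_ite_eq', Finset.mem_univ, if_true,
    Fin.prod_univ_four, Matrix.of_apply, Matrix.cons_val]

/-- The Hodge star in an oriented orthonormal frame. -/
def frameStar (B : Matrix (Fin 4) (Fin 4) ℂ) : Matrix (Fin 4) (Fin 4) ℂ :=
  Matrix.of fun a b => (1 / 2 : ℂ) * ∑ c, ∑ d, (leviCivitaSymbol c d a b : ℂ) * B c d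

/-- The basis of the anti-self-dual bivectors in an oriented orthonormal frame. -/
def asdBasis (j : Fin 3) : Matrix (Fin 4) (Fin 4) ℂ :=
  match j with
  | 0 => !![0, 1, 0, 0; -1, 0, 0, 0; 0, 0, 0, -1; 0, 0, 1, 0]
  | 1 => !![0, 0, 1, 0; 0, 0, 0, 1; -1, 0, 0, 0; 0, -1, 0, 0]
  | 2 => !![0, 0, 0, 1; 0, 0, -1, 0; 0, 1, 0, 0; -1, 0, 0, 0]

theorem leviCivitaSymbol_eq (i j k l : Fin 4) : (leviCivitaSymbol i j k l : ℂ) =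
    ((j : ℂ) - i) * ((k : ℂ) - i) * ((l : ℂ) - i) *
      ((k : ℂ) - j) * ((l : ℂ) - j) * ((l : ℂ) - k) / 12 := by
  rw [eq_div_iff (by norm_num)]
  exact_mod_cast congrArg Complex.ofReal (leviCivitaSymbol_mul i j k l)

theorem frameStar_sdBasis (j : Fin 3) : frameStar (sdBasis ℂ j) = sdBasis ℂ j := by
  ext a b
  simp only [frameStar, leviCivitaSymbol_eq, Matrix.of_apply, Fin.sum_univ_four]
  fin_cases j <;> fin_cases a <;> fin_cases b <;> simp [sdBasis] <;> norm_num

theorem frameStar_asdBasis (j : Fin 3) : frameStar (asdBasis j) = -asdBasis j := by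
  ext a b
  simp only [frameStar, leviCivitaSymbol_eq, Matrix.of_apply, Fin.sum_univ_four]
  fin_cases j <;> fin_cases a <;> fin_cases b <;> simp [asdBasis] <;> norm_num

/-- The factor which relates the Hodge star and `frameStar`. -/
def frameSign (G : E4 → Matrix (Fin 4) (Fin 4) ℝ) (ε : E4 → ℝ) (y : E4)
    (E : Matrix (Fin 4) (Fin 4) ℂ) : ℂ := ((ε y * Real.sqrt |(G y).det| : ℝ) : ℂ) * E.det

variable {G : E4 → Matrix (Fin 4) (Fin 4) ℝ} {y : E4} {ε : E4 → ℝ}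

theorem inv_eq_of_frame (hd : (G y).det ≠ 0) {E : Matrix (Fin 4) (Fin 4) ℂ}
    (hE : E.transpose * cMat G y * E = 1) :
    ((G y)⁻¹).map Complex.ofReal = E * E.transpose := by
  have h1 : E * E.transpose * cMat G y = 1 := by
    rw [Matrix.mul_assoc]; exact mul_eq_one_comm.mp hE
  calc ((G y)⁻¹).map Complex.ofReal = E * E.transpose * cMat G y * ((G y)⁻¹).map Complex.ofReal := by
        rw [h1, Matrix.one_mul]
    _ = E * E.transpose := by rw [Matrix.mul_assoc, cMat_mul_inv hd, Matrix.mul_one]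

/-- On a frame the volume form takes the value `frameSign`, and the inverse metric is `E Eᵀ`; so in
frame components the star is that number times the standard star. -/
theorem hodgeStar_frame (hs : (G y).transpose = G y) (hd : (G y).det ≠ 0)
    {E : Matrix (Fin 4) (Fin 4) ℂ} (hE : E.transpose * cMat G y * E = 1)
    (B : Matrix (Fin 4) (Fin 4) ℂ) :
    hodgeStar G ε y (E * B * E.transpose) =
      frameSign G ε y E • (E * frameStar B * E.transpose) := by
  rw [hodgeStar, bivectorOperator_eq _ hs, inv_eq_of_frame hd hE]
  set N : Matrix (Fin 4) (Fin 4) ℂ := Matrix.of fun p q => (1 / 2 : ℂ) * ∑ i, ∑ j,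
    (volumeForm G ε i j p q y : ℂ) * (E * B * E.transpose) i j with hN
  have key : E.transpose * N * E = frameSign G ε y E • frameStar B := by
    ext a b
    have e : ∀ f : Fin 4 → Fin 4 → Fin 4 → Fin 4 → Fin 4 → Fin 4 → ℂ,
        ∑ q, ∑ p, ∑ i, ∑ j, ∑ d, ∑ c, f q p i j d c = ∑ c, ∑ d, ∑ i, ∑ j, ∑ p, ∑ q, f q p i j d c := by
      intro f
      calc _ = ∑ x : Fin 4 × Fin 4, ∑ y : Fin 4 × Fin 4, ∑ z : Fin 4 × Fin 4,
            f x.2 x.1 y.1 y.2 z.2 z.1 := by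
            simp only [Fintype.sum_prod_type]
            rw [Finset.sum_comm]
            refine Finset.sum_congr rfl fun _ _ => Finset.sum_congr rfl fun _ _ =>
              Finset.sum_congr rfl fun _ _ => Finset.sum_congr rfl fun _ _ => ?_
            rw [Finset.sum_comm]
        _ = ∑ z : Fin 4 × Fin 4, ∑ y : Fin 4 × Fin 4, ∑ x : Fin 4 × Fin 4,
            f x.2 x.1 y.1 y.2 z.2 z.1 := by
            rw [Finset.sum_comm]
            simp only [Finset.sum_comm (s := Finset.univ (α := Fin 4 × Fin 4))
              (t := Finset.univ (α := Fin 4 × Fin 4)) (f := fun x z => f x.2 x.1 _ _ z.2 z.1)]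
            rw [Finset.sum_comm]
        _ = _ := by simp only [Fintype.sum_prod_type]
    have lhs : (E.transpose * N * E) a b = ∑ c, ∑ d, ∑ i, ∑ j, ∑ p, ∑ q,
        (1 / 2 : ℂ) * ((ε y * Real.sqrt |(G y).det| : ℝ) : ℂ) * B c d *
          ((leviCivitaSymbol i j p q : ℂ) * (E i c * E j d * E p a * E q b)) := by
      rw [← e]
      simp only [Matrix.mul_apply, hN, Matrix.of_apply, Matrix.transpose_apply, Finset.mul_sum,
        Finset.sum_mul, volumeForm]
      refine Finset.sum_congr rfl fun q _ => Finset.sum_congr rfl fun p _ =>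
        Finset.sum_congr rfl fun i _ => Finset.sum_congr rfl fun j _ =>
        Finset.sum_congr rfl fun d _ => Finset.sum_congr rfl fun c _ => ?_
      push_cast
      ring
    rw [lhs]
    simp only [← Finset.mul_sum, sum_leviCivitaSymbol]
    rw [Matrix.smul_apply, frameStar, Matrix.of_apply, smul_eq_mul, frameSign]
    simp only [Finset.mul_sum]
    refine Finset.sum_congr rfl fun c _ => Finset.sum_congr rfl fun d _ => ?_
    ring
  calc E * E.transpose * N * (E * E.transpose) = E * (E.transpose * N * E) * E.transpose := by
        simp only [Matrix.mul_assoc]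
    _ = _ := by rw [key, Matrix.mul_smul, Matrix.smul_mul]

theorem skew_decomposition {B : Matrix (Fin 4) (Fin 4) ℂ} (hB : B.transpose = -B) :
    B = ∑ j : Fin 3, ((1 / 2 * (B 0 j.succ + B (j + 1).succ (j + 2).succ)) • sdBasis ℂ j +
      (1 / 2 * (B 0 j.succ - B (j + 1).succ (j + 2).succ)) • asdBasis j) := by
  have e : ∀ a b, B b a = -B a b := fun i j => congrFun (congrFun hB i) j
  have e0 : ∀ a, B a a = 0 := fun a => by linear_combination (1 / 2 : ℂ) * e a a
  ext a b
  fin_cases a <;> fin_cases b <;>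
  simp [Fin.sum_univ_three, sdBasis, asdBasis, e0, e 0 1, e 0 2, e 0 3, e 1 2, e 1 3, e 2 3] <;> ring

theorem mem_bivectors {α : Matrix (Fin 4) (Fin 4) ℂ} : α ∈ bivectors ↔ α.transpose = -α := by
  constructor
  · intro h
    ext i j
    exact h j i
  · intro h i j
    exact congrFun (congrFun h j) i

/-- The self-dual bivectors in an adapted orthonormal frame. -/
theorem mem_selfDual_iff (hs : (G y).transpose = G y) (hd : (G y).det ≠ 0)
    {E : Matrix (Fin 4) (Fin 4) ℂ} (hE : E.transpose * cMat G y * E = 1)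
    (hsign : frameSign G ε y E = starEigenvalue G y) {α : Matrix (Fin 4) (Fin 4) ℂ} :
    α ∈ selfDual G ε y ↔ ∃ f : Fin 3 → ℂ, α = ∑ j, f j • (E * sdBasis ℂ j * E.transpose) := by
  have hne : starEigenvalue G y ≠ 0 := by
    rw [starEigenvalue]; split_ifs
    · exact one_ne_zero
    · exact Complex.I_ne_zero
  have h1 : E * (E.transpose * cMat G y) = 1 := mul_eq_one_comm.mp hE
  constructor
  · rintro ⟨hα, hstar⟩
    rw [SetLike.mem_coe, Module.End.mem_eigenspace_iff] at hstar
    rw [SetLike.mem_coe, mem_bivectors] at hα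
    set B := (E.transpose * cMat G y) * α * (E.transpose * cMat G y).transpose with hB
    have hBs : B.transpose = -B := skew_conj _ hα
    have hαB : α = E * B * E.transpose := by
      have h2 : (E.transpose * cMat G y).transpose * E.transpose = 1 := by
        rw [← Matrix.transpose_mul, h1, Matrix.transpose_one]
      rw [hB]
      calc α = E * (E.transpose * cMat G y) * α * ((E.transpose * cMat G y).transpose * E.transpose) := by
            rw [h1, h2, Matrix.one_mul, Matrix.mul_one]
        _ = _ := by simp only [Matrix.mul_assoc]
    rw [hαB, hodgeStar_frame hs hd hE, hsign] at hstar
    have h3 := smul_right_injective _ hne hstar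
    have h4 : frameStar B = B := by
      have h5 := congrArg (fun M => (E.transpose * cMat G y) * M * (E.transpose * cMat G y).transpose) h3
      have h6 : ∀ M, (E.transpose * cMat G y) * (E * M * E.transpose) *
          (E.transpose * cMat G y).transpose = M := by
        intro M
        calc _ = (E.transpose * cMat G y * E) * M * (E.transpose * cMat G y * E).transpose := by
              rw [Matrix.transpose_mul (E.transpose * cMat G y) E]; simp only [Matrix.mul_assoc]
          _ = M := by rw [hE, Matrix.transpose_one, Matrix.one_mul, Matrix.mul_one]
      simpa only [h6] using h5
    have hlin : ∀ (f : Fin 3 → ℂ) (h : Fin 3 → ℂ),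
        frameStar (∑ j, (f j • sdBasis ℂ j + h j • asdBasis j)) =
          ∑ j, (f j • sdBasis ℂ j - h j • asdBasis j) := by
      intro f h
      have hadd : ∀ M N, frameStar (M + N) = frameStar M + frameStar N := by
        intro M N; ext a b
        simp [frameStar, mul_add, Finset.sum_add_distrib]
      have hsmul : ∀ (c : ℂ) M, frameStar (c • M) = c • frameStar M := by
        intro c M; ext a b
        simp only [frameStar, Matrix.of_apply, Matrix.smul_apply, smul_eq_mul, Finset.mul_sum]
        exact Finset.sum_congr rfl fun _ _ => Finset.sum_congr rfl fun _ _ => by ring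
      simp only [Fin.sum_univ_three, hadd, hsmul, frameStar_sdBasis, frameStar_asdBasis, smul_neg,
        sub_eq_add_neg]
    have hdec := skew_decomposition hBs
    refine ⟨fun j => 1 / 2 * (B 0 j.succ + B (j + 1).succ (j + 2).succ), ?_⟩
    -- The standard star fixes the I_j and negates the anti-self-dual basis. Adding `B` and its
    -- image, which is `B` again, leaves twice the self-dual part.
    have h7 : B = ∑ j : Fin 3, (1 / 2 * (B 0 j.succ + B (j + 1).succ (j + 2).succ)) • sdBasis ℂ j := by
      have h8 := hlin (fun j => 1 / 2 * (B 0 j.succ + B (j + 1).succ (j + 2).succ))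
        (fun j => 1 / 2 * (B 0 j.succ - B (j + 1).succ (j + 2).succ))
      rw [← hdec, h4, Finset.sum_sub_distrib] at h8
      have h9 := hdec
      rw [Finset.sum_add_distrib] at h9
      have h10 : (2 : ℂ) • B = (2 : ℂ) • ∑ j : Fin 3,
          (1 / 2 * (B 0 j.succ + B (j + 1).succ (j + 2).succ)) • sdBasis ℂ j := by
        rw [two_smul, two_smul]
        exact (congrArg₂ (· + ·) h8 h9).trans (by abel)
      exact smul_right_injective _ (two_ne_zero' ℂ) h10
    rw [hαB]
    conv_lhs => rw [h7]
    simp only [Matrix.mul_sum, Matrix.sum_mul, Matrix.mul_smul, Matrix.smul_mul]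
  · rintro ⟨f, rfl⟩
    refine Submodule.sum_mem _ fun j _ => Submodule.smul_mem _ _ ⟨?_, ?_⟩
    · exact mem_bivectors.mpr (skew_conj E (sdBasis_transpose j))
    · rw [SetLike.mem_coe, Module.End.mem_eigenspace_iff, hodgeStar_frame hs hd hE, hsign,
        frameStar_sdBasis]

/-- The determinant of `Eᵀ G E = 1` gives (det E)² det G = 1, so the square of `frameSign` is the
sign of det G. Thus a frame yields the required star eigenvalue or its negative. -/
theorem frameSign_sq (hd : (G y).det ≠ 0) {E : Matrix (Fin 4) (Fin 4) ℂ}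
    (hE : E.transpose * cMat G y * E = 1) (hε : ε y ^ 2 = 1) :
    frameSign G ε y E ^ 2 = starEigenvalue G y ^ 2 := by
  have h1 := congrArg Matrix.det hE
  rw [Matrix.det_mul, Matrix.det_mul, Matrix.det_transpose, Matrix.det_one] at h1
  have h2 : (cMat G y).det = ((G y).det : ℂ) := by
    rw [cMat, ← Complex.ofRealHom_eq_coe, RingHom.map_det]; rfl
  rw [h2] at h1
  have h3 : Real.sqrt |(G y).det| ^ 2 = |(G y).det| := Real.sq_sqrt (abs_nonneg _)
  have h4 : frameSign G ε y E ^ 2 = (|(G y).det| : ℝ) * E.det ^ 2 := by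
    rw [frameSign, mul_pow, ← Complex.ofReal_pow, mul_pow, hε, h3, one_mul]
  rw [h4, starEigenvalue]
  split_ifs with h
  · rw [abs_of_pos h]; linear_combination h1
  · rw [abs_of_neg (lt_of_le_of_ne (not_lt.mp h) hd), Complex.I_sq]
    push_cast
    linear_combination -h1

end Star

end EinsteinFour

end

noncomputable section

namespace EinsteinFour

/-! ### Oriented orthonormal frames and the matrix of the Weyl tensor -/

section AdaptedFrame

open TopologicalSpace (Opens)

variable {V : Opens E4} {G : E4 → Matrix (Fin 4) (Fin 4) ℝ} {y y₀ : E4} {ε : E4 → ℝ}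

theorem IsLocalMetric.mono {V' : Opens E4} (h : IsLocalMetric V G) (hV : V' ≤ V) :
    IsLocalMetric V' G where
  smooth i j := (h.smooth i j).mono hV
  symm z hz := h.symm z (hV hz)
  det_ne_zero z hz := h.det_ne_zero z (hV hz)

theorem IsLocalMetric.smoothMatOn (h : IsLocalMetric V G) : SmoothMatOn V (cMat G) :=
  fun i j => contDiffOn_ofReal (h.smooth i j)

theorem det_cMat : (cMat G y).det = ((G y).det : ℂ) := by
  rw [cMat, ← Complex.ofRealHom_eq_coe, RingHom.map_det]; rfl

theorem IsLocalMetric.exists_frame (h : IsLocalMetric V G) (hy₀ : y₀ ∈ V) :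
    ∃ U ⊆ (V : Set E4), IsOpen U ∧ y₀ ∈ U ∧ ∃ E : E4 → Matrix (Fin 4) (Fin 4) ℂ, SmoothMatOn U E ∧
      ∀ y ∈ U, (E y).transpose * cMat G y * E y = 1 := by
  obtain ⟨B, hB, -⟩ := EinsteinFour.exists_congruence_one (S := cMat G y₀)
    (by rw [det_cMat]; exact_mod_cast h.det_ne_zero y₀ hy₀) (cMat_transpose (h.symm y₀ hy₀))
  -- After the constant congruence `B` the metric is the identity at y₀, as the smooth version
  -- requires. The choice D = 1 makes its commutation clause void.
  obtain ⟨U, hU, ho, hm, T, hT, -, hTT⟩ := SmoothMatOn.exists_congruence_one V.2 hy₀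
    (((SmoothMatOn.const B.transpose).mul h.smoothMatOn).mul (SmoothMatOn.const B))
    (fun y hy => by
      rw [Matrix.transpose_mul, Matrix.transpose_mul, Matrix.transpose_transpose,
        cMat_transpose (h.symm y hy), Matrix.mul_assoc]) hB (D := 1) (by simp)
  refine ⟨U, hU, ho, hm, fun y => B * T y, (SmoothMatOn.const B).mul hT, fun y hy => ?_⟩
  rw [← (hTT y hy).1, Matrix.transpose_mul]; simp only [Matrix.mul_assoc]

theorem frameSign_mul (E S : Matrix (Fin 4) (Fin 4) ℂ) :
    frameSign G ε y (E * S) = frameSign G ε y E * S.det := by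
  rw [frameSign, frameSign, Matrix.det_mul, mul_assoc]

/-- By `frameSign_sq` only a sign can be wrong. It is corrected at y₀ by rescaling one frame vector
and stays correct nearby by continuity. -/
theorem IsLocalMetric.exists_oriented_frame (h : IsLocalMetric V G) (hy₀ : y₀ ∈ V)
    (hε : ∀ y ∈ V, ε y = ε y₀) (hε₀ : ε y₀ ^ 2 = 1) :
    ∃ U ⊆ (V : Set E4), IsOpen U ∧ y₀ ∈ U ∧ ∃ E : E4 → Matrix (Fin 4) (Fin 4) ℂ, SmoothMatOn U E ∧
      ∀ y ∈ U, (E y).transpose * cMat G y * E y = 1 ∧ frameSign G ε y (E y) = starEigenvalue G y := by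
  obtain ⟨U, hU, ho, hm, E, hE, hEo⟩ := h.exists_frame hy₀
  have hne : starEigenvalue G y₀ ≠ 0 := by
    rw [starEigenvalue]; split_ifs
    · exact one_ne_zero
    · exact Complex.I_ne_zero
  have hsq : ∀ y ∈ U, frameSign G ε y (E y) ^ 2 = starEigenvalue G y ^ 2 := fun y hy =>
    frameSign_sq (h.det_ne_zero y (hU hy)) (hEo y hy) (by rw [hε y (hU hy), hε₀])
  have hκ : frameSign G ε y₀ (E y₀) ≠ 0 := fun h0 => by
    have := hsq y₀ hm
    rw [h0] at this
    exact pow_ne_zero 2 hne (by rw [← this]; ring)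
  -- This ratio is 1 or −1; multiplying the last frame vector by it keeps the frame orthonormal.
  set s : ℂ := starEigenvalue G y₀ / frameSign G ε y₀ (E y₀) with hs
  have hs2 : s * s = 1 := by
    rw [hs, div_mul_div_comm, ← sq, ← sq, hsq y₀ hm, div_self (pow_ne_zero 2 hne)]
  set Δ : Matrix (Fin 4) (Fin 4) ℂ := Matrix.diagonal ![1, 1, 1, s] with hΔ
  have hΔ1 : Δ.transpose * Δ = 1 := by
    rw [hΔ, Matrix.diagonal_transpose, Matrix.diagonal_mul_diagonal, ← Matrix.diagonal_one]
    congr 1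
    funext i
    fin_cases i <;> simp [hs2]
  have hΔd : Δ.det = s := by
    rw [hΔ, Matrix.det_diagonal]; simp [Fin.prod_univ_four]
  set E' : E4 → Matrix (Fin 4) (Fin 4) ℂ := fun y => E y * Δ
  have hE' : SmoothMatOn U E' := hE.mul (SmoothMatOn.const Δ)
  have hEo' : ∀ y ∈ U, (E' y).transpose * cMat G y * E' y = 1 := by
    intro y hy
    have : (E' y).transpose * cMat G y * E' y =
        Δ.transpose * ((E y).transpose * cMat G y * E y) * Δ := by
      simp only [E', Matrix.transpose_mul, Matrix.mul_assoc]
    rw [this, hEo y hy, Matrix.mul_one, hΔ1]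
  have hsq' : ∀ y ∈ U, frameSign G ε y (E' y) ^ 2 = starEigenvalue G y ^ 2 := fun y hy =>
    frameSign_sq (h.det_ne_zero y (hU hy)) (hEo' y hy) (by rw [hε y (hU hy), hε₀])
  have h0 : frameSign G ε y₀ (E' y₀) = starEigenvalue G y₀ := by
    rw [frameSign_mul, hΔd, hs, mul_div_cancel₀ _ hκ]
  have hdetc : ContinuousOn (fun y => (G y).det) U :=
    ((contDiffOn_det (F := ℝ) h.smooth).mono hU).continuousOn
  have hfc : ContinuousAt (fun y => ((ε y₀ * Real.sqrt |(G y).det| : ℝ) : ℂ) * (E' y).det) y₀ := by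
    have h1 : ContinuousOn (fun y => ((ε y₀ * Real.sqrt |(G y).det| : ℝ) : ℂ) * (E' y).det) U :=
      (Complex.continuous_ofReal.comp_continuousOn
        (continuousOn_const.mul (Real.continuous_sqrt.comp_continuousOn hdetc.abs))).mul
        (contDiffOn_det hE').continuousOn
    exact h1.continuousAt (ho.mem_nhds hm)
  have hev1 : ∀ᶠ y in 𝓝 y₀, starEigenvalue G y = starEigenvalue G y₀ := by
    have hc := hdetc.continuousAt (ho.mem_nhds hm)
    rcases lt_or_gt_of_ne (h.det_ne_zero y₀ hy₀) with hlt | hgt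
    · filter_upwards [hc.eventually_lt_const hlt] with y hy
      rw [starEigenvalue, starEigenvalue, if_neg (not_lt.mpr hy.le), if_neg (not_lt.mpr hlt.le)]
    · filter_upwards [hc.eventually_const_lt hgt] with y hy
      rw [starEigenvalue, starEigenvalue, if_pos hy, if_pos hgt]
  have hev2 : ∀ᶠ y in 𝓝 y₀, ((ε y₀ * Real.sqrt |(G y).det| : ℝ) : ℂ) * (E' y).det ≠
      -starEigenvalue G y₀ := by
    refine hfc.eventually_ne ?_
    have : ((ε y₀ * Real.sqrt |(G y₀).det| : ℝ) : ℂ) * (E' y₀).det = starEigenvalue G y₀ := h0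
    rw [this]
    intro hc
    exact hne (by linear_combination (1 / 2 : ℂ) * hc)
  obtain ⟨U', hU', ho', hm'⟩ := eventually_nhds_iff.mp ((hev1.and hev2).and (ho.mem_nhds hm))
  refine ⟨U', fun y hy => hU (hU' y hy).2, ho', hm', E', hE'.mono fun y hy => (hU' y hy).2,
    fun y hy => ⟨hEo' y (hU' y hy).2, ?_⟩⟩
  obtain ⟨⟨e1, e2⟩, hy⟩ := hU' y hy
  -- The other sign is excluded by `e2`: close to y₀ the continuous value stays away from the
  -- negative of its value at y₀.
  rcases sq_eq_sq_iff_eq_or_eq_neg.mp (hsq' y hy) with h3 | h3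
  · exact h3
  · exfalso
    apply e2
    rw [← e1, ← h3, frameSign, hε y (hU hy)]

theorem sdBasis_mul_trace (j k : Fin 3) :
    -(1 / 4 : ℂ) * (sdBasis ℂ j * sdBasis ℂ k).trace = if j = k then 1 else 0 := by
  fin_cases j <;> fin_cases k <;>
  simp [Matrix.trace, Fin.sum_univ_four, sdBasis] <;> norm_num

/-- The scalar product of bivectors. -/
def bivectorInner (G : E4 → Matrix (Fin 4) (Fin 4) ℝ) (y : E4) (α β : Matrix (Fin 4) (Fin 4) ℂ) : ℂ :=
  -(1 / 4 : ℂ) * (cMat G y * α * cMat G y * β).trace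

theorem bivectorInner_frame {E : Matrix (Fin 4) (Fin 4) ℂ} (hE : E.transpose * cMat G y * E = 1)
    (j k : Fin 3) : bivectorInner G y (E * sdBasis ℂ j * E.transpose) (E * sdBasis ℂ k * E.transpose) =
      if j = k then 1 else 0 := by
  rw [← sdBasis_mul_trace, bivectorInner]
  congr 1
  have : cMat G y * (E * sdBasis ℂ j * E.transpose) * cMat G y * (E * sdBasis ℂ k * E.transpose) =
      (cMat G y * E * sdBasis ℂ j * (E.transpose * cMat G y * E) * sdBasis ℂ k) * E.transpose := by
    simp only [Matrix.mul_assoc]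
  rw [this, Matrix.trace_mul_comm, hE]
  have : E.transpose * (cMat G y * E * sdBasis ℂ j * 1 * sdBasis ℂ k) =
      (E.transpose * cMat G y * E) * (sdBasis ℂ j * sdBasis ℂ k) := by
    simp only [Matrix.mul_assoc, Matrix.mul_one]
  rw [this, hE, Matrix.one_mul]

theorem bivectorInner_comm (α β : Matrix (Fin 4) (Fin 4) ℂ) :
    bivectorInner G y α β = bivectorInner G y β α := by
  rw [bivectorInner, bivectorInner, Matrix.mul_assoc (cMat G y * α), Matrix.trace_mul_comm]
  simp only [Matrix.mul_assoc]

theorem bivectorInner_sum_right (α : Matrix (Fin 4) (Fin 4) ℂ) (f : Fin 3 → ℂ)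
    (β : Fin 3 → Matrix (Fin 4) (Fin 4) ℂ) :
    bivectorInner G y α (∑ j, f j • β j) = ∑ j, f j * bivectorInner G y α (β j) := by
  simp only [bivectorInner, Matrix.trace_sum, Matrix.mul_smul, Matrix.trace_smul,
    Finset.mul_sum, smul_eq_mul]
  exact Finset.sum_congr rfl fun _ _ => by ring

/-- Pair symmetry of the Weyl tensor. In an orthonormal basis of bivectors its matrix is therefore
symmetric, which orthonormal diagonalization needs. -/
theorem IsLocalMetric.bivectorInner_weyl (h : IsLocalMetric V G) (hy : y ∈ V)
    (hEin : ∀ i k, ricci G i k y = scalarCurvature G y / 4 * G y i k)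
    {α β : Matrix (Fin 4) (Fin 4) ℂ} (hα : α.transpose = -α) (hβ : β.transpose = -β) :
    bivectorInner G y (weylOperator G y α) β = bivectorInner G y α (weylOperator G y β) := by
  rw [bivectorInner_comm α]
  have ea : ∀ a b, α b a = -α a b := fun i j => congrFun (congrFun hα i) j
  have eb : ∀ a b, β b a = -β a b := fun i j => congrFun (congrFun hβ i) j
  have hsymm : ∀ i j k l, weyl G i j k l y = weyl G k l i j y := by
    intro i j k l
    have hg : ∀ p i, G y p i = G y i p := fun p i => congrFun (congrFun (h.symm y hy) i) p
    rw [weyl_of_einstein hEin, weyl_of_einstein hEin, h.curvatureLow_pair_symm i j k l ⟨y, hy⟩,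
      hg i k, hg j l, hg i l, hg j k]
    ring
  rw [bivectorInner, bivectorInner, weylOperator,
    lower_bivectorOperator _ (h.symm y hy) (h.det_ne_zero y hy),
    lower_bivectorOperator _ (h.symm y hy) (h.det_ne_zero y hy)]
  congr 1
  have e : ∀ (α β : Matrix (Fin 4) (Fin 4) ℂ), (Matrix.trace ((Matrix.of fun p q => (1 / 2 : ℂ) *
      ∑ i, ∑ j, (weyl G i j p q y : ℂ) * α i j) * β)) =
      ∑ p, ∑ q, ∑ i, ∑ j, (1 / 2 : ℂ) * (weyl G i j p q y : ℂ) * α i j * β q p := by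
    intro α β
    simp only [Matrix.trace, Matrix.diag_apply, Matrix.mul_apply, Matrix.of_apply, Finset.mul_sum,
      Finset.sum_mul, mul_assoc]
  rw [e, e]
  have sw : ∀ f : Fin 4 → Fin 4 → Fin 4 → Fin 4 → ℂ, ∑ p, ∑ q, ∑ i, ∑ j, f p q i j =
      ∑ i, ∑ j, ∑ p, ∑ q, f p q i j := by
    intro f
    calc _ = ∑ x : Fin 4 × Fin 4, ∑ z : Fin 4 × Fin 4, f x.1 x.2 z.1 z.2 := by
          simp only [Fintype.sum_prod_type]
      _ = ∑ z : Fin 4 × Fin 4, ∑ x : Fin 4 × Fin 4, f x.1 x.2 z.1 z.2 := Finset.sum_comm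
      _ = _ := by simp only [Fintype.sum_prod_type]
  rw [sw]
  refine Finset.sum_congr rfl fun i _ => Finset.sum_congr rfl fun j _ => Finset.sum_congr rfl fun p _ =>
    Finset.sum_congr rfl fun q _ => ?_
  rw [hsymm i j p q, eb p q, ea i j]
  ring

theorem IsLocalMetric.contDiffOn_weyl (h : IsLocalMetric V G) (i j k l : Fin 4) :
    ContDiffOn ℝ ∞ (weyl G i j k l) V := by
  have hσ : ∀ i k, ContDiffOn ℝ ∞ (schouten G i k) V := fun i k =>
    (h.contDiffOn_ricci i k).sub ((h.contDiffOn_scalarCurvature.div_const 6).mul (h.smooth i k))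
  unfold weyl
  exact (h.contDiffOn_curvatureLow i j k l).sub (contDiffOn_const.mul
    (((((h.smooth _ _).mul (hσ _ _)).sub ((h.smooth _ _).mul (hσ _ _))).sub
      ((h.smooth _ _).mul (hσ _ _))).add ((h.smooth _ _).mul (hσ _ _))))

theorem IsLocalMetric.smoothMatOn_weyl (h : IsLocalMetric V G) {U : Set E4} (hU : U ⊆ V)
    {α : E4 → Matrix (Fin 4) (Fin 4) ℂ} (hα : SmoothMatOn U α) :
    SmoothMatOn U fun y => weylOperator G y (α y) := by
  intro k l
  simp only [weylOperator, bivectorOperator, LinearMap.coe_mk, AddHom.coe_mk, Matrix.of_apply]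
  refine contDiffOn_const.mul (ContDiffOn.sum fun i _ => ContDiffOn.sum fun j _ =>
    ContDiffOn.sum fun p _ => ContDiffOn.sum fun q _ => ContDiffOn.mul ?_ (hα i j))
  exact (contDiffOn_ofReal (((h.contDiffOn_inv k p).mul (h.contDiffOn_inv l q)).mul
    (h.contDiffOn_weyl i j p q))).mono hU

/-- The bivector with the components `f` in a frame. -/
def frameBivector (E : Matrix (Fin 4) (Fin 4) ℂ) : (Fin 3 → ℂ) →ₗ[ℂ] Matrix (Fin 4) (Fin 4) ℂ :=
  Fintype.linearCombination ℂ fun j => E * sdBasis ℂ j * E.transpose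

theorem frameBivector_apply (E : Matrix (Fin 4) (Fin 4) ℂ) (f : Fin 3 → ℂ) :
    frameBivector E f = ∑ j, f j • (E * sdBasis ℂ j * E.transpose) := rfl

theorem frameBivector_injective {E : Matrix (Fin 4) (Fin 4) ℂ} (hE : E.transpose * cMat G y * E = 1) :
    Function.Injective (frameBivector E) := by
  intro f f' h
  funext j
  have := congrArg (bivectorInner G y (E * sdBasis ℂ j * E.transpose)) h
  simpa [frameBivector_apply, bivectorInner_sum_right, bivectorInner_frame hE] using this

/-- The matrix of the Weyl tensor in a frame. -/
def frameWeyl (G : E4 → Matrix (Fin 4) (Fin 4) ℝ) (y : E4) (E : Matrix (Fin 4) (Fin 4) ℂ) :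
    Matrix (Fin 3) (Fin 3) ℂ :=
  Matrix.of fun j k => bivectorInner G y (E * sdBasis ℂ j * E.transpose)
    (weylOperator G y (E * sdBasis ℂ k * E.transpose))

/-- The condition that the eigenvectors of the Weyl tensor span the self-dual bivectors at `y`. -/
def WeylDiagonalizable (G : E4 → Matrix (Fin 4) (Fin 4) ℝ) (ε : E4 → ℝ) (y : E4) : Prop :=
  Submodule.span ℂ {α | ∃ μ : ℂ, α ∈ selfDual G ε y ∧ α ≠ 0 ∧ weylOperator G y α = μ • α} =
    selfDual G ε y

/-- The set of eigenvalues of the self-dual Weyl tensor at `y`. -/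
def weylEigenvalues (G : E4 → Matrix (Fin 4) (Fin 4) ℝ) (ε : E4 → ℝ) (y : E4) : Set ℂ :=
  {μ | ∃ α, α ∈ selfDual G ε y ∧ α ≠ 0 ∧ weylOperator G y α = μ • α}

/-- That W preserves the self-dual bivectors is read off from diagonalizability, since eigenvectors
span them; the commutation of W with the star is not needed. -/
theorem weylOperator_frameBivector (hs : (G y).transpose = G y) (hd : (G y).det ≠ 0)
    {E : Matrix (Fin 4) (Fin 4) ℂ} (hE : E.transpose * cMat G y * E = 1)
    (hsign : frameSign G ε y E = starEigenvalue G y) (hdiag : WeylDiagonalizable G ε y)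
    (v : Fin 3 → ℂ) :
    weylOperator G y (frameBivector E v) = frameBivector E ((frameWeyl G y E).mulVec v) := by
  have hmem := fun α => mem_selfDual_iff hs hd hE hsign (α := α)
  have hpres : ∀ α ∈ selfDual G ε y, weylOperator G y α ∈ selfDual G ε y := by
    intro α hα
    rw [← hdiag] at hα
    induction hα using Submodule.span_induction with
    | mem α h => obtain ⟨μ, h1, -, h3⟩ := h; rw [h3]; exact Submodule.smul_mem _ _ h1
    | zero => rw [map_zero]; exact Submodule.zero_mem _
    | add α β _ _ h1 h2 => rw [map_add]; exact Submodule.add_mem _ h1 h2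
    | smul c α _ h1 => rw [map_smul]; exact Submodule.smul_mem _ _ h1
  have hbasis : ∀ k, weylOperator G y (E * sdBasis ℂ k * E.transpose) =
      ∑ j, frameWeyl G y E j k • (E * sdBasis ℂ j * E.transpose) := by
    intro k
    have h1 : E * sdBasis ℂ k * E.transpose ∈ selfDual G ε y :=
      (hmem _).mpr ⟨Pi.single k 1, by simp [Pi.single_apply, ite_smul]⟩
    obtain ⟨f, hf⟩ := (hmem _).mp (hpres _ h1)
    rw [hf]
    refine Finset.sum_congr rfl fun j _ => ?_
    congr 1
    rw [frameWeyl, Matrix.of_apply, hf, bivectorInner_sum_right]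
    simp [bivectorInner_frame hE]
  rw [frameBivector_apply, map_sum]
  simp only [map_smul, hbasis, frameBivector_apply, Matrix.mulVec, dotProduct, Finset.smul_sum,
    smul_smul, Finset.sum_smul]
  rw [Finset.sum_comm]
  simp only [mul_comm]

/-- Since `frameBivector E` maps ℂ³ isomorphically onto the self-dual bivectors, the hypotheses on
W⁽⁺⁾ become statements about a 3×3 matrix. -/
theorem frameWeyl_eigenvectors (hs : (G y).transpose = G y) (hd : (G y).det ≠ 0)
    {E : Matrix (Fin 4) (Fin 4) ℂ} (hE : E.transpose * cMat G y * E = 1)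
    (hsign : frameSign G ε y E = starEigenvalue G y) (hdiag : WeylDiagonalizable G ε y) :
    Submodule.span ℂ {v : Fin 3 → ℂ | ∃ μ : ℂ, v ≠ 0 ∧ (frameWeyl G y E).mulVec v = μ • v} = ⊤ ∧
    {μ : ℂ | ∃ v : Fin 3 → ℂ, v ≠ 0 ∧ (frameWeyl G y E).mulVec v = μ • v} = weylEigenvalues G ε y := by
  have hmem := fun α => mem_selfDual_iff hs hd hE hsign (α := α)
  have hinj := frameBivector_injective hE
  have hW := weylOperator_frameBivector hs hd hE hsign hdiag
  have hrange : Submodule.map (frameBivector E) ⊤ = selfDual G ε y := by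
    ext α
    rw [hmem, Submodule.map_top, LinearMap.mem_range]
    exact ⟨fun ⟨f, hf⟩ => ⟨f, hf.symm⟩, fun ⟨f, hf⟩ => ⟨f, hf.symm⟩⟩
  have hiff : ∀ (v : Fin 3 → ℂ) (μ : ℂ), (v ≠ 0 ∧ (frameWeyl G y E).mulVec v = μ • v) ↔
      (frameBivector E v ∈ selfDual G ε y ∧ frameBivector E v ≠ 0 ∧
        weylOperator G y (frameBivector E v) = μ • frameBivector E v) := by
    intro v μ
    rw [hW, ← map_smul, hinj.eq_iff, Ne, Ne, map_eq_zero_iff _ hinj]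
    exact ⟨fun h => ⟨(hmem _).mpr ⟨v, rfl⟩, h.1, h.2⟩, fun h => h.2⟩
  constructor
  · apply Submodule.map_injective_of_injective hinj
    rw [hrange, Submodule.map_span]
    conv_rhs => rw [← hdiag]
    congr 1
    ext α
    constructor
    · rintro ⟨v, ⟨μ, hv⟩, rfl⟩
      exact ⟨μ, (hiff v μ).mp hv⟩
    · rintro ⟨μ, h1, h2⟩
      obtain ⟨f, rfl⟩ := (hmem _).mp h1
      exact ⟨f, ⟨μ, (hiff f μ).mpr ⟨h1, h2⟩⟩, rfl⟩
  · ext μ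
    constructor
    · rintro ⟨v, hv⟩
      exact ⟨_, (hiff v μ).mp hv⟩
    · rintro ⟨α, h1, h2⟩
      obtain ⟨f, rfl⟩ := (hmem _).mp h1
      exact ⟨f, (hiff f μ).mpr ⟨h1, h2⟩⟩

/-- The extension of a rotation of `ℂ³` to `ℂ⁴`. -/
def rotation (O : Matrix (Fin 3) (Fin 3) ℂ) : Matrix (Fin 4) (Fin 4) ℂ :=
  !![1, 0, 0, 0; 0, O 0 0, O 0 1, O 0 2; 0, O 1 0, O 1 1, O 1 2; 0, O 2 0, O 2 1, O 2 2]

theorem rotation_orthogonal {O : Matrix (Fin 3) (Fin 3) ℂ} (hO : O.transpose * O = 1) :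
    (rotation O).transpose * rotation O = 1 := by
  have e : ∀ i j, ∑ k, O k i * O k j = (1 : Matrix (Fin 3) (Fin 3) ℂ) i j := fun i j =>
    congrFun (congrFun hO i) j
  simp only [Fin.sum_univ_three] at e
  ext i j
  fin_cases i <;> fin_cases j <;> simp [Matrix.mul_apply, Fin.sum_univ_four, rotation, e]

/-- A rotation that fixes e_0 acts on self-dual bivectors as on ℂ³. The components among e_1, e_2,
e_3 transform by 2×2 minors, and these are entries of O because its adjugate equals its transpose.
-/
theorem rotation_sdBasis {O : Matrix (Fin 3) (Fin 3) ℂ} (hO : O.transpose * O = 1) (hd : O.det = 1)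
    (j : Fin 3) : rotation O * sdBasis ℂ j * (rotation O).transpose = ∑ k, O k j • sdBasis ℂ k := by
  have hadj : O.adjugate = O.transpose := by
    calc O.adjugate = (O.transpose * O) * O.adjugate := by rw [hO, Matrix.one_mul]
      _ = O.transpose := by rw [Matrix.mul_assoc, Matrix.mul_adjugate, hd, one_smul, Matrix.mul_one]
  rw [Matrix.adjugate_fin_three] at hadj
  have e : ∀ i j, O.transpose i j = _ := fun i j => (congrFun (congrFun hadj i) j).symm
  have e00 := e 0 0
  have e01 := e 0 1
  have e02 := e 0 2
  have e10 := e 1 0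
  have e11 := e 1 1
  have e12 := e 1 2
  have e20 := e 2 0
  have e21 := e 2 1
  have e22 := e 2 2
  simp at e00 e01 e02 e10 e11 e12 e20 e21 e22
  ext a b
  fin_cases j <;> fin_cases a <;> fin_cases b <;>
  simp [Matrix.mul_apply, Fin.sum_univ_four, Fin.sum_univ_three, rotation, sdBasis] <;>
  first
    | ring1
    | linear_combination e00
    | linear_combination e01
    | linear_combination e02
    | linear_combination e10
    | linear_combination e11
    | linear_combination e12
    | linear_combination e20
    | linear_combination e21
    | linear_combination e22
    | linear_combination -e00
    | linear_combination -e01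
    | linear_combination -e02
    | linear_combination -e10
    | linear_combination -e11
    | linear_combination -e12
    | linear_combination -e20
    | linear_combination -e21
    | linear_combination -e22

end AdaptedFrame

end EinsteinFour

end

noncomputable section

namespace EinsteinFour

/-! ### Adapted frames and covariant derivatives of self-dual bivectors -/

section LocalTheory

open TopologicalSpace (Opens)

variable {V : Opens E4} {G : E4 → Matrix (Fin 4) (Fin 4) ℝ} {y y₀ : E4} {ε : E4 → ℝ}

/-- A smooth complex orthonormal frame in which the self-dual Weyl tensor is diagonal, with constant
eigenvalues. -/
structure IsAdaptedFrame (V : Set E4) (G : E4 → Matrix (Fin 4) (Fin 4) ℝ) (ε : E4 → ℝ)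
    (lam : Fin 3 → ℂ) (E : E4 → Matrix (Fin 4) (Fin 4) ℂ) : Prop where
  smooth : SmoothMatOn V E
  orthonormal : ∀ y ∈ V, (E y).transpose * cMat G y * E y = 1
  weyl : ∀ y ∈ V, ∀ j, weylOperator G y (E y * sdBasis ℂ j * (E y).transpose) =
    lam j • (E y * sdBasis ℂ j * (E y).transpose)
  exists_components : ∀ y ∈ V, ∀ α ∈ selfDual G ε y, ∃ f : Fin 3 → ℂ, α = frameBivector (E y) f

theorem IsAdaptedFrame.mono {V V' : Set E4} {lam : Fin 3 → ℂ} {E : E4 → Matrix (Fin 4) (Fin 4) ℂ}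
    (h : IsAdaptedFrame V G ε lam E) (hV : V' ⊆ V) : IsAdaptedFrame V' G ε lam E where
  smooth := h.smooth.mono hV
  orthonormal y hy := h.orthonormal y (hV hy)
  weyl y hy := h.weyl y (hV hy)
  exists_components y hy := h.exists_components y (hV hy)

theorem frameBivector_rotation (E : Matrix (Fin 4) (Fin 4) ℂ) {O : Matrix (Fin 3) (Fin 3) ℂ}
    (hO : O.transpose * O = 1) (hd : O.det = 1) (v : Fin 3 → ℂ) :
    frameBivector (E * rotation O) v = frameBivector E (O.mulVec v) := by
  have h1 : ∀ j, E * rotation O * sdBasis ℂ j * (E * rotation O).transpose =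
      ∑ k, O k j • (E * sdBasis ℂ k * E.transpose) := by
    intro j
    have : E * rotation O * sdBasis ℂ j * (E * rotation O).transpose =
        E * (rotation O * sdBasis ℂ j * (rotation O).transpose) * E.transpose := by
      rw [Matrix.transpose_mul]; simp only [Matrix.mul_assoc]
    rw [this, rotation_sdBasis hO hd]
    simp only [Matrix.mul_sum, Matrix.sum_mul, Matrix.mul_smul, Matrix.smul_mul]
  simp only [frameBivector_apply, h1, Matrix.mulVec, dotProduct, Finset.smul_sum, smul_smul,
    Finset.sum_smul]
  rw [Finset.sum_comm]
  simp only [mul_comm]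

theorem frameBivector_single (E : Matrix (Fin 4) (Fin 4) ℂ) (j : Fin 3) :
    frameBivector E (Pi.single j 1) = E * sdBasis ℂ j * E.transpose := by
  simp [frameBivector_apply, Pi.single_apply, ite_smul]

/-- Start from an oriented frame, diagonalize the symmetric 3×3 matrix of W smoothly by an
orthogonal matrix, and realize that matrix as a rotation of the tangent frame. -/
theorem IsLocalMetric.exists_adaptedFrame (h : IsLocalMetric V G) (hy₀ : y₀ ∈ V)
    (hEin : ∀ y ∈ V, ∀ i k, ricci G i k y = scalarCurvature G y / 4 * G y i k)
    (hε : ∀ y ∈ V, ε y = ε y₀) (hε₀ : ε y₀ ^ 2 = 1)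
    (hdiag : ∀ y ∈ V, WeylDiagonalizable G ε y) {Λ : Set ℂ}
    (hΛ : ∀ y ∈ V, weylEigenvalues G ε y = Λ) :
    ∃ U ⊆ (V : Set E4), IsOpen U ∧ y₀ ∈ U ∧ ∃ (E : E4 → Matrix (Fin 4) (Fin 4) ℂ) (lam : Fin 3 → ℂ),
      IsAdaptedFrame U G ε lam E ∧ Set.range lam = Λ := by
  obtain ⟨U, hU, ho, hm, E, hE, hEo⟩ := h.exists_oriented_frame hy₀ hε hε₀
  have hs : ∀ y ∈ U, (G y).transpose = G y := fun y hy => h.symm y (hU hy)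
  have hd : ∀ y ∈ U, (G y).det ≠ 0 := fun y hy => h.det_ne_zero y (hU hy)
  have hA : ∀ j, SmoothMatOn U fun y => E y * sdBasis ℂ j * (E y).transpose := fun j =>
    (hE.mul (SmoothMatOn.const _)).mul hE.transpose
  have hM : SmoothMatOn U fun y => frameWeyl G y (E y) := by
    intro j k
    simp only [frameWeyl, bivectorInner, Matrix.of_apply, Matrix.trace, Matrix.diag_apply]
    have hC := h.smoothMatOn.mono hU
    exact contDiffOn_const.mul (ContDiffOn.sum fun i _ =>
      (((hC.mul (hA j)).mul hC).mul (h.smoothMatOn_weyl hU (hA k))) i i)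
  have hMs : ∀ y ∈ U, (frameWeyl G y (E y)).transpose = frameWeyl G y (E y) := by
    intro y hy
    ext j k
    simp only [Matrix.transpose_apply, frameWeyl, Matrix.of_apply]
    rw [bivectorInner_comm, h.bivectorInner_weyl (hU hy) (hEin y (hU hy))
      (skew_conj _ (sdBasis_transpose j)) (skew_conj _ (sdBasis_transpose k))]
  obtain ⟨U', hU', ho', hm', O, lam, hO, hrange, hOy⟩ := hM.exists_diagonalization ho hm hMs
    (fun y hy => (frameWeyl_eigenvectors (hs y hy) (hd y hy) (hEo y hy).1 (hEo y hy).2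
      (hdiag y (hU hy))).1)
    (fun y hy => (frameWeyl_eigenvectors (hs y hy) (hd y hy) (hEo y hy).1 (hEo y hy).2
      (hdiag y (hU hy))).2.trans (hΛ y (hU hy)))
  have hdet2 : ∀ y ∈ U', (O y).det * (O y).det = 1 := by
    intro y hy
    have := congrArg Matrix.det (hOy y hy).1
    rwa [Matrix.det_mul, Matrix.det_transpose, Matrix.det_one] at this
  -- Only rotations lift to frames. In dimension three, multiplying by the determinant ±1 makes the
  -- determinant (det O)⁴ = 1, and the columns remain eigenvectors.
  set O' : E4 → Matrix (Fin 3) (Fin 3) ℂ := fun y => (O y).det • O y with hO'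
  have hO's : SmoothMatOn U' O' := hO.smul (contDiffOn_det hO)
  have hO'1 : ∀ y ∈ U', (O' y).transpose * O' y = 1 := by
    intro y hy
    rw [hO', Matrix.transpose_smul, Matrix.smul_mul, Matrix.mul_smul, smul_smul, hdet2 y hy, one_smul,
      (hOy y hy).1]
  have hO'd : ∀ y ∈ U', (O' y).det = 1 := by
    intro y hy
    rw [hO', Matrix.det_smul, Fintype.card_fin]
    linear_combination ((O y).det * (O y).det + 1) * hdet2 y hy
  have hO'M : ∀ y ∈ U', frameWeyl G y (E y) * O' y = O' y * Matrix.diagonal lam := by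
    intro y hy
    rw [hO', Matrix.mul_smul, (hOy y hy).2, Matrix.smul_mul]
  have hR : SmoothMatOn U' fun y => rotation (O' y) := by
    intro i j
    have hO's' : ∀ i j, ContDiffOn ℝ ∞ (fun y => O' y i j) U' := hO's
    fin_cases i <;> fin_cases j <;> simp [rotation, contDiffOn_const, hO's']
  refine ⟨U', hU'.trans hU, ho', hm', fun y => E y * rotation (O' y), lam, ⟨?_, ?_, ?_, ?_⟩, hrange⟩
  · exact (hE.mono hU').mul hR
  · intro y hy
    have : (E y * rotation (O' y)).transpose * cMat G y * (E y * rotation (O' y)) =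
        (rotation (O' y)).transpose * ((E y).transpose * cMat G y * E y) * rotation (O' y) := by
      simp only [Matrix.transpose_mul, Matrix.mul_assoc]
    rw [this, (hEo y (hU' hy)).1, Matrix.mul_one, rotation_orthogonal (hO'1 y hy)]
  · intro y hy j
    rw [← frameBivector_single, frameBivector_rotation _ (hO'1 y hy) (hO'd y hy),
      weylOperator_frameBivector (hs y (hU' hy)) (hd y (hU' hy)) (hEo y (hU' hy)).1
        (hEo y (hU' hy)).2 (hdiag y (hU (hU' hy))), Matrix.mulVec_mulVec, hO'M y hy,
      ← Matrix.mulVec_mulVec, ← map_smul, ← Matrix.mulVec_smul]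
    congr 2
    ext i
    rw [Matrix.mulVec_diagonal, Pi.smul_apply, smul_eq_mul]
    by_cases hij : i = j
    · subst hij; rfl
    · simp [hij]
  · intro y hy α hα
    obtain ⟨f, hf⟩ := (mem_selfDual_iff (hs y (hU' hy)) (hd y (hU' hy)) (hEo y (hU' hy)).1
        (hEo y (hU' hy)).2).mp hα
    refine ⟨(O' y).transpose.mulVec f, ?_⟩
    rw [frameBivector_rotation _ (hO'1 y hy) (hO'd y hy), Matrix.mulVec_mulVec,
      mul_eq_one_comm.mp (hO'1 y hy), Matrix.one_mulVec, frameBivector_apply, hf]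

/-- A smooth matrix-valued function, as a matrix of smooth functions. -/
def SmoothMatOn.mat {m n : Type*} {M : E4 → Matrix m n ℂ} (h : SmoothMatOn V M) :
    Matrix m n (SmoothFun V) :=
  Matrix.of fun i j => SmoothFun.mk (fun y => M y i j) (h i j)

theorem SmoothMatOn.eval_mat {m n : Type*} {M : E4 → Matrix m n ℂ} (h : SmoothMatOn V M) (x : V) :
    h.mat.map (SmoothFun.eval x) = M x := rfl

theorem IsAdaptedFrame.mat_orthonormal (h : IsLocalMetric V G) {lam : Fin 3 → ℂ}
    {E : E4 → Matrix (Fin 4) (Fin 4) ℂ} (hE : IsAdaptedFrame V G ε lam E) :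
    hE.smooth.mat.transpose * h.mat * hE.smooth.mat = 1 := by
  refine matrix_ext_eval fun x => ?_
  rw [Matrix.map_mul, Matrix.map_mul, Matrix.transpose_map, h.eval_mat, hE.smooth.eval_mat]
  refine (hE.orthonormal x x.2).trans ?_
  exact (Matrix.map_one (SmoothFun.eval x) (map_zero (SmoothFun.eval x))
    (map_one (SmoothFun.eval x))).symm

theorem IsAdaptedFrame.selfDualEquations (h : IsLocalMetric V G) {lam : Fin 3 → ℂ}
    {E : E4 → Matrix (Fin 4) (Fin 4) ℂ} (hE : IsAdaptedFrame V G ε lam E)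
    (hEin : ∀ y ∈ V, ∀ i k, ricci G i k y = scalarCurvature G y / 4 * G y i k) :
    ∃ σ, SelfDualEquations SmoothFun.D (coframe h.mat hE.smooth.mat) hE.smooth.mat
      (sdConn SmoothFun.D h.mat h.conn hE.smooth.mat) lam σ :=
  ⟨_, h.selfDualEquations (hE.mat_orthonormal h) hEin fun x j => by
    rw [hE.smooth.eval_mat]; exact hE.weyl x x.2 j⟩

section CovariantDerivative

variable {A : Type*} [CommRing A] [Algebra ℂ A]

/-- The covariant derivative of a bivector field. -/
def covD (D : Fin 4 → Derivation ℂ A A) (Γ : Fin 4 → Matrix (Fin 4) (Fin 4) A) (i : Fin 4)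
    (α : Matrix (Fin 4) (Fin 4) A) : Matrix (Fin 4) (Fin 4) A :=
  α.map (D i) + Γ i * α + α * (Γ i).transpose

theorem covD_frame {D : Fin 4 → Derivation ℂ A A} {g E : Matrix (Fin 4) (Fin 4) A}
    {Γ : Fin 4 → Matrix (Fin 4) (Fin 4) A} (hΓ : IsLeviCivita D g Γ) (hg : g.transpose = g)
    (hE : E.transpose * g * E = 1) (i : Fin 4) (B : Matrix (Fin 4) (Fin 4) A) :
    covD D Γ i (E * B * E.transpose) = E * (B.map (D i) + frameConn D g Γ E i * B
      - B * frameConn D g Γ E i) * E.transpose := by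
  have h1 := mul_frameConn (D := D) (Γ := Γ) hE i
  have h2 := congrArg Matrix.transpose h1
  rw [Matrix.transpose_mul, frameConn_skew hΓ hg hE, Matrix.transpose_add, Matrix.transpose_mul] at h2
  generalize frameConn D g Γ E i = W at *
  have h3 : E * (B.map (D i) + W * B - B * W) * E.transpose =
      E * B.map (D i) * E.transpose + (E * W) * B * E.transpose + E * B * (-W * E.transpose) := by
    noncomm_ring
  rw [h3, h1, h2, covD, map_mul_derivation, map_mul_derivation, Matrix.transpose_map]
  noncomm_ring

/-- The bracket relations of so(4): on the self-dual summand a skew-symmetric matrix acts through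
its self-dual part alone. -/
theorem sdBasis_commutator {W : Matrix (Fin 4) (Fin 4) A} (hW : W.transpose = -W) (j : Fin 3) :
    W * sdBasis A j - sdBasis A j * W =
      sdPart (j + 1) W • sdBasis A (j + 2) - sdPart (j + 2) W • sdBasis A (j + 1) := by
  have e : ∀ a b, W b a = -W a b := fun i j => congrFun (congrFun hW i) j
  have e0 : ∀ a, W a a = 0 := fun a => two_mul_cancel (by linear_combination e a a)
  ext a b
  simp only [Matrix.sub_apply, Matrix.mul_apply, Fin.sum_univ_four, Matrix.smul_apply]
  fin_cases j <;> fin_cases a <;> fin_cases b <;>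
  simp [sdBasis, sdPart, e0, e 0 1, e 0 2, e 0 3, e 1 2, e 1 3,
    e 2 3] <;> ring

theorem sdBasis_map_derivation (d : Derivation ℂ A A) (j : Fin 3) : (sdBasis A j).map d = 0 := by
  ext a b
  fin_cases j <;> fin_cases a <;> fin_cases b <;> simp [sdBasis]

/-- So the connection induced on self-dual bivectors has the connection forms ξ_j, acting on the
components by a cross product. -/
theorem covD_frame_sum {D : Fin 4 → Derivation ℂ A A} {g E : Matrix (Fin 4) (Fin 4) A}
    {Γ : Fin 4 → Matrix (Fin 4) (Fin 4) A} (hΓ : IsLeviCivita D g Γ) (hg : g.transpose = g)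
    (hE : E.transpose * g * E = 1) (i : Fin 4) (f : Fin 3 → A) :
    covD D Γ i (E * (∑ j, f j • sdBasis A j) * E.transpose) =
      E * (∑ j, (D i (f j) + f (j + 1) * sdConn D g Γ E (j + 2) i
        - f (j + 2) * sdConn D g Γ E (j + 1) i) • sdBasis A j) * E.transpose := by
  rw [covD_frame hΓ hg hE]
  congr 2
  have hW := frameConn_skew hΓ hg hE i
  simp only [sdConn]
  generalize frameConn D g Γ E i = W at *
  have h1 : (∑ j, f j • sdBasis A j).map (D i) = ∑ j, D i (f j) • sdBasis A j := by
    simp only [Fin.sum_univ_three, map_add_derivation, map_smul_derivation, sdBasis_map_derivation,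
      smul_zero, add_zero]
  have h2 : W * (∑ j, f j • sdBasis A j) - (∑ j, f j • sdBasis A j) * W =
      ∑ j, f j • (sdPart (j + 1) W • sdBasis A (j + 2) - sdPart (j + 2) W • sdBasis A (j + 1)) := by
    simp only [← sdBasis_commutator hW, Matrix.mul_sum, Matrix.sum_mul, Matrix.mul_smul,
      Matrix.smul_mul, ← Finset.sum_sub_distrib, smul_sub]
  rw [h1, add_sub_assoc, h2]
  simp only [Fin.sum_univ_three]
  ext a b
  simp
  ring

end CovariantDerivative

end LocalTheory

end EinsteinFour

end

noncomputable section

namespace EinsteinFour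

/-! ### Coinciding eigenvalues and the canonical frame -/

section LocalTheory

open TopologicalSpace (Opens)

variable {V : Opens E4} {G : E4 → Matrix (Fin 4) (Fin 4) ℝ} {y y₀ : E4} {ε : E4 → ℝ}

theorem IsLocalMetric.covDeriv_eq (h : IsLocalMetric V G) {α : E4 → Matrix (Fin 4) (Fin 4) ℂ}
    (hα : SmoothMatOn V α) (i : Fin 4) (x : V) :
    covDeriv G i α x = (covD SmoothFun.D h.conn i hα.mat).map (SmoothFun.eval x) := by
  ext k l
  simp only [covDeriv, covD, Matrix.of_apply, Matrix.map_apply, Matrix.add_apply, map_add,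
    Matrix.mul_apply, map_sum, map_mul, Matrix.transpose_apply, Finset.sum_add_distrib, add_assoc]
  congr 1
  · exact (SmoothFun.D_mk (fun z => α z k l) (hα k l) i x).symm
  · congr 1
    exact Finset.sum_congr rfl fun m _ => mul_comm _ _

/-- In an adapted frame W⁽⁺⁾ is a constant diagonal matrix, so its covariant derivative is its
commutator with the connection, whose entries are the (λ_{j+1} − λ_{j+2}) ξ_j up to sign. They
vanish by `SelfDualEquations.mul_eq_zero`. -/
theorem IsAdaptedFrame.parallel (h : IsLocalMetric V G) {lam : Fin 3 → ℂ}
    {E : E4 → Matrix (Fin 4) (Fin 4) ℂ} (hE : IsAdaptedFrame V G ε lam E)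
    (hEin : ∀ y ∈ V, ∀ i k, ricci G i k y = scalarCurvature G y / 4 * G y i k) {j₀ : Fin 3}
    (hj₀ : lam (j₀ + 1) = lam (j₀ + 2)) {α : E4 → Matrix (Fin 4) (Fin 4) ℂ} (hα : SmoothMatOn V α)
    (hαsd : ∀ y ∈ V, α y ∈ selfDual G ε y) (i : Fin 4) (x : V) :
    covDeriv G i (fun y => weylOperator G y (α y)) x = weylOperator G x (covDeriv G i α x) := by
  obtain ⟨σ, hS⟩ := hE.selfDualEquations h hEin
  have hξ := fun j => hS.mul_eq_zero hj₀ j i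
  have hB : ∀ j, SmoothMatOn V fun y => E y * sdBasis ℂ j * (E y).transpose := fun j =>
    (hE.smooth.mul (SmoothMatOn.const _)).mul hE.smooth.transpose
  -- The components of α are taken as inner products with the orthonormal basis, so that their
  -- smoothness is evident.
  set f : Fin 3 → E4 → ℂ := fun j y =>
    bivectorInner G y (E y * sdBasis ℂ j * (E y).transpose) (α y) with hf
  have hfs : ∀ j, ContDiffOn ℝ ∞ (f j) V := by
    intro j
    simp only [hf, bivectorInner, Matrix.trace, Matrix.diag_apply]
    exact contDiffOn_const.mul (ContDiffOn.sum fun i _ =>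
      (((h.smoothMatOn.mul (hB j)).mul h.smoothMatOn).mul hα) i i)
  have hαf : ∀ y ∈ V, α y = frameBivector (E y) fun j => f j y := by
    intro y hy
    obtain ⟨v, hv⟩ := hE.exists_components y hy _ (hαsd y hy)
    have : (fun j => f j y) = v := by
      funext j
      simp only [hf]
      rw [hv, frameBivector_apply, bivectorInner_sum_right]
      simp [bivectorInner_frame (hE.orthonormal y hy)]
    rw [this, hv]
  set φ : Fin 3 → SmoothFun V := fun j => SmoothFun.mk (f j) (hfs j) with hφ
  set ε' := hE.smooth.mat with hε'
  have hmap : ∀ (u : Fin 3 → SmoothFun V) (x : V),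
      (ε' * (∑ j, u j • sdBasis (SmoothFun V) j) * ε'.transpose).map (SmoothFun.eval x) =
        frameBivector (E x) fun j => (u j).1 x := by
    intro u x
    have h1 : (∑ j, u j • sdBasis (SmoothFun V) j).map (SmoothFun.eval x) =
        ∑ j, (u j).1 x • sdBasis ℂ j := by
      ext a b
      have e : ∀ j, SmoothFun.eval x (sdBasis (SmoothFun V) j a b) = sdBasis ℂ j a b := fun j =>
        congrFun (congrFun (sdBasis_map (SmoothFun.eval x : SmoothFun V →+* ℂ) j) a) b
      simp only [Matrix.map_apply, Matrix.sum_apply, Matrix.smul_apply, smul_eq_mul, map_sum, map_mul, e]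
      rfl
    rw [Matrix.map_mul, Matrix.map_mul, Matrix.transpose_map, h1, hε', hE.smooth.eval_mat,
      frameBivector_apply]
    simp only [Matrix.mul_sum, Matrix.sum_mul, Matrix.mul_smul, Matrix.smul_mul]
  have hWf : ∀ y ∈ V, ∀ v : Fin 3 → ℂ, weylOperator G y (frameBivector (E y) v) =
      frameBivector (E y) fun j => lam j * v j := by
    intro y hy v
    rw [frameBivector_apply, frameBivector_apply, map_sum]
    exact Finset.sum_congr rfl fun j _ => by rw [map_smul, hE.weyl y hy, smul_smul, mul_comm]
  have hWα : SmoothMatOn V fun y => weylOperator G y (α y) := h.smoothMatOn_weyl le_rfl hα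
  have e1 : hα.mat = ε' * (∑ j, φ j • sdBasis (SmoothFun V) j) * ε'.transpose := by
    refine matrix_ext_eval fun x => ?_
    rw [hmap, hα.eval_mat]
    exact hαf x x.2
  have e2 : hWα.mat = ε' * (∑ j, (algebraMap ℂ (SmoothFun V) (lam j) * φ j) •
      sdBasis (SmoothFun V) j) * ε'.transpose := by
    refine matrix_ext_eval fun x => ?_
    rw [hmap, hWα.eval_mat]
    refine (congrArg (weylOperator G x) (hαf x x.2)).trans ?_
    rw [hWf x x.2]
    rfl
  rw [h.covDeriv_eq hα, h.covDeriv_eq hWα, e1, e2,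
    covD_frame_sum h.isLeviCivita h.mat_transpose (hE.mat_orthonormal h),
    covD_frame_sum h.isLeviCivita h.mat_transpose (hE.mat_orthonormal h), hmap, hmap, hWf x x.2]
  congr 1
  funext j
  have h1 := congrArg (SmoothFun.eval x) (hξ (j + 1))
  have h2 := congrArg (SmoothFun.eval x) (hξ (j + 2))
  have i1 : j + 1 + 1 = j + 2 := by rw [add_assoc]; rfl
  have i2 : j + 1 + 2 = j := by rw [add_assoc]; exact add_zero j
  have i3 : j + 2 + 1 = j := by rw [add_assoc]; exact add_zero j
  have i4 : j + 2 + 2 = j + 1 := by rw [add_assoc]; rfl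
  rw [i1, i2] at h1
  rw [i3, i4] at h2
  rw [map_mul, AlgHom.commutes, map_zero, Algebra.algebraMap_self, RingHom.id_apply] at h1 h2
  have hDl : ∀ j, SmoothFun.D i (algebraMap ℂ (SmoothFun V) (lam j) * φ j) =
      algebraMap ℂ (SmoothFun V) (lam j) * SmoothFun.D i (φ j) := by
    intro j
    rw [Derivation.leibniz, Derivation.map_algebraMap, smul_zero, add_zero, smul_eq_mul]
  rw [hDl]
  simp only [← SmoothFun.eval_apply, map_sub, map_add, map_mul, AlgHom.commutes,
    Algebra.algebraMap_self, RingHom.id_apply]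
  linear_combination -SmoothFun.eval x (φ (j + 2)) * h1 - SmoothFun.eval x (φ (j + 1)) * h2

/-- The numbers in the canonical form of a metric. -/
theorem exists_structure_constants {lam : Fin 3 → ℂ} (hlam : ∀ j : Fin 3, lam (j + 1) ≠ lam (j + 2))
    (h2 : ∑ j, (lam (j + 1) - lam (j + 2)) ^ 2 = 0) {m : ℂ} (hm : m ≠ 0) {r : Fin 3 → ℂ}
    (hr : ∀ j, r j = m * (lam (j + 1) - lam (j + 2)) ^ 2 /
      ((lam 1 - lam 2) * (lam 2 - lam 0) * (lam 0 - lam 1))) :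
    ∃ κ : ℂ, κ ≠ 0 ∧ (∀ j, r j ≠ 0) ∧ (∀ j k, j ≠ k → r j ≠ r k) ∧
      ∀ z : ℂ, z ^ 3 = (κ ^ 2) ^ 2 ↔ ∃ j, z = κ * r j := by
  set d : Fin 3 → ℂ := fun j => lam (j + 1) - lam (j + 2) with hd
  have hd0 : ∀ j, d j ≠ 0 := fun j => sub_ne_zero.mpr (hlam j)
  set P : ℂ := (lam 1 - lam 2) * (lam 2 - lam 0) * (lam 0 - lam 1) with hP
  have hPd : P = d 0 * d 1 * d 2 := rfl
  have hP0 : P ≠ 0 := by rw [hPd]; exact mul_ne_zero (mul_ne_zero (hd0 0) (hd0 1)) (hd0 2)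
  have hsum : d 0 + d 1 + d 2 = 0 := by simp [hd]
  have h2' : d 0 ^ 2 + d 1 ^ 2 + d 2 ^ 2 = 0 := by
    have := h2
    rw [Fin.sum_univ_three] at this
    exact this
  have e2 : d 0 * d 1 + d 1 * d 2 + d 2 * d 0 = 0 := by
    linear_combination (1 / 2 : ℂ) * (d 0 + d 1 + d 2) * hsum - (1 / 2 : ℂ) * h2'
  -- The first two elementary symmetric functions of the d_j vanish, so the d_j are the roots of x³
  -- − P.
  have hcube : ∀ j, d j ^ 3 = P := by
    have : ∀ x : ℂ, (x - d 0) * (x - d 1) * (x - d 2) = x ^ 3 - P := by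
      intro x; rw [hPd]; linear_combination x * e2 - x ^ 2 * hsum
    intro j
    have h0 : (d j - d 0) * (d j - d 1) * (d j - d 2) = 0 := by fin_cases j <;> simp
    linear_combination h0 - this (d j)
  have hr' : ∀ j, r j = m * d j ^ 2 / P := hr
  have e22 : d 0 ^ 2 * d 1 ^ 2 + d 1 ^ 2 * d 2 ^ 2 + d 2 ^ 2 * d 0 ^ 2 = 0 := by
    linear_combination (d 0 * d 1 + d 1 * d 2 + d 2 * d 0) * e2 - 2 * d 0 * d 1 * d 2 * hsum
  -- The scale is dictated by the cube root condition: r_j³ = m³/P, so (κ r_j)³ = κ⁴ requires κ =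
  -- m³/P.
  refine ⟨m ^ 3 / P, div_ne_zero (pow_ne_zero 3 hm) hP0, fun j => ?_, fun j k hjk he => ?_, fun z => ?_⟩
  · rw [hr']; exact div_ne_zero (mul_ne_zero hm (pow_ne_zero 2 (hd0 j))) hP0
  · rw [hr', hr', div_left_inj' hP0] at he
    have he2 : d j ^ 2 = d k ^ 2 := mul_left_cancel₀ hm he
    -- Nonzero numbers with equal squares and equal cubes are equal.
    have he3 : d j = d k := by
      have h3 : d j * d j ^ 2 = d k * d j ^ 2 := by
        rw [show d j * d j ^ 2 = d j ^ 3 by ring, hcube, he2, show d k * d k ^ 2 = d k ^ 3 by ring, hcube]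
      exact mul_right_cancel₀ (pow_ne_zero 2 (hd0 j)) h3
    -- two equal differences contradict `∑ δ = 0`, `∑ δ ^ 2 = 0`
    have : ∀ a b c : ℂ, a ≠ 0 → a = b → a + b + c = 0 → a ^ 2 + b ^ 2 + c ^ 2 = 0 → False := by
      intro a b c ha hab h1 h2
      subst hab
      have hc : c = -2 * a := by linear_combination h1
      rw [hc] at h2
      have : a ^ 2 = 0 := by linear_combination (1 / 6 : ℂ) * h2
      exact ha (pow_eq_zero_iff two_ne_zero |>.mp this)
    fin_cases j <;> fin_cases k <;> simp at hjk he3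
    · exact this _ _ _ (hd0 0) he3 hsum h2'
    · exact this (d 0) (d 2) (d 1) (hd0 0) he3 (by linear_combination hsum) (by linear_combination h2')
    · exact this _ _ _ (hd0 0) he3.symm hsum h2'
    · exact this (d 1) (d 2) (d 0) (hd0 1) he3 (by linear_combination hsum) (by linear_combination h2')
    · exact this (d 0) (d 2) (d 1) (hd0 0) he3.symm (by linear_combination hsum) (by linear_combination h2')
    · exact this (d 1) (d 2) (d 0) (hd0 1) he3.symm (by linear_combination hsum) (by linear_combination h2')
  · have hρ : ∀ j, m ^ 3 / P * r j = m ^ 4 / P ^ 2 * d j ^ 2 := by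
      intro j; rw [hr']; field_simp
    have key : z ^ 3 - ((m ^ 3 / P) ^ 2) ^ 2 = (z - m ^ 3 / P * r 0) * (z - m ^ 3 / P * r 1) *
        (z - m ^ 3 / P * r 2) := by
      rw [hρ, hρ, hρ]
      have : ((m ^ 3 / P) ^ 2) ^ 2 = (m ^ 4 / P ^ 2) ^ 3 * P ^ 2 := by field_simp
      rw [this]
      generalize m ^ 4 / P ^ 2 = c
      rw [hPd]
      linear_combination c * z ^ 2 * h2' - c ^ 2 * z * e22
    rw [← sub_eq_zero, key, mul_eq_zero, mul_eq_zero, sub_eq_zero, sub_eq_zero, sub_eq_zero, or_assoc]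
    constructor
    · rintro (h | h | h)
      exacts [⟨0, h⟩, ⟨1, h⟩, ⟨2, h⟩]
    · rintro ⟨j, h⟩
      fin_cases j
      exacts [Or.inl h, Or.inr (Or.inl h), Or.inr (Or.inr h)]

/-- The canonical frame of an Einstein metric whose self-dual Weyl tensor has three constant
eigenvalues. -/
theorem SelfDualEquations.exists_canonical_frame {A : Type*} [CommRing A] [Algebra ℂ A] [Nontrivial A]
    {D : Fin 4 → Derivation ℂ A A} {g E : Matrix (Fin 4) (Fin 4) A} {ξ : Fin 3 → Fin 4 → A}
    {lam : Fin 3 → ℂ} {σ : A} (hE : E.transpose * g * E = 1)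
    (hS : SelfDualEquations D (coframe g E) E ξ lam σ)
    (hlam : ∀ j : Fin 3, lam (j + 1) ≠ lam (j + 2)) :
    ∑ j, (lam (j + 1) - lam (j + 2)) ^ 2 = 0 ∧
    ∃ (e : Matrix (Fin 4) (Fin 4) A) (r : Fin 3 → ℂ) (κ : ℂ),
      e.transpose * g * e = 1 ∧ κ ≠ 0 ∧ (∀ j, r j ≠ 0) ∧ (∀ j k, j ≠ k → r j ≠ r k) ∧
      (∀ z : ℂ, z ^ 3 = (κ ^ 2) ^ 2 ↔ ∃ j, z = κ * r j) ∧
      (∀ j k, vecBracket D (fun i => e i 0) (fun i => e i j.succ) k =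
        algebraMap ℂ A (r j) * e k j.succ) ∧
      ∀ j l k, vecBracket D (fun i => e i (Fin.succ j)) (fun i => e i (Fin.succ l)) k = 0 := by
  obtain ⟨S, m, hm, hSS, hS', hξ⟩ := hS.exists_canonical hlam
  obtain ⟨h2, hd0, hdj⟩ := hS'.structure_equations hlam hm hξ
  set r : Fin 3 → ℂ := fun j => m * (lam (j + 1) - lam (j + 2)) ^ 2 /
      ((lam 1 - lam 2) * (lam 2 - lam 0) * (lam 0 - lam 1)) with hr
  obtain ⟨κ, hκ, hr0, hrne, hz⟩ := exists_structure_constants hlam h2 hm (r := r) (fun j => rfl)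
  set e := E * S with he
  set θ := S.transpose * coframe g E with hθ
  have hθe : θ * e = 1 := hS'.dual
  have hdj' : ∀ j p q, extDerivOne D (θ (Fin.succ j)) p q =
      algebraMap ℂ A (-r j) * (θ 0 p * θ j.succ q - θ 0 q * θ j.succ p) := by
    intro j p q
    rw [hdj, hr, ← neg_div, neg_mul_eq_neg_mul]
  have hcon : ∀ c a b, ∑ p, ∑ q, e p a * e q b * (θ 0 p * θ c q - θ 0 q * θ c p) =
      (1 : Matrix (Fin 4) (Fin 4) A) 0 a * (1 : Matrix (Fin 4) (Fin 4) A) c b -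
      (1 : Matrix (Fin 4) (Fin 4) A) 0 b * (1 : Matrix (Fin 4) (Fin 4) A) c a := by
    intro c a b
    rw [← hθe]
    simp only [Matrix.mul_apply, Fin.sum_univ_four]
    ring
  have hB : ∀ a b k, vecBracket D (fun i => e i a) (fun i => e i b) k =
      ∑ j : Fin 3, algebraMap ℂ A (r j) *
        ((1 : Matrix (Fin 4) (Fin 4) A) 0 a * (1 : Matrix (Fin 4) (Fin 4) A) j.succ b -
      (1 : Matrix (Fin 4) (Fin 4) A) 0 b * (1 : Matrix (Fin 4) (Fin 4) A) j.succ a)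
        * e k j.succ := by
    intro a b k
    rw [vecBracket_frame hθe, Fin.sum_univ_succ]
    simp only [hd0, mul_zero, Finset.sum_const_zero, zero_mul, zero_add]
    rw [← Finset.sum_neg_distrib]
    refine Finset.sum_congr rfl fun j _ => ?_
    rw [← hcon j.succ a b]
    simp only [hdj', mul_left_comm _ (algebraMap ℂ A (-r j)), ← Finset.mul_sum]
    rw [map_neg]
    ring
  refine ⟨h2, e, r, κ, ?_, hκ, hr0, hrne, hz, fun j k => ?_, fun j l k => ?_⟩
  · rw [he, Matrix.transpose_mul]
    calc _ = S.transpose * (E.transpose * g * E) * S := by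
          simp only [Matrix.mul_assoc]
      _ = 1 := by rw [hE, Matrix.mul_one, hSS]
  · rw [hB, Finset.sum_eq_single j]
    · simp [Matrix.one_apply]
    · intro l _ hl
      simp [Matrix.one_apply, hl]
    · simp
  · rw [hB]
    simp [Matrix.one_apply, (Fin.succ_ne_zero _).symm]

/-- The canonical frame of an Einstein metric whose self-dual Weyl tensor has three constant
eigenvalues. -/
theorem IsAdaptedFrame.exists_canonical [Nonempty V] (h : IsLocalMetric V G) {lam : Fin 3 → ℂ}
    {E : E4 → Matrix (Fin 4) (Fin 4) ℂ} (hE : IsAdaptedFrame V G ε lam E)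
    (hEin : ∀ y ∈ V, ∀ i k, ricci G i k y = scalarCurvature G y / 4 * G y i k)
    (hlam : ∀ j : Fin 3, lam (j + 1) ≠ lam (j + 2)) :
    ∑ j, (lam (j + 1) - lam (j + 2)) ^ 2 = 0 ∧
    ∃ (e : Matrix (Fin 4) (Fin 4) (SmoothFun V)) (r : Fin 3 → ℂ) (κ : ℂ),
      e.transpose * h.mat * e = 1 ∧ κ ≠ 0 ∧ (∀ j, r j ≠ 0) ∧ (∀ j k, j ≠ k → r j ≠ r k) ∧
      (∀ z : ℂ, z ^ 3 = (κ ^ 2) ^ 2 ↔ ∃ j, z = κ * r j) ∧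
      (∀ j k, vecBracket SmoothFun.D (fun i => e i 0) (fun i => e i j.succ) k =
        algebraMap ℂ (SmoothFun V) (r j) * e k j.succ) ∧
      ∀ j l k, vecBracket SmoothFun.D (fun i => e i (Fin.succ j)) (fun i => e i (Fin.succ l)) k = 0 := by
  obtain ⟨σ, hS⟩ := hE.selfDualEquations h hEin
  exact hS.exists_canonical_frame (hE.mat_orthonormal h) hlam

/-- Killing fields commute with the canonical frame. -/
theorem vecBracket_eq_zero_of_killing {A : Type*} [CommRing A] [Algebra ℂ A]
    {D : Fin 4 → Derivation ℂ A A} (hD : ∀ i j f, D i (D j f) = D j (D i f))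
    (hinj : ∀ X : Fin 4 → A, vecDer D X = 0 → X = 0) {g e : Matrix (Fin 4) (Fin 4) A}
    (hg : g.transpose = g) (he : e.transpose * g * e = 1) {r : Fin 3 → ℂ} (hr : ∀ j, r j ≠ 0)
    (hr' : ∀ j k, j ≠ k → r j ≠ r k)
    (h0 : ∀ j k, vecBracket D (fun i => e i 0) (fun i => e i j.succ) k = algebraMap ℂ A (r j) * e k j.succ)
    (hs : ∀ j l k, vecBracket D (fun i => e i (Fin.succ j)) (fun i => e i (Fin.succ l)) k = 0)
    {X : Fin 4 → A}
    (hX : ∀ i j, vecDer D X (g i j) + ∑ k, (D i (X k) * g k j + g i k * D j (X k)) = 0) (a k : Fin 4) :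
    vecBracket D X (fun i => e i a) k = 0 := by
  have hsmul : ∀ (f : Fin 4 → A), ∑ c, f c • vecDer D (fun i => e i c) =
      vecDer D (fun i => ∑ c, f c * e i c) := by
    intro f
    simp only [vecDer, Finset.smul_sum, smul_smul, Finset.sum_smul]
    rw [Finset.sum_comm]
  have hvec : ∀ b, vecBracket D X (fun i => e i b) =
      fun i => ∑ c, (∑ k, coframe g e c k * vecBracket D X (fun i => e i b) k) * e i c := by
    intro b
    have h1 := mul_coframe he
    funext i
    calc vecBracket D X (fun i => e i b) i =
        ((e * coframe g e).mulVec (vecBracket D X (fun i => e i b))) i := by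
          rw [h1, Matrix.one_mulVec]
      _ = _ := by
          rw [← Matrix.mulVec_mulVec]
          simp only [Matrix.mulVec, dotProduct]
          exact Finset.sum_congr rfl fun c _ => mul_comm _ _
  have key := lie_eq_zero_of_skew (e := fun a => vecDer D fun i => e i a) (r := r)
    (X := vecDer D X) (z := fun b c => ∑ k, coframe g e c k * vecBracket D X (fun i => e i b) k)
    (fun f hf => by
      rw [hsmul] at hf
      have h1 := hinj _ hf
      have h2 : e.mulVec f = 0 := by
        funext i
        have := congrFun h1 i
        simp only [Matrix.mulVec, dotProduct, mul_comm (e i _)]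
        exact this
      rw [← Matrix.one_mulVec f, ← he, ← Matrix.mulVec_mulVec, h2, Matrix.mulVec_zero]) hr hr'
    (fun j => by
      rw [lie_vecDer hD]
      have : vecBracket D (fun i => e i 0) (fun i => e i j.succ) =
          fun i => algebraMap ℂ A (r j) * e i j.succ := funext (h0 j)
      rw [this]
      simp only [vecDer, Finset.smul_sum, smul_smul])
    (fun j l => by
      rw [lie_vecDer hD]
      have : vecBracket D (fun i => e i j.succ) (fun i => e i l.succ) = 0 := funext (hs j l)
      rw [this]
      simp [vecDer])
    (fun a => by rw [lie_vecDer hD, hsmul, ← hvec])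
    (fun a b => killing_skew hg he hX a b) a
  rw [lie_vecDer hD] at key
  exact congrFun (hinj _ key) k

end LocalTheory

end EinsteinFour

end

noncomputable section

namespace EinsteinFour

/-! ### Canonical frames as matrix functions and reality of Riemannian eigenvalues -/

section LocalTheory

open TopologicalSpace (Opens)

variable {V : Opens E4} {G : E4 → Matrix (Fin 4) (Fin 4) ℝ} {y y₀ : E4} {ε : E4 → ℝ}

/-- The bracket of complex vector fields given by their components. -/
def compBracket (u v : E4 → Fin 4 → ℂ) (y : E4) (k : Fin 4) : ℂ :=
  ∑ i, (u y i * pderiv i (fun z => v z k) y - v y i * pderiv i (fun z => u z k) y)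

theorem compBracket_swap (u v : E4 → Fin 4 → ℂ) (y : E4) (k : Fin 4) :
    compBracket u v y k = -compBracket v u y k := by
  rw [compBracket, compBracket, ← Finset.sum_neg_distrib]
  exact Finset.sum_congr rfl fun i _ => by ring

theorem eval_vecBracket {u v : Fin 4 → SmoothFun V} {u' v' : E4 → Fin 4 → ℂ}
    (hu : ∀ (x : V) i, u' x i = (u i).1 x) (hv : ∀ (x : V) i, v' x i = (v i).1 x) (x : V) (k : Fin 4) :
    (vecBracket SmoothFun.D u v k).1 x = compBracket u' v' x k := by
  rw [← SmoothFun.eval_apply, vecBracket, map_sub, vecDer_apply, vecDer_apply, map_sum, map_sum,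
    ← Finset.sum_sub_distrib]
  refine Finset.sum_congr rfl fun i _ => ?_
  rw [map_mul, map_mul, SmoothFun.eval_apply, SmoothFun.eval_apply, SmoothFun.eval_apply,
    SmoothFun.eval_apply, SmoothFun.D_apply (F := fun z => v' z k) (fun x => hv x k),
    SmoothFun.D_apply (F := fun z => u' z k) (fun x => hu x k), hu, hv]

/-- An orthonormal frame with the brackets of the canonical frame. -/
structure IsCanonicalFrame (V : Set E4) (G : E4 → Matrix (Fin 4) (Fin 4) ℝ) (r : Fin 3 → ℂ)
    (e : E4 → Matrix (Fin 4) (Fin 4) ℂ) : Prop where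
  smooth : SmoothMatOn V e
  orthonormal : ∀ y ∈ V, (e y).transpose * cMat G y * e y = 1
  bracket_zero : ∀ y ∈ V, ∀ j k, compBracket (fun z i => e z i 0) (fun z i => e z i (Fin.succ j)) y k =
    r j * e y k j.succ
  bracket_succ : ∀ y ∈ V, ∀ j l k,
    compBracket (fun z i => e z i (Fin.succ j)) (fun z i => e z i (Fin.succ l)) y k = 0

theorem IsCanonicalFrame.mono {V V' : Set E4} {r : Fin 3 → ℂ} {e : E4 → Matrix (Fin 4) (Fin 4) ℂ}
    (h : IsCanonicalFrame V G r e) (hV : V' ⊆ V) : IsCanonicalFrame V' G r e where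
  smooth := h.smooth.mono hV
  orthonormal y hy := h.orthonormal y (hV hy)
  bracket_zero y hy := h.bracket_zero y (hV hy)
  bracket_succ y hy := h.bracket_succ y (hV hy)

theorem IsAdaptedFrame.exists_canonicalFrame [Nonempty V] (h : IsLocalMetric V G) {lam : Fin 3 → ℂ}
    {E : E4 → Matrix (Fin 4) (Fin 4) ℂ} (hE : IsAdaptedFrame V G ε lam E)
    (hEin : ∀ y ∈ V, ∀ i k, ricci G i k y = scalarCurvature G y / 4 * G y i k)
    (hlam : ∀ j : Fin 3, lam (j + 1) ≠ lam (j + 2)) :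
    ∃ (e : E4 → Matrix (Fin 4) (Fin 4) ℂ) (r : Fin 3 → ℂ) (κ : ℂ),
      IsCanonicalFrame V G r e ∧ κ ≠ 0 ∧ (∀ j, r j ≠ 0) ∧ (∀ j k, j ≠ k → r j ≠ r k) ∧
      ∀ z : ℂ, z ^ 3 = (κ ^ 2) ^ 2 ↔ ∃ j, z = κ * r j := by
  obtain ⟨-, e, r, κ, he, hκ, hr, hr', hz, h0, hs⟩ := hE.exists_canonical h hEin hlam
  have hrep : ∀ (x : V) i a, (e i a).rep x = (e i a).1 x := fun x i a => (e i a).rep_apply x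
  refine ⟨fun y => Matrix.of fun i a => (e i a).rep y, r, κ, ⟨?_, ?_, ?_, ?_⟩, hκ, hr, hr', hz⟩
  · exact fun i a => (e i a).contDiffOn_rep
  · intro y hy
    have h1 := congrArg (fun M => M.map (SmoothFun.eval ⟨y, hy⟩)) he
    rw [Matrix.map_mul, Matrix.map_mul, Matrix.transpose_map, h.eval_mat,
      Matrix.map_one (SmoothFun.eval _) (map_zero _) (map_one _)] at h1
    have h2 : (Matrix.of fun i a => (e i a).rep y) = e.map (SmoothFun.eval ⟨y, hy⟩) := by
      ext i a; exact hrep ⟨y, hy⟩ i a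
    rw [h2]; exact h1
  · intro y hy j k
    have h1 := congrArg (SmoothFun.eval ⟨y, hy⟩) (h0 j k)
    rw [SmoothFun.eval_apply, map_mul, AlgHom.commutes, SmoothFun.eval_apply, ← hrep,
      eval_vecBracket (u' := fun z i => (e i 0).rep z) (v' := fun z i => (e i j.succ).rep z)
        (fun x i => hrep x i 0) (fun x i => hrep x i j.succ)] at h1
    exact h1
  · intro y hy j l k
    have h1 := congrArg (SmoothFun.eval ⟨y, hy⟩) (hs j l k)
    rw [SmoothFun.eval_apply, map_zero,
      eval_vecBracket (u' := fun z i => (e i j.succ).rep z) (v' := fun z i => (e i l.succ).rep z)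
        (fun x i => hrep x i j.succ) (fun x i => hrep x i l.succ)] at h1
    exact h1

/-- Killing fields commute with the canonical frame. -/
theorem IsCanonicalFrame.killing (h : IsLocalMetric V G) {r : Fin 3 → ℂ}
    {e : E4 → Matrix (Fin 4) (Fin 4) ℂ} (he : IsCanonicalFrame V G r e) (hr : ∀ j, r j ≠ 0)
    (hr' : ∀ j k, j ≠ k → r j ≠ r k) {X : E4 → Fin 4 → ℝ}
    (hXs : ∀ i, ContDiffOn ℝ ∞ (fun z => X z i) V)
    (hX : ∀ y ∈ V, ∀ i j, ∑ k, X y k * pderiv k (fun z => G z i j) y +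
      ∑ k, (pderiv i (fun z => X z k) y * G y k j + G y i k * pderiv j (fun z => X z k) y) = 0)
    (x : V) (a k : Fin 4) :
    compBracket (fun z i => (X z i : ℂ)) (fun z i => e z i a) x k = 0 := by
  have horth : he.smooth.mat.transpose * h.mat * he.smooth.mat = 1 := by
    refine matrix_ext_eval fun x => ?_
    rw [Matrix.map_mul, Matrix.map_mul, Matrix.transpose_map, h.eval_mat, he.smooth.eval_mat]
    refine (he.orthonormal x x.2).trans ?_
    exact (Matrix.map_one (SmoothFun.eval x) (map_zero (SmoothFun.eval x))
      (map_one (SmoothFun.eval x))).symm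
  have key := vecBracket_eq_zero_of_killing (SmoothFun.D_comm (V := V))
    (fun X hX => SmoothFun.vecDer_injective hX) h.mat_transpose horth hr hr'
    (fun j k => SmoothFun.ext fun x => by
      rw [eval_vecBracket (u' := fun z i => e z i 0) (v' := fun z i => e z i j.succ)
        (fun _ _ => rfl) (fun _ _ => rfl)]
      exact he.bracket_zero x x.2 j k)
    (fun j l k => SmoothFun.ext fun x => by
      rw [eval_vecBracket (u' := fun z i => e z i j.succ) (v' := fun z i => e z i l.succ)
        (fun _ _ => rfl) (fun _ _ => rfl)]
      exact he.bracket_succ x x.2 j l k)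
    (X := fun i => SmoothFun.ofReal (fun z => X z i) (hXs i))
    (fun i j => SmoothFun.ext fun x => by
      rw [← SmoothFun.eval_apply, map_add, map_sum, vecDer_apply, map_sum]
      simp only [map_add, map_mul, SmoothFun.eval_apply, IsLocalMetric.mat, Matrix.of_apply,
        SmoothFun.D_ofReal, SmoothFun.ofReal_apply]
      have := congrArg Complex.ofReal (hX x x.2 i j)
      push_cast at this
      exact this) a k
  have h1 := congrArg (SmoothFun.eval x) key
  rw [SmoothFun.eval_apply, map_zero, eval_vecBracket (u' := fun z i => (X z i : ℂ))
    (v' := fun z i => e z i a) (fun _ _ => rfl) (fun _ _ => rfl)] at h1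
  exact h1

theorem weylOperator_conj (α : Matrix (Fin 4) (Fin 4) ℂ) :
    weylOperator G y (α.map (starRingEnd ℂ)) = (weylOperator G y α).map (starRingEnd ℂ) := by
  ext k l
  simp [weylOperator, bivectorOperator, map_sum]
  exact Or.inl (map_ofNat (starRingEnd ℂ) 2).symm

/-- The eigenvalues of the Weyl tensor of a Riemannian metric are real. -/
theorem IsLocalMetric.weyl_eigenvalue_real (h : IsLocalMetric V G) (hy : y ∈ V)
    (hEin : ∀ i k, ricci G i k y = scalarCurvature G y / 4 * G y i k)
    {B : Matrix (Fin 4) (Fin 4) ℝ} (hB : B.transpose * G y * B = 1) {α : Matrix (Fin 4) (Fin 4) ℂ}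
    (hα : α.transpose = -α) (hα0 : α ≠ 0) {μ : ℂ} (hμ : weylOperator G y α = μ • α) :
    starRingEnd ℂ μ = μ := by
  set E := B.map Complex.ofReal with hE
  have hEo : E.transpose * cMat G y * E = 1 := by
    have := congrArg (fun M => M.map Complex.ofReal) hB
    simp only [map_ofReal_mul, map_ofReal_one] at this
    exact this
  set β := (E.transpose * cMat G y) * α * (E.transpose * cMat G y).transpose with hβ
  have h1 : E * (E.transpose * cMat G y) = 1 := mul_eq_one_comm.mp hEo
  have h2 : (E.transpose * cMat G y).transpose * E.transpose = 1 := by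
    rw [← Matrix.transpose_mul, h1, Matrix.transpose_one]
  have hαβ : α = E * β * E.transpose := by
    rw [hβ]
    calc α = E * (E.transpose * cMat G y) * α * ((E.transpose * cMat G y).transpose * E.transpose) := by
          rw [h1, h2, Matrix.one_mul, Matrix.mul_one]
      _ = _ := by simp only [Matrix.mul_assoc]
  set α' := α.map (starRingEnd ℂ) with hα'
  set β' := β.map (starRingEnd ℂ) with hβ'
  have hEc : E.map (starRingEnd ℂ) = E := by
    ext i j; simp [hE]
  have hαβ' : α' = E * β' * E.transpose := by
    rw [hα', hβ']
    conv_lhs => rw [hαβ, Matrix.map_mul, Matrix.map_mul, Matrix.transpose_map, hEc]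
  have hβs : β.transpose = -β := skew_conj _ hα
  have hα's : α'.transpose = -α' := by
    rw [hα', ← Matrix.transpose_map, hα]
    ext i j; simp
  -- Since the orthonormal frame is real, the pairing of α with its conjugate is a sum of squared
  -- moduli of components. It is therefore positive, and self-adjointness of W gives reality as for
  -- Hermitian operators.
  have hinner : bivectorInner G y α α' = -(1 / 4 : ℂ) * (β * β').trace := by
    rw [bivectorInner]
    congr 1
    rw [hαβ, hαβ']
    have : cMat G y * (E * β * E.transpose) * cMat G y * (E * β' * E.transpose) =
        (cMat G y * E * β * (E.transpose * cMat G y * E) * β') * E.transpose := by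
      simp only [Matrix.mul_assoc]
    rw [this, Matrix.trace_mul_comm, hEo]
    have : E.transpose * (cMat G y * E * β * 1 * β') =
        (E.transpose * cMat G y * E) * (β * β') := by
      simp only [Matrix.mul_assoc, Matrix.one_mul]
    rw [this, hEo, Matrix.one_mul]
  have htr : (β * β').trace = -((∑ i, ∑ j, Complex.normSq (β i j) : ℝ) : ℂ) := by
    rw [Matrix.trace]
    push_cast
    rw [← Finset.sum_neg_distrib]
    refine Finset.sum_congr rfl fun i _ => ?_
    rw [Matrix.diag_apply, Matrix.mul_apply, ← Finset.sum_neg_distrib]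
    refine Finset.sum_congr rfl fun j _ => ?_
    have e : β j i = -β i j := congrFun (congrFun hβs i) j
    rw [hβ', Matrix.map_apply, e, map_neg, mul_neg, Complex.mul_conj]
  have hne : bivectorInner G y α α' ≠ 0 := by
    rw [hinner, htr]
    refine mul_ne_zero (by norm_num) (neg_ne_zero.mpr ?_)
    intro h0
    have h0' : ∑ i, ∑ j, Complex.normSq (β i j) = 0 := by exact_mod_cast h0
    apply hα0
    have hβ0 : β = 0 := by
      ext i j
      have h3 := (Finset.sum_eq_zero_iff_of_nonneg (fun i _ => Finset.sum_nonneg fun j _ =>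
        Complex.normSq_nonneg (β i j))).mp h0' i (Finset.mem_univ i)
      have h4 := (Finset.sum_eq_zero_iff_of_nonneg (fun j _ => Complex.normSq_nonneg (β i j))).mp h3 j
        (Finset.mem_univ j)
      exact Complex.normSq_eq_zero.mp h4
    rw [hαβ, hβ0]; simp
  have hsym := h.bivectorInner_weyl hy hEin hα hα's
  have hμ' : weylOperator G y α' = starRingEnd ℂ μ • α' := by
    rw [hα', weylOperator_conj, hμ]
    ext i j; simp
  rw [hμ, hμ'] at hsym
  have e1 : bivectorInner G y (μ • α) α' = μ * bivectorInner G y α α' := by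
    simp only [bivectorInner, Matrix.mul_smul, Matrix.smul_mul, Matrix.trace_smul, smul_eq_mul]; ring
  have e2 : bivectorInner G y α (starRingEnd ℂ μ • α') = starRingEnd ℂ μ * bivectorInner G y α α' := by
    simp only [bivectorInner, Matrix.mul_smul, Matrix.trace_smul, smul_eq_mul]; ring
  rw [e1, e2] at hsym
  exact (mul_right_cancel₀ hne hsym).symm

end LocalTheory

end EinsteinFour

end

noncomputable section

namespace EinsteinFour

/-! ### Change of coordinates -/

section CoordinateChange

open TopologicalSpace (Opens)

variable {V V' : Opens E4} {G G' : E4 → Matrix (Fin 4) (Fin 4) ℝ} {Φ : E4 → E4} {z : E4}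

/-- The Jacobian matrix. -/
def jacobian (Φ : E4 → E4) (z : E4) : Matrix (Fin 4) (Fin 4) ℝ :=
  Matrix.of fun b i => pderiv i (fun y => Φ y b) z

theorem sum_smul_single (v : E4) : ∑ i, v i • EuclideanSpace.single i (1 : ℝ) = v := by
  ext j
  simp [Pi.single_apply]

theorem fderiv_eq_sum_pderiv {F : Type*} [NormedAddCommGroup F] [NormedSpace ℝ F] (f : E4 → F)
    (y v : E4) : fderiv ℝ f y v = ∑ i, v i • pderiv i f y := by
  conv_lhs => rw [← sum_smul_single v]
  simp only [map_sum, map_smul, pderiv]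

theorem pderiv_apply {f : E4 → E4} {y : E4} (hf : DifferentiableAt ℝ f y) (i b : Fin 4) :
    pderiv i (fun z => f z b) y = pderiv i f y b := by
  have : (fun z => f z b) = (EuclideanSpace.proj b : E4 →L[ℝ] ℝ) ∘ f := rfl
  rw [pderiv, this, fderiv_comp _ (EuclideanSpace.proj b : E4 →L[ℝ] ℝ).differentiableAt hf,
    ContinuousLinearMap.fderiv]
  rfl

theorem pderiv_comp {F : Type*} [NormedAddCommGroup F] [NormedSpace ℝ F] {f : E4 → F}
    (hf : DifferentiableAt ℝ f (Φ z)) (hΦ : DifferentiableAt ℝ Φ z) (i : Fin 4) :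
    pderiv i (fun y => f (Φ y)) z = ∑ b, jacobian Φ z b i • pderiv b f (Φ z) := by
  rw [pderiv, fderiv_fun_comp z hf hΦ, ContinuousLinearMap.comp_apply, fderiv_eq_sum_pderiv]
  simp only [jacobian, Matrix.of_apply, pderiv_apply hΦ]
  rfl

/-- The composition with a smooth map. -/
def SmoothFun.comp (hΦ : ContDiffOn ℝ ∞ Φ V') (hm : ∀ z ∈ V', Φ z ∈ V) :
    SmoothFun V →+* SmoothFun V' where
  toFun f := ⟨fun z => f.1 ⟨Φ z, hm z z.2⟩, fun z => f.rep (Φ z), f.contDiffOn_rep.comp hΦ hm,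
    fun z => f.rep_apply ⟨Φ z, hm z z.2⟩⟩
  map_one' := rfl
  map_mul' _ _ := rfl
  map_zero' := rfl
  map_add' _ _ := rfl

theorem contDiffOn_coord (hΦ : ContDiffOn ℝ ∞ Φ V') (b : Fin 4) :
    ContDiffOn ℝ ∞ (fun y => Φ y b) V' :=
  (EuclideanSpace.proj b : E4 →L[ℝ] ℝ).contDiff.comp_contDiffOn hΦ

/-- The Jacobian matrix as a matrix of smooth functions. -/
def smoothJacobian (hΦ : ContDiffOn ℝ ∞ Φ V') : Matrix (Fin 4) (Fin 4) (SmoothFun V') :=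
  Matrix.of fun b i => SmoothFun.D i (SmoothFun.ofReal (fun y => Φ y b) (contDiffOn_coord hΦ b))

theorem eval_smoothJacobian (hΦ : ContDiffOn ℝ ∞ Φ V') (x : V') :
    (smoothJacobian hΦ).map (SmoothFun.eval x) = (jacobian Φ x).map Complex.ofReal := by
  ext b i
  exact SmoothFun.D_ofReal _ (contDiffOn_coord hΦ b) i x

theorem SmoothFun.D_comp (hΦ : ContDiffOn ℝ ∞ Φ V') (hm : ∀ z ∈ V', Φ z ∈ V) (i : Fin 4)
    (f : SmoothFun V) : SmoothFun.D i (SmoothFun.comp hΦ hm f) =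
      ∑ b, smoothJacobian hΦ b i * SmoothFun.comp hΦ hm (SmoothFun.D b f) := by
  refine SmoothFun.ext fun x => ?_
  rw [SmoothFun.D_apply (F := fun z => f.rep (Φ z)) (fun z => f.rep_apply ⟨Φ z, hm z z.2⟩),
    pderiv_comp (differentiableAt_of_contDiffOn V.2 f.contDiffOn_rep (hm x x.2))
      (differentiableAt_of_contDiffOn V'.2 hΦ x.2), ← SmoothFun.eval_apply, map_sum]
  refine Finset.sum_congr rfl fun b _ => ?_
  rw [map_mul]
  have := congrFun (congrFun (eval_smoothJacobian hΦ x) b) i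
  simp only [Matrix.map_apply] at this
  rw [this]
  rfl

/-- The tensor `T'` is the pullback of `T` under a linear map with the matrix `J`. -/
def IsTensorPullback (J : Matrix (Fin 4) (Fin 4) ℝ) (T' T : Fin 4 → Fin 4 → Fin 4 → Fin 4 → ℝ) : Prop :=
  ∀ i j k l, T' i j k l =
    ∑ a, ∑ b, J a i * J b j * (J.transpose * Matrix.of (T a b) * J) k l

section LeviCivita

variable {A B : Type*} [CommRing A] [Algebra ℂ A] [CommRing B] [Algebra ℂ B]

/-- The transformation rule of the curvature. -/
theorem IsLeviCivita.mul_connCurv_pullback {D : Fin 4 → Derivation ℂ A A}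
    {D' : Fin 4 → Derivation ℂ B B} (hD' : ∀ i j f, D' i (D' j f) = D' j (D' i f))
    {φ : A →+* B} {J K H' : Matrix (Fin 4) (Fin 4) B}
    (hφ : ∀ i f, D' i (φ f) = ∑ b, J b i * φ (D b f))
    (hJ : ∀ i j b, D' i (J b j) = D' j (J b i)) (hJK : J * K = 1)
    {G : Matrix (Fin 4) (Fin 4) A} {Γ : Fin 4 → Matrix (Fin 4) (Fin 4) A}
    {G' : Matrix (Fin 4) (Fin 4) B} {Γ' : Fin 4 → Matrix (Fin 4) (Fin 4) B}
    (h : IsLeviCivita D G Γ) (h' : IsLeviCivita D' G' Γ') (hG' : G'.transpose = G')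
    (hH' : H' * G' = 1) (hG : G' = J.transpose * G.map φ * J) (i j : Fin 4) :
    G' * connCurv D' Γ' i j =
      ∑ b, ∑ c, (J b i * J c j) • (J.transpose * (G * connCurv D Γ b c).map φ * J) := by
  -- Uniqueness of the Levi-Civita connection replaces the classical computation of the transformed
  -- Christoffel symbols.
  have h1 : Γ' = fun i => K * (J.map (D' i) + pullbackConn φ J Γ i * J) :=
    h'.unique (hG ▸ h.pullback hφ hJ hJK) hG' hH'
  have h2 : ∀ i, J * Γ' i = J.map (D' i) + pullbackConn φ J Γ i * J := by
    intro i
    rw [h1, ← Matrix.mul_assoc, hJK, Matrix.one_mul]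
  have h3 := connCurv_gauge hD' h2 i j
  rw [hG, Matrix.mul_assoc, h3, connCurv_pullback hφ hJ]
  simp only [Finset.sum_mul, Finset.mul_sum, Matrix.smul_mul, Matrix.mul_smul, Matrix.map_mul,
    Matrix.mul_assoc]

end LeviCivita

theorem IsLocalMetric.det_jacobian_ne_zero (h' : IsLocalMetric V' G')
    (hG : ∀ z ∈ V', G' z = (jacobian Φ z).transpose * G (Φ z) * jacobian Φ z) (hz : z ∈ V') :
    (jacobian Φ z).det ≠ 0 := by
  intro h0
  apply h'.det_ne_zero z hz
  rw [hG z hz, Matrix.det_mul, h0, mul_zero]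

theorem isUnit_smoothFun {f : SmoothFun V} (hf : ∀ x : V, f.1 x ≠ 0) : IsUnit f := by
  have hs : ContDiffOn ℝ ∞ (fun z => (f.rep z)⁻¹) V :=
    f.contDiffOn_rep.inv fun z hz => by rw [f.rep_apply ⟨z, hz⟩]; exact hf ⟨z, hz⟩
  refine IsUnit.of_mul_eq_one (SmoothFun.mk _ hs) (SmoothFun.ext fun x => ?_)
  rw [← SmoothFun.eval_apply, map_mul, SmoothFun.eval_apply, SmoothFun.eval_apply, SmoothFun.mk_apply,
    f.rep_apply, mul_inv_cancel₀ (hf x), ← SmoothFun.eval_apply, map_one]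

theorem isUnit_det_smoothJacobian (hΦ : ContDiffOn ℝ ∞ Φ V')
    (hd : ∀ z ∈ V', (jacobian Φ z).det ≠ 0) : IsUnit (smoothJacobian hΦ).det := by
  refine isUnit_smoothFun fun x => ?_
  rw [← SmoothFun.eval_apply, AlgHom.map_det]
  have : (SmoothFun.eval x).mapMatrix (smoothJacobian hΦ) =
      Complex.ofRealHom.mapMatrix (jacobian Φ x) := eval_smoothJacobian hΦ x
  rw [this, ← RingHom.map_det]
  exact Complex.ofReal_ne_zero.mpr (hd x x.2)

theorem IsLocalMetric.mat_pullback (h : IsLocalMetric V G) (h' : IsLocalMetric V' G')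
    (hΦ : ContDiffOn ℝ ∞ Φ V') (hm : ∀ z ∈ V', Φ z ∈ V)
    (hG : ∀ z ∈ V', G' z = (jacobian Φ z).transpose * G (Φ z) * jacobian Φ z) :
    h'.mat = (smoothJacobian hΦ).transpose * h.mat.map (SmoothFun.comp hΦ hm) *
      smoothJacobian hΦ := by
  refine matrix_ext_eval fun x => ?_
  rw [Matrix.map_mul, Matrix.map_mul, Matrix.transpose_map, eval_smoothJacobian, h'.eval_mat,
    hG x x.2, map_ofReal_mul, map_ofReal_mul]
  rfl

theorem eval_conj_smoothJacobian (hΦ : ContDiffOn ℝ ∞ Φ V') (x : V')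
    {C : Matrix (Fin 4) (Fin 4) (SmoothFun V')} {N : Matrix (Fin 4) (Fin 4) ℝ}
    (hC : C.map (SmoothFun.eval x) = -N.transpose.map Complex.ofReal) (k l : Fin 4) :
    (((smoothJacobian hΦ).transpose * C * smoothJacobian hΦ) l k).1 x =
      -(((jacobian Φ x).transpose * N * jacobian Φ x) k l : ℝ) := by
  have h2 : ((smoothJacobian hΦ).transpose * C * smoothJacobian hΦ).map (SmoothFun.eval x) =
      -(((jacobian Φ x).transpose * N * jacobian Φ x).transpose).map Complex.ofReal := by
    rw [Matrix.map_mul, Matrix.map_mul, Matrix.transpose_map, eval_smoothJacobian, hC,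
      Matrix.transpose_mul, Matrix.transpose_mul, map_ofReal_mul, map_ofReal_mul,
      Matrix.transpose_transpose, ← Matrix.transpose_map]
    simp only [Matrix.mul_neg, Matrix.neg_mul, Matrix.mul_assoc]
  exact congrFun (congrFun h2 l) k

theorem SmoothFun.sum_smul_apply (x : V) (J : Fin 4 → Fin 4 → SmoothFun V)
    (C : Fin 4 → Fin 4 → Matrix (Fin 4) (Fin 4) (SmoothFun V)) (l k : Fin 4) :
    ((∑ b, ∑ c, J b c • C b c) l k).1 x = ∑ b, ∑ c, (J b c).1 x * (C b c l k).1 x := by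
  rw [← SmoothFun.eval_apply]
  simp only [Matrix.sum_apply, Matrix.smul_apply, smul_eq_mul, map_sum, map_mul, SmoothFun.eval_apply]

theorem IsLocalMetric.curvatureLow_pullback (h : IsLocalMetric V G) (h' : IsLocalMetric V' G')
    (hΦ : ContDiffOn ℝ ∞ Φ V') (hm : ∀ z ∈ V', Φ z ∈ V)
    (hG : ∀ z ∈ V', G' z = (jacobian Φ z).transpose * G (Φ z) * jacobian Φ z) (hz : z ∈ V') :
    IsTensorPullback (jacobian Φ z) (fun i j k l => curvatureLow G' i j k l z)
      (fun i j k l => curvatureLow G i j k l (Φ z)) := by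
  intro i j k l
  have key := h.isLeviCivita.mul_connCurv_pullback (SmoothFun.D_comm (V := V'))
    (SmoothFun.D_comp hΦ hm) (J := smoothJacobian hΦ)
    (fun i j b => SmoothFun.D_comm (V := V') i j _)
    (Matrix.mul_nonsing_inv _ (isUnit_det_smoothJacobian hΦ fun z hz => h'.det_jacobian_ne_zero hG hz))
    h'.isLeviCivita h'.mat_transpose h'.invMat_mul (h.mat_pullback h' hΦ hm hG) i j
  have h1 := congrArg (fun M : Matrix (Fin 4) (Fin 4) (SmoothFun V') => (M l k).1 ⟨z, hz⟩) key
  have h2 : ∀ b c, (((h.mat * connCurv SmoothFun.D h.conn b c).map (SmoothFun.comp hΦ hm)).map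
      (SmoothFun.eval ⟨z, hz⟩)) =
      -(Matrix.of (fun c' d => curvatureLow G b c c' d (Φ z))).transpose.map Complex.ofReal := by
    intro b c
    ext p q
    exact h.mat_mul_connCurv_apply b c p q ⟨Φ z, hm z hz⟩
  have hJ : ∀ b i, (smoothJacobian hΦ b i).1 ⟨z, hz⟩ = ((jacobian Φ z b i : ℝ) : ℂ) := fun b i =>
    congrFun (congrFun (eval_smoothJacobian hΦ ⟨z, hz⟩) b) i
  have h3 : ∀ b c, (smoothJacobian hΦ b i * smoothJacobian hΦ c j).1 ⟨z, hz⟩ =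
      ((jacobian Φ z b i * jacobian Φ z c j : ℝ) : ℂ) := by
    intro b c
    rw [← SmoothFun.eval_apply, map_mul, SmoothFun.eval_apply, SmoothFun.eval_apply, hJ, hJ]
    push_cast; rfl
  rw [h'.mat_mul_connCurv_apply, SmoothFun.sum_smul_apply] at h1
  simp only [eval_conj_smoothJacobian hΦ ⟨z, hz⟩ (h2 _ _), h3] at h1
  simp only [mul_neg, Finset.sum_neg_distrib, neg_inj] at h1
  exact_mod_cast h1

end CoordinateChange

end EinsteinFour

end

noncomputable section

namespace EinsteinFour

/-! ### Transformation of curvature, Hodge star and Weyl spectrum at a point -/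

section PointwiseCoordinateChange

open TopologicalSpace (Opens)

variable {G G' : E4 → Matrix (Fin 4) (Fin 4) ℝ} {z y : E4} {J : Matrix (Fin 4) (Fin 4) ℝ}

theorem isTensorPullback_iff {T' T : Fin 4 → Fin 4 → Fin 4 → Fin 4 → ℝ} :
    IsTensorPullback J T' T ↔ ∀ i j k l, T' i j k l =
      ∑ a, ∑ b, ∑ c, ∑ d, J a i * J b j * (J c k * J d l * T a b c d) := by
  refine forall_congr' fun i => forall_congr' fun j => forall_congr' fun k => forall_congr' fun l => ?_
  refine Eq.congr_right (Finset.sum_congr rfl fun a _ => Finset.sum_congr rfl fun b _ => ?_)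
  simp only [Matrix.mul_apply, Matrix.transpose_apply, Matrix.of_apply, Finset.sum_mul, Finset.mul_sum]
  rw [Finset.sum_comm]
  refine Finset.sum_congr rfl fun c _ => Finset.sum_congr rfl fun d _ => ?_
  ring

theorem IsTensorPullback.sub {T' T S' S : Fin 4 → Fin 4 → Fin 4 → Fin 4 → ℝ}
    (hT : IsTensorPullback J T' T) (hS : IsTensorPullback J S' S) :
    IsTensorPullback J (fun i j k l => T' i j k l - S' i j k l)
      (fun i j k l => T i j k l - S i j k l) := by
  rw [isTensorPullback_iff] at *
  intro i j k l
  simp only [hT i j k l, hS i j k l, mul_sub, Finset.sum_sub_distrib]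

theorem IsTensorPullback.const_mul {T' T : Fin 4 → Fin 4 → Fin 4 → Fin 4 → ℝ} (r : ℝ)
    (hT : IsTensorPullback J T' T) :
    IsTensorPullback J (fun i j k l => r * T' i j k l) (fun i j k l => r * T i j k l) := by
  rw [isTensorPullback_iff] at *
  intro i j k l
  simp only [hT i j k l, Finset.mul_sum]
  refine Finset.sum_congr rfl fun a _ => Finset.sum_congr rfl fun b _ =>
    Finset.sum_congr rfl fun c _ => Finset.sum_congr rfl fun d _ => ?_
  ring

theorem conj_apply (J N : Matrix (Fin 4) (Fin 4) ℝ) (i k : Fin 4) :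
    (J.transpose * N * J) i k = ∑ a, ∑ c, J a i * J c k * N a c := by
  simp only [Matrix.mul_apply, Matrix.transpose_apply, Finset.sum_mul]
  rw [Finset.sum_comm]
  refine Finset.sum_congr rfl fun a _ => Finset.sum_congr rfl fun c _ => ?_
  ring

theorem isTensorPullback_mul {N' N P' P : Matrix (Fin 4) (Fin 4) ℝ}
    (hN : N' = J.transpose * N * J) (hP : P' = J.transpose * P * J) :
    IsTensorPullback J (fun i j k l => N' i k * P' j l) (fun i j k l => N i k * P j l) := by
  rw [isTensorPullback_iff]
  intro i j k l
  rw [hN, hP]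
  simp only [conj_apply, Finset.sum_mul_sum]
  refine Finset.sum_congr rfl fun a _ => Finset.sum_congr rfl fun b _ => ?_
  refine Finset.sum_congr rfl fun c _ => Finset.sum_congr rfl fun d _ => ?_
  ring

theorem isTensorPullback_mul_swap {N' N P' P : Matrix (Fin 4) (Fin 4) ℝ}
    (hN : N' = J.transpose * N * J) (hP : P' = J.transpose * P * J) :
    IsTensorPullback J (fun i j k l => N' i l * P' j k) (fun i j k l => N i l * P j k) := by
  rw [isTensorPullback_iff]
  intro i j k l
  rw [hN, hP]
  simp only [conj_apply, Finset.sum_mul_sum]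
  refine Finset.sum_congr rfl fun a _ => Finset.sum_congr rfl fun b _ => ?_
  rw [Finset.sum_comm]
  refine Finset.sum_congr rfl fun c _ => Finset.sum_congr rfl fun d _ => ?_
  ring

/-- The metric matrices `A'` and `A` correspond to each other under a change of coordinates. -/
structure IsMetricPullback (J A' A : Matrix (Fin 4) (Fin 4) ℝ) : Prop where
  eq : A' = J.transpose * A * J
  symm : A.transpose = A
  det_ne_zero : A.det ≠ 0
  det_jacobian : J.det ≠ 0

section

variable {A' A : Matrix (Fin 4) (Fin 4) ℝ}

theorem IsMetricPullback.inv_eq (h : IsMetricPullback J A' A) :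
    J * A'⁻¹ * J.transpose = A⁻¹ := by
  have hJ : IsUnit J.det := isUnit_iff_ne_zero.mpr h.det_jacobian
  have hJ' : IsUnit J.transpose.det := by rwa [Matrix.det_transpose]
  rw [h.eq, Matrix.mul_inv_rev, Matrix.mul_inv_rev, ← Matrix.mul_assoc, Matrix.mul_nonsing_inv _ hJ,
    Matrix.one_mul, Matrix.mul_assoc, Matrix.nonsing_inv_mul _ hJ', Matrix.mul_one]

theorem IsMetricPullback.det_eq (h : IsMetricPullback J A' A) : A'.det = J.det ^ 2 * A.det := by
  rw [h.eq, Matrix.det_mul, Matrix.det_mul, Matrix.det_transpose]; ring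

theorem IsMetricPullback.symm' (h : IsMetricPullback J A' A) : A'.transpose = A' := by
  rw [h.eq, Matrix.transpose_mul, Matrix.transpose_mul, h.symm, Matrix.transpose_transpose,
    Matrix.mul_assoc]

theorem IsMetricPullback.det_ne_zero' (h : IsMetricPullback J A' A) : A'.det ≠ 0 := by
  rw [h.det_eq]
  exact mul_ne_zero (pow_ne_zero 2 h.det_jacobian) h.det_ne_zero

/-- The metric trace of the pullback of a matrix. -/
theorem IsMetricPullback.trace (h : IsMetricPullback J A' A) (N : Matrix (Fin 4) (Fin 4) ℝ) :
    (A'⁻¹ * (J.transpose * N * J)).trace = (A⁻¹ * N).trace := by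
  rw [← h.inv_eq, ← Matrix.mul_assoc, Matrix.trace_mul_comm, ← Matrix.mul_assoc, ← Matrix.mul_assoc]

end

/-- In terms of the lowered curvature the Ricci tensor is a metric trace, and metric traces
transform by `IsMetricPullback.trace`. -/
theorem ricci_eq (hd : (G y).det ≠ 0) (i k : Fin 4) :
    ricci G i k y = ((G y)⁻¹ * Matrix.of fun j l => curvatureLow G i j k l y).trace := by
  have hc : ∀ j, curvature G i j k j y = ∑ l, curvatureLow G i j k l y * (G y)⁻¹ l j := by
    intro j
    have e : (fun l => curvatureLow G i j k l y) = Matrix.vecMul (fun m => curvature G i j k m y) (G y) :=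
      rfl
    have e2 := congrFun (congrArg (fun v => Matrix.vecMul v (G y)⁻¹) e) j
    rw [Matrix.vecMul_vecMul, Matrix.mul_nonsing_inv _ (isUnit_iff_ne_zero.mpr hd),
      Matrix.vecMul_one] at e2
    exact e2.symm
  rw [ricci, Matrix.trace_mul_comm, Matrix.trace]
  refine Finset.sum_congr rfl fun j _ => ?_
  rw [hc, Matrix.diag_apply, Matrix.mul_apply]
  rfl

theorem ricci_pullback (h : IsMetricPullback J (G' z) (G y))
    (hR : IsTensorPullback J (fun i j k l => curvatureLow G' i j k l z)
      (fun i j k l => curvatureLow G i j k l y)) :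
    (Matrix.of fun i k => ricci G' i k z) = J.transpose * (Matrix.of fun i k => ricci G i k y) * J := by
  ext i k
  rw [conj_apply, Matrix.of_apply, ricci_eq h.det_ne_zero']
  simp only [Matrix.of_apply]
  have e : (Matrix.of fun j l => curvatureLow G' i j k l z) =
      ∑ a, ∑ c, (J a i * J c k) • (J.transpose * (Matrix.of fun b d => curvatureLow G a b c d y) * J) := by
    ext j l
    have := isTensorPullback_iff.mp hR i j k l
    rw [Matrix.of_apply, this]
    simp only [Matrix.sum_apply, Matrix.smul_apply, conj_apply, smul_eq_mul, Matrix.of_apply,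
      Finset.mul_sum]
    refine Finset.sum_congr rfl fun a _ => ?_
    rw [Finset.sum_comm]
    refine Finset.sum_congr rfl fun c _ => Finset.sum_congr rfl fun b _ =>
      Finset.sum_congr rfl fun d _ => ?_
    ring
  rw [e]
  simp only [Finset.mul_sum, Matrix.trace_sum, Matrix.mul_smul, Matrix.trace_smul, h.trace, smul_eq_mul,
    ricci_eq h.det_ne_zero]

theorem scalarCurvature_eq (hs : (G y).transpose = G y) :
    scalarCurvature G y = ((G y)⁻¹ * Matrix.of fun i k => ricci G i k y).trace := by
  have hsi : ((G y)⁻¹).transpose = (G y)⁻¹ := by rw [Matrix.transpose_nonsing_inv, hs]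
  rw [← hsi, Matrix.trace, scalarCurvature, Finset.sum_comm]
  rfl

theorem scalarCurvature_pullback (h : IsMetricPullback J (G' z) (G y))
    (hR : IsTensorPullback J (fun i j k l => curvatureLow G' i j k l z)
      (fun i j k l => curvatureLow G i j k l y)) : scalarCurvature G' z = scalarCurvature G y := by
  rw [scalarCurvature_eq h.symm', scalarCurvature_eq h.symm, ricci_pullback h hR, h.trace]

theorem einstein_pullback (h : IsMetricPullback J (G' z) (G y))
    (hR : IsTensorPullback J (fun i j k l => curvatureLow G' i j k l z)
      (fun i j k l => curvatureLow G i j k l y))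
    (hEin : ∀ i k, ricci G i k y = scalarCurvature G y / 4 * G y i k) (i k : Fin 4) :
    ricci G' i k z = scalarCurvature G' z / 4 * G' z i k := by
  have e : (Matrix.of fun i k => ricci G i k y) = (scalarCurvature G y / 4) • G y := by
    ext i k; exact hEin i k
  have h1 := congrFun (congrFun (ricci_pullback h hR) i) k
  rw [e, Matrix.mul_smul, Matrix.smul_mul, ← h.eq] at h1
  rw [scalarCurvature_pullback h hR]
  exact h1

/-- By the Einstein condition W is R minus a multiple of a product of metrics, and each of these
tensors is known to transform correctly. -/
theorem weyl_pullback (h : IsMetricPullback J (G' z) (G y))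
    (hR : IsTensorPullback J (fun i j k l => curvatureLow G' i j k l z)
      (fun i j k l => curvatureLow G i j k l y))
    (hEin : ∀ i k, ricci G i k y = scalarCurvature G y / 4 * G y i k) :
    IsTensorPullback J (fun i j k l => weyl G' i j k l z) (fun i j k l => weyl G i j k l y) := by
  simp only [weyl_of_einstein hEin, weyl_of_einstein (einstein_pullback h hR hEin),
    scalarCurvature_pullback h hR]
  exact hR.sub (((isTensorPullback_mul h.eq h.eq).sub (isTensorPullback_mul_swap h.eq h.eq)).const_mul _)

/-- The root of |det G| acquires the factor |det J| and the orientation sign acquires sign(det J);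
the product is the determinant that the Levi-Civita symbol demands. -/
theorem volumeForm_pullback (h : IsMetricPullback J (G' z) (G y)) {ε ε' : E4 → ℝ}
    (hε : ε' z = ε y * SignType.sign J.det) :
    IsTensorPullback J (fun i j k l => volumeForm G' ε' i j k l z)
      (fun i j k l => volumeForm G ε i j k l y) := by
  rw [isTensorPullback_iff]
  intro i j k l
  have h1 : ∑ a, ∑ b, ∑ c, ∑ d, leviCivitaSymbol a b c d * (J a i * J b j * J c k * J d l) =
      J.det * leviCivitaSymbol i j k l := by
    have := sum_leviCivitaSymbol (J.map Complex.ofReal) i j k l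
    have hd : (J.map Complex.ofReal).det = ((J.det : ℝ) : ℂ) := by
      rw [← Complex.ofRealHom_eq_coe, RingHom.map_det]; rfl
    rw [hd] at this
    simp only [Matrix.map_apply] at this
    exact_mod_cast this
  have h2 : ε' z * Real.sqrt |(G' z).det| = ε y * Real.sqrt |(G y).det| * J.det := by
    rw [h.det_eq, abs_mul, abs_pow, Real.sqrt_mul (by positivity), Real.sqrt_sq (abs_nonneg _), hε]
    have := sign_mul_abs J.det
    linear_combination (ε y * Real.sqrt |(G y).det|) * this
  simp only [volumeForm]
  rw [h2, mul_assoc, ← h1, Finset.mul_sum]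
  refine Finset.sum_congr rfl fun a _ => ?_
  rw [Finset.mul_sum]
  refine Finset.sum_congr rfl fun b _ => ?_
  rw [Finset.mul_sum]
  refine Finset.sum_congr rfl fun c _ => ?_
  rw [Finset.mul_sum]
  refine Finset.sum_congr rfl fun d _ => ?_
  ring

/-- The action of a linear map with a real matrix on bivectors. -/
def pushBivector (J : Matrix (Fin 4) (Fin 4) ℝ) :
    Matrix (Fin 4) (Fin 4) ℂ →ₗ[ℂ] Matrix (Fin 4) (Fin 4) ℂ where
  toFun α := J.map Complex.ofReal * α * (J.map Complex.ofReal).transpose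
  map_add' _ _ := by rw [Matrix.mul_add, Matrix.add_mul]
  map_smul' _ _ := by rw [Matrix.mul_smul, Matrix.smul_mul]; rfl

theorem pushBivector_apply (α : Matrix (Fin 4) (Fin 4) ℂ) :
    pushBivector J α = J.map Complex.ofReal * α * (J.map Complex.ofReal).transpose := rfl

theorem pushBivector_mul (J K : Matrix (Fin 4) (Fin 4) ℝ) (α : Matrix (Fin 4) (Fin 4) ℂ) :
    pushBivector (J * K) α = pushBivector J (pushBivector K α) := by
  simp only [pushBivector_apply, map_ofReal_mul, Matrix.transpose_mul, Matrix.mul_assoc]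

theorem pushBivector_one (α : Matrix (Fin 4) (Fin 4) ℂ) : pushBivector 1 α = α := by
  rw [pushBivector_apply, map_ofReal_one, Matrix.transpose_one, Matrix.mul_one, Matrix.one_mul]

theorem pushBivector_bijective (hJ : J.det ≠ 0) : Function.Bijective (pushBivector J) := by
  have hu : IsUnit J.det := isUnit_iff_ne_zero.mpr hJ
  refine Function.bijective_iff_has_inverse.mpr ⟨pushBivector J⁻¹, fun α => ?_, fun α => ?_⟩
  · rw [← pushBivector_mul, Matrix.nonsing_inv_mul _ hu, pushBivector_one]
  · rw [← pushBivector_mul, Matrix.mul_nonsing_inv _ hu, pushBivector_one]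

/-- Naturality of the operator defined by a tensor. Used both for the Weyl tensor and for the volume
form, it identifies the self-dual spaces and the spectra in two charts. -/
theorem pushBivector_bivectorOperator (h : IsMetricPullback J (G' z) (G y))
    {T' T : Fin 4 → Fin 4 → Fin 4 → Fin 4 → E4 → ℝ}
    (hT : IsTensorPullback J (fun i j k l => T' i j k l z) (fun i j k l => T i j k l y))
    (α : Matrix (Fin 4) (Fin 4) ℂ) :
    pushBivector J (bivectorOperator G' T' z α) = bivectorOperator G T y (pushBivector J α) := by
  have hinv : ((G y)⁻¹).map Complex.ofReal = J.map Complex.ofReal * ((G' z)⁻¹).map Complex.ofReal *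
      (J.map Complex.ofReal).transpose := by
    rw [← h.inv_eq, map_ofReal_mul, map_ofReal_mul, Matrix.transpose_map]
  have key : (Matrix.of fun p q => (1 / 2 : ℂ) * ∑ i, ∑ j, (T' i j p q z : ℂ) * α i j) =
      (J.map Complex.ofReal).transpose *
        (Matrix.of fun p q => (1 / 2 : ℂ) * ∑ i, ∑ j, (T i j p q y : ℂ) * pushBivector J α i j) *
        J.map Complex.ofReal := by
    have e : ∀ (T : Fin 4 → Fin 4 → Fin 4 → Fin 4 → E4 → ℝ) (y : E4) (α : Matrix (Fin 4) (Fin 4) ℂ),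
        (Matrix.of fun p q => (1 / 2 : ℂ) * ∑ i, ∑ j, (T i j p q y : ℂ) * α i j) =
        (1 / 2 : ℂ) • ∑ i, ∑ j, α i j • (Matrix.of fun p q => T i j p q y).map Complex.ofReal := by
      intro T y α
      ext p q
      simp only [Matrix.of_apply, Matrix.smul_apply, Matrix.sum_apply, Matrix.map_apply, smul_eq_mul]
      simp only [mul_comm (α _ _)]
    have hT' : ∀ i j, (Matrix.of fun p q => T' i j p q z).map Complex.ofReal =
        ∑ a, ∑ b, ((J a i : ℂ) * (J b j : ℂ)) • ((J.map Complex.ofReal).transpose *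
          (Matrix.of fun p q => T a b p q y).map Complex.ofReal * J.map Complex.ofReal) := by
      intro i j
      ext p q
      have h1 := hT i j p q
      have h2 : ∀ a b, ((J.map Complex.ofReal).transpose *
          (Matrix.of fun p q => T a b p q y).map Complex.ofReal * J.map Complex.ofReal) p q =
          (((J.transpose * Matrix.of (fun p q => T a b p q y) * J) p q : ℝ) : ℂ) := by
        intro a b
        rw [← Matrix.transpose_map, ← map_ofReal_mul, ← map_ofReal_mul]
        rfl
      simp only [Matrix.sum_apply, Matrix.smul_apply, Matrix.map_apply, Matrix.of_apply, smul_eq_mul,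
        h2, h1]
      push_cast
      rfl
    have hp : ∀ a b, pushBivector J α a b = ∑ i, ∑ j, α i j * ((J a i : ℂ) * (J b j : ℂ)) := by
      intro a b
      simp only [pushBivector_apply, Matrix.mul_apply, Matrix.map_apply, Matrix.transpose_apply,
        Finset.sum_mul]
      rw [Finset.sum_comm]
      refine Finset.sum_congr rfl fun i _ => Finset.sum_congr rfl fun j _ => ?_
      ring
    rw [e, e, Matrix.mul_smul, Matrix.smul_mul]
    congr 1
    simp only [hT', hp, Finset.mul_sum, Finset.sum_mul, Matrix.mul_smul, Matrix.smul_mul, Finset.smul_sum,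
      Finset.sum_smul, smul_smul]
    have sw : ∀ f : Fin 4 → Fin 4 → Fin 4 → Fin 4 → Matrix (Fin 4) (Fin 4) ℂ,
        ∑ i, ∑ j, ∑ a, ∑ b, f i j a b = ∑ a, ∑ b, ∑ i, ∑ j, f i j a b := by
      intro f
      have h1 : ∀ i, ∑ j, ∑ a, ∑ b, f i j a b = ∑ a, ∑ b, ∑ j, f i j a b := by
        intro i
        rw [Finset.sum_comm]
        exact Finset.sum_congr rfl fun a _ => Finset.sum_comm
      simp only [h1]
      rw [Finset.sum_comm]
      exact Finset.sum_congr rfl fun a _ => Finset.sum_comm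
    exact sw _
  rw [bivectorOperator_eq T' h.symm', bivectorOperator_eq T h.symm, key, hinv, pushBivector_apply]
  simp only [Matrix.mul_assoc]

theorem pushBivector_mem_bivectors (hJ : J.det ≠ 0) {α : Matrix (Fin 4) (Fin 4) ℂ} :
    pushBivector J α ∈ bivectors ↔ α ∈ bivectors := by
  rw [mem_bivectors, mem_bivectors]
  have e : (pushBivector J α).transpose = pushBivector J α.transpose := by
    simp only [pushBivector_apply, Matrix.transpose_mul, Matrix.transpose_transpose, Matrix.mul_assoc]
  rw [e, ← map_neg, (pushBivector_bijective hJ).1.eq_iff]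

theorem starEigenvalue_pullback (h : IsMetricPullback J (G' z) (G y)) :
    starEigenvalue G' z = starEigenvalue G y := by
  have : 0 < (G' z).det ↔ 0 < (G y).det := by
    rw [h.det_eq]
    exact mul_pos_iff_of_pos_left (sq_pos_of_ne_zero h.det_jacobian)
  simp only [starEigenvalue, this]

theorem pushBivector_mem_selfDual (h : IsMetricPullback J (G' z) (G y)) {ε ε' : E4 → ℝ}
    (hε : ε' z = ε y * SignType.sign J.det) {α : Matrix (Fin 4) (Fin 4) ℂ} :
    pushBivector J α ∈ selfDual G ε y ↔ α ∈ selfDual G' ε' z := by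
  rw [selfDual, selfDual, Submodule.mem_inf, Submodule.mem_inf, pushBivector_mem_bivectors h.det_jacobian,
    Module.End.mem_eigenspace_iff, Module.End.mem_eigenspace_iff, hodgeStar, hodgeStar,
    ← pushBivector_bivectorOperator h (volumeForm_pullback h hε), starEigenvalue_pullback h, ← map_smul,
    (pushBivector_bijective h.det_jacobian).1.eq_iff]

theorem pushBivector_eigenvector (h : IsMetricPullback J (G' z) (G y))
    (hR : IsTensorPullback J (fun i j k l => curvatureLow G' i j k l z)
      (fun i j k l => curvatureLow G i j k l y))
    (hEin : ∀ i k, ricci G i k y = scalarCurvature G y / 4 * G y i k) {ε ε' : E4 → ℝ}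
    (hε : ε' z = ε y * SignType.sign J.det) {α : Matrix (Fin 4) (Fin 4) ℂ} {μ : ℂ} :
    (pushBivector J α ∈ selfDual G ε y ∧ pushBivector J α ≠ 0 ∧
      weylOperator G y (pushBivector J α) = μ • pushBivector J α) ↔
    (α ∈ selfDual G' ε' z ∧ α ≠ 0 ∧ weylOperator G' z α = μ • α) := by
  have hb := pushBivector_bijective h.det_jacobian
  rw [pushBivector_mem_selfDual h hε, weylOperator, weylOperator,
    ← pushBivector_bivectorOperator h (weyl_pullback h hR hEin), ← map_smul, hb.1.eq_iff,
    (map_ne_zero_iff _ hb.1)]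

theorem weylEigenvalues_pullback (h : IsMetricPullback J (G' z) (G y))
    (hR : IsTensorPullback J (fun i j k l => curvatureLow G' i j k l z)
      (fun i j k l => curvatureLow G i j k l y))
    (hEin : ∀ i k, ricci G i k y = scalarCurvature G y / 4 * G y i k) {ε ε' : E4 → ℝ}
    (hε : ε' z = ε y * SignType.sign J.det) : weylEigenvalues G' ε' z = weylEigenvalues G ε y := by
  ext μ
  have hb := pushBivector_bijective h.det_jacobian
  exact (exists_congr fun α => (pushBivector_eigenvector h hR hEin hε).symm).trans
    (hb.2.exists (p := fun α => α ∈ selfDual G ε y ∧ α ≠ 0 ∧ weylOperator G y α = μ • α)).symm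

theorem WeylDiagonalizable.pullback (h : IsMetricPullback J (G' z) (G y))
    (hR : IsTensorPullback J (fun i j k l => curvatureLow G' i j k l z)
      (fun i j k l => curvatureLow G i j k l y))
    (hEin : ∀ i k, ricci G i k y = scalarCurvature G y / 4 * G y i k) {ε ε' : E4 → ℝ}
    (hε : ε' z = ε y * SignType.sign J.det) (hdiag : WeylDiagonalizable G ε y) :
    WeylDiagonalizable G' ε' z := by
  have hb := pushBivector_bijective h.det_jacobian
  have e : selfDual G ε y = (selfDual G' ε' z).map (pushBivector J) := by
    ext α
    obtain ⟨β, rfl⟩ := hb.2 α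
    rw [pushBivector_mem_selfDual h hε, Submodule.mem_map]
    exact ⟨fun hβ => ⟨β, hβ, rfl⟩, fun ⟨β', h1, h2⟩ => hb.1 h2 ▸ h1⟩
  refine Submodule.map_injective_of_injective hb.1 ?_
  rw [Submodule.map_span, ← e, ← hdiag]
  congr 1
  ext α
  obtain ⟨β, rfl⟩ := hb.2 α
  rw [hb.1.mem_set_image]
  exact exists_congr fun μ => (pushBivector_eigenvector h hR hEin hε).symm

end PointwiseCoordinateChange

end EinsteinFour

end

noncomputable section

namespace EinsteinFour

/-! ### Coordinate vector fields on a manifold -/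

section CoordinateFields

variable {M : Type*} [TopologicalSpace M] [ChartedSpace E4 M]

/-- The derivative of the preferred chart at `x₀`. -/
def chartDeriv (x₀ x : M) : E4 →L[ℝ] E4 := mfderiv (𝓡 4) 𝓘(ℝ, E4) (extChartAt (𝓡 4) x₀) x

/-- The derivative of the inverse of the preferred chart at `x₀`. -/
def chartInvDeriv (x₀ : M) (y : E4) : E4 →L[ℝ] E4 :=
  mfderiv 𝓘(ℝ, E4) (𝓡 4) (extChartAt (𝓡 4) x₀).symm y

/-- The vector field on `M` with the components `u` in the preferred chart at `x₀`. -/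
def coordField (x₀ : M) (u : E4 → E4) (x : M) : TangentSpace (𝓡 4) x :=
  VectorField.mpullback (𝓡 4) 𝓘(ℝ, E4) (extChartAt (𝓡 4) x₀) u x

variable {x₀ x : M} {y : E4}

theorem isOpen_preimage_chart {S : Set E4} (hS : IsOpen S) :
    IsOpen ((extChartAt (𝓡 4) x₀).source ∩ extChartAt (𝓡 4) x₀ ⁻¹' S) :=
  (continuousOn_extChartAt x₀).isOpen_inter_preimage (isOpen_extChartAt_source x₀) hS

theorem coordField_congr {u v : E4 → E4} (h : u (extChartAt (𝓡 4) x₀ x) = v (extChartAt (𝓡 4) x₀ x)) :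
    coordField x₀ u x = coordField x₀ v x := by
  change (chartDeriv x₀ x).inverse _ = (chartDeriv x₀ x).inverse _
  exact congrArg _ h

variable [IsManifold (𝓡 4) ∞ M]

theorem isManifold_one : IsManifold (𝓡 4) 1 M := IsManifold.of_le (n := ∞) (by norm_cast)

theorem isManifold_minSmoothness : IsManifold (𝓡 4) (minSmoothness ℝ 2) M := by
  rw [minSmoothness_of_isRCLikeNormedField]
  exact IsManifold.of_le (n := ∞) (by norm_cast)

theorem chartDeriv_comp_chartInvDeriv (hy : y ∈ (extChartAt (𝓡 4) x₀).target) :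
    (chartDeriv x₀ ((extChartAt (𝓡 4) x₀).symm y)).comp (chartInvDeriv x₀ y) =
      ContinuousLinearMap.id ℝ E4 := by
  have : IsManifold (𝓡 4) 1 M := isManifold_one
  have := mfderiv_extChartAt_comp_mfderivWithin_extChartAt_symm (I := 𝓡 4) (x := x₀) hy
  rw [ModelWithCorners.range_eq_univ, mfderivWithin_univ] at this
  exact this

theorem chartInvDeriv_comp_chartDeriv (hx : x ∈ (extChartAt (𝓡 4) x₀).source) :
    (chartInvDeriv x₀ (extChartAt (𝓡 4) x₀ x)).comp (chartDeriv x₀ x) =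
      ContinuousLinearMap.id ℝ E4 := by
  have : IsManifold (𝓡 4) 1 M := isManifold_one
  have := mfderivWithin_extChartAt_symm_comp_mfderiv_extChartAt' (I := 𝓡 4) (x := x₀) hx
  rw [ModelWithCorners.range_eq_univ, mfderivWithin_univ] at this
  exact this

theorem chartDeriv_comp_chartInvDeriv' (hx : x ∈ (extChartAt (𝓡 4) x₀).source) :
    (chartDeriv x₀ x).comp (chartInvDeriv x₀ (extChartAt (𝓡 4) x₀ x)) =
      ContinuousLinearMap.id ℝ E4 := by
  have := chartDeriv_comp_chartInvDeriv ((extChartAt (𝓡 4) x₀).map_source hx)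
  rwa [(extChartAt (𝓡 4) x₀).left_inv hx] at this

theorem isInvertible_chartDeriv (hx : x ∈ (extChartAt (𝓡 4) x₀).source) :
    (mfderiv (𝓡 4) 𝓘(ℝ, E4) (extChartAt (𝓡 4) x₀) x).IsInvertible := by
  have : IsManifold (𝓡 4) 1 M := isManifold_one
  exact isInvertible_mfderiv_extChartAt hx

theorem inverse_chartInvDeriv (hy : y ∈ (extChartAt (𝓡 4) x₀).target) :
    (chartInvDeriv x₀ y).inverse = chartDeriv x₀ ((extChartAt (𝓡 4) x₀).symm y) := by
  have := chartInvDeriv_comp_chartDeriv ((extChartAt (𝓡 4) x₀).map_target hy)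
  rw [(extChartAt (𝓡 4) x₀).right_inv hy] at this
  exact ContinuousLinearMap.inverse_eq this (chartDeriv_comp_chartInvDeriv hy)

theorem isInvertible_chartInvDeriv (hy : y ∈ (extChartAt (𝓡 4) x₀).target) :
    (chartInvDeriv x₀ y).IsInvertible := by
  have := chartInvDeriv_comp_chartDeriv ((extChartAt (𝓡 4) x₀).map_target hy)
  rw [(extChartAt (𝓡 4) x₀).right_inv hy] at this
  exact ContinuousLinearMap.IsInvertible.of_inverse this (chartDeriv_comp_chartInvDeriv hy)

theorem coordField_eq (u : E4 → E4) (hx : x ∈ (extChartAt (𝓡 4) x₀).source) :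
    (coordField x₀ u x : E4) = chartInvDeriv x₀ (extChartAt (𝓡 4) x₀ x) (u (extChartAt (𝓡 4) x₀ x)) := by
  have h : (chartDeriv x₀ x).inverse = chartInvDeriv x₀ (extChartAt (𝓡 4) x₀ x) :=
    ContinuousLinearMap.inverse_eq (chartDeriv_comp_chartInvDeriv' hx) (chartInvDeriv_comp_chartDeriv hx)
  rw [← h]
  rfl

theorem coordField_smooth {S : Set E4} (hS : IsOpen S) {u : E4 → E4} (hu : ContDiffOn ℝ ∞ u S) :
    IsSmoothOn (coordField x₀ u) ((extChartAt (𝓡 4) x₀).source ∩ extChartAt (𝓡 4) x₀ ⁻¹' S) := by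
  intro x hx
  have h1 : ContMDiffAt 𝓘(ℝ, E4) 𝓘(ℝ, E4).tangent ∞
      (fun y => (⟨y, u y⟩ : TangentBundle 𝓘(ℝ, E4) E4)) (extChartAt (𝓡 4) x₀ x) := by
    have := (contMDiffAt_vectorSpace_iff_contDiffAt (V := u)).mpr
      (hu.contDiffAt (hS.mem_nhds hx.2))
    exact this
  have h2 : ContMDiffAt (𝓡 4) 𝓘(ℝ, E4) ∞ (extChartAt (𝓡 4) x₀) x :=
    contMDiffAt_extChartAt' (by rw [← extChartAt_source (𝓡 4)]; exact hx.1)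
  exact (h1.mpullback_vectorField_preimage h2 (isInvertible_chartDeriv hx.1) (by simp)).contMDiffWithinAt

/-- The components of a vector field in the preferred chart at `x₀`. -/
def components (x₀ : M) (X : Π x : M, TangentSpace (𝓡 4) x) (y : E4) : E4 :=
  chartDeriv x₀ ((extChartAt (𝓡 4) x₀).symm y) (X ((extChartAt (𝓡 4) x₀).symm y))

theorem coordField_components (X : Π x : M, TangentSpace (𝓡 4) x)
    (hx : x ∈ (extChartAt (𝓡 4) x₀).source) : coordField x₀ (components x₀ X) x = X x := by
  have h1 := coordField_eq (components x₀ X) hx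
  have h2 := congrArg (fun L => L (X x)) (chartInvDeriv_comp_chartDeriv hx)
  have h3 : components x₀ X (extChartAt (𝓡 4) x₀ x) = chartDeriv x₀ x (X x) := by
    rw [components, (extChartAt (𝓡 4) x₀).left_inv hx]
  rw [h3] at h1
  exact h1.trans h2

theorem components_smooth {S : Set M} {X : Π x : M, TangentSpace (𝓡 4) x} (hX : IsSmoothOn X S)
    (hS : IsOpen S) :
    ContDiffOn ℝ ∞ (components x₀ X)
      ((extChartAt (𝓡 4) x₀).target ∩ (extChartAt (𝓡 4) x₀).symm ⁻¹' S) := by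
  intro y hy
  have h1 : ContMDiffAt 𝓘(ℝ, E4) (𝓡 4) ∞ (extChartAt (𝓡 4) x₀).symm y :=
    (contMDiffOn_extChartAt_symm x₀).contMDiffAt ((isOpen_extChartAt_target x₀).mem_nhds hy.1)
  have hi : (mfderiv 𝓘(ℝ, E4) (𝓡 4) (extChartAt (𝓡 4) x₀).symm y).IsInvertible :=
    isInvertible_chartInvDeriv hy.1
  have h2 : ContMDiffAt (𝓡 4) (𝓡 4).tangent ∞ (fun x => (⟨x, X x⟩ : TangentBundle (𝓡 4) M))
      ((extChartAt (𝓡 4) x₀).symm y) := hX.contMDiffAt (hS.mem_nhds hy.2)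
  have h3 := h2.mpullback_vectorField_preimage h1 hi (by simp)
  have h4 := contMDiffAt_vectorSpace_iff_contDiffAt.mp h3
  refine ContDiffAt.contDiffWithinAt (h4.congr_of_eventuallyEq ?_)
  filter_upwards [(isOpen_extChartAt_target x₀).mem_nhds hy.1] with z hz
  have := congrArg (fun L => L (X ((extChartAt (𝓡 4) x₀).symm z))) (inverse_chartInvDeriv hz)
  exact this.symm

theorem mlieBracket_model (u v : Π y : E4, TangentSpace 𝓘(ℝ, E4) y) :
    VectorField.mlieBracket 𝓘(ℝ, E4) u v = VectorField.lieBracket ℝ u v :=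
  VectorField.mlieBracketWithin_univ.symm.trans
    (VectorField.mlieBracketWithin_eq_lieBracketWithin.trans
      (VectorField.lieBracketWithin_univ (𝕜 := ℝ) (V := (u : E4 → E4)) (W := v)))

theorem mlieBracket_coordField {S : Set E4} (hS : IsOpen S) {u v : E4 → E4}
    (hu : ContDiffOn ℝ ∞ u S) (hv : ContDiffOn ℝ ∞ v S) (hx : x ∈ (extChartAt (𝓡 4) x₀).source)
    (hx' : extChartAt (𝓡 4) x₀ x ∈ S) :
    VectorField.mlieBracket (𝓡 4) (coordField x₀ u) (coordField x₀ v) x =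
      coordField x₀ (VectorField.lieBracket ℝ u v) x := by
  have : IsManifold (𝓡 4) (minSmoothness ℝ 2) M := isManifold_minSmoothness
  have h1 : ∀ {u : E4 → E4}, ContDiffOn ℝ ∞ u S → MDifferentiableAt 𝓘(ℝ, E4) 𝓘(ℝ, E4).tangent
      (fun y => (⟨y, u y⟩ : TangentBundle 𝓘(ℝ, E4) E4)) (extChartAt (𝓡 4) x₀ x) := by
    intro u hu
    exact ((contMDiffAt_vectorSpace_iff_contDiffAt (V := u)).mpr
      (hu.contDiffAt (hS.mem_nhds hx'))).mdifferentiableAt (by simp)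
  have h2 : ContMDiffAt (𝓡 4) 𝓘(ℝ, E4) ∞ (extChartAt (𝓡 4) x₀) x :=
    contMDiffAt_extChartAt' (by rw [← extChartAt_source (𝓡 4)]; exact hx)
  have h3 := VectorField.mpullback_mlieBracket (h1 hu) (h1 hv) h2
    (by rw [minSmoothness_of_isRCLikeNormedField]; norm_cast)
  exact h3.symm.trans (congrArg (fun W : E4 → E4 => coordField x₀ W x) (mlieBracket_model u v))

variable (g : PseudoRiemannianMetric M)

/-- The metric, as a family of bilinear forms on the model space. -/
def PseudoRiemannianMetric.form (x : M) : E4 →L[ℝ] E4 →L[ℝ] ℝ := g.inner x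

theorem PseudoRiemannianMetric.inChart_apply (y : E4) (i j : Fin 4) :
    g.inChart x₀ y i j = g.form ((extChartAt (𝓡 4) x₀).symm y)
      (chartInvDeriv x₀ y (EuclideanSpace.single i 1)) (chartInvDeriv x₀ y (EuclideanSpace.single j 1)) :=
  rfl

theorem bilin_apply_eq_sum (B : E4 →L[ℝ] E4 →L[ℝ] ℝ) (L : E4 →L[ℝ] E4) (u v : E4) :
    B (L u) (L v) = ∑ i, ∑ j, u i * v j *
      B (L (EuclideanSpace.single i 1)) (L (EuclideanSpace.single j 1)) := by
  conv_lhs => rw [← sum_smul_single u, ← sum_smul_single v]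
  simp only [map_sum, map_smul, FunLike.coe_sum, Finset.sum_apply,
    FunLike.coe_smul, Pi.smul_apply, smul_eq_mul, Finset.mul_sum]
  rw [Finset.sum_comm]
  refine Finset.sum_congr rfl fun i _ => Finset.sum_congr rfl fun j _ => ?_
  ring

theorem PseudoRiemannianMetric.form_chartInvDeriv (y u v : E4) :
    g.form ((extChartAt (𝓡 4) x₀).symm y) (chartInvDeriv x₀ y u) (chartInvDeriv x₀ y v) =
      ∑ i, ∑ j, u i * v j * g.inChart x₀ y i j :=
  bilin_apply_eq_sum _ _ u v

theorem PseudoRiemannianMetric.inner_coordField (u v : E4 → E4)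
    (hx : x ∈ (extChartAt (𝓡 4) x₀).source) :
    g.inner x (coordField x₀ u x) (coordField x₀ v x) =
      ∑ i, ∑ j, u (extChartAt (𝓡 4) x₀ x) i * v (extChartAt (𝓡 4) x₀ x) j *
        g.inChart x₀ (extChartAt (𝓡 4) x₀ x) i j := by
  rw [← g.form_chartInvDeriv, (extChartAt (𝓡 4) x₀).left_inv hx, ← coordField_eq u hx,
    ← coordField_eq v hx]
  rfl

theorem PseudoRiemannianMetric.inner_smooth {S : Set M} {X Y : Π x : M, TangentSpace (𝓡 4) x}
    (hX : IsSmoothOn X S) (hY : IsSmoothOn Y S) :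
    ContMDiffOn (𝓡 4) 𝓘(ℝ, ℝ) ∞ (fun x => g.inner x (X x) (Y x)) S := by
  intro x hx
  have : ContMDiffWithinAt (𝓡 4) ((𝓡 4).prod 𝓘(ℝ, ℝ)) ∞
      (fun m ↦ Bundle.TotalSpace.mk' ℝ (E := Bundle.Trivial M ℝ) m (g.inner m (X m) (Y m))) S x := by
    apply ContMDiffWithinAt.clm_bundle_apply₂ (F₁ := E4) (F₂ := E4)
    · exact g.contMDiff.contMDiffAt.contMDiffWithinAt
    · exact hX x hx
    · exact hY x hx
  simp only [Bundle.contMDiffWithinAt_totalSpace] at this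
  exact this.2

theorem PseudoRiemannianMetric.contDiffOn_inChart (x₀ : M) (i j : Fin 4) :
    ContDiffOn ℝ ∞ (fun y => g.inChart x₀ y i j) (extChartAt (𝓡 4) x₀).target := by
  have hc : ∀ i, IsSmoothOn (coordField x₀ (fun _ => EuclideanSpace.single i 1))
      (extChartAt (𝓡 4) x₀).source := fun i => by
    simpa using coordField_smooth (x₀ := x₀) isOpen_univ
      (contDiffOn_const (c := (EuclideanSpace.single i (1 : ℝ) : E4)))
  have h1 := (g.inner_smooth (hc i) (hc j)).comp (contMDiffOn_extChartAt_symm x₀)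
    (fun y hy => (extChartAt (𝓡 4) x₀).map_target hy)
  refine (contMDiffOn_iff_contDiffOn.mp h1).congr fun y hy => ?_
  rw [Function.comp_apply, g.inner_coordField _ _ ((extChartAt (𝓡 4) x₀).map_target hy),
    (extChartAt (𝓡 4) x₀).right_inv hy]
  simp

theorem PseudoRiemannianMetric.isLocalMetric (x₀ : M) :
    IsLocalMetric ⟨(extChartAt (𝓡 4) x₀).target, isOpen_extChartAt_target x₀⟩ (g.inChart x₀) where
  smooth := g.contDiffOn_inChart x₀
  symm y hy := by
    ext i j
    exact g.symm _ _ _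
  det_ne_zero y hy h0 := by
    -- A kernel vector of the matrix gives a tangent vector orthogonal to everything; it vanishes by
    -- nondegeneracy, and the chart derivative is injective.
    obtain ⟨v, hv0, hv⟩ := Matrix.exists_mulVec_eq_zero_iff.mpr h0
    apply hv0
    set u : E4 := WithLp.toLp 2 v with hu
    have h1 : chartInvDeriv x₀ y u = 0 := by
      refine g.nondegenerate ((extChartAt (𝓡 4) x₀).symm y) (chartInvDeriv x₀ y u) fun w => ?_
      set w' : E4 := chartDeriv x₀ ((extChartAt (𝓡 4) x₀).symm y) w with hw'
      have hw : w = chartInvDeriv x₀ y w' := by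
        have := chartInvDeriv_comp_chartDeriv ((extChartAt (𝓡 4) x₀).map_target hy)
        rw [(extChartAt (𝓡 4) x₀).right_inv hy] at this
        exact (congrArg (fun L => L w) this).symm
      have h2 := g.form_chartInvDeriv (x₀ := x₀) y u w'
      rw [← hw] at h2
      refine h2.trans ?_
      rw [Finset.sum_comm]
      refine Finset.sum_eq_zero fun j _ => ?_
      have h3 := congrFun hv j
      have hs : ∀ i, g.inChart x₀ y i j = g.inChart x₀ y j i := fun i => g.symm _ _ _
      simp only [Matrix.mulVec, dotProduct, Pi.zero_apply] at h3
      calc _ = w' j * ∑ i, g.inChart x₀ y j i * v i := by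
            rw [Finset.mul_sum]
            refine Finset.sum_congr rfl fun i _ => ?_
            rw [hs, hu]; ring
        _ = 0 := by rw [h3, mul_zero]
    have h4 := congrArg (fun L => L u) (chartDeriv_comp_chartInvDeriv hy)
    simp only [ContinuousLinearMap.comp_apply, h1, map_zero, ContinuousLinearMap.id_apply] at h4
    funext i
    exact congrArg (fun w : E4 => w i) h4.symm

end CoordinateFields

end EinsteinFour

end

noncomputable section

namespace EinsteinFour

/-! ### Change of charts on a manifold -/

section Charts

open TopologicalSpace (Opens)

variable {M : Type*} [TopologicalSpace M] [ChartedSpace E4 M] {x₀ x : M} {z : E4}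

/-- The transition map from the preferred chart at `x₀` to that at `x`. -/
def transition (x₀ x : M) (z : E4) : E4 := extChartAt (𝓡 4) x ((extChartAt (𝓡 4) x₀).symm z)

/-- The domain of the transition map. -/
def transitionDomain (x₀ x : M) : Opens E4 :=
  ⟨(extChartAt (𝓡 4) x₀).target ∩ (extChartAt (𝓡 4) x₀).symm ⁻¹' (extChartAt (𝓡 4) x).source,
    (continuousOn_extChartAt_symm x₀).isOpen_inter_preimage (isOpen_extChartAt_target x₀)
      (isOpen_extChartAt_source x)⟩

/-- The image of the preferred chart at `x₀`. -/
def chartTarget (x₀ : M) : Opens E4 :=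
  ⟨(extChartAt (𝓡 4) x₀).target, isOpen_extChartAt_target x₀⟩

theorem transition_mem (hz : z ∈ transitionDomain x₀ x) : transition x₀ x z ∈ chartTarget x :=
  (extChartAt (𝓡 4) x).map_source hz.2

theorem symm_transition (hz : z ∈ transitionDomain x₀ x) :
    (extChartAt (𝓡 4) x).symm (transition x₀ x z) = (extChartAt (𝓡 4) x₀).symm z :=
  (extChartAt (𝓡 4) x).left_inv hz.2

theorem mem_transitionDomain_symm (hz : z ∈ chartTarget x₀) :
    z ∈ transitionDomain x₀ ((extChartAt (𝓡 4) x₀).symm z) :=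
  ⟨hz, mem_extChartAt_source _⟩

open Classical in
/-- `1` for a positively oriented frame, and `-1` otherwise. -/
def frameOrientation (o : Orientation ℝ E4 (Fin 4)) (b : Fin 4 → E4) : ℝ :=
  if IsPositiveFrame o b then 1 else -1

theorem isPositiveFrame_basis (o : Orientation ℝ E4 (Fin 4)) (B : Module.Basis (Fin 4) ℝ E4) :
    IsPositiveFrame o B ↔ B.orientation = o :=
  ⟨fun ⟨B', h1, h2⟩ => by rw [← h2, DFunLike.coe_injective h1], fun h => ⟨B, rfl, h⟩⟩

open Classical in
theorem frameOrientation_basis (o : Orientation ℝ E4 (Fin 4)) (B : Module.Basis (Fin 4) ℝ E4) :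
    frameOrientation o B = if B.orientation = o then 1 else -1 := by
  rw [frameOrientation]
  exact if_congr (isPositiveFrame_basis o B) rfl rfl

/-- Two bases have the same orientation exactly when the determinant of the change of basis is
positive, and there are only two orientations. -/
theorem frameOrientation_eq_mul_sign (o : Orientation ℝ E4 (Fin 4)) (B B' : Module.Basis (Fin 4) ℝ E4)
    {J : Matrix (Fin 4) (Fin 4) ℝ} (hJ : J.det ≠ 0) (h : ∀ i, B' i = ∑ a, J a i • B a) :
    frameOrientation o B' = frameOrientation o B * SignType.sign J.det := by
  have hdet : B.det B' = J.det := by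
    rw [Module.Basis.det_apply]
    congr 1
    ext a i
    rw [Module.Basis.toMatrix_apply, h, map_sum]
    simp [Finsupp.single_apply]
  have ho := B.orientation_eq_or_eq_neg B'.orientation
  have hiff := B.orientation_eq_iff_det_pos B'
  rw [hdet] at hiff
  rw [frameOrientation_basis, frameOrientation_basis]
  rcases lt_or_gt_of_ne hJ with hneg | hpos
  · have h1 : B'.orientation = -B.orientation :=
      ho.resolve_left fun e => not_lt.mpr hneg.le (hiff.mp e.symm)
    rw [h1, sign_neg hneg]
    rcases B.orientation_eq_or_eq_neg o with h2 | h2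
    · rw [h2, if_neg (Module.Ray.ne_neg_self _).symm, if_pos rfl]; simp
    · rw [h2, if_pos rfl, if_neg (Module.Ray.ne_neg_self _)]; simp
  · rw [← hiff.mpr hpos, sign_pos hpos]; simp

/-- An orientation, as a family of orientations of the model space. -/
def ManifoldOrientation.orientModel (o : ManifoldOrientation M) (x : M) : Orientation ℝ E4 (Fin 4) :=
  o.orient x

theorem ManifoldOrientation.sign_eq (o : ManifoldOrientation M) (x₀ : M) (z : E4) :
    o.sign x₀ z = frameOrientation (o.orientModel ((extChartAt (𝓡 4) x₀).symm z))
      (fun i => chartInvDeriv x₀ z (EuclideanSpace.single i 1)) := rfl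

theorem ManifoldOrientation.sign_sq (o : ManifoldOrientation M) (x₀ : M) (z : E4) :
    o.sign x₀ z ^ 2 = 1 := by
  rw [sign]; split_ifs <;> norm_num

open Classical in
theorem ManifoldOrientation.eventually_sign_eq (o : ManifoldOrientation M) (x₀ : M) :
    ∀ᶠ z in 𝓝 (coord x₀), o.sign x₀ z = o.sign x₀ (coord x₀) := by
  filter_upwards [o.locallyConstant x₀] with z hz
  rw [sign, sign]
  exact if_congr hz rfl rfl

variable [IsManifold (𝓡 4) ∞ M]

theorem contDiffOn_transition : ContDiffOn ℝ ∞ (transition x₀ x) (transitionDomain x₀ x) := by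
  refine contMDiffOn_iff_contDiffOn.mp (ContMDiffOn.comp (t := (extChartAt (𝓡 4) x).source)
    (I' := 𝓡 4) ?_ ?_ fun z hz => hz.2)
  · rw [extChartAt_source]
    exact contMDiffOn_extChartAt
  · exact (contMDiffOn_extChartAt_symm x₀).mono fun z hz => hz.1

theorem fderiv_transition (hz : z ∈ transitionDomain x₀ x) :
    fderiv ℝ (transition x₀ x) z =
      (chartDeriv x ((extChartAt (𝓡 4) x₀).symm z)).comp (chartInvDeriv x₀ z) := by
  have h1 : MDifferentiableAt 𝓘(ℝ, E4) (𝓡 4) (extChartAt (𝓡 4) x₀).symm z :=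
    ((contMDiffOn_extChartAt_symm (n := ∞) x₀).contMDiffAt
      ((isOpen_extChartAt_target x₀).mem_nhds hz.1)).mdifferentiableAt (by simp)
  have h2 : MDifferentiableAt (𝓡 4) 𝓘(ℝ, E4) (extChartAt (𝓡 4) x) ((extChartAt (𝓡 4) x₀).symm z) :=
    (contMDiffAt_extChartAt' (n := ∞) (by rw [← extChartAt_source (𝓡 4)]; exact hz.2)).mdifferentiableAt
      (by simp)
  rw [← mfderiv_eq_fderiv]
  exact mfderiv_comp z h2 h1

theorem chartInvDeriv_transition (hz : z ∈ transitionDomain x₀ x) (v : E4) :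
    chartInvDeriv x (transition x₀ x z) (fderiv ℝ (transition x₀ x) z v) = chartInvDeriv x₀ z v := by
  have h := chartInvDeriv_comp_chartDeriv hz.2
  rw [fderiv_transition hz]
  exact congrArg (fun L => L (chartInvDeriv x₀ z v)) h

theorem pderiv_transition_apply (hz : z ∈ transitionDomain x₀ x) (i b : Fin 4) :
    fderiv ℝ (transition x₀ x) z (EuclideanSpace.single i 1) b = jacobian (transition x₀ x) z b i :=
  (pderiv_apply (differentiableAt_of_contDiffOn (transitionDomain x₀ x).2 contDiffOn_transition hz)
    i b).symm

theorem PseudoRiemannianMetric.inChart_transition (g : PseudoRiemannianMetric M)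
    (hz : z ∈ transitionDomain x₀ x) :
    g.inChart x₀ z = (jacobian (transition x₀ x) z).transpose * g.inChart x (transition x₀ x z) *
      jacobian (transition x₀ x) z := by
  ext i j
  rw [conj_apply, g.inChart_apply, ← chartInvDeriv_transition hz, ← chartInvDeriv_transition hz,
    ← symm_transition hz, g.form_chartInvDeriv]
  simp only [pderiv_transition_apply hz]

theorem PseudoRiemannianMetric.isMetricPullback (g : PseudoRiemannianMetric M)
    (hz : z ∈ transitionDomain x₀ x) :
    IsMetricPullback (jacobian (transition x₀ x) z) (g.inChart x₀ z)
      (g.inChart x (transition x₀ x z)) where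
  eq := g.inChart_transition hz
  symm := (g.isLocalMetric x).symm _ (transition_mem hz)
  det_ne_zero := (g.isLocalMetric x).det_ne_zero _ (transition_mem hz)
  det_jacobian h0 := by
    apply (g.isLocalMetric x₀).det_ne_zero z hz.1
    rw [g.inChart_transition hz, Matrix.det_mul, h0, mul_zero]

theorem PseudoRiemannianMetric.curvatureLow_transition (g : PseudoRiemannianMetric M)
    (hz : z ∈ transitionDomain x₀ x) :
    IsTensorPullback (jacobian (transition x₀ x) z) (fun i j k l => curvatureLow (g.inChart x₀) i j k l z)
      (fun i j k l => curvatureLow (g.inChart x) i j k l (transition x₀ x z)) := by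
  have h1 : IsLocalMetric (chartTarget x) (g.inChart x) := g.isLocalMetric x
  have h2 : IsLocalMetric (transitionDomain x₀ x) (g.inChart x₀) :=
    (g.isLocalMetric x₀).mono fun z hz => hz.1
  exact h1.curvatureLow_pullback h2 contDiffOn_transition (fun z hz => transition_mem hz)
    (fun z hz => g.inChart_transition hz) hz

/-- The coordinate frame as a basis. -/
theorem exists_basis_chartInvDeriv (hz : z ∈ (extChartAt (𝓡 4) x₀).target) :
    ∃ B : Module.Basis (Fin 4) ℝ E4, ∀ i, B i = chartInvDeriv x₀ z (EuclideanSpace.single i 1) := by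
  obtain ⟨L, hL⟩ := isInvertible_chartInvDeriv hz
  refine ⟨(EuclideanSpace.basisFun (Fin 4) ℝ).toBasis.map L.toLinearEquiv, fun i => ?_⟩
  rw [← hL]
  simp

/-- At a common point the two coordinate frames differ by the Jacobian matrix of the transition map.
-/
theorem ManifoldOrientation.sign_transition (o : ManifoldOrientation M)
    (hJ : (jacobian (transition x₀ x) z).det ≠ 0) (hz : z ∈ transitionDomain x₀ x) :
    o.sign x₀ z = o.sign x (transition x₀ x z) * SignType.sign (jacobian (transition x₀ x) z).det := by
  obtain ⟨B', hB'⟩ := exists_basis_chartInvDeriv hz.1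
  obtain ⟨B, hB⟩ := exists_basis_chartInvDeriv (transition_mem hz)
  rw [o.sign_eq, o.sign_eq, symm_transition hz, ← funext hB, ← funext hB']
  refine frameOrientation_eq_mul_sign _ B B' hJ fun i => ?_
  rw [hB', ← chartInvDeriv_transition hz, ← sum_smul_single (fderiv ℝ _ z _), map_sum]
  refine Finset.sum_congr rfl fun a _ => ?_
  rw [map_smul, pderiv_transition_apply hz, hB]


variable (g : PseudoRiemannianMetric M) (o : ManifoldOrientation M)

/-- The hypothesis speaks of each point only in the preferred chart at that same point. A point z of
the chart at x₀ is compared with the chart centred at the point that z represents. -/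
theorem PseudoRiemannianMetric.IsEinstein.inChart {g : PseudoRiemannianMetric M} (h : g.IsEinstein)
    (hz : z ∈ chartTarget x₀) (i k : Fin 4) : ricci (g.inChart x₀) i k z =
      scalarCurvature (g.inChart x₀) z / 4 * g.inChart x₀ z i k :=
  einstein_pullback (g.isMetricPullback (mem_transitionDomain_symm hz))
    (g.curvatureLow_transition (mem_transitionDomain_symm hz)) (h _) i k

theorem PseudoRiemannianMetric.IsEinstein.weylDiagonalizable {g : PseudoRiemannianMetric M}
    {o : ManifoldOrientation M} (h : g.IsEinstein) (hz : z ∈ chartTarget x₀)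
    (hd : ∀ x, g.IsWeylPlusDiagonalizableAt o x) :
    WeylDiagonalizable (g.inChart x₀) (o.sign x₀) z :=
  have hz' := mem_transitionDomain_symm hz
  WeylDiagonalizable.pullback (g.isMetricPullback hz') (g.curvatureLow_transition hz') (h _)
    (o.sign_transition (g.isMetricPullback hz').det_jacobian hz') (hd _)

theorem PseudoRiemannianMetric.IsEinstein.weylEigenvalues_eq {g : PseudoRiemannianMetric M}
    (o : ManifoldOrientation M) (h : g.IsEinstein) (hz : z ∈ chartTarget x₀) :
    weylEigenvalues (g.inChart x₀) (o.sign x₀) z =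
      g.weylPlusEigenvalues o ((extChartAt (𝓡 4) x₀).symm z) :=
  have hz' := mem_transitionDomain_symm hz
  weylEigenvalues_pullback (g.isMetricPullback hz') (g.curvatureLow_transition hz') (h _)
    (o.sign_transition (g.isMetricPullback hz').det_jacobian hz')

/-- A self-dual Weyl tensor with constant eigenvalues can be diagonalized smoothly. -/
theorem PseudoRiemannianMetric.IsEinstein.exists_adaptedFrame {g : PseudoRiemannianMetric M}
    {o : ManifoldOrientation M} (h : g.IsEinstein) (hd : ∀ x, g.IsWeylPlusDiagonalizableAt o x)
    (hc : ∀ x y, g.weylPlusEigenvalues o x = g.weylPlusEigenvalues o y) (x₀ : M) :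
    ∃ U ⊆ (extChartAt (𝓡 4) x₀).target, IsOpen U ∧ coord x₀ ∈ U ∧ ∃ E lam,
      IsAdaptedFrame U (g.inChart x₀) (o.sign x₀) lam E ∧
        Set.range lam = g.weylPlusEigenvalues o x₀ := by
  -- An orientation is only required to be locally constant near the centre of the chart, so the
  -- domain is shrunk to where the sign is fixed.
  obtain ⟨S, hS, hSo, hxS⟩ := eventually_nhds_iff.mp (o.eventually_sign_eq x₀)
  have hV : (chartTarget x₀ ⊓ ⟨S, hSo⟩ : Opens E4) ≤ chartTarget x₀ := inf_le_left
  have hx : coord x₀ ∈ (chartTarget x₀ ⊓ ⟨S, hSo⟩ : Opens E4) := ⟨mem_extChartAt_target x₀, hxS⟩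
  have hG : IsLocalMetric (chartTarget x₀ ⊓ ⟨S, hSo⟩) (g.inChart x₀) := (g.isLocalMetric x₀).mono hV
  have hW : ∀ y ∈ (chartTarget x₀ ⊓ ⟨S, hSo⟩ : Opens E4),
      weylEigenvalues (g.inChart x₀) (o.sign x₀) y = g.weylPlusEigenvalues o x₀ := fun y hy =>
    (h.weylEigenvalues_eq o (hV hy)).trans (hc _ x₀)
  obtain ⟨U, hU, hUo, hxU, E, lam, hE, hr⟩ := hG.exists_adaptedFrame hx
    (fun y hy => h.inChart (hV hy)) (fun y hy => hS y hy.2) (o.sign_sq x₀ _)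
    (fun y hy => h.weylDiagonalizable (hV hy) hd) hW
  exact ⟨U, fun y hy => hV (hU hy), hUo, hxU, E, lam, hE, hr⟩

end Charts

end EinsteinFour

end

noncomputable section

namespace EinsteinFour

/-! ### Complex vector fields in coordinates -/

section ComplexFields

open TopologicalSpace (Opens)

variable {M : Type*} [TopologicalSpace M] [ChartedSpace E4 M] {x₀ x : M} {y : E4}
  {u v : E4 → Fin 4 → ℂ}

/-- The real part of a complex vector field given by its components. -/
def rePart (u : E4 → Fin 4 → ℂ) (y : E4) : E4 := WithLp.toLp 2 fun i => (u y i).re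

/-- The imaginary part of a complex vector field given by its components. -/
def imPart (u : E4 → Fin 4 → ℂ) (y : E4) : E4 := WithLp.toLp 2 fun i => (u y i).im

/-- The complex vector field on `M` with the components `u` in the preferred chart at `x₀`. -/
def complexField (x₀ : M) (u : E4 → Fin 4 → ℂ) : ComplexVectorField M :=
  ⟨coordField x₀ (rePart u), coordField x₀ (imPart u)⟩

theorem contDiffOn_toLp {S : Set E4} {f : E4 → Fin 4 → ℝ} (hf : ∀ i, ContDiffOn ℝ ∞ (fun y => f y i) S) :
    ContDiffOn ℝ ∞ (fun y => (WithLp.toLp 2 (f y) : E4)) S :=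
  contDiffOn_euclidean.mpr hf

theorem contDiffOn_rePart {S : Set E4} (hu : ∀ i, ContDiffOn ℝ ∞ (fun y => u y i) S) :
    ContDiffOn ℝ ∞ (rePart u) S :=
  contDiffOn_toLp fun i => Complex.reCLM.contDiff.comp_contDiffOn (hu i)

theorem contDiffOn_imPart {S : Set E4} (hu : ∀ i, ContDiffOn ℝ ∞ (fun y => u y i) S) :
    ContDiffOn ℝ ∞ (imPart u) S :=
  contDiffOn_toLp fun i => Complex.imCLM.contDiff.comp_contDiffOn (hu i)

theorem pderiv_re {f : E4 → ℂ} (hf : DifferentiableAt ℝ f y) (i : Fin 4) :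
    pderiv i (fun z => (f z).re) y = (pderiv i f y).re := by
  have h : (fun z => (f z).re) = Complex.reCLM ∘ f := rfl
  rw [pderiv, h, fderiv_comp _ Complex.reCLM.differentiableAt hf]
  simp [pderiv]

theorem pderiv_im {f : E4 → ℂ} (hf : DifferentiableAt ℝ f y) (i : Fin 4) :
    pderiv i (fun z => (f z).im) y = (pderiv i f y).im := by
  have h : (fun z => (f z).im) = Complex.imCLM ∘ f := rfl
  rw [pderiv, h, fderiv_comp _ Complex.imCLM.differentiableAt hf]
  simp [pderiv]

theorem lieBracket_apply {a b : E4 → E4} (ha : DifferentiableAt ℝ a y) (hb : DifferentiableAt ℝ b y)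
    (k : Fin 4) : VectorField.lieBracket ℝ a b y k =
      ∑ i, (a y i * pderiv i (fun z => b z k) y - b y i * pderiv i (fun z => a z k) y) := by
  rw [VectorField.lieBracket, fderiv_eq_sum_pderiv, fderiv_eq_sum_pderiv, Finset.sum_sub_distrib]
  simp only [pderiv_apply ha, pderiv_apply hb]
  simp

theorem differentiableAt_rePart (hu : ∀ i, DifferentiableAt ℝ (fun z => u z i) y) :
    DifferentiableAt ℝ (rePart u) y :=
  differentiableAt_euclidean.mpr fun i => Complex.reCLM.differentiableAt.comp y (hu i)

theorem differentiableAt_imPart (hu : ∀ i, DifferentiableAt ℝ (fun z => u z i) y) :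
    DifferentiableAt ℝ (imPart u) y :=
  differentiableAt_euclidean.mpr fun i => Complex.imCLM.differentiableAt.comp y (hu i)

theorem compBracket_re (hu : ∀ i, DifferentiableAt ℝ (fun z => u z i) y)
    (hv : ∀ i, DifferentiableAt ℝ (fun z => v z i) y) :
    VectorField.lieBracket ℝ (rePart u) (rePart v) y - VectorField.lieBracket ℝ (imPart u) (imPart v) y =
      rePart (compBracket u v) y := by
  ext k
  rw [PiLp.sub_apply, lieBracket_apply (differentiableAt_rePart hu) (differentiableAt_rePart hv),
    lieBracket_apply (differentiableAt_imPart hu) (differentiableAt_imPart hv)]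
  simp only [rePart, imPart, compBracket, Complex.re_sum, ← Finset.sum_sub_distrib,
    pderiv_re (hu _), pderiv_re (hv _), pderiv_im (hu _), pderiv_im (hv _), Complex.sub_re, Complex.mul_re]
  exact Finset.sum_congr rfl fun i _ => by ring

theorem compBracket_im (hu : ∀ i, DifferentiableAt ℝ (fun z => u z i) y)
    (hv : ∀ i, DifferentiableAt ℝ (fun z => v z i) y) :
    VectorField.lieBracket ℝ (rePart u) (imPart v) y + VectorField.lieBracket ℝ (imPart u) (rePart v) y =
      imPart (compBracket u v) y := by
  ext k
  rw [PiLp.add_apply, lieBracket_apply (differentiableAt_rePart hu) (differentiableAt_imPart hv),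
    lieBracket_apply (differentiableAt_imPart hu) (differentiableAt_rePart hv)]
  simp only [rePart, imPart, compBracket, Complex.im_sum, ← Finset.sum_add_distrib,
    pderiv_re (hu _), pderiv_re (hv _), pderiv_im (hu _), pderiv_im (hv _), Complex.sub_im, Complex.mul_im]
  exact Finset.sum_congr rfl fun i _ => by ring

theorem compBracket_const_mul (c d : ℂ) (hu : ∀ i, DifferentiableAt ℝ (fun z => u z i) y)
    (hv : ∀ i, DifferentiableAt ℝ (fun z => v z i) y) (k : Fin 4) :
    compBracket (fun z i => c * u z i) (fun z i => d * v z i) y k = c * d * compBracket u v y k := by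
  have h : ∀ (c : ℂ) {f : E4 → ℂ}, DifferentiableAt ℝ f y → ∀ i,
      pderiv i (fun z => c * f z) y = c * pderiv i f y := by
    intro c f hf i
    rw [pderiv, fderiv_const_mul hf]
    rfl
  rw [compBracket, compBracket, Finset.mul_sum]
  refine Finset.sum_congr rfl fun i _ => ?_
  rw [h d (hv k), h c (hu k)]
  ring

open ComplexVectorField

theorem coordField_add (a b : E4 → E4) :
    coordField x₀ a x + coordField x₀ b x = coordField x₀ (fun y => a y + b y) x :=
  ((chartDeriv x₀ x).inverse.map_add _ _).symm

theorem coordField_sub (a b : E4 → E4) :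
    coordField x₀ a x - coordField x₀ b x = coordField x₀ (fun y => a y - b y) x :=
  ((chartDeriv x₀ x).inverse.map_sub _ _).symm

theorem coordField_smul (c : ℝ) (a : E4 → E4) :
    c • coordField x₀ a x = coordField x₀ (fun y => c • a y) x :=
  ((chartDeriv x₀ x).inverse.map_smul _ _).symm

theorem coordField_sum (a : Fin 4 → E4 → E4) :
    ∑ i, coordField x₀ (a i) x = coordField x₀ (fun y => ∑ i, a i y) x :=
  (map_sum (chartDeriv x₀ x).inverse _ _).symm

theorem complexField_congr (h : u (extChartAt (𝓡 4) x₀ x) = v (extChartAt (𝓡 4) x₀ x)) :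
    EqAt x (complexField x₀ u) (complexField x₀ v) :=
  ⟨coordField_congr (by simp only [rePart, h]), coordField_congr (by simp only [imPart, h])⟩

theorem complexField_zero : EqAt x (complexField x₀ fun _ _ => 0) zero :=
  ⟨(chartDeriv x₀ x).inverse.map_zero, (chartDeriv x₀ x).inverse.map_zero⟩

theorem smul_complexField (c : ℂ) :
    EqAt x (smul c (complexField x₀ u)) (complexField x₀ fun y i => c * u y i) := by
  constructor
  · simp only [smul, complexField, coordField_smul, coordField_sub]
    refine coordField_congr ?_
    ext i; simp [rePart, imPart]
  · simp only [smul, complexField, coordField_smul, coordField_add]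
    refine coordField_congr ?_
    ext i; simp [rePart, imPart]

theorem eqAt_trans {w₁ w₂ w₃ : ComplexVectorField M} (h : EqAt x w₁ w₂) (h' : EqAt x w₂ w₃) :
    EqAt x w₁ w₃ :=
  ⟨h.1.trans h'.1, h.2.trans h'.2⟩

theorem eqAt_symm {w₁ w₂ : ComplexVectorField M} (h : EqAt x w₁ w₂) : EqAt x w₂ w₁ :=
  ⟨h.1.symm, h.2.symm⟩

theorem sum_complexField {b : Fin 4 → ComplexVectorField M} {u : Fin 4 → E4 → Fin 4 → ℂ}
    (h : ∀ a, EqAt x (b a) (complexField x₀ (u a))) :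
    EqAt x (ComplexVectorField.sum b) (complexField x₀ fun y i => ∑ a, u a y i) := by
  constructor
  · change ∑ a, (b a).re x = _
    rw [Finset.sum_congr rfl fun a _ => (h a).1]
    simp only [complexField, coordField_sum]
    refine coordField_congr ?_
    ext i; simp [rePart]
  · change ∑ a, (b a).im x = _
    rw [Finset.sum_congr rfl fun a _ => (h a).2]
    simp only [complexField, coordField_sum]
    refine coordField_congr ?_
    ext i; simp [imPart]

variable [IsManifold (𝓡 4) ∞ M]

theorem coordField_eq_zero {a : E4 → E4} (hx : x ∈ (extChartAt (𝓡 4) x₀).source)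
    (h : coordField x₀ a x = 0) : a (extChartAt (𝓡 4) x₀ x) = 0 := by
  have h1 := coordField_eq a hx
  have h2 := congrArg (fun L => L (a (extChartAt (𝓡 4) x₀ x))) (chartDeriv_comp_chartInvDeriv' hx)
  simp only [ContinuousLinearMap.comp_apply, ContinuousLinearMap.id_apply] at h2
  rw [← h2, ← h1]
  exact (congrArg (chartDeriv x₀ x) h).trans (map_zero _)

theorem complexField_eq_zero (hx : x ∈ (extChartAt (𝓡 4) x₀).source)
    (h : EqAt x (complexField x₀ u) zero) : u (extChartAt (𝓡 4) x₀ x) = 0 := by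
  have h1 := coordField_eq_zero hx h.1
  have h2 := coordField_eq_zero hx h.2
  funext i
  exact Complex.ext (congrArg (fun w : E4 => w i) h1) (congrArg (fun w : E4 => w i) h2)

theorem complexField_smooth {S : Set E4} (hS : IsOpen S) (hu : ∀ i, ContDiffOn ℝ ∞ (fun y => u y i) S) :
    (complexField x₀ u).IsSmoothOn ((extChartAt (𝓡 4) x₀).source ∩ extChartAt (𝓡 4) x₀ ⁻¹' S) :=
  ⟨coordField_smooth hS (contDiffOn_rePart hu), coordField_smooth hS (contDiffOn_imPart hu)⟩

theorem PseudoRiemannianMetric.complexInner_complexField (g : PseudoRiemannianMetric M)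
    (hx : x ∈ (extChartAt (𝓡 4) x₀).source) :
    g.complexInner x (complexField x₀ u) (complexField x₀ v) =
      ∑ i, ∑ j, u (extChartAt (𝓡 4) x₀ x) i * v (extChartAt (𝓡 4) x₀ x) j *
        (g.inChart x₀ (extChartAt (𝓡 4) x₀ x) i j : ℂ) := by
  simp only [complexInner, complexField, g.inner_coordField _ _ hx]
  apply Complex.ext
  · simp only [Complex.re_sum, rePart, imPart, ← Finset.sum_sub_distrib]
    refine Finset.sum_congr rfl fun i _ => Finset.sum_congr rfl fun j _ => ?_
    simp; ring
  · simp only [Complex.im_sum, rePart, imPart, ← Finset.sum_add_distrib]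
    refine Finset.sum_congr rfl fun i _ => Finset.sum_congr rfl fun j _ => ?_
    simp; ring

theorem bracket_complexField {S : Set E4} (hS : IsOpen S) (hu : ∀ i, ContDiffOn ℝ ∞ (fun y => u y i) S)
    (hv : ∀ i, ContDiffOn ℝ ∞ (fun y => v y i) S) (hx : x ∈ (extChartAt (𝓡 4) x₀).source)
    (hx' : extChartAt (𝓡 4) x₀ x ∈ S) :
    EqAt x (bracket (complexField x₀ u) (complexField x₀ v)) (complexField x₀ (compBracket u v)) := by
  have hur := contDiffOn_rePart hu
  have hui := contDiffOn_imPart hu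
  have hvr := contDiffOn_rePart hv
  have hvi := contDiffOn_imPart hv
  have hdu := fun i => differentiableAt_of_contDiffOn hS (hu i) hx'
  have hdv := fun i => differentiableAt_of_contDiffOn hS (hv i) hx'
  constructor
  · simp only [bracket, complexField]
    rw [mlieBracket_coordField hS hur hvr hx hx', mlieBracket_coordField hS hui hvi hx hx',
      coordField_sub]
    exact coordField_congr (compBracket_re hdu hdv)
  · simp only [bracket, complexField]
    rw [mlieBracket_coordField hS hur hvi hx hx', mlieBracket_coordField hS hui hvr hx hx',
      coordField_add]
    exact coordField_congr (compBracket_im hdu hdv)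

omit [IsManifold (𝓡 4) ∞ M] in
theorem mlieBracket_congr_right (W : Π x : M, TangentSpace (𝓡 4) x) {X Y : Π x : M, TangentSpace (𝓡 4) x}
    (h : X =ᶠ[𝓝 x] Y) : VectorField.mlieBracket (𝓡 4) W X x = VectorField.mlieBracket (𝓡 4) W Y x :=
  Filter.EventuallyEq.mlieBracket_vectorField_eq Filter.EventuallyEq.rfl h

/-- A real vector field is given by its components in the preferred chart at `x₀`. -/
theorem bracket_ofReal {V : Set M} (hV : IsOpen V) (hV' : V ⊆ (extChartAt (𝓡 4) x₀).source)
    (w : ComplexVectorField M) (X : Π x : M, TangentSpace (𝓡 4) x) (hx : x ∈ V) :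
    EqAt x (bracket w (ofReal X))
      (bracket w (complexField x₀ fun y i => ((components x₀ X y i : ℝ) : ℂ))) := by
  have h1 : X =ᶠ[𝓝 x] coordField x₀ (rePart fun y i => ((components x₀ X y i : ℝ) : ℂ)) := by
    filter_upwards [hV.mem_nhds hx] with p hp
    rw [← coordField_components X (hV' hp)]
    exact coordField_congr rfl
  have h2 : (fun p => (0 : TangentSpace (𝓡 4) p)) =ᶠ[𝓝 x]
      coordField x₀ (imPart fun y i => ((components x₀ X y i : ℝ) : ℂ)) := by
    refine Filter.Eventually.of_forall fun p => ?_
    exact (chartDeriv x₀ p).inverse.map_zero.symm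
  exact ⟨congrArg₂ (fun a b : E4 => a - b) (mlieBracket_congr_right _ h1) (mlieBracket_congr_right _ h2),
    congrArg₂ (fun a b : E4 => a + b) (mlieBracket_congr_right _ h2) (mlieBracket_congr_right _ h1)⟩

/-- The Killing equation in coordinates. -/
theorem PseudoRiemannianMetric.IsKillingOn.components {g : PseudoRiemannianMetric M} {V : Set M}
    {X : Π x : M, TangentSpace (𝓡 4) x} (hX : g.IsKillingOn X V) (hV : IsOpen V)
    (hV' : V ⊆ (extChartAt (𝓡 4) x₀).source) (hy : y ∈ (extChartAt (𝓡 4) x₀).target)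
    (hyV : (extChartAt (𝓡 4) x₀).symm y ∈ V) (i j : Fin 4) :
    ∑ k, EinsteinFour.components x₀ X y k * pderiv k (fun z => g.inChart x₀ z i j) y +
      ∑ k, (pderiv i (fun z => EinsteinFour.components x₀ X z k) y * g.inChart x₀ y k j +
        g.inChart x₀ y i k * pderiv j (fun z => EinsteinFour.components x₀ X z k) y) = 0 := by
  have hcs := components_smooth (x₀ := x₀) hX.1 hV
  have hS : IsOpen ((extChartAt (𝓡 4) x₀).target ∩ (extChartAt (𝓡 4) x₀).symm ⁻¹' V) :=
    (continuousOn_extChartAt_symm x₀).isOpen_inter_preimage (isOpen_extChartAt_target x₀) hV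
  set x := (extChartAt (𝓡 4) x₀).symm y with hxy
  have hx : x ∈ (extChartAt (𝓡 4) x₀).source := hV' hyV
  have hyx : extChartAt (𝓡 4) x₀ x = y := (extChartAt (𝓡 4) x₀).right_inv hy
  have hXd : DifferentiableAt ℝ (EinsteinFour.components x₀ X) y :=
    differentiableAt_of_contDiffOn hS hcs ⟨hy, hyV⟩
  -- The Killing equation is tested on pairs of coordinate fields.
  have hconst : ∀ i : Fin 4, IsSmoothOn (coordField x₀ (fun _ => EuclideanSpace.single i 1)) V := fun i => by
    have := coordField_smooth (x₀ := x₀) isOpen_univ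
      (contDiffOn_const (c := (EuclideanSpace.single i (1 : ℝ) : E4)))
    exact this.mono fun p hp => ⟨hV' hp, trivial⟩
  -- The bracket [X, ∂_i] is −Σ (∂_i X^k) ∂_k; only its value at x matters, so the components on the
  -- right are frozen at y.
  have hbr : ∀ i : Fin 4, VectorField.mlieBracket (𝓡 4) X
      (coordField x₀ (fun _ => EuclideanSpace.single i 1)) x =
      coordField x₀ (fun _ => -pderiv i (EinsteinFour.components x₀ X) y) x := by
    intro i
    have h1 : X =ᶠ[𝓝 x] coordField x₀ (EinsteinFour.components x₀ X) := by
      filter_upwards [hV.mem_nhds hyV] with p hp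
      exact (coordField_components X (hV' hp)).symm
    refine (Filter.EventuallyEq.mlieBracket_vectorField_eq h1 Filter.EventuallyEq.rfl).trans ?_
    refine (mlieBracket_coordField hS hcs contDiffOn_const hx
      (by rw [hyx]; exact ⟨hy, hyV⟩)).trans ?_
    refine coordField_congr ?_
    rw [hyx, VectorField.lieBracket]
    simp [pderiv]
  have key := hX.2 _ _ (hconst i) (hconst j) x hyV
  rw [hbr, hbr] at key
  have hG : DifferentiableAt ℝ (fun z => g.inChart x₀ z i j) (extChartAt (𝓡 4) x₀ x) := by
    rw [hyx]
    exact differentiableAt_of_contDiffOn (isOpen_extChartAt_target x₀) (g.contDiffOn_inChart x₀ i j) hy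
  have hl : (mfderiv (𝓡 4) 𝓘(ℝ, ℝ) (fun p => g.inner p
      (coordField x₀ (fun _ => EuclideanSpace.single i 1) p)
      (coordField x₀ (fun _ => EuclideanSpace.single j 1) p)) x (X x) : ℝ) =
      ∑ k, EinsteinFour.components x₀ X y k * pderiv k (fun z => g.inChart x₀ z i j) y := by
    have e1 : (fun p => g.inner p
        (coordField x₀ (fun _ => EuclideanSpace.single i 1) p)
        (coordField x₀ (fun _ => EuclideanSpace.single j 1) p)) =ᶠ[𝓝 x]
        (fun z => g.inChart x₀ z i j) ∘ extChartAt (𝓡 4) x₀ := by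
      filter_upwards [hV.mem_nhds hyV] with p hp
      rw [g.inner_coordField _ _ (hV' hp)]
      simp
    have e2 : MDifferentiableAt (𝓡 4) 𝓘(ℝ, E4) (extChartAt (𝓡 4) x₀) x :=
      (contMDiffAt_extChartAt' (n := ∞)
        (by rw [← extChartAt_source (𝓡 4)]; exact hx)).mdifferentiableAt (by simp)
    have e3 := mfderiv_comp x hG.mdifferentiableAt e2
    rw [e1.mfderiv_eq, e3, mfderiv_eq_fderiv]
    have e4 := fderiv_eq_sum_pderiv (fun z => g.inChart x₀ z i j) (extChartAt (𝓡 4) x₀ x)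
      (chartDeriv x₀ x (X x))
    refine e4.trans ?_
    rw [hyx]
    rfl
  have a1 := g.inner_coordField (fun _ => -pderiv i (EinsteinFour.components x₀ X) y)
    (fun _ => EuclideanSpace.single j 1) hx
  have a2 := g.inner_coordField (fun _ => EuclideanSpace.single i 1)
    (fun _ => -pderiv j (EinsteinFour.components x₀ X) y) hx
  have a3 := hl.symm.trans (key.trans (congrArg₂ (fun a b : ℝ => a + b) a1 a2))
  rw [a3, hyx, Finset.sum_add_distrib]
  simp only [pderiv_apply hXd]
  simp [mul_comm]
  ring

end ComplexFields

end EinsteinFour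

end

noncomputable section

namespace EinsteinFour

/-! ### Distinct eigenvalues and the Riemannian case -/

section ParallelWeyl

open TopologicalSpace (Opens)

variable {M : Type*} [TopologicalSpace M] [ChartedSpace E4 M] [IsManifold (𝓡 4) ∞ M] {x₀ x : M}
  {g : PseudoRiemannianMetric M} {o : ManifoldOrientation M} {lam : Fin 3 → ℂ}
  {E : E4 → Matrix (Fin 4) (Fin 4) ℂ}

theorem PseudoRiemannianMetric.isLocalMetric_of_le {V : Opens E4} (hV : V ≤ chartTarget x₀) :
    IsLocalMetric V (g.inChart x₀) :=
  (g.isLocalMetric x₀).mono hV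

/-- If the self-dual Weyl tensor is not parallel, its three eigenvalues are distinct. -/
theorem PseudoRiemannianMetric.IsEinstein.eigenvalues_ne (h : g.IsEinstein) (hpar : ¬ g.IsWeylPlusParallel o) :
    ∃ x : M, ∀ (U : Set E4) (E : E4 → Matrix (Fin 4) (Fin 4) ℂ) (lam : Fin 3 → ℂ),
      U ⊆ (extChartAt (𝓡 4) x).target → IsOpen U → coord x ∈ U →
      IsAdaptedFrame U (g.inChart x) (o.sign x) lam E → ∀ j : Fin 3, lam (j + 1) ≠ lam (j + 2) := by
  by_contra! hne
  apply hpar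
  intro x V hVo hxV hVt α hα hαsd i
  obtain ⟨U, E, lam, hU, hUo, hxU, hE, j, hj⟩ := hne x
  have hle : (⟨U ∩ V, hUo.inter hVo⟩ : Opens E4) ≤ chartTarget x := fun y hy => hU hy.1
  have hG := PseudoRiemannianMetric.isLocalMetric_of_le (g := g) hle
  exact IsAdaptedFrame.parallel hG (hE.mono fun y hy => hy.1) (fun y hy => h.inChart (hle hy)) hj
    (fun k l => (hα k l).mono fun y hy => hy.2) (fun y hy => hαsd y hy.2) i ⟨coord x, hxU, hxV⟩

theorem sandwich_sdBasis_ne_zero {G : E4 → Matrix (Fin 4) (Fin 4) ℝ} {y : E4}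
    {F : Matrix (Fin 4) (Fin 4) ℂ} (hF : F.transpose * cMat G y * F = 1) (j : Fin 3) :
    F * sdBasis ℂ j * F.transpose ≠ 0 := by
  intro h0
  have h1 : F.transpose * (F.transpose * cMat G y).transpose = 1 := by
    rw [← Matrix.transpose_mul, hF, Matrix.transpose_one]
  have h2 : sdBasis ℂ j = 0 := by
    calc sdBasis ℂ j = (F.transpose * cMat G y * F) * sdBasis ℂ j *
          (F.transpose * (F.transpose * cMat G y).transpose) := by
          rw [hF, h1, Matrix.one_mul, Matrix.mul_one]
      _ = F.transpose * cMat G y * (F * sdBasis ℂ j * F.transpose) *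
          (F.transpose * cMat G y).transpose := by simp only [Matrix.mul_assoc]
      _ = 0 := by rw [h0, Matrix.mul_zero, Matrix.zero_mul]
  have h3 := congrFun (congrFun h2 0) j.succ
  fin_cases j <;> simp [sdBasis] at h3

theorem PseudoRiemannianMetric.IsRiemannian.exists_orthonormal (hg : g.IsRiemannian) {y : E4}
    (hy : y ∈ chartTarget x₀) :
    ∃ B : Matrix (Fin 4) (Fin 4) ℝ, B.transpose * g.inChart x₀ y * B = 1 := by
  obtain ⟨b, hb⟩ := hg ((extChartAt (𝓡 4) x₀).symm y)
  refine ⟨Matrix.of fun k i => chartDeriv x₀ ((extChartAt (𝓡 4) x₀).symm y) (b i) k, ?_⟩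
  ext i j
  rw [conj_apply]
  have h1 : ∀ i, chartInvDeriv x₀ y (chartDeriv x₀ ((extChartAt (𝓡 4) x₀).symm y) (b i)) = b i := by
    intro i
    have := chartInvDeriv_comp_chartDeriv ((extChartAt (𝓡 4) x₀).map_target hy)
    rw [(extChartAt (𝓡 4) x₀).right_inv hy] at this
    exact congrArg (fun L => L (b i)) this
  have h2 := g.form_chartInvDeriv (x₀ := x₀) y
    (chartDeriv x₀ ((extChartAt (𝓡 4) x₀).symm y) (b i))
    (chartDeriv x₀ ((extChartAt (𝓡 4) x₀).symm y) (b j))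
  rw [h1, h1] at h2
  refine h2.symm.trans ((hb i j).trans ?_)
  rw [Matrix.one_apply]
  refine if_congr Iff.rfl ?_ rfl
  fin_cases i <;> rfl

/-- The Riemannian case. -/
theorem PseudoRiemannianMetric.IsRiemannian.parallel (hg : g.IsRiemannian) (h : g.IsEinstein)
    (hd : ∀ x, g.IsWeylPlusDiagonalizableAt o x)
    (hc : ∀ x y, g.weylPlusEigenvalues o x = g.weylPlusEigenvalues o y) :
    g.IsWeylPlusParallel o := by
  by_contra hpar
  obtain ⟨x, hx⟩ := h.eigenvalues_ne hpar
  obtain ⟨U, hU, hUo, hxU, E, lam, hE, -⟩ := h.exists_adaptedFrame hd hc x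
  have hne := hx U E lam hU hUo hxU hE
  have hle : (⟨U, hUo⟩ : Opens E4) ≤ chartTarget x := hU
  have hG := PseudoRiemannianMetric.isLocalMetric_of_le (g := g) hle
  have : Nonempty (⟨U, hUo⟩ : Opens E4) := ⟨⟨coord x, hxU⟩⟩
  have hsum := (IsAdaptedFrame.exists_canonical hG hE (fun y hy => h.inChart (hle hy)) hne).1
  obtain ⟨B, hB⟩ := hg.exists_orthonormal (x₀ := x) (hU hxU)
  have hreal : ∀ j, ((lam j).re : ℂ) = lam j := fun j =>
    Complex.conj_eq_iff_re.mp (hG.weyl_eigenvalue_real hxU (h.inChart (hU hxU)) hB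
      (skew_conj (E (coord x)) (sdBasis_transpose j))
      (sandwich_sdBasis_ne_zero (hE.orthonormal _ hxU) j) (hE.weyl _ hxU j))
  have hsum' : ∑ j : Fin 3, ((lam (j + 1)).re - (lam (j + 2)).re) ^ 2 = 0 := by
    have e : ((∑ j : Fin 3, ((lam (j + 1)).re - (lam (j + 2)).re) ^ 2 : ℝ) : ℂ) = 0 := by
      push_cast
      simp only [hreal]
      exact hsum
    exact_mod_cast e
  -- A vanishing sum of squares of real numbers: two eigenvalues coincide, contrary to their
  -- distinctness.
  have h0 := (Finset.sum_eq_zero_iff_of_nonneg fun j _ => sq_nonneg _).mp hsum' 0 (Finset.mem_univ _)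
  apply hne 0
  rw [← hreal, ← hreal (0 + 2), sub_eq_zero.mp (pow_eq_zero_iff two_ne_zero |>.mp h0)]

/-- The hypothesis fixes only the set of eigenvalues, not their multiplicities. Three distinct
values at one point still force three distinct values at every other point. -/
theorem injective_of_range_eq {f f' : Fin 3 → ℂ} (hf : Function.Injective f)
    (h : Set.range f' = Set.range f) : Function.Injective f' := by
  have h1 : ∀ j, ∃ k, f' k = f j := fun j => by
    have : f j ∈ Set.range f' := h ▸ Set.mem_range_self j
    exact this
  choose σ hσ using h1
  have h2 : Function.Injective σ := fun a b hab => hf (by rw [← hσ, ← hσ, hab])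
  have h3 : Function.Surjective σ := Finite.surjective_of_injective h2
  intro a b hab
  obtain ⟨a, rfl⟩ := h3 a
  obtain ⟨b, rfl⟩ := h3 b
  rw [hσ, hσ] at hab
  rw [hf hab]

theorem injective_iff_cyclic (f : Fin 3 → ℂ) :
    Function.Injective f ↔ ∀ j : Fin 3, f (j + 1) ≠ f (j + 2) := by
  refine ⟨fun h j hj => absurd (h hj) (by fin_cases j <;> decide), fun h a b hab => ?_⟩
  have h0 := h 0
  have h1 := h 1
  have h2 := h 2
  fin_cases a <;> fin_cases b <;> simp_all

end ParallelWeyl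

/-! ### The canonical vector fields on the manifold -/

section CanonicalFields

open TopologicalSpace (Opens)
open ComplexVectorField

variable {M : Type*} [TopologicalSpace M] [ChartedSpace E4 M] [IsManifold (𝓡 4) ∞ M] {x₀ x : M}
  {g : PseudoRiemannianMetric M} {U : Set E4} {e : E4 → Matrix (Fin 4) (Fin 4) ℂ} {r : Fin 3 → ℂ} {κ : ℂ}

/-- The vector fields of a frame, multiplied by a constant. -/
def frameField (x₀ : M) (κ : ℂ) (e : E4 → Matrix (Fin 4) (Fin 4) ℂ) (a : Fin 4) : ComplexVectorField M :=
  complexField x₀ fun y i => κ * e y i a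

/-- The domain of a frame given in coordinates. -/
def fieldDomain (x₀ : M) (U : Set E4) : Set M :=
  (extChartAt (𝓡 4) x₀).source ∩ extChartAt (𝓡 4) x₀ ⁻¹' U

theorem frameField_smooth (hU : IsOpen U) (he : SmoothMatOn U e) (a : Fin 4) :
    (frameField x₀ κ e a).IsSmoothOn (fieldDomain x₀ U) :=
  complexField_smooth hU fun i => contDiffOn_const.mul (he i a)

theorem frameField_inner {G : E4 → Matrix (Fin 4) (Fin 4) ℝ}
    (hG : G = g.inChart x₀) (he : IsCanonicalFrame U G r e) (hx : x ∈ fieldDomain x₀ U) (a b : Fin 4) :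
    g.complexInner x (frameField x₀ κ e a) (frameField x₀ κ e b) = if a = b then κ ^ 2 else 0 := by
  have h := congrFun (congrFun (he.orthonormal _ hx.2) a) b
  rw [Matrix.one_apply] at h
  simp only [Matrix.mul_apply, Matrix.transpose_apply, Finset.sum_mul, cMat, Matrix.map_apply] at h
  rw [Finset.sum_comm] at h
  rw [frameField, frameField, g.complexInner_complexField hx.1]
  have e1 : (if a = b then κ ^ 2 else 0) = κ ^ 2 * if a = b then 1 else 0 := by simp
  rw [e1, ← h, Finset.mul_sum]
  refine Finset.sum_congr rfl fun i _ => ?_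
  rw [Finset.mul_sum]
  refine Finset.sum_congr rfl fun j _ => ?_
  rw [hG]; ring

theorem frameField_linearIndependent (hκ : κ ≠ 0) {G : E4 → Matrix (Fin 4) (Fin 4) ℝ}
    (he : IsCanonicalFrame U G r e) (hx : x ∈ fieldDomain x₀ U) :
    LinearIndependentAt x (frameField x₀ κ e) := by
  intro c hc
  have h1 := sum_complexField (x₀ := x₀) (x := x) fun a =>
    smul_complexField (x₀ := x₀) (u := fun y i => κ * e y i a) (c a)
  have h2 := complexField_eq_zero hx.1 (eqAt_trans (eqAt_symm h1) hc)
  have h3 : (e (extChartAt (𝓡 4) x₀ x)).mulVec (fun a => κ * c a) = 0 := by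
    funext i
    rw [← congrFun h2 i, Matrix.mulVec, dotProduct]
    exact Finset.sum_congr rfl fun a _ => by ring
  have h4 := congrArg (((e (extChartAt (𝓡 4) x₀ x)).transpose *
    cMat G (extChartAt (𝓡 4) x₀ x)).mulVec) h3
  rw [Matrix.mulVec_mulVec, he.orthonormal _ hx.2, Matrix.one_mulVec, Matrix.mulVec_zero] at h4
  intro a
  exact (mul_eq_zero.mp (congrFun h4 a)).resolve_left hκ

omit [IsManifold (𝓡 4) ∞ M] in
theorem frameField_vec : ![frameField x₀ κ e 0, frameField x₀ κ e (Fin.succ 0),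
    frameField x₀ κ e (Fin.succ 1), frameField x₀ κ e (Fin.succ 2)] = frameField x₀ κ e := by
  funext a
  fin_cases a <;> rfl

theorem bracket_frameField (hU : IsOpen U) (he : SmoothMatOn U e) (hx : x ∈ fieldDomain x₀ U)
    (a b : Fin 4) : EqAt x (bracket (frameField x₀ κ e a) (frameField x₀ κ e b))
      (complexField x₀ fun y k => κ ^ 2 * compBracket (fun z i => e z i a) (fun z i => e z i b) y k) := by
  refine eqAt_trans (bracket_complexField hU (fun i => contDiffOn_const.mul (he i a))
    (fun i => contDiffOn_const.mul (he i b)) hx.1 hx.2) (complexField_congr (funext fun k => ?_))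
  rw [compBracket_const_mul κ κ (fun i => differentiableAt_of_contDiffOn hU (he i a) hx.2)
    (fun i => differentiableAt_of_contDiffOn hU (he i b) hx.2), sq]

theorem bracket_frameField_zero (hU : IsOpen U) {G : E4 → Matrix (Fin 4) (Fin 4) ℝ}
    (he : IsCanonicalFrame U G r e) (hx : x ∈ fieldDomain x₀ U) (j : Fin 3) :
    EqAt x (bracket (frameField x₀ κ e 0) (frameField x₀ κ e j.succ))
      (smul (κ * r j) (frameField x₀ κ e j.succ)) := by
  refine eqAt_trans (bracket_frameField hU he.smooth hx _ _)
    (eqAt_trans (complexField_congr (funext fun k => ?_)) (eqAt_symm (smul_complexField _)))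
  rw [he.bracket_zero _ hx.2]
  ring

theorem bracket_frameField_succ (hU : IsOpen U) {G : E4 → Matrix (Fin 4) (Fin 4) ℝ}
    (he : IsCanonicalFrame U G r e) (hx : x ∈ fieldDomain x₀ U) (j k : Fin 3) :
    EqAt x (bracket (frameField x₀ κ e j.succ) (frameField x₀ κ e k.succ)) zero := by
  refine eqAt_trans (bracket_frameField hU he.smooth hx _ _)
    (eqAt_trans (complexField_congr (v := fun _ _ => 0) (funext fun l => ?_)) complexField_zero)
  rw [he.bracket_succ _ hx.2, mul_zero]

/-- Killing fields commute with the canonical vector fields. -/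
theorem bracket_frameField_killing
    (he : IsCanonicalFrame U (g.inChart x₀) r e) (hr : ∀ j, r j ≠ 0) (hr' : ∀ j k, j ≠ k → r j ≠ r k)
    {V : Set M} (hV : IsOpen V) (hVU : V ⊆ fieldDomain x₀ U) {X : Π x : M, TangentSpace (𝓡 4) x}
    (hX : g.IsKillingOn X V) (hx : x ∈ V) (a : Fin 4) :
    EqAt x (bracket (frameField x₀ κ e a) (ofReal X)) zero := by
  have hVs : V ⊆ (extChartAt (𝓡 4) x₀).source := fun p hp => (hVU hp).1
  have hSo : IsOpen ((extChartAt (𝓡 4) x₀).target ∩ (extChartAt (𝓡 4) x₀).symm ⁻¹' V) :=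
    (continuousOn_extChartAt_symm x₀).isOpen_inter_preimage (isOpen_extChartAt_target x₀) hV
  have hSU : (extChartAt (𝓡 4) x₀).target ∩ (extChartAt (𝓡 4) x₀).symm ⁻¹' V ⊆ U := by
    intro y hy
    have := (hVU hy.2).2
    rwa [Set.mem_preimage, (extChartAt (𝓡 4) x₀).right_inv hy.1] at this
  have hxS : extChartAt (𝓡 4) x₀ x ∈
      (extChartAt (𝓡 4) x₀).target ∩ (extChartAt (𝓡 4) x₀).symm ⁻¹' V :=
    ⟨(extChartAt (𝓡 4) x₀).map_source (hVs hx), by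
      rw [Set.mem_preimage, (extChartAt (𝓡 4) x₀).left_inv (hVs hx)]; exact hx⟩
  have hle : (⟨_, hSo⟩ : Opens E4) ≤ chartTarget x₀ := fun y hy => hy.1
  have heS := he.mono hSU
  have hXs : ∀ i, ContDiffOn ℝ ∞ (fun y => components x₀ X y i)
      ((extChartAt (𝓡 4) x₀).target ∩ (extChartAt (𝓡 4) x₀).symm ⁻¹' V) :=
    contDiffOn_euclidean.mp (components_smooth hX.1 hV)
  have key := IsCanonicalFrame.killing (V := ⟨_, hSo⟩) (PseudoRiemannianMetric.isLocalMetric_of_le hle)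
    heS hr hr' (X := fun y i => components x₀ X y i) hXs
    (fun y hy i j => hX.components hV hVs hy.1 hy.2 i j) ⟨_, hxS⟩ a
  have hXc : ∀ i, ContDiffOn ℝ ∞ (fun y => ((components x₀ X y i : ℝ) : ℂ))
      ((extChartAt (𝓡 4) x₀).target ∩ (extChartAt (𝓡 4) x₀).symm ⁻¹' V) := fun i =>
    contDiffOn_ofReal (hXs i)
  refine eqAt_trans (bracket_ofReal hV hVs _ X hx) (eqAt_trans (bracket_complexField hSo
    (fun i => contDiffOn_const.mul (heS.smooth i a)) hXc (hVs hx) hxS)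
    (eqAt_trans (complexField_congr (v := fun _ _ => 0) (funext fun k => ?_)) complexField_zero))
  have h1 := compBracket_const_mul (u := fun y i => e y i a)
    (v := fun y i => ((components x₀ X y i : ℝ) : ℂ)) κ 1
    (fun i => differentiableAt_of_contDiffOn hSo (heS.smooth i a) hxS)
    (fun i => differentiableAt_of_contDiffOn hSo (hXc i) hxS) k
  simp only [one_mul] at h1
  rw [h1, compBracket_swap, key k]
  simp

end CanonicalFields

end EinsteinFour

end

/-! ### Assembly of the theorem -/

open EinsteinFour ComplexVectorField in
theorem theorem11p1 {M : Type*} [TopologicalSpace M] [ChartedSpace E4 M] [IsManifold (𝓡 4) ∞ M]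
    (g : PseudoRiemannianMetric M) (o : ManifoldOrientation M)
    (hEinstein : g.IsEinstein)
    (hdiag : ∀ x : M, g.IsWeylPlusDiagonalizableAt o x)
    (hconst : ∀ x y : M, g.weylPlusEigenvalues o x = g.weylPlusEigenvalues o y) :
    (g.IsRiemannian → g.IsWeylPlusParallel o) ∧
    (g.IsLorentzian ∨ g.IsNeutral → ¬ g.IsWeylPlusParallel o →
      ∀ x₀ : M, ∃ (U : Set M) (w : ComplexVectorField M) (v : Fin 3 → ComplexVectorField M)
        (γ : ℂ) (ρ : Fin 3 → ℂ),
        IsOpen U ∧ x₀ ∈ U ∧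
        w.IsSmoothOn U ∧ (∀ j, (v j).IsSmoothOn U) ∧
        (∀ x ∈ U, LinearIndependentAt x ![w, v 0, v 1, v 2]) ∧
        (∀ (V : Set M) (X : Π x : M, TangentSpace (𝓡 4) x),
          IsOpen V → V ⊆ U → g.IsKillingOn X V →
            ∀ x ∈ V, EqAt x (bracket w (ofReal X)) zero ∧
              ∀ j, EqAt x (bracket (v j) (ofReal X)) zero) ∧
        γ ≠ 0 ∧
        (∀ z : ℂ, z ^ 3 = γ ^ 2 ↔ ∃ j, z = ρ j) ∧
        (∀ x ∈ U,
          g.complexInner x w w = γ ∧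
          (∀ j, g.complexInner x w (v j) = 0) ∧
          (∀ j k, g.complexInner x (v j) (v k) = if j = k then γ else 0) ∧
          (∀ j, EqAt x (bracket w (v j)) (smul (ρ j) (v j))) ∧
          (∀ j k, EqAt x (bracket (v j) (v k)) zero))) := by
  refine ⟨fun hR => hR.parallel hEinstein hdiag hconst, fun _ hpar x₀ => ?_⟩
  obtain ⟨x₁, hx₁⟩ := hEinstein.eigenvalues_ne hpar
  obtain ⟨U₁, hU₁, hU₁o, hxU₁, E₁, lam₁, hE₁, hr₁⟩ := hEinstein.exists_adaptedFrame hdiag hconst x₁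
  obtain ⟨U, hU, hUo, hxU, E, lam, hE, hrange⟩ := hEinstein.exists_adaptedFrame hdiag hconst x₀
  -- Failure of parallelism shows that the eigenvalues are distinct at some point x₁; constancy of
  -- the spectrum carries this to x₀.
  have hinj : Function.Injective lam :=
    injective_of_range_eq ((injective_iff_cyclic lam₁).mpr (hx₁ U₁ E₁ lam₁ hU₁ hU₁o hxU₁ hE₁))
      (by rw [hrange, hr₁, hconst x₀ x₁])
  have hle : (⟨U, hUo⟩ : TopologicalSpace.Opens E4) ≤ chartTarget x₀ := hU
  have : Nonempty (⟨U, hUo⟩ : TopologicalSpace.Opens E4) := ⟨⟨coord x₀, hxU⟩⟩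
  obtain ⟨e, r, κ, he, hκ, hr, hr', hroots⟩ :=
    IsAdaptedFrame.exists_canonicalFrame (PseudoRiemannianMetric.isLocalMetric_of_le hle) hE
      (fun y hy => hEinstein.inChart (hle hy)) ((injective_iff_cyclic lam).mp hinj)
  -- Scaling the orthonormal frame by κ multiplies the squares by κ² and the bracket coefficients by
  -- κ, hence γ = κ² and ρ_j = κ r_j.
  refine ⟨fieldDomain x₀ U, frameField x₀ κ e 0, fun j => frameField x₀ κ e j.succ, κ ^ 2,
    fun j => κ * r j, isOpen_preimage_chart hUo, ⟨mem_extChartAt_source x₀, hxU⟩,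
    frameField_smooth hUo he.smooth 0, fun j => frameField_smooth hUo he.smooth j.succ,
    fun x hx => ?_, fun V X hV hVU hX x hx => ⟨?_, fun j => ?_⟩, pow_ne_zero 2 hκ, hroots,
    fun x hx => ⟨?_, fun j => ?_, fun j k => ?_, fun j => ?_, fun j k => ?_⟩⟩
  · rw [frameField_vec]
    exact frameField_linearIndependent hκ he hx
  · exact bracket_frameField_killing he hr hr' hV hVU hX hx 0
  · exact bracket_frameField_killing he hr hr' hV hVU hX hx j.succ
  · rw [frameField_inner rfl he hx, if_pos rfl]
  · rw [frameField_inner rfl he hx, if_neg (Fin.succ_ne_zero j).symm]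
  · rw [frameField_inner rfl he hx]
    exact if_congr (Fin.succ_injective 3).eq_iff rfl rfl
  · exact bracket_frameField_zero hUo he hx j
  · exact bracket_frameField_succ hUo he hx j k
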